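/- **Conventions.** Graphs are finite and loopless; multiple edges are allowed unless the graph is said to be simple. A connected graph with at least two vertices is *matching covered* if each of its edges lies in a perfect matching; an edge $e$ of a matching covered graph $G$ is *removable* if $G-e$ is matching covered. A *brick* is a 3-connected graph with at least four vertices such that deleting any two distinct vertices leaves a graph with a perfect matching; a *brace* is a bipartite matching covered graph without nontrivial tight cuts. A cut $\partial(X)$ of a matching covered graph is *tight* if each perfect matching contains exactly one of its edges, and *nontrivial* if both $X$ and its complement have at least two vertices. Repeatedly replacing a graph that has a nontrivial tight cut by the two graphs obtained by contracting one shore of that cut to a single vertex yields a list of bricks and braces; a matching covered graph is a *near-brick* if exactly one member of this list is a brick. The *retract* of $G$ is the multigraph obtained from $G$ by contracting each edge incident with a vertex of degree two. An *$R$-brick* is a brick $G$ with a fixed *removable doubleton* $R$, that is, a pair of edges such that $H:=G-R$ is bipartite and matching covered ($G$ being nonbipartite). $V(R)$ is the set of ends of the edges of $R$. An edge $e$ of $G$ is *$R$-compatible* if it is removable both in $G$ and in $H$. It is *thin* if it is removable in $G$, $G-e$ is a near-brick and the retract of $G-e$ is a brick; it is *strictly thin* if, moreover, this retract is simple. It is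 *(strictly) $R$-thin* if it is $R$-compatible and (strictly) thin. A *barrier* of a connected graph $F$ with a perfect matching is a nonempty set $S$ of vertices such that $F-S$ has exactly $|S|$ components of odd order; it is *nontrivial* if $|S|\ge 2$. The *index* of an $R$-compatible edge $e$ is the number of maximal barriers of $G-e$ that are nontrivial. A *ladder* consists of two vertex-disjoint paths $x_0x_1\dots x_j$ and $y_0y_1\dots y_j$, where $j\ge 2$, together with the *rungs* $x_iy_i$ for $0\le i\le j$; the rungs $x_0y_0$ and $x_jy_j$ are *external*, the others *internal*. An *$R$-ladder configuration* of $G$ is a subgraph $K$ of $H$ that is a ladder with external rungs $au$ and $bw$, where $a,w$ lie in one colour class of $H$ and $b,u$ in the other, such that 1. every vertex of $K$, except possibly $u$ and $w$, has degree three in $G$; 2. $a$ and $b$ both lie in $V(R)$; 3. every internal rung of $K$ is an $R$-thin edge of $G$ whose index is two. **Theorem 3.4 ($R$-ladder Theorem).** Let $G$ be a simple $R$-brick that has no strictly $R$-thin edge, and let $e$ be an $R$-thin edge of $G$ whose index is two. Then $G$ has an $R$-ladder configuration $K$ with $e\in E(K)$. -/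

import Mathlib

open scoped Graph

namespace RBrick

/-! Graphs are Mathlib's multigraphs `Graph α β` (vertices in `α`, edges in `β`). -/

/-- The number of edges incident with `v` (all graphs below are loopless). -/
noncomputable def degree {α β : Type*} (G : Graph α β) (v : α) : ℕ :=
  (G.incidenceSet v).ncard

/-- A vertex is cubic if it has degree three. -/
def IsCubic {α β : Type*} (G : Graph α β) (v : α) : Prop := degree G v = 3

/-- Connectedness of a multigraph; multiplicities are irrelevant. In particular the graph has a
vertex. -/
def IsConnected {α β : Type*} (G : Graph α β) : Prop := G.toSimpleGraph.Connected

/-- The set of edges `M` is a perfect matching of `G`. -/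
def IsPerfectMatching {α β : Type*} (G : Graph α β) (M : Set β) : Prop :=
  M ⊆ E(G) ∧ ∀ v ∈ V(G), ∃! e, e ∈ M ∧ G.Inc e v

/-- `A` and `B` are the colour classes of a proper 2-colouring of `G`. -/
structure IsBipartition {α β : Type*} (G : Graph α β) (A B : Set α) : Prop where
  disjoint : Disjoint A B
  union_eq : A ∪ B = V(G)
  link : ∀ e u v, G.IsLink e u v → (u ∈ A ∧ v ∈ B) ∨ (u ∈ B ∧ v ∈ A)

/-- `G` is bipartite. -/
def IsBipartite {α β : Type*} (G : Graph α β) : Prop := ∃ A B : Set α, IsBipartition G A B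

/-- A matching covered graph: loopless and connected, with at least two vertices, every edge being
admissible, that is, lying in some perfect matching. -/
structure IsMatchingCovered {α β : Type*} (G : Graph α β) : Prop where
  loopless : G.Loopless
  two_le : 2 ≤ V(G).ncard
  connected : IsConnected G
  admissible : ∀ e ∈ E(G), ∃ M, IsPerfectMatching G M ∧ e ∈ M

/-- A brick: a (loopless) 3-connected graph such that deleting any two distinct vertices leaves a
graph with a perfect matching. -/
structure IsBrick {α β : Type*} (G : Graph α β) : Prop where
  loopless : G.Loopless
  four_le : 4 ≤ V(G).ncard
  three_connected : ∀ S ⊆ V(G), S.ncard ≤ 2 → IsConnected (G.deleteVerts S)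
  bicritical : ∀ u ∈ V(G), ∀ v ∈ V(G), u ≠ v →
    ∃ M, IsPerfectMatching (G.deleteVerts {u, v}) M

/-- The edge `e` is removable in the (matching covered) graph `G`. -/
def IsRemovable {α β : Type*} (G : Graph α β) (e : β) : Prop :=
  e ∈ E(G) ∧ IsMatchingCovered (G.deleteEdges {e})

/-! ### Tight cuts and the number of bricks -/

/-- The cut `∂(X)`. -/
def cut {α β : Type*} (G : Graph α β) (X : Set α) : Set β :=
  {e | ∃ u v, G.IsLink e u v ∧ u ∈ X ∧ v ∉ X}

/-- `∂(X)` is a nontrivial tight cut of `G`: it meets each perfect matching in exactly one edge, and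
both its shores have at least two vertices. -/
structure IsNontrivialTightCut {α β : Type*} (G : Graph α β) (X : Set α) : Prop where
  subset : X ⊆ V(G)
  nontrivial : X.Nontrivial
  nontrivial_compl : (V(G) \ X).Nontrivial
  tight : ∀ M, IsPerfectMatching G M → (M ∩ cut G X).ncard = 1

open Classical in
/-- The contraction `G / (X → x)` of a set of vertices `X` to a single vertex, labelled `x`; the
edges with both ends in `X` disappear. -/
noncomputable def contractShore {α β : Type*} (G : Graph α β) (X : Set α) (x : α) : Graph α β :=
  (G.deleteEdges E(G.induce X)).map (fun v => if v ∈ X then x else v)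

/-- `HasBrickCount G n`: the matching covered graph `G` has a tight cut decomposition into bricks
and braces with precisely `n` bricks, i.e. `b(G) = n`. (Each `∂(X)`-contraction of a matching covered
graph with respect to a tight cut is again matching covered; the label of the contraction vertex is
any vertex of the contracted shore.) -/
inductive HasBrickCount {α β : Type*} : Graph α β → ℕ → Prop
  | brace (G : Graph α β) : IsMatchingCovered G → IsBipartite G →
      (∀ X, ¬ IsNontrivialTightCut G X) → HasBrickCount G 0
  | brick (G : Graph α β) : IsBrick G → HasBrickCount G 1
  | split (G : Graph α β) (X : Set α) (x y : α) (m n : ℕ) :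
      IsNontrivialTightCut G X → x ∈ X → y ∈ V(G) \ X →
      HasBrickCount (contractShore G X x) m →
      HasBrickCount (contractShore G (V(G) \ X) y) n → HasBrickCount G (m + n)

/-- A near-brick: a matching covered graph with exactly one brick. -/
def IsNearBrick {α β : Type*} (G : Graph α β) : Prop :=
  IsMatchingCovered G ∧ HasBrickCount G 1

/-- A removable edge `e` of the brick `G` is b-invariant if `G - e` is a near-brick. -/
def IsBInvariant {α β : Type*} (G : Graph α β) (e : β) : Prop :=
  IsRemovable G e ∧ IsNearBrick (G.deleteEdges {e})

/-! ### Retracts, thin edges -/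

/-- The edges incident with a vertex of degree two. -/
def degreeTwoEdges {α β : Type*} (G : Graph α β) : Set β :=
  {e | ∃ v, G.Inc e v ∧ degree G v = 2}

/-- The graph obtained by contracting the set of edges `C`: the edges in `C` are deleted, and each
vertex is replaced by the set of all vertices that can be reached from it along edges in `C`. -/
def contractEdges {α β : Type*} (G : Graph α β) (C : Set β) : Graph (Set α) β :=
  (G.deleteEdges C).map
    (fun v => {w | Relation.ReflTransGen (fun p q => ∃ c ∈ C, G.IsLink c p q) v w})

/-- The retract of `G`: all vertices of degree two are bicontracted, that is, each edge that is
incident with a vertex of degree two is contracted. Parallel edges are kept. -/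
def retract {α β : Type*} (G : Graph α β) : Graph (Set α) β :=
  contractEdges G (degreeTwoEdges G)

/-- A b-invariant edge `e` of the brick `G` is thin if the retract of `G - e` is a brick. -/
def IsThin {α β : Type*} (G : Graph α β) (e : β) : Prop :=
  IsBInvariant G e ∧ IsBrick (retract (G.deleteEdges {e}))

/-- A thin edge `e` of the simple brick `G` is strictly thin if the retract of `G - e` is simple. -/
def IsStrictlyThin {α β : Type*} (G : Graph α β) (e : β) : Prop :=
  IsThin G e ∧ (retract (G.deleteEdges {e})).Simple

/-! ### Near-bipartite bricks -/

/-- `R` is a removable doubleton of the nonbipartite matching covered graph `G`, that is, a pair of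
edges such that `G - R` is bipartite and matching covered. -/
structure IsRemovableDoubleton {α β : Type*} (G : Graph α β) (R : Set β) : Prop where
  matchingCovered : IsMatchingCovered G
  nonbipartite : ¬ IsBipartite G
  subset : R ⊆ E(G)
  pair : R.ncard = 2
  bipartite_delete : IsBipartite (G.deleteEdges R)
  matchingCovered_delete : IsMatchingCovered (G.deleteEdges R)

/-- An `R`-brick: a brick with the fixed removable doubleton `R`. -/
def IsRBrick {α β : Type*} (G : Graph α β) (R : Set β) : Prop :=
  IsBrick G ∧ IsRemovableDoubleton G R

/-- The set `V(R)` of the ends of the edges in `R`. -/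
def endsOf {α β : Type*} (G : Graph α β) (R : Set β) : Set α := {v | ∃ e ∈ R, G.Inc e v}

/-- `e` is `R`-compatible: it is removable in `G` as well as in `G - R`. -/
def IsRCompatible {α β : Type*} (G : Graph α β) (R : Set β) (e : β) : Prop :=
  IsRemovable G e ∧ IsRemovable (G.deleteEdges R) e

/-- `e` is `R`-thin: it is thin and `R`-compatible. -/
def IsRThin {α β : Type*} (G : Graph α β) (R : Set β) (e : β) : Prop :=
  IsThin G e ∧ IsRCompatible G R e

/-- `e` is strictly `R`-thin: it is strictly thin and `R`-thin. -/
def IsStrictlyRThin {α β : Type*} (G : Graph α β) (R : Set β) (e : β) : Prop :=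
  IsRThin G R e ∧ IsStrictlyThin G e

/-! ### The index of an edge -/

/-- A barrier of a connected graph with a perfect matching: a nonempty set `S` of vertices such that
`G - S` has exactly `|S|` components of odd order. -/
structure IsBarrier {α β : Type*} (G : Graph α β) (S : Set α) : Prop where
  subset : S ⊆ V(G)
  nonempty : S.Nonempty
  odd_eq : (G.deleteVerts S).toSimpleGraph.oddComponents.ncard = S.ncard

/-- The index of `e`: the number of maximal nontrivial barriers of `G - e`, where a barrier is
nontrivial if it has more than one vertex. -/
noncomputable def index {α β : Type*} (G : Graph α β) (e : β) : ℕ :=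
  {S : Set α | Maximal (IsBarrier (G.deleteEdges {e})) S ∧ S.Nontrivial}.ncard

/-! ### Ladders -/

/-- `K` is the ladder formed by the disjoint paths `x 0, …, x j` and `y 0, …, y j`, where `j ≥ 2`,
and the rungs joining `x i` and `y i`; the external rungs are those with `i = 0` and `i = j`. -/
structure IsLadder {α β : Type*} (K : Graph α β) (j : ℕ) (x y : ℕ → α) : Prop where
  two_le : 2 ≤ j
  injOn_x : Set.InjOn x (Set.Iic j)
  injOn_y : Set.InjOn y (Set.Iic j)
  ne : ∀ i ≤ j, ∀ k ≤ j, x i ≠ y k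
  vertexSet_eq : V(K) = x '' Set.Iic j ∪ y '' Set.Iic j
  simple : K.Simple
  adj_iff : ∀ p q, K.Adj p q ↔
    (∃ i ≤ j, s(p, q) = s(x i, y i)) ∨
    (∃ i < j, s(p, q) = s(x i, x (i + 1)) ∨ s(p, q) = s(y i, y (i + 1)))

/-- `K` is an `R`-ladder configuration of `G`: it is a subgraph of `H := G - R` that is a ladder with
external rungs `au` and `bw`, where `a, w` lie in one colour class of `H` and `b, u` in the other, such
that in `G` every vertex of `K` except possibly `u` and `w` is cubic, `a` and `b` lie in `V(R)`, and
every internal rung of `K` is an `R`-thin edge of `G` of index two. -/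
def IsRLadderConfiguration {α β : Type*} (G : Graph α β) (R : Set β) (K : Graph α β) : Prop :=
  K ≤ G.deleteEdges R ∧
  ∃ (j : ℕ) (x y : ℕ → α) (A B : Set α) (a u b w : α),
    IsLadder K j x y ∧
    IsBipartition (G.deleteEdges R) A B ∧
    s(a, u) = s(x 0, y 0) ∧ s(b, w) = s(x j, y j) ∧
    a ∈ A ∧ w ∈ A ∧ b ∈ B ∧ u ∈ B ∧
    (∀ v ∈ V(K), v ≠ u → v ≠ w → IsCubic G v) ∧
    a ∈ endsOf G R ∧ b ∈ endsOf G R ∧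
    (∀ i f, 0 < i → i < j → K.IsLink f (x i) (y i) → IsRThin G R f ∧ index G f = 2)

end RBrick

/-! Everything takes place in the bipartite graph `H = G - R`, recorded as a `HallGraph`. Since `H`
is matching covered, every proper nonempty subset of a colour class has a surplus of one neighbour;
since `G` is bicritical, the surplus is two if the set avoids the ends of `R`. A vertex of degree
two in `H` (`Special`) is therefore an end of `R` and cubic in `G`, while a `Free` vertex is a cubic
vertex off `R`.

Whether an edge `e = xy` of `H` is `R`-thin depends on these surpluses alone. Deleting `xy` spoils
the surplus of a set `T` only if `x` is the sole neighbour of `y` in `T`, or the same with `x` and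
`y` exchanged, and only if `T` is tight. `Thin x y` says that no tight set other than `{x}` and
`{y}` is affected, that neither end is special, and that the two neighbours left at a free end are
not both ends of `R`; otherwise an edge of `R` would become a loop of the retract.

If this holds, Hall's theorem gives perfect matchings of `G - e` minus any two vertices, except for
the pairs of neighbours left at a free end (`Model.matchable`). Each of these pairs becomes a single
vertex when the free ends are bicontracted, so the retract is a brick (`Frame.isBrick`); each
bicontraction splits off a brace, and `e` is `R`-thin (`Model.isRThin`). The same pairs are the
nontrivial barriers of `G - e`, so index two means that both ends are free
(`Model.index_eq_two_iff`). Conversely, an offending tight set contradicts the bicriticality of the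
retract or the matching coveredness of `H - e` (`Model.thin_of_isRThin`). Finally, the retract can
have multiple edges only in the configurations of `Multi` (`Model.core_simple`): the two neighbours
left at a free end have another common neighbour, or both ends are free and two disjoint edges join
their remaining neighbours. So the absence of strictly `R`-thin edges says that every thin pair is
`Multi`.

The rest is counting with surpluses. Let `pq` be thin with free ends. Two disjoint edges between the
remaining neighbours of `p` and `q` make `pq` the inner rung of a ladder with three rungs. If
instead the remaining neighbours `p₁`, `p₂` of `p` have a common neighbour `w ≠ p`, then `w` is
neither special nor free; unless a small set obstructs it, each edge `wpᵢ` is thin, hence `Multi`.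
The outcome (`common_neighbour`) is again such a ladder, or one of `p₁`, `p₂` is special, and then a
ladder contains `pq` as an edge of one of its paths (`initial_ladder`).

An external rung without special vertices is thin, because it ends a ladder of three rungs with a
free inner rung (`thin_of_quad`); being `Multi`, it admits one more rung (`extend_rung`). The new
rung cannot return to the ladder, since then a colour class of the ladder would have too few
neighbours (`Lad.not_wrap`). By finiteness the growth stops in both directions, and it can only stop
at special vertices, which are ends of `R`. If those of the two external rungs all had one colour,
the ladder vertices of that colour would have no surplus and hence form a whole colour class; but
this would make the other end of an external rung special too (`Lad.exists_special`). -/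

namespace RBrick

/-! ### Bipartite graphs with a Hall-type surplus -/

/-- A bipartite graph on finite colour classes `A`, `B` of equal size, given by its neighbourhoods,
with two distinguished vertices in either class (the members of `R`), such that each proper nonempty
subset of a colour class has a surplus of one neighbour, and of two if it avoids `R`. -/
structure HallGraph (α : Type*) [DecidableEq α] where
  A : Finset α
  B : Finset α
  R : Finset α
  N : α → Finset α
  disj : Disjoint A B
  card_eq : A.card = B.card
  card_RA : (R ∩ A).card = 2
  card_RB : (R ∩ B).card = 2
  symm : ∀ {v w}, w ∈ N v → v ∈ N w
  mem : ∀ {v w}, w ∈ N v → (v ∈ A ∧ w ∈ B) ∨ (v ∈ B ∧ w ∈ A)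
  hall : ∀ T : Finset α, (T ⊆ A ∨ T ⊆ B) → T.Nonempty → T ≠ A → T ≠ B →
    T.card + (if Disjoint T R then 2 else 1) ≤ (T.biUnion N).card

namespace HallGraph

variable {α : Type*} [DecidableEq α] (P : HallGraph α)

/-- The set of neighbours of a set of vertices. -/
def nb (T : Finset α) : Finset α := T.biUnion P.N

/-- The surplus required of a set of vertices. -/
def req (T : Finset α) : ℕ := if Disjoint T P.R then 2 else 1

/-- The set lies in one colour class. -/
def Side (T : Finset α) : Prop := T ⊆ P.A ∨ T ⊆ P.B

/-- A one-sided set whose surplus is as small as possible. -/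
def Tight (T : Finset α) : Prop :=
  P.Side T ∧ T.Nonempty ∧ (P.nb T).card = T.card + P.req T

/-- No tight set other than `{x}` contains `x` as the only neighbour of `y`. -/
def Half (x y : α) : Prop := ∀ T, P.Tight T → x ∈ T → P.N y ∩ T = {x} → T = {x}

/-- A vertex with three neighbours which lies outside `R`. -/
def Free (v : α) : Prop := (P.N v).card = 3 ∧ v ∉ P.R

/-- A vertex with two neighbours; such a vertex lies in `R`. -/
def Special (v : α) : Prop := (P.N v).card = 2

/-- The combinatorial description of `R`-thin edges. -/
structure Thin (x y : α) : Prop where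
  adj : y ∈ P.N x
  left_not_special : ¬ P.Special x
  right_not_special : ¬ P.Special y
  left : P.Half x y
  right : P.Half y x
  left_tri : P.Free x → ¬ (P.N x).erase y ⊆ P.R
  right_tri : P.Free y → ¬ (P.N y).erase x ⊆ P.R

/-- The local configurations which create multiple edges in the retract after deleting `xy`. -/
def Multi (x y : α) : Prop :=
  (P.Free x ∧ ∃ w, w ≠ x ∧ (P.N x).erase y ⊆ P.N w) ∨
  (P.Free y ∧ ∃ w, w ≠ y ∧ (P.N y).erase x ⊆ P.N w) ∨
  (P.Free x ∧ P.Free y ∧ ∃ x₁ x₂ y₁ y₂, P.N x = {y, x₁, x₂} ∧ P.N y = {x, y₁, y₂} ∧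
    x₁ ≠ x₂ ∧ y₁ ≠ y₂ ∧ y₁ ∈ P.N x₁ ∧ y₂ ∈ P.N x₂)

/-- Two vertices lie in the same colour class. -/
def Same (u v : α) : Prop := (u ∈ P.A ∧ v ∈ P.A) ∨ (u ∈ P.B ∧ v ∈ P.B)

variable {P}

lemma not_mem_A_B {v : α} (h : v ∈ P.A) (h' : v ∈ P.B) : False :=
  (Finset.disjoint_left.1 P.disj) h h'

lemma same_of_mem {u v w : α} (hv : v ∈ P.N u) (hw : w ∈ P.N u) : P.Same v w := by
  have h1 := P.mem hv
  have h2 := P.mem hw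
  have := @not_mem_A_B _ _ P u
  unfold Same
  tauto

lemma Same.symm {u v : α} (h : P.Same u v) : P.Same v u := by
  unfold Same at *; tauto

lemma Same.trans {u v w : α} (h : P.Same u v) (h' : P.Same v w) : P.Same u w := by
  have := @not_mem_A_B _ _ P v
  unfold Same at *; tauto

lemma Same.not_adj {u v : α} (h : P.Same u v) : v ∉ P.N u := by
  intro h'
  have h1 := P.mem h'
  have := @not_mem_A_B _ _ P u
  have := @not_mem_A_B _ _ P v
  unfold Same at *; tauto

lemma Same.ne_of_adj {u v w : α} (h : P.Same u v) (h' : w ∈ P.N u) : v ≠ w := by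
  rintro rfl
  exact h.not_adj h'

lemma ne_of_adj {u v : α} (h : v ∈ P.N u) : u ≠ v := by
  rintro rfl
  have h1 := P.mem h
  have := @not_mem_A_B _ _ P u
  tauto

lemma side_of_same {T : Finset α} (u : α) (hu : u ∈ T) (h : ∀ v ∈ T, P.Same u v) : P.Side T := by
  rcases h u hu with ⟨hA, -⟩ | ⟨hB, -⟩
  · left
    intro v hv
    rcases h v hv with h | h
    · exact h.2
    · exact (not_mem_A_B hA h.1).elim
  · right
    intro v hv
    rcases h v hv with h | h
    · exact (not_mem_A_B h.1 hB).elim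
    · exact h.2

lemma Side.same {T : Finset α} (h : P.Side T) {u v : α} (hu : u ∈ T) (hv : v ∈ T) :
    P.Same u v := by
  rcases h with h | h
  · exact Or.inl ⟨h hu, h hv⟩
  · exact Or.inr ⟨h hu, h hv⟩

lemma Side.subset {T S : Finset α} (h : P.Side T) (hS : S ⊆ T) : P.Side S :=
  h.imp hS.trans hS.trans

lemma mem_nb {T : Finset α} {w : α} : w ∈ P.nb T ↔ ∃ v ∈ T, w ∈ P.N v := by
  simp [nb]

lemma one_le_req (T : Finset α) : 1 ≤ P.req T := by
  unfold req; split_ifs <;> omega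

lemma req_anti {S T : Finset α} (h : S ⊆ T) : P.req T ≤ P.req S := by
  unfold req
  by_cases hT : Disjoint T P.R
  · rw [if_pos hT, if_pos (Finset.disjoint_of_subset_left h hT)]
  · rw [if_neg hT]; split_ifs <;> omega

lemma req_of_avoid {T : Finset α} (h : ∀ v ∈ T, v ∉ P.R) : P.req T = 2 :=
  if_pos (Finset.disjoint_left.2 h)

lemma req_insert {T : Finset α} {v : α} (hv : v ∉ P.R) : P.req (insert v T) = P.req T := by
  simp [req, Finset.disjoint_insert_left, hv]

lemma hall' {T : Finset α} (h : P.Side T) (hne : T.Nonempty) (hA : T ≠ P.A) (hB : T ≠ P.B) :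
    T.card + P.req T ≤ (P.nb T).card := P.hall T h hne hA hB

/-- Each colour class contains two vertices of `R`. Properness is therefore automatic for sets that
avoid `R`, and `hall_avoid` need not assume it. -/
lemma avoid_ne {T : Finset α} (h : ∀ v ∈ T, v ∉ P.R) : T ≠ P.A ∧ T ≠ P.B := by
  constructor <;> rintro rfl
  · have := P.card_RA
    obtain ⟨x, hx⟩ := Finset.card_pos.1 (by omega : 0 < (P.R ∩ P.A).card)
    rw [Finset.mem_inter] at hx
    exact h x hx.2 hx.1
  · have := P.card_RB
    obtain ⟨x, hx⟩ := Finset.card_pos.1 (by omega : 0 < (P.R ∩ P.B).card)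
    rw [Finset.mem_inter] at hx
    exact h x hx.2 hx.1

lemma hall_avoid {T K : Finset α} (h : P.Side T) (hne : T.Nonempty) (hR : ∀ v ∈ T, v ∉ P.R)
    (hK : ∀ v ∈ T, P.N v ⊆ K) : T.card + 2 ≤ K.card := by
  have h1 := hall' h hne (avoid_ne hR).1 (avoid_ne hR).2
  rw [req_of_avoid hR] at h1
  exact h1.trans (Finset.card_le_card (Finset.biUnion_subset.2 hK))

lemma two_le_A : 2 ≤ P.A.card := by
  rw [← P.card_RA]; exact Finset.card_le_card Finset.inter_subset_right

lemma two_le_B : 2 ≤ P.B.card := P.card_eq ▸ P.two_le_A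

lemma singleton_ne (v : α) : {v} ≠ P.A ∧ {v} ≠ P.B := by
  constructor <;> intro h
  · have := P.two_le_A; rw [← h] at this; simp at this
  · have := P.two_le_B; rw [← h] at this; simp at this

lemma side_singleton {v : α} (hv : v ∈ P.A ∨ v ∈ P.B) : P.Side {v} := by
  simpa [Side] using hv

lemma mem_side {v w : α} (h : w ∈ P.N v) : v ∈ P.A ∨ v ∈ P.B := by
  have := P.mem h; tauto

lemma req_le_card {v : α} (hv : v ∈ P.A ∨ v ∈ P.B) : 1 + P.req {v} ≤ (P.N v).card := by
  simpa [nb] using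
    hall' (side_singleton hv) (Finset.singleton_nonempty v) (singleton_ne v).1 (singleton_ne v).2

lemma two_le_card {v : α} (hv : v ∈ P.A ∨ v ∈ P.B) : 2 ≤ (P.N v).card := by
  have := req_le_card hv
  have := one_le_req (P := P) {v}
  omega

lemma three_le_card {v : α} (hv : v ∈ P.A ∨ v ∈ P.B) (hR : v ∉ P.R) : 3 ≤ (P.N v).card := by
  have := req_le_card hv
  rw [req_of_avoid (by simpa using hR)] at this
  omega

lemma three_le_card_of_not_special {v : α} (hv : v ∈ P.A ∨ v ∈ P.B) (h : ¬ P.Special v) :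
    3 ≤ (P.N v).card := by
  have := two_le_card hv
  unfold Special at h
  omega

/-- Off `R`, even a single vertex needs three neighbours. -/
lemma Special.mem_R {v : α} (h : P.Special v) : v ∈ P.R := by
  by_contra hR
  obtain ⟨w, hw⟩ := Finset.card_pos.1 (by unfold Special at h; omega : 0 < (P.N v).card)
  have := three_le_card (mem_side hw) hR
  unfold Special at h
  omega

lemma Free.not_special {v : α} (h : P.Free v) : ¬ P.Special v := by
  unfold Special; have := h.1; omega

/-- This version without surplus also covers whole colour classes: dropping one vertex leaves a
proper subset, whose surplus of one makes up for the dropped vertex. -/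
lemma hall_weak {T : Finset α} (h : P.Side T) : T.card ≤ (P.nb T).card := by
  have key : ∀ C : Finset α, 2 ≤ C.card → (∀ S ⊆ C, S.Nonempty → S ≠ C → S.card < (P.nb S).card) →
      ∀ T ⊆ C, T.card ≤ (P.nb T).card := by
    intro C hC hS T hT
    rcases T.eq_empty_or_nonempty with rfl | hne
    · simp
    by_cases hTC : T = C
    · obtain ⟨x, hx⟩ := hne
      have h1 : (T.erase x).card + 1 = T.card := Finset.card_erase_add_one hx
      have h2 := hS (T.erase x) ((Finset.erase_subset _ _).trans hT)
        (Finset.card_pos.1 (by rw [← hTC] at hC; omega))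
        (by intro h; rw [h, ← hTC] at h1; omega)
      have h3 : (P.nb (T.erase x)).card ≤ (P.nb T).card :=
        Finset.card_le_card (Finset.biUnion_subset_biUnion_of_subset_left _ (Finset.erase_subset _ _))
      omega
    · exact (hS T hT hne hTC).le
  have hAB : P.A ≠ P.B := by
    intro h
    have := P.disj
    rw [h, Finset.disjoint_self_iff_empty] at this
    have := P.two_le_B
    simp_all
  have aux : ∀ S : Finset α, P.Side S → S.Nonempty → S ≠ P.A → S ≠ P.B → S.card < (P.nb S).card := by
    intro S h h1 h2 h3
    have := hall' h h1 h2 h3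
    have := one_le_req (P := P) S
    omega
  rcases h with h | h
  · refine key P.A P.two_le_A (fun S hS h1 h2 => aux S (Or.inl hS) h1 h2 ?_) T h
    rintro rfl
    obtain ⟨x, hx⟩ := h1
    exact not_mem_A_B (hS hx) hx
  · refine key P.B P.two_le_B (fun S hS h1 h2 => aux S (Or.inr hS) h1 ?_ h2) T h
    rintro rfl
    obtain ⟨x, hx⟩ := h1
    exact not_mem_A_B hx (hS hx)

/-- A tight set cannot absorb a vertex outside `R` without gaining a neighbour. -/
lemma Tight.not_subset_nb {T : Finset α} (h : P.Tight T) {v : α} (hv : v ∉ T) (hR : v ∉ P.R)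
    (hs : P.Side (insert v T)) (hA : insert v T ≠ P.A) (hB : insert v T ≠ P.B) :
    ¬ P.N v ⊆ P.nb T := by
  intro hsub
  have h1 := hall' hs (Finset.insert_nonempty _ _) hA hB
  rw [req_insert hR, Finset.card_insert_of_notMem hv] at h1
  have h2 : P.nb (insert v T) ⊆ P.nb T := by
    simp only [nb, Finset.biUnion_insert]
    exact Finset.union_subset hsub subset_rfl
  have := Finset.card_le_card h2
  have := h.2.2
  omega

/-- In a tight set no vertex has two private neighbours. -/
lemma Tight.exists_other {T : Finset α} (h : P.Tight T) {x y z : α} (hx : x ∈ T) (hT : T ≠ {x})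
    (hy : P.N y ∩ T = {x}) (hz : z ∈ P.N x) (hzy : z ≠ y) :
    ∃ w ∈ T, w ≠ x ∧ w ∈ P.N z := by
  by_contra! hcon
  have hne : (T.erase x).Nonempty := by
    rw [Finset.nonempty_iff_ne_empty]
    intro h0
    exact hT ((Finset.erase_eq_empty_iff _ _).1 h0 |>.resolve_left (Finset.ne_empty_of_mem hx))
  have hs : P.Side (T.erase x) := h.1.subset (Finset.erase_subset _ _)
  have hc := Finset.card_erase_add_one hx
  -- Removing `x` would cost the two neighbours `y` and `z`, one more than a tight set can afford;
  -- the requirement does not decrease when the set shrinks.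
  have hlt : P.nb (T.erase x) ⊆ ((P.nb T).erase y).erase z := by
    intro w hw
    obtain ⟨v, hv, hvw⟩ := mem_nb.1 hw
    rw [Finset.mem_erase] at hv
    refine Finset.mem_erase.2 ⟨?_, Finset.mem_erase.2 ⟨?_, mem_nb.2 ⟨v, hv.2, hvw⟩⟩⟩
    · rintro rfl
      exact hcon v hv.2 hv.1 (P.symm hvw)
    · rintro rfl
      have : v ∈ P.N w ∩ T := Finset.mem_inter.2 ⟨P.symm hvw, hv.2⟩
      rw [hy, Finset.mem_singleton] at this
      exact hv.1 this
  have hyT : y ∈ P.nb T := by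
    have : x ∈ P.N y ∩ T := by rw [hy]; simp
    exact mem_nb.2 ⟨x, hx, P.symm (Finset.mem_inter.1 this).1⟩
  have hzT : z ∈ (P.nb T).erase y := Finset.mem_erase.2 ⟨hzy, mem_nb.2 ⟨x, hx, hz⟩⟩
  have h1 := Finset.card_le_card hlt
  have h2 := Finset.card_erase_add_one hyT
  have h3 := Finset.card_erase_add_one hzT
  have h4 := h.2.2
  have h6 := req_anti (P := P) (Finset.erase_subset x T)
  have hAe : T.erase x ≠ P.A ∧ T.erase x ≠ P.B := by
    constructor
    · intro he
      rcases h.1 with h' | h'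
      · exact (Finset.notMem_erase x T) (he ▸ h' hx)
      · obtain ⟨v, hv⟩ := hne
        exact not_mem_A_B (he ▸ hv) (h' (Finset.mem_of_mem_erase hv))
    · intro he
      rcases h.1 with h' | h'
      · obtain ⟨v, hv⟩ := hne
        exact not_mem_A_B (h' (Finset.mem_of_mem_erase hv)) (he ▸ hv)
      · exact (Finset.notMem_erase x T) (he ▸ h' hx)
  have h5 := hall' hs hne hAe.1 hAe.2
  omega

/-- The neighbours of a whole class lie in the other class, which has the same size, so there is no
surplus. -/
lemma Tight.ne {T : Finset α} (h : P.Tight T) : T ≠ P.A ∧ T ≠ P.B := by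
  have h1 := h.2.2
  have h2 := one_le_req (P := P) T
  constructor <;> rintro rfl
  · have : P.nb P.A ⊆ P.B := by
      intro w hw
      obtain ⟨v, hv, hvw⟩ := mem_nb.1 hw
      have := P.mem hvw
      have := @not_mem_A_B _ _ P v
      tauto
    have := Finset.card_le_card this
    have := P.card_eq
    omega
  · have : P.nb P.B ⊆ P.A := by
      intro w hw
      obtain ⟨v, hv, hvw⟩ := mem_nb.1 hw
      have := P.mem hvw
      have := @not_mem_A_B _ _ P v
      tauto
    have := Finset.card_le_card this
    have := P.card_eq
    omega

lemma eq_of_card_three {v a b c : α} (h : (P.N v).card ≤ 3) (ha : a ∈ P.N v) (hb : b ∈ P.N v)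
    (hc : c ∈ P.N v) (hab : a ≠ b) (hac : a ≠ c) (hbc : b ≠ c) : P.N v = {a, b, c} := by
  symm
  apply Finset.eq_of_subset_of_card_le
  · intro x; simp only [Finset.mem_insert, Finset.mem_singleton]; rintro (rfl | rfl | rfl) <;> assumption
  · rw [Finset.card_eq_three.2 ⟨a, b, c, hab, hac, hbc, rfl⟩]; exact h

lemma eq_of_card_two {v a b : α} (h : (P.N v).card ≤ 2) (ha : a ∈ P.N v) (hb : b ∈ P.N v)
    (hab : a ≠ b) : P.N v = {a, b} := by
  symm
  apply Finset.eq_of_subset_of_card_le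
  · intro x; simp only [Finset.mem_insert, Finset.mem_singleton]; rintro (rfl | rfl) <;> assumption
  · rw [Finset.card_pair hab]; exact h

lemma exists_third {v a b : α} (h : 3 ≤ (P.N v).card) : ∃ c ∈ P.N v, c ≠ a ∧ c ≠ b := by
  by_contra! hcon
  have : P.N v ⊆ {a, b} := by
    intro x hx
    by_cases hxa : x = a
    · simp [hxa]
    · simp [hcon x hx hxa]
  have := (Finset.card_le_card this).trans Finset.card_le_two
  omega

lemma Free.exists_eq {v a b : α} (h : P.Free v) (ha : a ∈ P.N v) (hb : b ∈ P.N v) (hab : a ≠ b) :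
    ∃ c, c ≠ a ∧ c ≠ b ∧ P.N v = {a, b, c} := by
  obtain ⟨c, hc, hca, hcb⟩ := exists_third (a := a) (b := b) h.1.ge
  exact ⟨c, hca, hcb, eq_of_card_three h.1.le ha hb hc hab hca.symm hcb.symm⟩

lemma Free.ne_of_eq {v a b c : α} (h : P.Free v) (e : P.N v = {a, b, c}) :
    a ≠ b ∧ a ≠ c ∧ b ≠ c := by
  have h3 := h.1
  rw [e] at h3
  refine ⟨?_, ?_, ?_⟩ <;> rintro rfl
  · rw [Finset.insert_eq_of_mem (by simp)] at h3
    have : ({a, c} : Finset α).card ≤ 2 := Finset.card_le_two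
    omega
  · rw [Finset.insert_eq_of_mem (by simp)] at h3
    have : ({b, a} : Finset α).card ≤ 2 := Finset.card_le_two
    omega
  · have : ({a, b, b} : Finset α) = {a, b} := by simp
    rw [this] at h3
    have : ({a, b} : Finset α).card ≤ 2 := Finset.card_le_two
    omega

/-- Two vertices outside `R` of the same class have at least four neighbours altogether. -/
lemma four_le_of_pair {u v : α} {K : Finset α} (huv : u ≠ v) (hs : P.Same u v) (hu : u ∉ P.R)
    (hv : v ∉ P.R) (hKu : P.N u ⊆ K) (hKv : P.N v ⊆ K) : 4 ≤ K.card := by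
  have := hall_avoid (P := P) (T := {u, v}) (K := K)
    (side_of_same u (by simp) (by
      intro w hw
      rw [Finset.mem_insert, Finset.mem_singleton] at hw
      rcases hw with rfl | rfl
      · exact hs.trans hs.symm
      · exact hs))
    (by simp) (by simp [hu, hv]) (by simp [hKu, hKv])
  rwa [Finset.card_pair huv] at this

lemma Thin.symm {x y : α} (h : P.Thin x y) : P.Thin y x :=
  ⟨P.symm h.adj, h.right_not_special, h.left_not_special, h.right, h.left, h.right_tri, h.left_tri⟩

/-- The edges `xy`, `x'z`, `x₂z₂` are the rungs of a ladder with inner rung `x'z`. A larger tight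
set `T` must contain a second neighbour of `x'`; as `z` is a neighbour of `y`, this can only be
`x₂`. But then `z ∉ R` could be added to `T` without gaining a neighbour. That `y` is not special
keeps the enlarged set from being a whole class. -/
lemma half_of_quad {x y z x' x₂ z₂ : α} (hy : ¬ P.Special y) (hyx : y ∈ P.N x)
    (hxz : x ≠ z) (hx'y : x' ≠ y) (hx'x : x' ∈ P.N x) (hzR : z ∉ P.R)
    (hx' : P.N x' = {x, z, x₂}) (hz : P.N z = {y, x', z₂}) (h2 : z₂ ∈ P.N x₂) : P.Half x y := by
  intro T hT hxT hyT
  by_contra hne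
  have hzy : z ∈ P.N y := P.symm (by rw [hz]; simp)
  have hzT : z ∉ T := by
    intro h
    have : z ∈ P.N y ∩ T := Finset.mem_inter.2 ⟨hzy, h⟩
    rw [hyT, Finset.mem_singleton] at this
    exact hxz this.symm
  obtain ⟨w, hwT, hwx, hw⟩ := hT.exists_other hxT hne hyT hx'x hx'y
  have hx₂ : x₂ ∈ T := by
    rw [hx'] at hw
    simp only [Finset.mem_insert, Finset.mem_singleton] at hw
    rcases hw with rfl | rfl | rfl
    · exact (hwx rfl).elim
    · exact (hzT hwT).elim
    · exact hwT
  have hside : P.Side (insert z T) := by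
    refine side_of_same x (by simp [hxT]) fun v hv => ?_
    rcases Finset.mem_insert.1 hv with rfl | hv
    · exact same_of_mem (P.symm hyx) hzy
    · exact hT.1.same hxT hv
  have hnot : ∀ C, C ⊆ P.A ∪ P.B → (∀ v ∈ P.A ∪ P.B, P.Same x v → v ∈ C) → insert z T ≠ C := by
    rintro C - hC rfl
    apply hy
    have hsub : P.N y ⊆ {x, z} := by
      intro v hv
      have h1 := mem_side (P.symm hv)
      have h3 := hC v (by simpa using h1) (same_of_mem (P.symm hyx) hv)
      rcases Finset.mem_insert.1 h3 with rfl | h3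
      · simp
      · have : v ∈ P.N y ∩ T := Finset.mem_inter.2 ⟨hv, h3⟩
        rw [hyT, Finset.mem_singleton] at this
        simp [this]
    have h1 := (Finset.card_le_card hsub).trans Finset.card_le_two
    have h3 := two_le_card (mem_side hzy)
    unfold Special
    omega
  have hneAB : insert z T ≠ P.A ∧ insert z T ≠ P.B := by
    constructor
    · intro h
      refine hnot P.A Finset.subset_union_left (fun v _ hs => ?_) h
      rcases hs with hs | hs
      · exact hs.2
      · exact (not_mem_A_B (h ▸ Finset.mem_insert_of_mem hxT) hs.1).elim
    · intro h
      refine hnot P.B Finset.subset_union_right (fun v _ hs => ?_) h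
      rcases hs with hs | hs
      · exact (not_mem_A_B hs.1 (h ▸ Finset.mem_insert_of_mem hxT)).elim
      · exact hs.2
  refine hT.not_subset_nb hzT hzR hside hneAB.1 hneAB.2 ?_
  rw [hz]
  intro v hv
  simp only [Finset.mem_insert, Finset.mem_singleton] at hv
  rcases hv with rfl | rfl | rfl
  · exact mem_nb.2 ⟨x, hxT, hyx⟩
  · exact mem_nb.2 ⟨x, hxT, hx'x⟩
  · exact mem_nb.2 ⟨x₂, hx₂, h2⟩

/-- The outer rungs of a ladder with three rungs are thin if the inner rung has cubic ends
outside `R`. -/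
lemma thin_of_quad {x y z x' x₂ z₂ : α} (hx : ¬ P.Special x) (hy : ¬ P.Special y)
    (hyx : y ∈ P.N x) (hxz : x ≠ z) (hx'y : x' ≠ y) (hzF : P.Free z) (hx'F : P.Free x')
    (hx' : P.N x' = {x, z, x₂}) (hz : P.N z = {y, x', z₂}) (h2 : z₂ ∈ P.N x₂) : P.Thin x y := by
  have hx'x : x' ∈ P.N x := P.symm (by rw [hx']; simp)
  have hzy : z ∈ P.N y := P.symm (by rw [hz]; simp)
  refine ⟨hyx, hx, hy, half_of_quad hy hyx hxz hx'y hx'x hzF.2 hx' hz h2,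
    half_of_quad hx (P.symm hyx) hx'y.symm hxz.symm hzy hx'F.2 hz hx' (P.symm h2), ?_, ?_⟩
  · intro _ h
    exact hx'F.2 (h (Finset.mem_erase.2 ⟨hx'y, hx'x⟩))
  · intro _ h
    exact hzF.2 (h (Finset.mem_erase.2 ⟨hxz.symm, hzy⟩))

end HallGraph
end RBrick

/-! ### Common neighbours around a thin edge with free ends -/

namespace RBrick
namespace HallGraph

variable {α : Type*} [DecidableEq α] {P : HallGraph α}

lemma triple_rotate (a b c : α) : ({a, b, c} : Finset α) = {b, c, a} := by ext; simp; tauto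

lemma triple_swap_left (a b c : α) : ({a, b, c} : Finset α) = {b, a, c} := Finset.insert_comm a b _

lemma triple_swap_right (a b c : α) : ({a, b, c} : Finset α) = {a, c, b} := by
  rw [Finset.pair_comm b c]

lemma triple_swap_outer (a b c : α) : ({a, b, c} : Finset α) = {c, b, a} := by
  rw [triple_rotate, triple_swap_left]

/-- A common neighbour of the outer ends of three consecutive rungs contradicts thinness of the
middle rung. -/
lemma third_not_mem (hM : ∀ x y, P.Thin x y → P.Multi x y) {p q p₁ q₁ p₂ q₂ s : α}
    (h : P.Thin p q) (hp : P.Free p) (hq : P.Free q) (hNp : P.N p = {q, p₁, p₂})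
    (hNq : P.N q = {p, q₁, q₂}) (h2 : q₂ ∈ P.N p₂)
    (hp₁ : P.Free p₁) (hN₁ : P.N p₁ = {p, q₁, s}) : s ∉ P.N q ∧ s ∉ P.N p₂ := by
  obtain ⟨hpq₁, hpq₂, hq₁₂⟩ := hq.ne_of_eq hNq
  obtain ⟨hqp₁, hqp₂, hp₁₂⟩ := hp.ne_of_eq hNp
  obtain ⟨_, hps, hq₁s⟩ := hp₁.ne_of_eq hN₁
  have hqp : q ∈ P.N p := by simp [hNp]
  have hp₁p : p₁ ∈ P.N p := by simp [hNp]
  have hp₂p : p₂ ∈ P.N p := by simp [hNp]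
  have hsp₁ : s ∈ P.N p₁ := by simp [hN₁]
  have hsq : s ∉ P.N q := by
    intro hs
    have hs2 : s = q₂ := by
      rw [hNq] at hs
      simp only [Finset.mem_insert, Finset.mem_singleton] at hs
      rcases hs with rfl | rfl | rfl
      · exact (hps rfl).elim
      · exact (hq₁s rfl).elim
      · rfl
    subst hs2
    have := four_le_of_pair (K := {p, q₁, s}) hqp₁ (same_of_mem hqp hp₁p) hq.2 hp₁.2
      hNq.subset hN₁.subset
    have := (Finset.card_le_three (a := p) (b := q₁) (c := s))
    omega
  refine ⟨hsq, fun hsp₂ => ?_⟩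
  have hsame : P.Same p s := same_of_mem (P.symm hp₁p) hsp₁
  have hside : P.Side {p, s} := side_of_same p (by simp) (by
    intro w hw
    rw [Finset.mem_insert, Finset.mem_singleton] at hw
    rcases hw with rfl | rfl
    · exact hsame.trans hsame.symm
    · exact hsame)
  have hcap : P.N q ∩ {p, s} = {p} := by
    ext v
    simp only [Finset.mem_inter, Finset.mem_insert, Finset.mem_singleton]
    constructor
    · rintro ⟨h1, rfl | rfl⟩
      · rfl
      · exact (hsq h1).elim
    · rintro rfl
      exact ⟨P.symm hqp, Or.inl rfl⟩
  -- If `s` were special or free, it would have so few neighbours besides those of `p` that `{p, s}`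
  -- would be tight. The next two case distinctions exclude this.
  have hnt : ¬ P.Tight {p, s} := by
    intro ht
    have := h.left {p, s} ht (by simp) hcap
    have h2 : s ∈ ({p} : Finset α) := this ▸ (by simp)
    exact hps (Finset.mem_singleton.1 h2).symm
  have hsV := mem_side (P.symm hsp₂)
  have hnbp : P.nb {p, s} = P.N p ∪ P.N s := by simp [nb]
  have hp₁s : p₁ ∈ P.N s := P.symm hsp₁
  have hp₂s : p₂ ∈ P.N s := P.symm hsp₂
  by_cases hsS : P.Special s
  · apply hnt
    refine ⟨hside, by simp, ?_⟩
    have hNs := eq_of_card_two hsS.le hp₁s hp₂s hp₁₂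
    have : P.nb {p, s} = {q, p₁, p₂} := by
      rw [hnbp, hNp, hNs]; ext; simp
    rw [this, Finset.card_eq_three.2 ⟨q, p₁, p₂, hqp₁, hqp₂, hp₁₂, rfl⟩, Finset.card_pair hps]
    have := hsS.mem_R
    simp [req, this]
  by_cases hsF : P.Free s
  · apply hnt
    refine ⟨hside, by simp, ?_⟩
    obtain ⟨z, -, -, hNs⟩ := hsF.exists_eq hp₁s hp₂s hp₁₂
    have hle : (P.nb {p, s}).card ≤ 4 := by
      refine (Finset.card_le_card (t := {q, p₁, p₂, z}) ?_).trans Finset.card_le_four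
      rw [hnbp, hNp, hNs]; intro v; simp
    have hR : ∀ v ∈ ({p, s} : Finset α), v ∉ P.R := by simp [hp.2, hsF.2]
    have hge := hall_avoid (K := P.nb {p, s}) hside (by simp) hR
      (fun v hv => Finset.subset_biUnion_of_mem P.N hv)
    rw [req_of_avoid hR]
    rw [Finset.card_pair hps] at hge ⊢
    omega
  have hps₂ : p ∈ P.N p₂ := P.symm hp₂p
  have hsq₂ : s ≠ q₂ := by
    rintro rfl; exact hsq (by simp [hNq])
  have hnS : ¬ P.Special p₂ := by
    intro hS
    have := eq_of_card_two hS.le hps₂ h2 hpq₂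
    rw [this] at hsp₂
    simp only [Finset.mem_insert, Finset.mem_singleton] at hsp₂
    rcases hsp₂ with rfl | rfl
    · exact hps rfl
    · exact hsq₂ rfl
  -- The rungs `p₂s`, `pp₁`, `qq₁` form a ladder, so `p₂s` is thin. As `s` is not free, each form of
  -- `Multi` makes `p₂` free.
  have hthin : P.Thin p₂ s := by
    refine thin_of_quad (z := p₁) (x' := p) (x₂ := q) (z₂ := q₁) hnS hsS hsp₂ hp₁₂.symm hps hp₁ hp
      ?_ ?_ ?_
    · rw [hNp, triple_swap_outer]
    · rw [hN₁, triple_rotate, triple_rotate]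
    · simp [hNq]
  have hF₂ : P.Free p₂ := by
    rcases hM _ _ hthin with h | h | h
    · exact h.1
    · exact (hsF h.1).elim
    · exact h.1
  have hN₂ := eq_of_card_three hF₂.1.le hps₂ h2 hsp₂ hpq₂ hps hsq₂.symm
  -- Three vertices off `R` need five neighbours, but these have only four.
  have := hall_avoid (P := P) (T := {q, p₁, p₂}) (K := {p, q₁, q₂, s})
    (hNp ▸ (side_of_same q (by simp [hNp]) (fun v hv => same_of_mem hqp hv)))
    (by simp) (by simp [hq.2, hp₁.2, hF₂.2]) (by
      intro v hv
      simp only [Finset.mem_insert, Finset.mem_singleton] at hv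
      rcases hv with rfl | rfl | rfl
      · rw [hNq]; simp [Finset.insert_subset_iff]
      · rw [hN₁]; simp [Finset.insert_subset_iff]
      · rw [hN₂]; simp [Finset.insert_subset_iff])
  rw [Finset.card_eq_three.2 ⟨q, p₁, p₂, hqp₁, hqp₂, hp₁₂, rfl⟩] at this
  have := (Finset.card_le_four (a := p) (b := q₁) (c := q₂) (d := s))
  omega

/-- If the rung next to a thin rung contains no special vertex, then both its ends are cubic, and
the ladder can be continued beyond it. -/
lemma extend_rung (hM : ∀ x y, P.Thin x y → P.Multi x y) {p q p₁ q₁ p₂ q₂ : α}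
    (h : P.Thin p q) (hp : P.Free p) (hq : P.Free q) (hNp : P.N p = {q, p₁, p₂})
    (hNq : P.N q = {p, q₁, q₂}) (h1 : q₁ ∈ P.N p₁) (h2 : q₂ ∈ P.N p₂)
    (hs₁ : ¬ P.Special p₁) (hs₂ : ¬ P.Special q₁) :
    P.Thin p₁ q₁ ∧ P.Free p₁ ∧ P.Free q₁ ∧ ∃ s t, P.N p₁ = {p, q₁, s} ∧ P.N q₁ = {q, p₁, t} ∧
      t ∈ P.N s := by
  obtain ⟨hpq₁, hpq₂, hq₁₂⟩ := hq.ne_of_eq hNq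
  obtain ⟨hqp₁, hqp₂, hp₁₂⟩ := hp.ne_of_eq hNp
  have hp₁p : p ∈ P.N p₁ := P.symm (by simp [hNp])
  have hq₁q : q ∈ P.N q₁ := P.symm (by simp [hNq])
  have hthin : P.Thin p₁ q₁ := thin_of_quad (z := q) (x' := p) (x₂ := p₂) (z₂ := q₂) hs₁ hs₂ h1
    hqp₁.symm hpq₁ hq hp (by rw [hNp, triple_swap_left]) (by rw [hNq, triple_swap_left]) h2
  have keyp : P.Free p₁ → ∀ s, P.N p₁ = {p, q₁, s} → s ∉ P.N q ∧ s ∉ P.N p₂ :=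
    fun hF s hs => third_not_mem hM h hp hq hNp hNq h2 hF hs
  have keyq : P.Free q₁ → ∀ t, P.N q₁ = {q, p₁, t} → t ∉ P.N p ∧ t ∉ P.N q₂ :=
    fun hF s hs => third_not_mem hM h.symm hq hp hNq hNp (P.symm h2) hF hs
  -- A common neighbour of `p` and the third neighbour `s` of `p₁` would be one of the neighbours
  -- `q`, `p₁`, `p₂` of `p`; `third_not_mem` excludes `q` and `p₂`. So neither of the first two
  -- forms of `Multi` occurs.
  have aux : ∀ {p q p₁ q₁ p₂ : α}, P.N p = {q, p₁, p₂} → q₁ ∈ P.N p₁ → p ∈ P.N p₁ → p ≠ q₁ →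
      (P.Free p₁ → ∀ s, P.N p₁ = {p, q₁, s} → s ∉ P.N q ∧ s ∉ P.N p₂) →
      (P.Free p₁ ∧ ∃ w, w ≠ p₁ ∧ (P.N p₁).erase q₁ ⊆ P.N w) → False := by
    rintro p q p₁ q₁ p₂ hNp h1 hp₁p hpq₁ key ⟨hF, w, hw, hsub⟩
    obtain ⟨s, hsp, hsq, hs⟩ := hF.exists_eq hp₁p h1 hpq₁
    have hk := key hF s hs
    have hwp : w ∈ P.N p := P.symm (hsub (Finset.mem_erase.2 ⟨hpq₁, hp₁p⟩))
    have hws : s ∈ P.N w := hsub (Finset.mem_erase.2 ⟨hsq, by simp [hs]⟩)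
    rw [hNp] at hwp
    simp only [Finset.mem_insert, Finset.mem_singleton] at hwp
    rcases hwp with rfl | rfl | rfl
    · exact hk.1 hws
    · exact hw rfl
    · exact hk.2 hws
  rcases hM _ _ hthin with hc | hc | ⟨hF, hF', x₁, x₂, y₁, y₂, e1, e2, hx, hy, h3, h4⟩
  · exact (aux hNp h1 hp₁p hpq₁ keyp hc).elim
  · exact (aux hNq (P.symm h1) hq₁q hqp₁ keyq hc).elim
  · refine ⟨hthin, hF, hF', ?_⟩
    obtain ⟨s, hsp, hsq, hs⟩ := hF.exists_eq hp₁p h1 hpq₁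
    obtain ⟨t, htp, htq, ht⟩ := hF'.exists_eq hq₁q (P.symm h1) hqp₁
    refine ⟨s, t, hs, ht, ?_⟩
    have hk := (keyp hF s hs).1
    have hk' := (keyq hF' t ht).1
    obtain ⟨n1, n2, -⟩ := hF.ne_of_eq e1
    obtain ⟨n3, n4, -⟩ := hF'.ne_of_eq e2
    have m : ∀ {x}, x ∈ P.N p₁ → x ≠ q₁ → x = p ∨ x = s := by
      intro x hx hx'
      rw [hs] at hx
      simp only [Finset.mem_insert, Finset.mem_singleton] at hx
      tauto
    have m' : ∀ {x}, x ∈ P.N q₁ → x ≠ p₁ → x = q ∨ x = t := by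
      intro x hx hx'
      rw [ht] at hx
      simp only [Finset.mem_insert, Finset.mem_singleton] at hx
      tauto
    have a1 := m (x := x₁) (by simp [e1]) n1.symm
    have a2 := m (x := x₂) (by simp [e1]) n2.symm
    have a3 := m' (x := y₁) (by simp [e2]) n3.symm
    have a4 := m' (x := y₂) (by simp [e2]) n4.symm
    -- The two disjoint edges cannot pair `p` with `t`, nor `q` with `s`; hence they are `pq` and
    -- `st`.
    rcases a1 with rfl | rfl <;> rcases a3 with rfl | rfl
    · rcases a2 with rfl | rfl
      · exact (hx rfl).elim
      · rcases a4 with rfl | rfl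
        · exact (hy rfl).elim
        · exact h4
    · exact (hk' h3).elim
    · exact (hk (P.symm h3)).elim
    · exact h3

/-- Let `T ≠ {p₁}` be tight with `p₁` as the only neighbour of `x` in it. It contains another
neighbour of `p`, which must be `q` because `p₂` is adjacent to `x`. Without `p₁` the set is still
tight and has `q` as the only neighbour of `p`, so thinness of `pq` gives `T = {p₁, q}`. Equality in
the count then puts `p₁` off `R`, and each neighbour of `p₁` other than `x` must be shared with `q`;
this is the case excluded by the last hypothesis. -/
lemma half_spoke_left {p q p₁ q₁ p₂ q₂ x : α}
    (h : P.Thin p q) (hp : P.Free p) (hq : P.Free q) (hNp : P.N p = {q, p₁, p₂})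
    (hNq : P.N q = {p, q₁, q₂}) (hxp : x ≠ p) (hx₁ : x ∈ P.N p₁) (hx₂ : x ∈ P.N p₂)
    (hG : ¬ (p₁ ∉ P.R ∧ P.N p₁ ⊆ {p, x, q₁, q₂})) : P.Half p₁ x := by
  obtain ⟨hqp₁, hqp₂, hp₁₂⟩ := hp.ne_of_eq hNp
  have hp₁p : p₁ ∈ P.N p := by simp [hNp]
  intro T hT hT₁ hcap
  by_contra hne
  obtain ⟨w, hwT, hw₁, hw⟩ := hT.exists_other hT₁ hne hcap (P.symm hp₁p) hxp.symm
  have hp₂T : p₂ ∉ T := by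
    intro h2
    have : p₂ ∈ P.N x ∩ T := Finset.mem_inter.2 ⟨P.symm hx₂, h2⟩
    rw [hcap, Finset.mem_singleton] at this
    exact hp₁₂ this.symm
  have hwq : w = q := by
    rw [hNp] at hw
    simp only [Finset.mem_insert, Finset.mem_singleton] at hw
    rcases hw with rfl | rfl | rfl
    · rfl
    · exact (hw₁ rfl).elim
    · exact (hp₂T hwT).elim
  subst hwq
  -- the set without `p₁`
  have hcap' : P.N p ∩ T.erase p₁ = {w} := by
    ext v
    rw [hNp]
    simp only [Finset.mem_inter, Finset.mem_insert, Finset.mem_singleton, Finset.mem_erase]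
    constructor
    · rintro ⟨rfl | rfl | rfl, h1, h2⟩
      · rfl
      · exact (h1 rfl).elim
      · exact (hp₂T h2).elim
    · rintro rfl
      exact ⟨Or.inl rfl, hw₁, hwT⟩
  have hwe : w ∈ T.erase p₁ := Finset.mem_erase.2 ⟨hw₁, hwT⟩
  have hsub : P.nb (T.erase p₁) ⊆ (P.nb T).erase x := by
    intro y hy
    obtain ⟨v, hv, hvy⟩ := mem_nb.1 hy
    rw [Finset.mem_erase] at hv
    refine Finset.mem_erase.2 ⟨?_, mem_nb.2 ⟨v, hv.2, hvy⟩⟩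
    rintro rfl
    have : v ∈ P.N y ∩ T := Finset.mem_inter.2 ⟨P.symm hvy, hv.2⟩
    rw [hcap, Finset.mem_singleton] at this
    exact hv.1 this
  have hxT : x ∈ P.nb T := mem_nb.2 ⟨p₁, hT₁, hx₁⟩
  have c1 := Finset.card_le_card hsub
  have c2 := Finset.card_erase_add_one hxT
  have c3 := Finset.card_erase_add_one hT₁
  have c4 := hT.2.2
  have c5 := req_anti (P := P) (Finset.erase_subset p₁ T)
  have hse := hT.1.subset (Finset.erase_subset p₁ T)
  have hAB : T.erase p₁ ≠ P.A ∧ T.erase p₁ ≠ P.B := by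
    constructor
    · intro he
      rcases hT.1 with h' | h'
      · exact (Finset.notMem_erase p₁ T) (he ▸ h' hT₁)
      · exact not_mem_A_B (he ▸ hwe) (h' hwT)
    · intro he
      rcases hT.1 with h' | h'
      · exact not_mem_A_B (h' hwT) (he ▸ hwe)
      · exact (Finset.notMem_erase p₁ T) (he ▸ h' hT₁)
  have c6 := hall' hse ⟨w, hwe⟩ hAB.1 hAB.2
  have htight : P.Tight (T.erase p₁) := ⟨hse, ⟨w, hwe⟩, by omega⟩
  have hTe := h.right _ htight hwe hcap'
  apply hG
  have hr : P.req (T.erase p₁) = 2 := by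
    rw [hTe]; exact req_of_avoid (by simpa using hq.2)
  have hr' : P.req T = 2 := by
    have : P.req T ≤ 2 := by unfold req; split_ifs <;> omega
    omega
  constructor
  · intro hR
    have : P.req T = 1 := if_neg (fun hd => (Finset.disjoint_left.1 hd) hT₁ hR)
    omega
  · intro v hv
    by_cases hvx : v = x
    · simp [hvx]
    · obtain ⟨w', hw'T, hw'₁, hw'⟩ := hT.exists_other hT₁ hne hcap hv hvx
      have : w' ∈ T.erase p₁ := Finset.mem_erase.2 ⟨hw'₁, hw'T⟩
      rw [hTe, Finset.mem_singleton] at this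
      subst this
      have := P.symm hw'
      rw [hNq] at this
      simp only [Finset.mem_insert, Finset.mem_singleton] at this ⊢
      tauto

/-- Given a tight set containing `x` but no other neighbour of `p₁`, add `p`: its neighbours `p₁`
and `p₂` are already counted, so `q` is the only new one and the set stays tight. Now `p` is the
only neighbour of `q` in it, against the thinness of `pq`. A third neighbour of `p₁` shows that the
enlarged set is not a whole class. -/
lemma half_spoke_right {p q p₁ p₂ x : α}
    (h : P.Thin p q) (hp : P.Free p) (hNp : P.N p = {q, p₁, p₂})
    (hxp : x ≠ p) (hx₁ : x ∈ P.N p₁) (hx₂ : x ∈ P.N p₂)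
    (hS : ¬ P.Special p₁) : P.Half x p₁ := by
  obtain ⟨hqp₁, hqp₂, hp₁₂⟩ := hp.ne_of_eq hNp
  have hp₁p : p₁ ∈ P.N p := by simp [hNp]
  intro T hT hxT hcap
  by_contra hne
  have hpT : p ∉ T := by
    intro h2
    have : p ∈ P.N p₁ ∩ T := Finset.mem_inter.2 ⟨P.symm hp₁p, h2⟩
    rw [hcap, Finset.mem_singleton] at this
    exact hxp this.symm
  have hside' : P.Side (insert p T) := by
    refine side_of_same p (by simp) fun v hv => ?_
    have hpx : P.Same p x := same_of_mem (P.symm hp₁p) hx₁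
    rcases Finset.mem_insert.1 hv with rfl | hv
    · exact hpx.trans hpx.symm
    · exact hpx.trans (hT.1.same hxT hv)
  obtain ⟨c, hc, hcp, hcx⟩ := exists_third (a := p) (b := x)
    (three_le_card_of_not_special (mem_side hx₁) hS)
  have hcT : c ∉ insert p T := by
    intro h2
    rcases Finset.mem_insert.1 h2 with rfl | h2
    · exact hcp rfl
    have : c ∈ P.N p₁ ∩ T := Finset.mem_inter.2 ⟨hc, h2⟩
    rw [hcap, Finset.mem_singleton] at this
    exact hcx this
  have hpc : P.Same p c := same_of_mem (P.symm hp₁p) hc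
  have hAB : insert p T ≠ P.A ∧ insert p T ≠ P.B := by
    constructor <;> intro he <;> rcases hpc with h' | h'
    · exact hcT (he ▸ h'.2)
    · exact not_mem_A_B (he ▸ Finset.mem_insert_self p T) h'.1
    · exact not_mem_A_B h'.1 (he ▸ Finset.mem_insert_self p T)
    · exact hcT (he ▸ h'.2)
  have hqT : q ∉ P.nb T := by
    intro hqT
    refine hT.not_subset_nb hpT hp.2 hside' hAB.1 hAB.2 ?_
    rw [hNp]
    intro v hv
    simp only [Finset.mem_insert, Finset.mem_singleton] at hv
    rcases hv with rfl | rfl | rfl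
    · exact hqT
    · exact mem_nb.2 ⟨x, hxT, P.symm hx₁⟩
    · exact mem_nb.2 ⟨x, hxT, P.symm hx₂⟩
  have hnb : P.nb (insert p T) = insert q (P.nb T) := by
    ext v
    rw [mem_nb, Finset.mem_insert, mem_nb]
    constructor
    · rintro ⟨u, hu, huv⟩
      rcases Finset.mem_insert.1 hu with rfl | hu
      · rw [hNp] at huv
        simp only [Finset.mem_insert, Finset.mem_singleton] at huv
        rcases huv with rfl | rfl | rfl
        · exact Or.inl rfl
        · exact Or.inr ⟨x, hxT, P.symm hx₁⟩
        · exact Or.inr ⟨x, hxT, P.symm hx₂⟩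
      · exact Or.inr ⟨u, hu, huv⟩
    · rintro (rfl | ⟨u, hu, huv⟩)
      · exact ⟨p, by simp, by simp [hNp]⟩
      · exact ⟨u, by simp [hu], huv⟩
  have ht : P.Tight (insert p T) := by
    refine ⟨hside', Finset.insert_nonempty _ _, ?_⟩
    rw [hnb, req_insert hp.2, Finset.card_insert_of_notMem hqT,
      Finset.card_insert_of_notMem hpT, hT.2.2]
    ring
  have := h.left _ ht (by simp) (by
    ext v
    simp only [Finset.mem_inter, Finset.mem_insert, Finset.mem_singleton]
    constructor
    · rintro ⟨hv, rfl | hvT⟩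
      · rfl
      · exact (hqT (mem_nb.2 ⟨v, hvT, P.symm hv⟩)).elim
    · rintro rfl
      exact ⟨P.symm (by simp [hNp]), Or.inl rfl⟩)
  have hx : x ∈ ({p} : Finset α) := this ▸ (by simp [hxT])
  exact hxp (Finset.mem_singleton.1 hx)

/-- The possibilities for an end of an edge joining `x` to a neighbour of `p`. -/
lemma spoke (hM : ∀ x y, P.Thin x y → P.Multi x y) {p q p₁ q₁ p₂ q₂ x : α}
    (h : P.Thin p q) (hp : P.Free p) (hq : P.Free q) (hNp : P.N p = {q, p₁, p₂})
    (hNq : P.N q = {p, q₁, q₂}) (hxp : x ≠ p) (hx₁ : x ∈ P.N p₁) (hx₂ : x ∈ P.N p₂)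
    (hxS : ¬ P.Special x) (hxF : ¬ P.Free x) :
    P.Special p₁ ∨ (p₁ ∉ P.R ∧ P.N p₁ ⊆ {p, x, q₁, q₂}) ∨
      (P.Free p₁ ∧ ∃ r, r ≠ p ∧ r ≠ x ∧ P.N p₁ = {p, x, r} ∧ r ∈ P.N p₂) := by
  obtain ⟨hqp₁, hqp₂, hp₁₂⟩ := hp.ne_of_eq hNp
  have hp₁p : p₁ ∈ P.N p := by simp [hNp]
  by_cases hS : P.Special p₁
  · exact Or.inl hS
  refine Or.inr ?_
  by_cases hG : p₁ ∉ P.R ∧ P.N p₁ ⊆ {p, x, q₁, q₂}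
  · exact Or.inl hG
  refine Or.inr ?_
  have hleft := half_spoke_left h hp hq hNp hNq hxp hx₁ hx₂ hG
  have hright := half_spoke_right h hp hNp hxp hx₁ hx₂ hS
  have hthin : P.Thin p₁ x := ⟨hx₁, hS, hxS, hleft, hright,
    fun _ hsub => hp.2 (hsub (Finset.mem_erase.2 ⟨hxp.symm, P.symm hp₁p⟩)),
    fun hF => (hxF hF).elim⟩
  -- Since `x` is not free, only the first form of `Multi` is possible: `p` and the third neighbour
  -- `r` of `p₁` have a common neighbour. If this is `q`, the case `hG` excluded above returns;
  -- otherwise it is `p₂`.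
  rcases hM _ _ hthin with ⟨hF, w, hw, hsub⟩ | hc | hc
  · obtain ⟨r, hrp, hrx, hN₁⟩ := hF.exists_eq (P.symm hp₁p) hx₁ hxp.symm
    refine ⟨hF, r, hrp, hrx, hN₁, ?_⟩
    have hwp : w ∈ P.N p := P.symm (hsub (Finset.mem_erase.2 ⟨hxp.symm, P.symm hp₁p⟩))
    have hwr : r ∈ P.N w := hsub (Finset.mem_erase.2 ⟨hrx, by simp [hN₁]⟩)
    rw [hNp] at hwp
    simp only [Finset.mem_insert, Finset.mem_singleton] at hwp
    rcases hwp with rfl | rfl | rfl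
    · refine (hG ⟨hF.2, ?_⟩).elim
      rw [hNq] at hwr
      rw [hN₁]
      intro v hv
      simp only [Finset.mem_insert, Finset.mem_singleton] at hv hwr ⊢
      rcases hv with rfl | rfl | rfl
      · exact Or.inl rfl
      · exact Or.inr (Or.inl rfl)
      · tauto
    · exact (hw rfl).elim
    · exact hwr
  · exact (hxF hc.1).elim
  · exact (hxF hc.2.1).elim

/-- Here `x` is itself one of `q₁`, `q₂`. It is matched with `p₁`, and a third neighbour of `p₂` is
the other one. -/
lemma matching_of_mem {p q p₁ q₁ p₂ q₂ x : α} (hNq : P.N q = {p, q₁, q₂}) (hxp : x ≠ p)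
    (hx₁ : x ∈ P.N p₁) (hx₂ : x ∈ P.N p₂) (hR : p₂ ∉ P.R) (hsub : P.N p₂ ⊆ {p, x, q₁, q₂})
    (hxq : x ∈ P.N q) :
    (q₁ ∈ P.N p₁ ∧ q₂ ∈ P.N p₂) ∨ (q₂ ∈ P.N p₁ ∧ q₁ ∈ P.N p₂) := by
  obtain ⟨c, hc, hcp, hcx⟩ := exists_third (a := p) (b := x) (three_le_card (mem_side hx₂) hR)
  have := hsub hc
  rw [hNq] at hxq
  simp only [Finset.mem_insert, Finset.mem_singleton] at this hxq
  rcases hxq with h | h | h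
  · exact (hxp h).elim
  · subst h
    rcases this with h' | h' | h' | h'
    · exact (hcp h').elim
    · exact (hcx h').elim
    · exact (hcx h').elim
    · exact Or.inl ⟨hx₁, h' ▸ hc⟩
  · subst h
    rcases this with h' | h' | h' | h'
    · exact (hcp h').elim
    · exact (hcx h').elim
    · exact Or.inr ⟨hx₁, h' ▸ hc⟩
    · exact (hcx h').elim

/-- If `x` had at most one neighbour besides `p₁` and `p₂`, then `{p, x}` would be a tight set
contradicting the thinness of `pq`. The exception is `x` adjacent to `q`, where a free `x` would
have the same three neighbours as `p`. -/
lemma hub_not_cubic {p q p₁ p₂ x : α}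
    (h : P.Thin p q) (hp : P.Free p) (hNp : P.N p = {q, p₁, p₂})
    (hxp : x ≠ p) (hx₁ : x ∈ P.N p₁) (hx₂ : x ∈ P.N p₂) : ¬ P.Special x ∧ ¬ P.Free x := by
  obtain ⟨hqp₁, hqp₂, hp₁₂⟩ := hp.ne_of_eq hNp
  have hqp : q ∈ P.N p := by simp [hNp]
  have hp₁p : p₁ ∈ P.N p := by simp [hNp]
  have hp₂p : p₂ ∈ P.N p := by simp [hNp]
  have hsame : P.Same p x := same_of_mem (P.symm hp₁p) hx₁
  have hp₁x : p₁ ∈ P.N x := P.symm hx₁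
  have hp₂x : p₂ ∈ P.N x := P.symm hx₂
  have hside : P.Side {p, x} := side_of_same p (by simp) (by
    intro w hw
    rw [Finset.mem_insert, Finset.mem_singleton] at hw
    rcases hw with rfl | rfl
    · exact hsame.trans hsame.symm
    · exact hsame)
  have hnt : x ∉ P.N q → ¬ P.Tight {p, x} := by
    intro hxq ht
    have hcap : P.N q ∩ {p, x} = {p} := by
      ext v
      simp only [Finset.mem_inter, Finset.mem_insert, Finset.mem_singleton]
      constructor
      · rintro ⟨h1, rfl | rfl⟩
        · rfl
        · exact (hxq h1).elim
      · rintro rfl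
        exact ⟨P.symm hqp, Or.inl rfl⟩
    have := h.left {p, x} ht (by simp) hcap
    have h2 : x ∈ ({p} : Finset α) := this ▸ (by simp)
    exact hxp (Finset.mem_singleton.1 h2)
  have hnbp : P.nb {p, x} = P.N p ∪ P.N x := by simp [nb]
  have hxS : ¬ P.Special x := by
    intro hS
    have hNx := eq_of_card_two hS.le hp₁x hp₂x hp₁₂
    by_cases hxq : x ∈ P.N q
    · have := P.symm hxq
      rw [hNx] at this
      simp [hqp₁, hqp₂] at this
    · apply hnt hxq
      refine ⟨hside, by simp, ?_⟩
      have : P.nb {p, x} = {q, p₁, p₂} := by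
        rw [hnbp, hNp, hNx]; ext; simp
      rw [this, Finset.card_eq_three.2 ⟨q, p₁, p₂, hqp₁, hqp₂, hp₁₂, rfl⟩,
        Finset.card_pair hxp.symm]
      have := hS.mem_R
      simp [req, this]
  have hxF : ¬ P.Free x := by
    intro hF
    obtain ⟨z, -, -, hNx⟩ := hF.exists_eq hp₁x hp₂x hp₁₂
    by_cases hxq : x ∈ P.N q
    · have := four_le_of_pair (K := {q, p₁, p₂}) hxp.symm hsame hp.2 hF.2 hNp.subset
        (by rw [eq_of_card_three hF.1.le (P.symm hxq) hp₁x hp₂x hqp₁ hqp₂ hp₁₂])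
      have := (Finset.card_le_three (a := q) (b := p₁) (c := p₂))
      omega
    apply hnt hxq
    refine ⟨hside, by simp, ?_⟩
    have hle : (P.nb {p, x}).card ≤ 4 := by
      refine (Finset.card_le_card (t := {q, p₁, p₂, z}) ?_).trans Finset.card_le_four
      rw [hnbp, hNp, hNx]; intro v; simp
    have hR : ∀ v ∈ ({p, x} : Finset α), v ∉ P.R := by simp [hp.2, hF.2]
    have hge := hall_avoid (K := P.nb {p, x}) hside (by simp) hR
      (fun v hv => Finset.subset_biUnion_of_mem P.N hv)
    rw [req_of_avoid hR]
    rw [Finset.card_pair hxp.symm] at hge ⊢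
    omega
  exact ⟨hxS, hxF⟩

/-- A cubic end of a spoke whose third neighbour is joined to the other end. -/
lemma third_neighbour_cases {p q₁ q₂ x p₁ p₂ r : α} (hxp : x ≠ p) (hs : P.Same p₁ p₂)
    (hne : p₁ ≠ p₂) (hpp₂ : p ∈ P.N p₂) (hx₂ : x ∈ P.N p₂)
    (hcase : P.Special p₂ ∨ (p₂ ∉ P.R ∧ P.N p₂ ⊆ {p, x, q₁, q₂}) ∨
      (P.Free p₂ ∧ ∃ r, r ≠ p ∧ r ≠ x ∧ P.N p₂ = {p, x, r} ∧ r ∈ P.N p₁))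
    (hF : P.Free p₁) (hrp : r ≠ p) (hrx : r ≠ x) (hN₁ : P.N p₁ = {p, x, r}) (hr : r ∈ P.N p₂) :
    p₁ ∉ P.R ∧ P.N p₁ ⊆ {p, x, q₁, q₂} := by
  rcases hcase with hS | ⟨-, hsub⟩ | ⟨hF₂, r', hr'p, hr'x, hN₂, hr'₁⟩
  · have := eq_of_card_two hS.le hpp₂ hx₂ hxp.symm
    rw [this] at hr
    simp [hrp, hrx] at hr
  · refine ⟨hF.2, ?_⟩
    have := hsub hr
    rw [hN₁]
    intro v hv
    simp only [Finset.mem_insert, Finset.mem_singleton] at hv this ⊢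
    rcases hv with rfl | rfl | rfl
    · exact Or.inl rfl
    · exact Or.inr (Or.inl rfl)
    · exact this
  · have : r = r' := by
      rw [hN₂] at hr
      simp only [Finset.mem_insert, Finset.mem_singleton] at hr
      tauto
    subst this
    have := four_le_of_pair (K := {p, x, r}) hne hs hF.2 hF₂.2 hN₁.subset hN₂.subset
    have := (Finset.card_le_three (a := p) (b := x) (c := r))
    omega

lemma exists_mem_of_subset {p x c c' p₁ p₂ : α} (hne : p₁ ≠ p₂) (hs : P.Same p₁ p₂)
    (h₁ : p₁ ∉ P.R) (h₂ : p₂ ∉ P.R) (k₁ : P.N p₁ ⊆ {p, x, c, c'}) (k₂ : P.N p₂ ⊆ {p, x, c, c'}) :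
    c' ∈ P.N p₁ ∨ c' ∈ P.N p₂ := by
  by_contra! hcon
  have aux : ∀ u, P.N u ⊆ {p, x, c, c'} → c' ∉ P.N u → P.N u ⊆ {p, x, c} := by
    intro u hu hc v hv
    have := hu hv
    simp only [Finset.mem_insert, Finset.mem_singleton] at this
    rcases this with rfl | rfl | rfl | rfl
    · simp
    · simp
    · simp
    · exact (hc hv).elim
  have := four_le_of_pair hne hs h₁ h₂ (aux _ k₁ hcon.1) (aux _ k₂ hcon.2)
  have := (Finset.card_le_three (a := p) (b := x) (c := c))
  omega

/-- The outcome of a multiple edge formed by two edges joining a vertex `x` to `p₁` and `p₂`. -/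
lemma common_neighbour (hM : ∀ x y, P.Thin x y → P.Multi x y) {p q p₁ q₁ p₂ q₂ x : α}
    (h : P.Thin p q) (hp : P.Free p) (hq : P.Free q) (hNp : P.N p = {q, p₁, p₂})
    (hNq : P.N q = {p, q₁, q₂}) (hxp : x ≠ p) (hx₁ : x ∈ P.N p₁) (hx₂ : x ∈ P.N p₂) :
    (q₁ ∈ P.N p₁ ∧ q₂ ∈ P.N p₂) ∨ (q₂ ∈ P.N p₁ ∧ q₁ ∈ P.N p₂) ∨
    (x ∉ P.N q ∧ P.Special p₁ ∧ p₂ ∉ P.R ∧ P.N p₂ ⊆ {p, x, q₁, q₂}) ∨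
    (x ∉ P.N q ∧ P.Special p₂ ∧ p₁ ∉ P.R ∧ P.N p₁ ⊆ {p, x, q₁, q₂}) := by
  obtain ⟨hpq₁, hpq₂, hq₁₂⟩ := hq.ne_of_eq hNq
  obtain ⟨hqp₁, hqp₂, hp₁₂⟩ := hp.ne_of_eq hNp
  have hqp : q ∈ P.N p := by simp [hNp]
  have hp₁p : p₁ ∈ P.N p := by simp [hNp]
  have hp₂p : p₂ ∈ P.N p := by simp [hNp]
  obtain ⟨hxS, hxF⟩ := hub_not_cubic h hp hNp hxp hx₁ hx₂
  have hsame₁₂ : P.Same p₁ p₂ := same_of_mem hp₁p hp₂p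
  have hNp' : P.N p = {q, p₂, p₁} := by rw [hNp, triple_swap_right]
  have d1 := spoke hM h hp hq hNp hNq hxp hx₁ hx₂ hxS hxF
  have d2 := spoke hM h hp hq hNp' hNq hxp hx₂ hx₁ hxS hxF
  have d1' : P.Special p₁ ∨ (p₁ ∉ P.R ∧ P.N p₁ ⊆ {p, x, q₁, q₂}) := by
    rcases d1 with h1 | h1 | ⟨hF, r, hrp, hrx, hN₁, hr⟩
    · exact Or.inl h1
    · exact Or.inr h1
    · exact Or.inr (third_neighbour_cases hxp hsame₁₂ hp₁₂ (P.symm hp₂p) hx₂ d2 hF hrp hrx hN₁ hr)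
  have d2' : P.Special p₂ ∨ (p₂ ∉ P.R ∧ P.N p₂ ⊆ {p, x, q₁, q₂}) := by
    rcases d2 with h1 | h1 | ⟨hF, r, hrp, hrx, hN₁, hr⟩
    · exact Or.inl h1
    · exact Or.inr h1
    · exact Or.inr (third_neighbour_cases hxp hsame₁₂.symm hp₁₂.symm (P.symm hp₁p) hx₁ d1 hF hrp hrx hN₁ hr)
  rcases d1' with s1 | g1 <;> rcases d2' with s2 | g2
  -- Two special ends would have only the neighbours `p` and `x` together; as `q` lies in the same
  -- class, the surplus condition applies to them.
  · have e1 := eq_of_card_two s1.le (P.symm hp₁p) hx₁ hxp.symm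
    have e2 := eq_of_card_two s2.le (P.symm hp₂p) hx₂ hxp.symm
    have hs : P.Side {p₁, p₂} := side_of_same p₁ (by simp) (by
      intro w hw
      rw [Finset.mem_insert, Finset.mem_singleton] at hw
      rcases hw with rfl | rfl
      · exact hsame₁₂.trans hsame₁₂.symm
      · exact hsame₁₂)
    have hqn : q ∉ ({p₁, p₂} : Finset α) := by simp [hqp₁, hqp₂]
    have hsq : P.Same p₁ q := same_of_mem hp₁p hqp
    have hAB : ({p₁, p₂} : Finset α) ≠ P.A ∧ ({p₁, p₂} : Finset α) ≠ P.B := by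
      constructor <;> intro he <;> rcases hsq with h' | h'
      · exact hqn (he ▸ h'.2)
      · exact not_mem_A_B (he ▸ Finset.mem_insert_self p₁ _) h'.1
      · exact not_mem_A_B h'.1 (he ▸ Finset.mem_insert_self p₁ _)
      · exact hqn (he ▸ h'.2)
    have h1 := hall' hs (by simp) hAB.1 hAB.2
    have h2 : P.nb {p₁, p₂} = {p, x} := by simp [nb, e1, e2]
    have h3 := one_le_req (P := P) {p₁, p₂}
    rw [h2, Finset.card_pair hp₁₂] at h1
    have := (Finset.card_le_two (a := p) (b := x))
    omega
  · by_cases hxq : x ∈ P.N q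
    · rcases matching_of_mem hNq hxp hx₁ hx₂ g2.1 g2.2 hxq with hm | hm
      · exact Or.inl hm
      · exact Or.inr (Or.inl hm)
    · exact Or.inr (Or.inr (Or.inl ⟨hxq, s1, g2.1, g2.2⟩))
  · by_cases hxq : x ∈ P.N q
    · rcases matching_of_mem hNq hxp hx₂ hx₁ g1.1 g1.2 hxq with hm | hm
      · exact Or.inr (Or.inl hm.symm)
      · exact Or.inl hm.symm
    · exact Or.inr (Or.inr (Or.inr ⟨hxq, s2, g1.1, g1.2⟩))
  -- Each of `p₁`, `p₂` has a neighbour among `q₁`, `q₂`, and between them both `q₁` and `q₂` occur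
  -- because two vertices off `R` need four neighbours. This is Hall's condition for a matching of
  -- two pairs.
  · obtain ⟨c₁, hc₁, hc₁p, hc₁x⟩ := exists_third (a := p) (b := x)
      (three_le_card (mem_side hx₁) g1.1)
    obtain ⟨c₂, hc₂, hc₂p, hc₂x⟩ := exists_third (a := p) (b := x)
      (three_le_card (mem_side hx₂) g2.1)
    have h1 := g1.2 hc₁
    have h2 := g2.2 hc₂
    simp only [Finset.mem_insert, Finset.mem_singleton] at h1 h2
    have one := fun c c' => exists_mem_of_subset (P := P) (p := p) (x := x) (c := c) (c' := c')
      hp₁₂ hsame₁₂ g1.1 g2.1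
    have hcomm : ({p, x, q₁, q₂} : Finset α) = {p, x, q₂, q₁} := by
      rw [Finset.pair_comm q₁ q₂]
    have o2 := one q₁ q₂ g1.2 g2.2
    have o1 := one q₂ q₁ (hcomm ▸ g1.2) (hcomm ▸ g2.2)
    have m1 : q₁ ∈ P.N p₁ ∨ q₂ ∈ P.N p₁ := by
      rcases h1 with h1 | h1 | h1 | h1
      · exact (hc₁p h1).elim
      · exact (hc₁x h1).elim
      · exact Or.inl (h1 ▸ hc₁)
      · exact Or.inr (h1 ▸ hc₁)
    have m2 : q₁ ∈ P.N p₂ ∨ q₂ ∈ P.N p₂ := by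
      rcases h2 with h2 | h2 | h2 | h2
      · exact (hc₂p h2).elim
      · exact (hc₂x h2).elim
      · exact Or.inl (h2 ▸ hc₂)
      · exact Or.inr (h2 ▸ hc₂)
    rcases m1 with m1 | m1 <;> rcases m2 with m2 | m2
    · rcases o2 with o2 | o2
      · exact Or.inr (Or.inl ⟨o2, m2⟩)
      · exact Or.inl ⟨m1, o2⟩
    · exact Or.inl ⟨m1, m2⟩
    · exact Or.inr (Or.inl ⟨m1, m2⟩)
    · rcases o1 with o1 | o1
      · exact Or.inl ⟨o1, m2⟩
      · exact Or.inr (Or.inl ⟨m1, o1⟩)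

end HallGraph
end RBrick

/-! ### Ladders, and a first ladder through a given thin edge -/

namespace RBrick
namespace HallGraph

variable {α : Type*} [DecidableEq α] (P : HallGraph α)

/-- A ladder with rungs `X i`–`Y i`, all of whose internal rungs are thin with cubic ends. -/
structure Lad (j : ℕ) (X Y : ℕ → α) : Prop where
  two_le : 2 ≤ j
  rung : ∀ i ≤ j, Y i ∈ P.N (X i)
  stepX : ∀ i < j, X (i + 1) ∈ P.N (X i)
  stepY : ∀ i < j, Y (i + 1) ∈ P.N (Y i)
  injX : ∀ i ≤ j, ∀ k ≤ j, X i = X k → i = k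
  injY : ∀ i ≤ j, ∀ k ≤ j, Y i = Y k → i = k
  ne : ∀ i ≤ j, ∀ k ≤ j, X i ≠ Y k
  freeX : ∀ i, 0 < i → i < j → P.Free (X i)
  freeY : ∀ i, 0 < i → i < j → P.Free (Y i)
  thin : ∀ i, 0 < i → i < j → P.Thin (X i) (Y i)

/-- The vertices `u` and `v` are adjacent in the ladder. -/
def LadAdj (j : ℕ) (X Y : ℕ → α) (u v : α) : Prop :=
  (∃ i ≤ j, s(u, v) = s(X i, Y i)) ∨
  (∃ i < j, s(u, v) = s(X i, X (i + 1)) ∨ s(u, v) = s(Y i, Y (i + 1)))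

variable {P}

omit [DecidableEq α] in
lemma LadAdj.symm {j : ℕ} {X Y : ℕ → α} {u v : α} (h : LadAdj j X Y u v) : LadAdj j X Y v u := by
  unfold LadAdj at *
  rwa [Sym2.eq_swap (a := v)]

lemma lad_three {a b c a' b' c' : α} (h : P.Thin b b') (hb : P.Free b) (hb' : P.Free b')
    (hN : P.N b = {b', a, c}) (hN' : P.N b' = {b, a', c'}) (ha : a' ∈ P.N a) (hc : c' ∈ P.N c) :
    ∃ X Y, P.Lad 2 X Y ∧ (X 0 = a ∧ X 1 = b ∧ X 2 = c) ∧ (Y 0 = a' ∧ Y 1 = b' ∧ Y 2 = c') := by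
  obtain ⟨n1, n2, n3⟩ := hb.ne_of_eq hN
  obtain ⟨m1, m2, m3⟩ := hb'.ne_of_eq hN'
  have hab : a ∈ P.N b := by simp [hN]
  have hcb : c ∈ P.N b := by simp [hN]
  have hab' : a' ∈ P.N b' := by simp [hN']
  have hcb' : c' ∈ P.N b' := by simp [hN']
  have hac : P.Same a c := same_of_mem hab hcb
  have k1 : a ≠ a' := ne_of_adj ha
  have k2 : a ≠ c' := hac.symm.ne_of_adj hc
  have k3 : c ≠ a' := hac.ne_of_adj ha
  have k4 : c ≠ c' := ne_of_adj hc
  have k5 : b ≠ a := ne_of_adj hab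
  have k6 : b ≠ c := ne_of_adj hcb
  have k7 : b' ≠ a' := ne_of_adj hab'
  have k8 : b' ≠ c' := ne_of_adj hcb'
  have k9 : b ≠ b' := ne_of_adj h.adj
  refine ⟨fun i => if i = 0 then a else if i = 1 then b else c,
    fun i => if i = 0 then a' else if i = 1 then b' else c', ⟨le_rfl, ?_, ?_, ?_, ?_, ?_, ?_, ?_, ?_,
      ?_⟩, by simp, by simp⟩
  · intro i hi
    interval_cases i
    · simpa using ha
    · simpa using h.adj
    · simpa using hc
  · intro i hi
    interval_cases i
    · simpa using P.symm hab
    · simpa using hcb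
  · intro i hi
    interval_cases i
    · simpa using P.symm hab'
    · simpa using hcb'
  · intro i hi k hk
    interval_cases i <;> interval_cases k <;> simp [k5, k6, n3, k5.symm, k6.symm, n3.symm]
  · intro i hi k hk
    interval_cases i <;> interval_cases k <;> simp [k7, k8, m3, k7.symm, k8.symm, m3.symm]
  · intro i hi k hk
    interval_cases i <;> interval_cases k <;>
      simp [k1, k2, k3, k4, k9, n1.symm, n2.symm, m1, m2]
  · intro i h0 hi
    interval_cases i; simpa using hb
  · intro i h0 hi
    interval_cases i; simpa using hb'
  · intro i h0 hi
    interval_cases i; simpa using h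

lemma Lad.snoc {j : ℕ} {X Y : ℕ → α} (L : P.Lad j X Y) {s t : α} (hs : s ∈ P.N (X j))
    (ht : t ∈ P.N (Y j)) (hst : t ∈ P.N s) (hF : P.Free (X j)) (hF' : P.Free (Y j))
    (hT : P.Thin (X j) (Y j)) (sX : ∀ i ≤ j, s ≠ X i) (sY : ∀ i ≤ j, s ≠ Y i)
    (tX : ∀ i ≤ j, t ≠ X i) (tY : ∀ i ≤ j, t ≠ Y i) :
    ∃ X' Y', P.Lad (j + 1) X' Y' ∧ (∀ i ≤ j, X' i = X i) ∧ (∀ i ≤ j, Y' i = Y i) := by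
  have eX : ∀ i ≤ j, (if i ≤ j then X i else s) = X i := fun i hi => if_pos hi
  have eY : ∀ i ≤ j, (if i ≤ j then Y i else t) = Y i := fun i hi => if_pos hi
  have eX' : (if j + 1 ≤ j then X (j + 1) else s) = s := if_neg (by omega)
  have eY' : (if j + 1 ≤ j then Y (j + 1) else t) = t := if_neg (by omega)
  refine ⟨fun i => if i ≤ j then X i else s, fun i => if i ≤ j then Y i else t,
    ⟨by have := L.two_le; omega, ?_, ?_, ?_, ?_, ?_, ?_, ?_, ?_, ?_⟩, eX, eY⟩
  · intro i hi
    rcases Nat.le_succ_iff.1 hi with hi | rfl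
    · simpa [hi] using L.rung i hi
    · simpa using hst
  · intro i hi
    rcases Nat.lt_succ_iff_lt_or_eq.1 hi with hi | rfl
    · simpa [hi.le, Nat.succ_le_of_lt hi] using L.stepX i hi
    · simpa using hs
  · intro i hi
    rcases Nat.lt_succ_iff_lt_or_eq.1 hi with hi | rfl
    · simpa [hi.le, Nat.succ_le_of_lt hi] using L.stepY i hi
    · simpa using ht
  · intro i hi k hk
    rcases Nat.le_succ_iff.1 hi with hi | rfl <;> rcases Nat.le_succ_iff.1 hk with hk | rfl
    · simpa [hi, hk] using L.injX i hi k hk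
    · simpa [hi] using fun h => (sX i hi h.symm).elim
    · simpa [hk] using fun h => (sX k hk h).elim
    · simp
  · intro i hi k hk
    rcases Nat.le_succ_iff.1 hi with hi | rfl <;> rcases Nat.le_succ_iff.1 hk with hk | rfl
    · simpa [hi, hk] using L.injY i hi k hk
    · simpa [hi] using fun h => (tY i hi h.symm).elim
    · simpa [hk] using fun h => (tY k hk h).elim
    · simp
  · intro i hi k hk
    rcases Nat.le_succ_iff.1 hi with hi | rfl <;> rcases Nat.le_succ_iff.1 hk with hk | rfl
    · simpa [hi, hk] using L.ne i hi k hk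
    · simpa [hi] using (tX i hi).symm
    · simpa [hk] using sY k hk
    · simpa using ne_of_adj hst
  · intro i h0 hi
    rcases Nat.lt_succ_iff_lt_or_eq.1 hi with hi | rfl
    · simpa [hi.le] using L.freeX i h0 hi
    · simpa using hF
  · intro i h0 hi
    rcases Nat.lt_succ_iff_lt_or_eq.1 hi with hi | rfl
    · simpa [hi.le] using L.freeY i h0 hi
    · simpa using hF'
  · intro i h0 hi
    rcases Nat.lt_succ_iff_lt_or_eq.1 hi with hi | rfl
    · simpa [hi.le] using L.thin i h0 hi
    · simpa using hT

omit [DecidableEq α] in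
lemma LadAdj.mono {j k : ℕ} {X Y X' Y' : ℕ → α} (hjk : j ≤ k) (hX : ∀ i ≤ j, X' i = X i)
    (hY : ∀ i ≤ j, Y' i = Y i) {u v : α} (h : LadAdj j X Y u v) : LadAdj k X' Y' u v := by
  rcases h with ⟨i, hi, h⟩ | ⟨i, hi, h⟩
  · exact Or.inl ⟨i, hi.trans hjk, by rw [hX i hi, hY i hi, h]⟩
  · refine Or.inr ⟨i, hi.trans_le hjk, ?_⟩
    rwa [hX i hi.le, hY i hi.le, hX _ (Nat.succ_le_of_lt hi), hY _ (Nat.succ_le_of_lt hi)]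

/-- If `p₁` is special with neighbours `p` and `x`, an edge from `p₂` to a neighbour of `q` other
than `p` can only be thin if both these neighbours are adjacent to a third vertex. -/
lemma fan_rung (hM : ∀ x y, P.Thin x y → P.Multi x y) {p q p₁ p₂ x y y' : α}
    (hq : P.Free q) (hNp : P.N p = {q, p₁, p₂})
    (hNq : P.N q = {p, y, y'}) (hxq : x ∉ P.N q) (hp₂ : P.N p₂ = {p, x, y, y'})
    (hN₁ : P.N p₁ = {p, x}) (h₂₁ : p₂ ≠ p₁) (h₂q : p₂ ≠ q) (hS₂ : ¬ P.Special p₂)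
    (hF₂ : ¬ P.Free p₂) (hy : ¬ P.Special y) :
    P.Free y ∧ ∃ z, z ≠ q ∧ z ≠ p₂ ∧ P.N y = {q, p₂, z} ∧ z ∈ P.N y' := by
  obtain ⟨hpy, hpy', hyy'⟩ := hq.ne_of_eq hNq
  have hpp₂ : p ∈ P.N p₂ := by simp [hp₂]
  have hyp₂ : y ∈ P.N p₂ := by simp [hp₂]
  have hy'p₂ : y' ∈ P.N p₂ := by simp [hp₂]
  have hpq : p ∈ P.N q := by simp [hNq]
  have hyq : y ∈ P.N q := by simp [hNq]
  have hy'q : y' ∈ P.N q := by simp [hNq]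
  have hqy := P.symm hyq
  have hp₂y := P.symm hyp₂
  have hxy : x ≠ y := by rintro rfl; exact hxq hyq
  -- Both halves rest on `P.N q ⊆ P.N p₂`. Here `q` could be added to a tight set containing `p₂`
  -- without gaining a neighbour; in the other half a second neighbour of `q` in the tight set is
  -- also a second neighbour of `p₂`.
  have h1 : P.Half p₂ y := by
    intro T hT hT₂ hcap
    by_contra hne
    obtain ⟨w, hwT, hw₂, hw⟩ := hT.exists_other hT₂ hne hcap hpp₂ hpy
    have hqT : q ∉ T := by
      intro h2
      have : q ∈ P.N y ∩ T := Finset.mem_inter.2 ⟨hqy, h2⟩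
      rw [hcap, Finset.mem_singleton] at this
      exact h₂q this.symm
    have hside : P.Side (insert q T) := by
      refine side_of_same p₂ (by simp [hT₂]) fun v hv => ?_
      rcases Finset.mem_insert.1 hv with rfl | hv
      · exact same_of_mem hp₂y hqy
      · exact hT.1.same hT₂ hv
    obtain ⟨c, hc, hcq, hc₂⟩ := exists_third (a := q) (b := p₂)
      (three_le_card_of_not_special (mem_side hqy) hy)
    have hcT : c ∉ insert q T := by
      intro h2
      rcases Finset.mem_insert.1 h2 with rfl | h2
      · exact hcq rfl
      have : c ∈ P.N y ∩ T := Finset.mem_inter.2 ⟨hc, h2⟩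
      rw [hcap, Finset.mem_singleton] at this
      exact hc₂ this
    have hqc : P.Same q c := same_of_mem hqy hc
    have hAB : insert q T ≠ P.A ∧ insert q T ≠ P.B := by
      constructor <;> intro he <;> rcases hqc with h' | h'
      · exact hcT (he ▸ h'.2)
      · exact not_mem_A_B (he ▸ Finset.mem_insert_self q T) h'.1
      · exact not_mem_A_B h'.1 (he ▸ Finset.mem_insert_self q T)
      · exact hcT (he ▸ h'.2)
    refine hT.not_subset_nb hqT hq.2 hside hAB.1 hAB.2 ?_
    rw [hNq]
    intro v hv
    simp only [Finset.mem_insert, Finset.mem_singleton] at hv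
    rcases hv with rfl | rfl | rfl
    · exact mem_nb.2 ⟨p₂, hT₂, hpp₂⟩
    · exact mem_nb.2 ⟨p₂, hT₂, hyp₂⟩
    · exact mem_nb.2 ⟨p₂, hT₂, hy'p₂⟩
  have h2 : P.Half y p₂ := by
    intro T hT hyT hcap
    by_contra hne
    obtain ⟨w, hwT, hwy, hw⟩ := hT.exists_other hyT hne hcap hqy h₂q.symm
    have : w ∈ P.N p₂ ∩ T := by
      refine Finset.mem_inter.2 ⟨?_, hwT⟩
      rw [hNq] at hw
      rw [hp₂]
      simp only [Finset.mem_insert, Finset.mem_singleton] at hw ⊢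
      rcases hw with h | h | h
      · exact Or.inl h
      · exact (hwy h).elim
      · exact Or.inr (Or.inr (Or.inr h))
    rw [hcap, Finset.mem_singleton] at this
    exact hwy this
  have hthin : P.Thin p₂ y := ⟨hyp₂, hS₂, hy, h1, h2, fun h => (hF₂ h).elim,
    fun _ hsub => hq.2 (hsub (Finset.mem_erase.2 ⟨h₂q.symm, hqy⟩))⟩
  rcases hM _ _ hthin with hc | ⟨hF, w, hw, hsub⟩ | hc
  · exact (hF₂ hc.1).elim
  · refine ⟨hF, ?_⟩
    obtain ⟨z, hzq, hz₂, hN⟩ := hF.exists_eq hqy hp₂y h₂q.symm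
    refine ⟨z, hzq, hz₂, hN, ?_⟩
    have hwq : w ∈ P.N q := P.symm (hsub (Finset.mem_erase.2 ⟨h₂q.symm, hqy⟩))
    have hwz : z ∈ P.N w := hsub (Finset.mem_erase.2 ⟨hz₂, by simp [hN]⟩)
    rw [hNq] at hwq
    simp only [Finset.mem_insert, Finset.mem_singleton] at hwq
    rcases hwq with rfl | rfl | rfl
    · rw [hNp] at hwz
      simp only [Finset.mem_insert, Finset.mem_singleton] at hwz
      rcases hwz with rfl | rfl | rfl
      · exact (hzq rfl).elim
      · have : y ∈ P.N z := P.symm (by simp [hN])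
        rw [hN₁] at this
        simp only [Finset.mem_insert, Finset.mem_singleton] at this
        rcases this with h | h
        · exact (hpy h.symm).elim
        · exact (hxy h.symm).elim
      · exact (hz₂ rfl).elim
    · exact (hw rfl).elim
    · exact hwz
  · exact (hF₂ hc.1).elim

/-- The ladder containing `pq` as an edge of one of its paths. -/
lemma initial_ladder_of_special (hM : ∀ x y, P.Thin x y → P.Multi x y) {p q p₁ q₁ p₂ q₂ x : α}
    (hp : P.Free p) (hq : P.Free q) (hNp : P.N p = {q, p₁, p₂})
    (hNq : P.N q = {p, q₁, q₂}) (hxp : x ≠ p) (hxq : x ∉ P.N q) (hN₁ : P.N p₁ = {p, x})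
    (hR₁ : p₁ ∈ P.R) (hF₂ : P.Free p₂) (hN₂ : P.N p₂ = {p, x, q₂}) :
    ∃ j X Y, P.Lad j X Y ∧ LadAdj j X Y p q := by
  obtain ⟨hpq₁, hpq₂, hq₁₂⟩ := hq.ne_of_eq hNq
  obtain ⟨hqp₁, hqp₂, hp₁₂⟩ := hp.ne_of_eq hNp
  have hp₂p : p₂ ∈ P.N p := by simp [hNp]
  have hp₁p : p₁ ∈ P.N p := by simp [hNp]
  have hqp : q ∈ P.N p := by simp [hNp]
  have hq₁q : q₁ ∈ P.N q := by simp [hNq]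
  have hq₂q : q₂ ∈ P.N q := by simp [hNq]
  have hxq₁ : x ≠ q₁ := by rintro rfl; exact hxq hq₁q
  have hxq₂ : x ≠ q₂ := by rintro rfl; exact hxq hq₂q
  have hq₂p₂ : q₂ ∈ P.N p₂ := by simp [hN₂]
  have hx₁ : x ∈ P.N p₁ := by simp [hN₁]
  have hx₂ : x ∈ P.N p₂ := by simp [hN₂]
  have hq₁V := mem_side (P.symm hq₁q)
  have hq₂p₁ : q₂ ∉ P.N p₁ := by
    rw [hN₁]; simp [hpq₂.symm, hxq₂.symm]
  have hq₁p₁ : q₁ ∉ P.N p₁ := by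
    rw [hN₁]; simp [hpq₁.symm, hxq₁.symm]
  have hq₁p₂ : q₁ ∉ P.N p₂ := by
    rw [hN₂]; simp [hpq₁.symm, hxq₁.symm, hq₁₂]
  by_cases hS : P.Special q₂
  · have hNq₂ := eq_of_card_two hS.le (P.symm hq₂q) (P.symm hq₂p₂) hqp₂
    -- A larger tight set would need a second vertex adjacent to `q₂`, which has only the neighbours
    -- `q` and `p₂`; but `q` is adjacent to `p`. The other half uses the special vertex `p₁` and its
    -- neighbour `x` in the same way.
    have h1 : P.Half p₂ p := by
      intro T hT hT₂ hcap
      by_contra hne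
      obtain ⟨w, hwT, hw₂, hw⟩ := hT.exists_other hT₂ hne hcap hq₂p₂ hpq₂.symm
      rw [hNq₂] at hw
      simp only [Finset.mem_insert, Finset.mem_singleton] at hw
      rcases hw with rfl | rfl
      · have : w ∈ P.N p ∩ T := Finset.mem_inter.2 ⟨hqp, hwT⟩
        rw [hcap, Finset.mem_singleton] at this
        exact hw₂ this
      · exact hw₂ rfl
    have h2 : P.Half p p₂ := by
      intro T hT hpT hcap
      by_contra hne
      obtain ⟨w, hwT, hwp, hw⟩ := hT.exists_other hpT hne hcap hp₁p hp₁₂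
      rw [hN₁] at hw
      simp only [Finset.mem_insert, Finset.mem_singleton] at hw
      rcases hw with rfl | rfl
      · exact hwp rfl
      · have : w ∈ P.N p₂ ∩ T := Finset.mem_inter.2 ⟨hx₂, hwT⟩
        rw [hcap, Finset.mem_singleton] at this
        exact hwp this
    have htri : ¬ (P.N p₂).erase p ⊆ P.R := by
      intro hsub
      have hxR : x ∈ P.R := hsub (Finset.mem_erase.2 ⟨hxp, hx₂⟩)
      have hq₂R : q₂ ∈ P.R := hS.mem_R
      -- the colour class of `p` without `p`, `x`, `q₂` has too few neighbours
      have key : ∀ C D : Finset α, Disjoint C D → C.card = D.card → (P.R ∩ C).card = 2 →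
          (P.Side C) → p ∈ C → x ∈ C → q₂ ∈ C → q₁ ∈ C → p₁ ∈ D → p₂ ∈ D →
          (∀ v ∈ C, P.N v ⊆ D) → False := by
        intro C D _ hcard hRC hC hpC hxC hq₂C hq₁C hp₁D hp₂D hCD
        have hRC' : P.R ∩ C = {x, q₂} := by
          symm
          apply Finset.eq_of_subset_of_card_le
          · intro v hv
            simp only [Finset.mem_insert, Finset.mem_singleton] at hv
            rcases hv with rfl | rfl
            · exact Finset.mem_inter.2 ⟨hxR, hxC⟩
            · exact Finset.mem_inter.2 ⟨hq₂R, hq₂C⟩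
          · rw [hRC, Finset.card_pair hxq₂]
        have hs3 : ({p, x, q₂} : Finset α) ⊆ C := by simp [Finset.insert_subset_iff, *]
        have hs2 : ({p₁, p₂} : Finset α) ⊆ D := by simp [Finset.insert_subset_iff, *]
        have h3 : ({p, x, q₂} : Finset α).card = 3 :=
          Finset.card_eq_three.2 ⟨p, x, q₂, hxp.symm, hpq₂, hxq₂, rfl⟩
        have := hall_avoid (P := P) (T := C \ {p, x, q₂}) (K := D \ {p₁, p₂})
          (hC.subset Finset.sdiff_subset)
          ⟨q₁, by simp [hq₁C, hpq₁.symm, hxq₁.symm, hq₁₂]⟩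
          (by
            intro v hv hvR
            have : v ∈ P.R ∩ C := Finset.mem_inter.2 ⟨hvR, (Finset.mem_sdiff.1 hv).1⟩
            rw [hRC'] at this
            refine (Finset.mem_sdiff.1 hv).2 (Finset.mem_insert_of_mem this))
          (by
            intro v hv w hw
            rw [Finset.mem_sdiff] at hv ⊢
            refine ⟨hCD v hv.1 hw, fun hw' => hv.2 ?_⟩
            simp only [Finset.mem_insert, Finset.mem_singleton] at hw'
            rcases hw' with rfl | rfl
            · have := P.symm hw
              rw [hN₁] at this
              simp only [Finset.mem_insert, Finset.mem_singleton] at this ⊢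
              exact this.imp_right Or.inl
            · have := P.symm hw
              rw [hN₂] at this
              exact this)
        rw [Finset.card_sdiff_of_subset hs3, Finset.card_sdiff_of_subset hs2, h3,
          Finset.card_pair hp₁₂] at this
        have := Finset.card_le_card hs2
        rw [Finset.card_pair hp₁₂] at this
        have h4 : ({p, x, q₂, q₁} : Finset α) ⊆ C := by simp [Finset.insert_subset_iff, *]
        have h5 := Finset.card_le_card h4
        have h6 : ({p, x, q₂, q₁} : Finset α).card = 4 := by
          rw [Finset.card_insert_of_notMem (by simp [hxp.symm, hpq₂, hpq₁]),
            Finset.card_eq_three.2 ⟨x, q₂, q₁, hxq₂, hxq₁, hq₁₂.symm, rfl⟩]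
        omega
      have hx' := P.mem hx₁
      have hpp₁ := P.mem hp₁p
      have hpp₂ := P.mem hp₂p
      have hqq := P.mem hqp
      have hq1 := P.mem hq₁q
      have hq2 := P.mem hq₂q
      have nAB := fun v => @not_mem_A_B _ _ P v
      rcases hpp₁ with ⟨hpA, hp₁B⟩ | ⟨hpB, hp₁A⟩
      · have e1 : x ∈ P.A := hx'.elim (fun h => (nAB _ h.1 hp₁B).elim) (·.2)
        have e2 : p₂ ∈ P.B := hpp₂.elim (·.2) (fun h => (nAB _ hpA h.1).elim)
        have e3 : q ∈ P.B := hqq.elim (·.2) (fun h => (nAB _ hpA h.1).elim)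
        have e4 : q₁ ∈ P.A := hq1.elim (fun h => (nAB _ h.1 e3).elim) (·.2)
        have e5 : q₂ ∈ P.A := hq2.elim (fun h => (nAB _ h.1 e3).elim) (·.2)
        exact key P.A P.B P.disj P.card_eq P.card_RA (Or.inl subset_rfl) hpA e1 e5 e4 hp₁B e2
          (fun v hv w hw => (P.mem hw).elim (·.2) (fun h => (nAB _ hv h.1).elim))
      · have e1 : x ∈ P.B := hx'.elim (·.2) (fun h => (nAB _ hp₁A h.1).elim)
        have e2 : p₂ ∈ P.A := hpp₂.elim (fun h => (nAB _ h.1 hpB).elim) (·.2)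
        have e3 : q ∈ P.A := hqq.elim (fun h => (nAB _ h.1 hpB).elim) (·.2)
        have e4 : q₁ ∈ P.B := hq1.elim (·.2) (fun h => (nAB _ e3 h.1).elim)
        have e5 : q₂ ∈ P.B := hq2.elim (·.2) (fun h => (nAB _ e3 h.1).elim)
        exact key P.B P.A P.disj.symm P.card_eq.symm P.card_RB (Or.inr subset_rfl) hpB e1 e5 e4 hp₁A
          e2 (fun v hv w hw => (P.mem hw).elim (fun h => (nAB _ h.1 hv).elim) (·.2))
    have hthin : P.Thin p p₂ := ⟨hp₂p, hp.not_special, hF₂.not_special, h2, h1,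
      fun _ hsub => hq.2 (hsub (Finset.mem_erase.2 ⟨hqp₂, hqp⟩)), fun _ => htri⟩
    obtain ⟨X, Y, hL, ⟨-, hX1, hX2⟩, -⟩ := lad_three (a := p₁) (c := q) (a' := x) (c' := q₂) hthin hp
      hF₂ (by rw [hNp, triple_rotate, triple_rotate, triple_swap_right, triple_swap_right]) hN₂
      hx₁ hq₂q
    exact ⟨2, X, Y, hL, Or.inr ⟨1, by norm_num, Or.inl (by rw [hX1, hX2])⟩⟩
  -- The ladder with rungs `qq₂`, `pp₂`, `p₁x`, in which `pq` is an edge of a path.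
  · have hthin : P.Thin q q₂ := thin_of_quad (z := p₂) (x' := p) (x₂ := p₁) (z₂ := x)
      hq.not_special hS hq₂q hqp₂ hpq₂ hF₂ hp (by rw [hNp, triple_swap_right])
      (by rw [hN₂, triple_rotate, triple_rotate]) hx₁
    -- `p` and `q₁` have no common neighbour other than `q`
    have hno : ∀ w, w ≠ q → p ∈ P.N w → q₁ ∉ P.N w := by
      intro w hw hpw
      have := P.symm hpw
      rw [hNp] at this
      simp only [Finset.mem_insert, Finset.mem_singleton] at this
      rcases this with h | h | h
      · exact (hw h).elim
      · rwa [h]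
      · rwa [h]
    -- A rung `q₁t` beyond `qq₂` makes `pp₂` thin as well, and `p₁x`, `pp₂`, `qq₂`, `q₁t` are the
    -- rungs of a ladder.
    have fin : P.Free q₂ → ∀ t, P.N q₂ = {q, p₂, t} → t ∈ P.N q₁ →
        ∃ j X Y, P.Lad j X Y ∧ LadAdj j X Y p q := by
      intro hFq₂ t hNq₂ ht
      obtain ⟨-, hqt, hp₂t⟩ := hFq₂.ne_of_eq hNq₂
      have htq₂ : t ∈ P.N q₂ := by simp [hNq₂]
      have htp₁ : t ≠ p₁ := by rintro rfl; exact hq₂p₁ (P.symm htq₂)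
      have hthin' : P.Thin p p₂ := thin_of_quad (z := q₂) (x' := q) (x₂ := q₁) (z₂ := t)
        hp.not_special hF₂.not_special hp₂p hpq₂ hqp₂ hFq₂ hq
        (by rw [hNq, triple_swap_right]) (by rw [hNq₂, triple_swap_left]) ht
      obtain ⟨X, Y, hL, ⟨hX0, hX1, hX2⟩, ⟨hY0, hY1, hY2⟩⟩ := lad_three (a := p₁) (c := q) (a' := x)
        (c' := q₂) hthin' hp hF₂
        (by rw [hNp, triple_rotate, triple_rotate, triple_swap_right, triple_swap_right]) hN₂
        hx₁ hq₂q
      have same₁ : P.Same q₁ p := same_of_mem hq₁q (P.symm hqp)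
      have same₂ : P.Same t q := same_of_mem htq₂ (P.symm hq₂q)
      have hle : ∀ {i}, i ≤ 2 → i = 0 ∨ i = 1 ∨ i = 2 := by omega
      obtain ⟨X', Y', hL', hX', hY'⟩ := hL.snoc (s := q₁) (t := t) (by rw [hX2]; exact hq₁q)
        (by rw [hY2]; exact htq₂) ht (by rw [hX2]; exact hq) (by rw [hY2]; exact hFq₂)
        (by rw [hX2, hY2]; exact hthin)
        (by
          intro i hi
          rcases hle hi with rfl | rfl | rfl
          · rw [hX0]; exact same₁.symm.ne_of_adj hp₁p
          · rw [hX1]; exact hpq₁.symm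
          · rw [hX2]; exact (ne_of_adj hq₁q).symm)
        (by
          intro i hi
          rcases hle hi with rfl | rfl | rfl
          · rw [hY0]; exact hxq₁.symm
          · rw [hY1]; exact same₁.symm.ne_of_adj hp₂p
          · rw [hY2]; exact hq₁₂)
        (by
          intro i hi
          rcases hle hi with rfl | rfl | rfl
          · rw [hX0]; exact htp₁
          · rw [hX1]; exact same₂.symm.ne_of_adj (P.symm hqp)
          · rw [hX2]; exact hqt.symm)
        (by
          intro i hi
          rcases hle hi with rfl | rfl | rfl
          · rw [hY0]
            exact (((same_of_mem hp₁p hqp).trans same₂.symm).ne_of_adj hx₁)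
          · rw [hY1]; exact hp₂t.symm
          · rw [hY2]; exact (ne_of_adj htq₂).symm)
      refine ⟨3, X', Y', hL', Or.inr ⟨1, by norm_num, Or.inl ?_⟩⟩
      rw [hX' 1 (by norm_num), hX' 2 le_rfl, hX1, hX2]
    rcases hM _ _ hthin with ⟨-, w, hw, hsub⟩ | ⟨hFq₂, w, hw, hsub⟩ |
      ⟨-, hFq₂, x₁, x₂, y₁, y₂, e1, e2, hx, hy, h3, h4⟩
    · exact (hno w hw (hsub (Finset.mem_erase.2 ⟨hpq₂, P.symm hqp⟩))
        (hsub (Finset.mem_erase.2 ⟨hq₁₂, hq₁q⟩))).elim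
    · obtain ⟨t, htq, htp₂, hNq₂⟩ := hFq₂.exists_eq (P.symm hq₂q) (P.symm hq₂p₂) hqp₂
      have htq₂ : t ∈ P.N q₂ := by simp [hNq₂]
      have hw₂ : w ∈ P.N p₂ := P.symm (hsub (Finset.mem_erase.2 ⟨hqp₂.symm, by simp [hNq₂]⟩))
      have hwt : t ∈ P.N w := hsub (Finset.mem_erase.2 ⟨htq, htq₂⟩)
      rw [hN₂] at hw₂
      simp only [Finset.mem_insert, Finset.mem_singleton] at hw₂
      rcases hw₂ with rfl | rfl | rfl
      · rw [hNp] at hwt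
        simp only [Finset.mem_insert, Finset.mem_singleton] at hwt
        rcases hwt with rfl | rfl | rfl
        · exact (htq rfl).elim
        · exact (hq₂p₁ (P.symm htq₂)).elim
        · exact (htp₂ rfl).elim
      -- The common neighbour is joined to both `p₂` and `t`, the neighbours left at `q₂`, so the
      -- analysis applies with `q₂q` in the role of `pq`.
      · have := common_neighbour hM hthin.symm hFq₂ hq hNq₂ (q₁ := p) (q₂ := q₁)
          (by rw [hNq, triple_rotate, triple_rotate]) hw (by simp [hN₂]) (P.symm hwt)
        rcases this with ⟨-, h'⟩ | ⟨h', -⟩ | ⟨-, h', -⟩ | ⟨-, hSt, -⟩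
        · exact fin hFq₂ t hNq₂ (P.symm h')
        · exact (hq₁p₂ h').elim
        · exact (hF₂.not_special h').elim
        · -- four vertices with only four neighbours
          exfalso
          have hNt := eq_of_card_two hSt.le (P.symm htq₂) (P.symm hwt) hw.symm
          have hq₁t : q₁ ∉ P.N t := by rw [hNt]; simp [hq₁₂, hxq₁.symm]
          have htp₁ : t ≠ p₁ := by rintro rfl; exact hq₂p₁ (P.symm htq₂)
          have sq : P.Same q t := same_of_mem (P.symm hq₂q) htq₂
          have s1 : P.Same q p₁ := same_of_mem hqp hp₁p
          have s2 : P.Same q p₂ := same_of_mem hqp hp₂p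
          have hs : P.Side {t, q, p₁, p₂} := side_of_same q (by simp) (by
            intro v hv
            simp only [Finset.mem_insert, Finset.mem_singleton] at hv
            rcases hv with h | h | h | h <;> rw [h]
            · exact sq
            · exact sq.trans sq.symm
            · exact s1
            · exact s2)
          obtain ⟨d, hd, hdq⟩ : ∃ d ∈ P.N q₁, d ≠ q :=
            Finset.exists_mem_ne (by have := two_le_card hq₁V; omega) q
          have hdT : d ∉ ({t, q, p₁, p₂} : Finset α) := by
            simp only [Finset.mem_insert, Finset.mem_singleton]
            rintro (rfl | rfl | rfl | rfl)
            · exact hq₁t (P.symm hd)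
            · exact hdq rfl
            · exact hq₁p₁ (P.symm hd)
            · exact hq₁p₂ (P.symm hd)
          have sd : P.Same q d := same_of_mem (P.symm hq₁q) hd
          have hqT : q ∈ ({t, q, p₁, p₂} : Finset α) := by simp
          have hAB : ({t, q, p₁, p₂} : Finset α) ≠ P.A ∧ ({t, q, p₁, p₂} : Finset α) ≠ P.B := by
            constructor <;> intro he <;> rcases sd with h' | h'
            · exact hdT (he ▸ h'.2)
            · exact not_mem_A_B (he ▸ hqT) h'.1
            · exact not_mem_A_B h'.1 (he ▸ hqT)
            · exact hdT (he ▸ h'.2)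
          have h1 := hall' hs ⟨q, hqT⟩ hAB.1 hAB.2
          have h2 := one_le_req (P := P) {t, q, p₁, p₂}
          have h3 : (P.nb {t, q, p₁, p₂}).card ≤ 4 := by
            refine (Finset.card_le_card (t := {p, q₁, q₂, w}) ?_).trans Finset.card_le_four
            refine Finset.biUnion_subset.2 fun v hv => ?_
            simp only [Finset.mem_insert, Finset.mem_singleton] at hv
            rcases hv with h | h | h | h <;> rw [h]
            · rw [hNt]; simp [Finset.insert_subset_iff]
            · rw [hNq]; simp [Finset.insert_subset_iff]
            · rw [hN₁]; simp [Finset.insert_subset_iff]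
            · rw [hN₂]; simp [Finset.insert_subset_iff]
          rw [Finset.card_insert_of_notMem (by simp [htq, htp₁, htp₂]),
            Finset.card_eq_three.2 ⟨q, p₁, p₂, hqp₁, hqp₂, hp₁₂, rfl⟩] at h1
          omega
      · exact (hw rfl).elim
    · obtain ⟨t, htq, htp₂, hNq₂⟩ := hFq₂.exists_eq (P.symm hq₂q) (P.symm hq₂p₂) hqp₂
      obtain ⟨n1, n2, -⟩ := hq.ne_of_eq e1
      obtain ⟨m1, m2, -⟩ := hFq₂.ne_of_eq e2
      have m : ∀ {v}, v ∈ P.N q → v ≠ q₂ → v = p ∨ v = q₁ := by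
        intro v hv hv'
        rw [hNq] at hv
        simp only [Finset.mem_insert, Finset.mem_singleton] at hv
        rcases hv with h | h | h
        · exact Or.inl h
        · exact Or.inr h
        · exact (hv' h).elim
      have m' : ∀ {v}, v ∈ P.N q₂ → v ≠ q → v = p₂ ∨ v = t := by
        intro v hv hv'
        rw [hNq₂] at hv
        simp only [Finset.mem_insert, Finset.mem_singleton] at hv
        exact hv.resolve_left hv'
      rcases m (v := x₁) (by simp [e1]) n1.symm with rfl | rfl
      · obtain rfl := (m (v := x₂) (by simp [e1]) n2.symm).resolve_left hx.symm
        rcases m' (v := y₂) (by simp [e2]) m2.symm with rfl | rfl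
        · exact (hq₁p₂ (P.symm h4)).elim
        · exact fin hFq₂ _ hNq₂ h4
      · rcases m' (v := y₁) (by simp [e2]) m1.symm with rfl | rfl
        · exact (hq₁p₂ (P.symm h3)).elim
        · exact fin hFq₂ _ hNq₂ h3

/-- The common neighbour `w` leads either to two disjoint edges between the remaining neighbours of
`p` and `q`, and then `pq` is an inner rung, or to a special neighbour of `p`, and then `pq` is an
edge of a path. -/
lemma initial_ladder_of_common (hM : ∀ x y, P.Thin x y → P.Multi x y) {p q w : α}
    (h : P.Thin p q) (hp : P.Free p) (hq : P.Free q) (hw : w ≠ p)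
    (hsub : (P.N p).erase q ⊆ P.N w) : ∃ j X Y, P.Lad j X Y ∧ LadAdj j X Y p q := by
  obtain ⟨p₁, hp₁, hp₁q, -⟩ := exists_third (a := q) (b := q) hp.1.ge
  obtain ⟨p₂, hp₂q, hp₂₁, hNp⟩ := hp.exists_eq h.adj hp₁ hp₁q.symm
  obtain ⟨q₁, hq₁, hq₁p, -⟩ := exists_third (a := p) (b := p) hq.1.ge
  obtain ⟨q₂, hq₂p, hq₂₁, hNq⟩ := hq.exists_eq (P.symm h.adj) hq₁ hq₁p.symm
  have hp₂ : p₂ ∈ P.N p := by simp [hNp]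
  have hw₁ : w ∈ P.N p₁ := P.symm (hsub (Finset.mem_erase.2 ⟨hp₁q, hp₁⟩))
  have hw₂ : w ∈ P.N p₂ := P.symm (hsub (Finset.mem_erase.2 ⟨hp₂q, hp₂⟩))
  have fin : ∀ p₁ p₂ q₁ q₂, P.N p = {q, p₁, p₂} → P.N q = {p, q₁, q₂} → q₁ ∈ P.N p₁ → q₂ ∈ P.N p₂ →
      ∃ j X Y, P.Lad j X Y ∧ LadAdj j X Y p q := by
    intro p₁ p₂ q₁ q₂ h1 h2 h3 h4
    obtain ⟨X, Y, hL, ⟨-, hX, -⟩, ⟨-, hY, -⟩⟩ := lad_three h hp hq h1 h2 h3 h4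
    exact ⟨2, X, Y, hL, Or.inl ⟨1, by norm_num, by rw [hX, hY]⟩⟩
  -- one of the ends of the spokes is special
  have core : ∀ p₁ p₂, P.N p = {q, p₁, p₂} → w ∈ P.N p₁ → w ∈ P.N p₂ → w ∉ P.N q → P.Special p₁ →
      p₂ ∉ P.R → P.N p₂ ⊆ {p, w, q₁, q₂} → ∃ j X Y, P.Lad j X Y ∧ LadAdj j X Y p q := by
    intro p₁ p₂ hNp hw₁ hw₂ hwq hS hR hsub
    obtain ⟨hqp₁, hqp₂, hp₁₂⟩ := hp.ne_of_eq hNp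
    have hp₁ : p ∈ P.N p₁ := P.symm (by simp [hNp])
    have hp₂ : p ∈ P.N p₂ := P.symm (by simp [hNp])
    have hN₁ := eq_of_card_two hS.le hp₁ hw₁ hw.symm
    have hq₂ : q₂ ∈ P.N q := by simp [hNq]
    have hwq₁ : w ≠ q₁ := by rintro rfl; exact hwq hq₁
    have hwq₂ : w ≠ q₂ := by rintro rfl; exact hwq hq₂
    have h3 := three_le_card (mem_side hp₂) hR
    have hsp₂ : ∀ {v}, v ∈ P.N p₂ → v = p ∨ v = w ∨ v = q₁ ∨ v = q₂ := by
      intro v hv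
      have := hsub hv
      simpa only [Finset.mem_insert, Finset.mem_singleton] using this
    have hsub3 : ∀ a b, (∀ {v}, v ∈ P.N p₂ → v = p ∨ v = w ∨ v = a ∨ v = b) → b ∉ P.N p₂ →
        P.N p₂ = {p, w, a} := by
      intro a b hab hb
      apply Finset.eq_of_subset_of_card_le
      · intro v hv
        simp only [Finset.mem_insert, Finset.mem_singleton]
        rcases hab hv with h | h | h | h
        · exact Or.inl h
        · exact Or.inr (Or.inl h)
        · exact Or.inr (Or.inr h)
        · exact (hb (h ▸ hv)).elim
      · exact Finset.card_le_three.trans h3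
    by_cases h1 : q₁ ∈ P.N p₂
    · by_cases h2 : q₂ ∈ P.N p₂
      -- If `p₂` is adjacent to both `q₁` and `q₂`, then `fan_rung` allows one of them to be
      -- nonspecial only if both are free with the same three neighbours, which is too few. If both
      -- are special, they have only the neighbours `q` and `p₂`.
      · exfalso
        have hN₂ : P.N p₂ = {p, w, q₁, q₂} :=
          hsub.antisymm (by simp [Finset.insert_subset_iff, *])
        have h4 : (P.N p₂).card = 4 := by
          rw [hN₂, Finset.card_insert_of_notMem (by simp [hw.symm, hq₁p.symm, hq₂p.symm]),
            Finset.card_eq_three.2 ⟨w, q₁, q₂, hwq₁, hwq₂, hq₂₁.symm, rfl⟩]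
        have hS₂ : ¬ P.Special p₂ := by unfold Special; omega
        have hF₂ : ¬ P.Free p₂ := by rintro ⟨h5, -⟩; omega
        have f1 := fun hy => fan_rung hM hq hNp hNq hwq hN₂ hN₁ hp₁₂.symm hqp₂.symm hS₂ hF₂ (y := q₁)
          (y' := q₂) hy
        have f2 := fun hy => fan_rung hM hq hNp (hNq.trans (triple_swap_right _ _ _)) hwq
          (hN₂.trans (by rw [Finset.pair_comm q₁ q₂])) hN₁ hp₁₂.symm hqp₂.symm hS₂ hF₂ (y := q₂)
          (y' := q₁) hy
        have same : P.Same q₁ q₂ := same_of_mem hq₁ hq₂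
        have b1 : q ∈ P.N q₁ := P.symm hq₁
        have b2 : p₂ ∈ P.N q₁ := P.symm h1
        have b3 : q ∈ P.N q₂ := P.symm hq₂
        have b4 : p₂ ∈ P.N q₂ := P.symm h2
        have ns : ∀ {a b z}, z ≠ q → z ≠ p₂ → P.N a = {q, p₂, z} → z ∈ P.N b → q ∈ P.N b →
            p₂ ∈ P.N b → ¬ P.Special b := by
          intro a b z hzq hz₂ _ hz hqb hp₂b hSb
          rw [eq_of_card_two hSb.le hqb hp₂b hqp₂] at hz
          simp only [Finset.mem_insert, Finset.mem_singleton] at hz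
          exact hz.elim hzq hz₂
        by_cases s1 : P.Special q₁
        · by_cases s2 : P.Special q₂
          · have e1 := eq_of_card_two s1.le b1 b2 hqp₂
            have e2 := eq_of_card_two s2.le b3 b4 hqp₂
            have hs : P.Side {q₁, q₂} := side_of_same q₁ (by simp) (by
              intro v hv
              rw [Finset.mem_insert, Finset.mem_singleton] at hv
              rcases hv with rfl | rfl
              · exact same.trans same.symm
              · exact same)
            have sw : P.Same q₁ w := (same_of_mem h1 hw₂)
            have hwT : w ∉ ({q₁, q₂} : Finset α) := by simp [hwq₁, hwq₂]
            have hAB : ({q₁, q₂} : Finset α) ≠ P.A ∧ ({q₁, q₂} : Finset α) ≠ P.B := by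
              constructor <;> intro he <;> rcases sw with h' | h'
              · exact hwT (he ▸ h'.2)
              · exact not_mem_A_B (he ▸ Finset.mem_insert_self q₁ _) h'.1
              · exact not_mem_A_B h'.1 (he ▸ Finset.mem_insert_self q₁ _)
              · exact hwT (he ▸ h'.2)
            have k1 := hall' hs (by simp) hAB.1 hAB.2
            have k2 : P.nb {q₁, q₂} = {q, p₂} := by simp [nb, e1, e2]
            have k3 := one_le_req (P := P) {q₁, q₂}
            rw [k2, Finset.card_pair hq₂₁.symm] at k1
            have := Finset.card_le_two (a := q) (b := p₂)
            omega
          · obtain ⟨_, z, hzq, hz₂, e, hz⟩ := f2 s2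
            exact ns hzq hz₂ e hz b1 b2 s1
        · obtain ⟨hF₁, z, hzq, hz₂, e, hz⟩ := f1 s1
          obtain ⟨hFq₂, z', -, -, e', -⟩ := f2 (ns hzq hz₂ e hz b3 b4)
          have e2 := eq_of_card_three hFq₂.1.le b3 b4 hz hqp₂ hzq.symm hz₂.symm
          have := four_le_of_pair hq₂₁.symm same hF₁.2 hFq₂.2 e.subset e2.subset
          have := Finset.card_le_three (a := q) (b := p₂) (c := z)
          omega
      · have hN₂ := hsub3 q₁ q₂ hsp₂ h2
        have hF₂ : P.Free p₂ := by
          refine ⟨?_, hR⟩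
          rw [hN₂] at h3 ⊢
          exact le_antisymm Finset.card_le_three h3
        exact initial_ladder_of_special hM hp hq hNp (hNq.trans (triple_swap_right _ _ _)) hw hwq hN₁
          hS.mem_R hF₂ hN₂
    · have hN₂ := hsub3 q₂ q₁ (fun hv => by
        rcases hsp₂ hv with h | h | h | h
        · exact Or.inl h
        · exact Or.inr (Or.inl h)
        · exact Or.inr (Or.inr (Or.inr h))
        · exact Or.inr (Or.inr (Or.inl h))) h1
      have hF₂ : P.Free p₂ := by
        refine ⟨?_, hR⟩
        rw [hN₂] at h3 ⊢
        exact le_antisymm Finset.card_le_three h3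
      exact initial_ladder_of_special hM hp hq hNp hNq hw hwq hN₁ hS.mem_R hF₂ hN₂
  rcases common_neighbour hM h hp hq hNp hNq hw hw₁ hw₂ with ⟨h1, h2⟩ | ⟨h1, h2⟩ |
    ⟨h1, h2, h3, h4⟩ | ⟨h1, h2, h3, h4⟩
  · exact fin p₁ p₂ q₁ q₂ hNp hNq h1 h2
  · exact fin p₁ p₂ q₂ q₁ hNp (hNq.trans (triple_swap_right _ _ _)) h1 h2
  · exact core p₁ p₂ hNp hw₁ hw₂ h1 h2 h3 h4
  · exact core p₂ p₁ (hNp.trans (triple_swap_right _ _ _)) hw₂ hw₁ h1 h2 h3 h4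

lemma initial_ladder (hM : ∀ x y, P.Thin x y → P.Multi x y) {p q : α} (h : P.Thin p q)
    (hp : P.Free p) (hq : P.Free q) : ∃ j X Y, P.Lad j X Y ∧ LadAdj j X Y p q := by
  rcases hM _ _ h with ⟨-, w, hw, hsub⟩ | ⟨-, w, hw, hsub⟩ | ⟨-, -, x₁, x₂, y₁, y₂, e1, e2, -, -, h1, h2⟩
  · exact initial_ladder_of_common hM h hp hq hw hsub
  · obtain ⟨j, X, Y, hL, hadj⟩ := initial_ladder_of_common hM h.symm hq hp hw hsub
    exact ⟨j, X, Y, hL, hadj.symm⟩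
  · obtain ⟨X, Y, hL, ⟨-, hX, -⟩, ⟨-, hY, -⟩⟩ := lad_three h hp hq e1 e2 h1 h2
    exact ⟨2, X, Y, hL, Or.inl ⟨1, by norm_num, by rw [hX, hY]⟩⟩

end HallGraph
end RBrick

/-! ### Prolonging ladders up to special vertices -/

namespace RBrick
namespace HallGraph

variable {α : Type*} [DecidableEq α] {P : HallGraph α} {j : ℕ} {X Y : ℕ → α}

lemma Lad.swap (L : P.Lad j X Y) : P.Lad j Y X :=
  ⟨L.two_le, fun i hi => P.symm (L.rung i hi), L.stepY, L.stepX, L.injY, L.injX,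
    fun i hi k hk => (L.ne k hk i hi).symm, L.freeY, L.freeX, fun i h0 hi => (L.thin i h0 hi).symm⟩

lemma Lad.reverse (L : P.Lad j X Y) : P.Lad j (fun i => X (j - i)) (fun i => Y (j - i)) := by
  refine ⟨L.two_le, fun i hi => L.rung _ (by omega), fun i hi => ?_, fun i hi => ?_,
    fun i hi k hk h => ?_, fun i hi k hk h => ?_, fun i hi k hk => L.ne _ (by omega) _ (by omega),
    fun i h0 hi => L.freeX _ (by omega) (by omega), fun i h0 hi => L.freeY _ (by omega) (by omega),
    fun i h0 hi => L.thin _ (by omega) (by omega)⟩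
  · have := L.stepX (j - (i + 1)) (by omega)
    rw [show j - (i + 1) + 1 = j - i by omega] at this
    exact P.symm this
  · have := L.stepY (j - (i + 1)) (by omega)
    rw [show j - (i + 1) + 1 = j - i by omega] at this
    exact P.symm this
  · have := L.injX _ (by omega) _ (by omega) h
    omega
  · have := L.injY _ (by omega) _ (by omega) h
    omega

omit [DecidableEq α] in
lemma LadAdj.swap {u v : α} (h : LadAdj j X Y u v) : LadAdj j Y X u v := by
  rcases h with ⟨i, hi, h⟩ | ⟨i, hi, h⟩
  · exact Or.inl ⟨i, hi, by rw [h, Sym2.eq_swap]⟩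
  · exact Or.inr ⟨i, hi, h.symm⟩

omit [DecidableEq α] in
lemma LadAdj.reverse {u v : α} (h : LadAdj j X Y u v) :
    LadAdj j (fun i => X (j - i)) (fun i => Y (j - i)) u v := by
  rcases h with ⟨i, hi, h⟩ | ⟨i, hi, h⟩
  · exact Or.inl ⟨j - i, by omega, by simpa [Nat.sub_sub_self hi] using h⟩
  · refine Or.inr ⟨j - (i + 1), by omega, ?_⟩
    beta_reduce
    rw [show j - (j - (i + 1)) = i + 1 by omega, show j - (j - (i + 1) + 1) = i by omega]
    rcases h with h | h
    · exact Or.inl (by rw [h, Sym2.eq_swap])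
    · exact Or.inr (by rw [h, Sym2.eq_swap])

lemma Lad.nbrX (L : P.Lad j X Y) {m : ℕ} (hm : m + 1 < j) :
    P.N (X (m + 1)) = {Y (m + 1), X (m + 2), X m} := by
  refine eq_of_card_three (L.freeX (m + 1) (by omega) hm).1.le (L.rung _ hm.le)
    (L.stepX (m + 1) hm) (P.symm (L.stepX m (by omega))) (L.ne _ (by omega) _ (by omega)).symm
    (L.ne _ (by omega) _ (by omega)).symm ?_
  intro h
  have := L.injX _ (by omega) _ (by omega) h
  omega

lemma Lad.nbrY (L : P.Lad j X Y) {m : ℕ} (hm : m + 1 < j) :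
    P.N (Y (m + 1)) = {X (m + 1), Y (m + 2), Y m} := L.swap.nbrX hm

/-- The vertex `v` lies on the ladder. -/
def OnLad (j : ℕ) (X Y : ℕ → α) (v : α) : Prop := ∃ i ≤ j, v = X i ∨ v = Y i

omit [DecidableEq α] in
lemma OnLad.swap {v : α} (h : OnLad j X Y v) : OnLad j Y X v := by
  obtain ⟨i, hi, h⟩ := h
  exact ⟨i, hi, h.symm⟩

lemma Lad.onLad_of_interior (L : P.Lad j X Y) {i : ℕ} (h0 : 0 < i) (hi : i < j) {v w : α}
    (hv : v = X i ∨ v = Y i) (hw : w ∈ P.N v) : OnLad j X Y w := by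
  obtain ⟨m, rfl⟩ : ∃ m, i = m + 1 := ⟨i - 1, by omega⟩
  rcases hv with rfl | rfl
  · rw [L.nbrX hi] at hw
    simp only [Finset.mem_insert, Finset.mem_singleton] at hw
    rcases hw with rfl | rfl | rfl
    · exact ⟨m + 1, hi.le, Or.inr rfl⟩
    · exact ⟨m + 2, hi, Or.inl rfl⟩
    · exact ⟨m, by omega, Or.inl rfl⟩
  · rw [L.nbrY hi] at hw
    simp only [Finset.mem_insert, Finset.mem_singleton] at hw
    rcases hw with rfl | rfl | rfl
    · exact ⟨m + 1, hi.le, Or.inl rfl⟩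
    · exact ⟨m + 2, hi, Or.inr rfl⟩
    · exact ⟨m, by omega, Or.inr rfl⟩

/-- This is `extend_rung` applied to the last internal rung, which exists because `j ≥ 2`. -/
lemma Lad.extend_right (hM : ∀ x y, P.Thin x y → P.Multi x y) (L : P.Lad j X Y)
    (hX : ¬ P.Special (X j)) (hY : ¬ P.Special (Y j)) :
    P.Thin (X j) (Y j) ∧ P.Free (X j) ∧ P.Free (Y j) ∧ ∃ s t, P.N (X j) = {X (j - 1), Y j, s} ∧
      P.N (Y j) = {Y (j - 1), X j, t} ∧ t ∈ P.N s := by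
  obtain ⟨k, rfl⟩ : ∃ k, j = k + 2 := ⟨j - 2, by have := L.two_le; omega⟩
  exact extend_rung hM (L.thin (k + 1) (by omega) (by omega)) (L.freeX _ (by omega) (by omega))
    (L.freeY _ (by omega) (by omega)) (L.nbrX (by omega)) (L.nbrY (by omega)) (L.rung _ le_rfl)
    (L.rung k (by omega)) hX hY

open Classical in
/-- The vertices of the ladder in the colour class of `c`. -/
noncomputable def ladClass (P : HallGraph α) (j : ℕ) (X Y : ℕ → α) (c : α) : Finset α :=
  (Finset.range (j + 1)).image fun i => if P.Same c (X i) then X i else Y i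

lemma same_or_of_adj {c u v : α} (hc : c ∈ P.A ∨ c ∈ P.B) (h : v ∈ P.N u) :
    P.Same c u ∨ P.Same c v := by
  have := P.mem h
  unfold Same; tauto

lemma Lad.mem_ladClass (L : P.Lad j X Y) {c v : α} (hc : c ∈ P.A ∨ c ∈ P.B) :
    v ∈ ladClass P j X Y c ↔ P.Same c v ∧ OnLad j X Y v := by
  unfold ladClass OnLad
  simp only [Finset.mem_image, Finset.mem_range]
  constructor
  · rintro ⟨i, hi, rfl⟩
    split_ifs with h
    · exact ⟨h, i, by omega, Or.inl rfl⟩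
    · exact ⟨(same_or_of_adj hc (L.rung i (by omega))).resolve_left h, i, by omega, Or.inr rfl⟩
  · rintro ⟨hs, i, hi, rfl | rfl⟩
    · exact ⟨i, by omega, by rw [if_pos hs]⟩
    · exact ⟨i, by omega, if_neg fun hs' => (hs'.symm.trans hs).not_adj (L.rung i hi)⟩

lemma Lad.card_ladClass (L : P.Lad j X Y) (c : α) : (ladClass P j X Y c).card = j + 1 := by
  unfold ladClass
  rw [Finset.card_image_of_injOn, Finset.card_range]
  intro i hi k hk h
  simp only [Finset.coe_range, Set.mem_Iio] at hi hk
  simp only at h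
  split_ifs at h
  · exact L.injX _ (by omega) _ (by omega) h
  · exact (L.ne _ (by omega) _ (by omega) h).elim
  · exact (L.ne _ (by omega) _ (by omega) h.symm).elim
  · exact L.injY _ (by omega) _ (by omega) h

-- Every rung has one end in each colour class, so only `j + 1` vertices of the ladder are available
-- as neighbours. As `ladClass` has `j + 1` members too, a set containing it whose edges stay on the
-- ladder has no surplus.
open Classical in
lemma Lad.card_nb_le (L : P.Lad j X Y) {c : α} {T : Finset α} (hT : ∀ v ∈ T, P.Same c v)
    (hN : ∀ v ∈ T, ∀ w ∈ P.N v, OnLad j X Y w) : (P.nb T).card ≤ j + 1 := by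
  have : P.nb T ⊆ (Finset.range (j + 1)).image fun i => if P.Same c (X i) then Y i else X i := by
    intro w hw
    obtain ⟨v, hv, hvw⟩ := mem_nb.1 hw
    obtain ⟨i, hi, h⟩ := hN v hv w hvw
    refine Finset.mem_image.2 ⟨i, by simpa using Nat.lt_succ_of_le hi, ?_⟩
    have hnw : ¬ P.Same c w := fun h => ((hT v hv).symm.trans h).not_adj hvw
    rcases h with rfl | rfl
    · rw [if_neg hnw]
    · have hc : c ∈ P.A ∨ c ∈ P.B := (hT v hv).elim (fun h => Or.inl h.1) (fun h => Or.inr h.1)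
      rw [if_pos ((same_or_of_adj hc (L.rung i hi)).resolve_right hnw)]
  exact (Finset.card_le_card this).trans (Finset.card_image_le.trans (by simp))

/-- The internal vertices are saturated: all their neighbours are their neighbours in the ladder.
Only the first rung has room for a further edge. -/
lemma Lad.end_of_mem (L : P.Lad j X Y) {s : α} (hs : s ∈ P.N (X j)) (h1 : s ≠ X (j - 1))
    (h2 : s ≠ Y j) (hon : OnLad j X Y s) : s = X 0 ∨ s = Y 0 := by
  obtain ⟨i, hi, h⟩ := hon
  rcases Nat.eq_zero_or_pos i with rfl | h0
  · exact h
  exfalso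
  obtain ⟨m, rfl⟩ : ∃ m, i = m + 1 := ⟨i - 1, by omega⟩
  have h2j := L.two_le
  rcases hi.lt_or_eq with hi | rfl
  · have hs' := P.symm hs
    rcases h with rfl | rfl
    · rw [L.nbrX hi] at hs'
      simp only [Finset.mem_insert, Finset.mem_singleton] at hs'
      rcases hs' with h | h | h
      · exact L.ne _ le_rfl _ hi.le h
      · have := L.injX _ le_rfl _ (by omega) h
        exact h1 (by rw [this]; rfl)
      · have := L.injX _ le_rfl _ (by omega) h
        omega
    · rw [L.nbrY hi] at hs'
      simp only [Finset.mem_insert, Finset.mem_singleton] at hs'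
      rcases hs' with h | h | h
      · have := L.injX _ le_rfl _ hi.le h
        omega
      · exact L.ne _ le_rfl _ (by omega) h
      · exact L.ne _ le_rfl _ (by omega) h
  · rcases h with rfl | rfl
    · exact (ne_of_adj hs) rfl
    · exact h2 rfl

/-- The ladder cannot be closed up to a cyclic ladder. -/
lemma Lad.not_closed (L : P.Lad j X Y) (hX0 : P.Free (X 0)) (hY0 : P.Free (Y 0))
    (hXj : P.Free (X j)) (hYj : P.Free (Y j)) (h : ∀ v ∈ ({X 0, Y 0, X j, Y j} : Finset α),
      ∀ w ∈ P.N v, OnLad j X Y w) : False := by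
  have hc := mem_side (L.rung 0 (by omega))
  have hT : ∀ v ∈ ladClass P j X Y (X 0), P.Same (X 0) v :=
    fun v hv => ((L.mem_ladClass hc).1 hv).1
  have key : ∀ v, OnLad j X Y v → P.Free v ∧ ∀ w ∈ P.N v, OnLad j X Y w := by
    rintro v ⟨i, hi, hv⟩
    rcases Nat.eq_zero_or_pos i with rfl | h0
    · rcases hv with rfl | rfl
      · exact ⟨hX0, h _ (by simp)⟩
      · exact ⟨hY0, h _ (by simp)⟩
    rcases hi.lt_or_eq with hi | rfl
    · refine ⟨?_, fun w hw => L.onLad_of_interior h0 hi hv hw⟩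
      rcases hv with rfl | rfl
      · exact L.freeX _ h0 hi
      · exact L.freeY _ h0 hi
    · rcases hv with rfl | rfl
      · exact ⟨hXj, h _ (by simp)⟩
      · exact ⟨hYj, h _ (by simp)⟩
  have hcard := L.card_ladClass (X 0)
  have hx0 : X 0 ∈ ladClass P j X Y (X 0) :=
    (L.mem_ladClass hc).2 ⟨by unfold Same; tauto, 0, by omega, Or.inl rfl⟩
  -- Being free, these `j + 1` vertices require `j + 3` neighbours; the closed ladder offers only `j
  -- + 1`.
  have h1 := hall_avoid (P := P) (K := P.nb (ladClass P j X Y (X 0))) (side_of_same _ hx0 hT)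
    ⟨_, hx0⟩ (fun v hv => (key v ((L.mem_ladClass hc).1 hv).2).1.2)
    (fun v hv => Finset.subset_biUnion_of_mem P.N hv)
  have h2 := L.card_nb_le hT (fun v hv => (key v ((L.mem_ladClass hc).1 hv).2).2)
  omega

/-- A ladder with a special vertex on its first rung cannot return to that rung. -/
lemma Lad.not_return (hM : ∀ x y, P.Thin x y → P.Multi x y) (L : P.Lad j X Y) {s t c c₁ d₁ : α}
    (hT : P.Thin (X j) (Y j)) (hFX : P.Free (X j)) (hFY : P.Free (Y j))
    (hNX : P.N (X j) = {X (j - 1), Y j, s}) (hNY : P.N (Y j) = {Y (j - 1), X j, t})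
    (hst : t ∈ P.N s) (hc : P.Special c)
    (hcs : (c = X 0 ∧ s = Y 0 ∧ c₁ = X 1 ∧ d₁ = Y 1) ∨
      (c = Y 0 ∧ s = X 0 ∧ c₁ = Y 1 ∧ d₁ = X 1)) : False := by
  have h2j := L.two_le
  obtain ⟨k, rfl⟩ : ∃ k, j = k + 2 := ⟨j - 2, by omega⟩
  obtain ⟨-, hX1s, hYs⟩ := hFX.ne_of_eq hNX
  obtain ⟨-, hY1t, hXt⟩ := hFY.ne_of_eq hNY
  have hsX : s ∈ P.N (X (k + 2)) := by simp [hNX]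
  have htY : t ∈ P.N (Y (k + 2)) := by simp [hNY]
  have hcN : P.N c = {c₁, s} := by
    rcases hcs with ⟨rfl, rfl, rfl, rfl⟩ | ⟨rfl, rfl, rfl, rfl⟩
    · exact eq_of_card_two hc.le (L.stepX 0 (by omega)) (L.rung 0 (by omega))
        (L.ne _ (by omega) _ (by omega))
    · exact eq_of_card_two hc.le (L.stepY 0 (by omega)) (P.symm (L.rung 0 (by omega)))
        (L.ne _ (by omega) _ (by omega)).symm
  have hcon : OnLad (k + 2) X Y c := by
    rcases hcs with h | h
    · exact ⟨0, by omega, Or.inl h.1⟩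
    · exact ⟨0, by omega, Or.inr h.1⟩
  have hson : OnLad (k + 2) X Y s := by
    rcases hcs with h | h
    · exact ⟨0, by omega, Or.inr h.2.1⟩
    · exact ⟨0, by omega, Or.inl h.2.1⟩
  have hc₁on : OnLad (k + 2) X Y c₁ := by
    rcases hcs with h | h
    · exact ⟨1, by omega, Or.inl h.2.2.1⟩
    · exact ⟨1, by omega, Or.inr h.2.2.1⟩
  have hd₁s : d₁ ∈ P.N s := by
    rcases hcs with ⟨rfl, rfl, rfl, rfl⟩ | ⟨rfl, rfl, rfl, rfl⟩
    · exact L.stepY 0 (by omega)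
    · exact L.stepX 0 (by omega)
  have hcs' : s ∈ P.N c := by simp [hcN]
  have hYc₁ : Y (k + 2) ≠ c₁ := by
    rcases hcs with ⟨rfl, rfl, rfl, rfl⟩ | ⟨rfl, rfl, rfl, rfl⟩
    · exact (L.ne _ (by omega) _ (by omega)).symm
    · intro h
      have := L.injY _ (by omega) _ (by omega) h
      omega
  have htc : t ≠ c := by
    rintro rfl
    have := P.symm htY
    rw [hcN] at this
    simp only [Finset.mem_insert, Finset.mem_singleton] at this
    exact this.elim hYc₁ hYs
  have htd₁ : t ≠ d₁ := by
    rcases hcs with ⟨rfl, rfl, rfl, rfl⟩ | ⟨rfl, rfl, rfl, rfl⟩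
    · rintro rfl
      have := P.symm htY
      rw [L.nbrY (m := 0) (by omega)] at this
      simp only [Finset.mem_insert, Finset.mem_singleton] at this
      rcases this with h | h | h
      · exact L.ne _ (by omega) _ (by omega) h.symm
      · have := L.injY _ (by omega) _ (by omega) h
        obtain rfl : k = 0 := by omega
        exact hY1t rfl
      · have := L.injY _ (by omega) _ (by omega) h
        omega
    · rintro rfl
      have := P.symm htY
      rw [L.nbrX (m := 0) (by omega)] at this
      simp only [Finset.mem_insert, Finset.mem_singleton] at this
      rcases this with h | h | h
      · have := L.injY _ (by omega) _ (by omega) h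
        omega
      · exact L.ne _ (by omega) _ (by omega) h.symm
      · exact L.ne _ (by omega) _ (by omega) h.symm
  have hcd₁ : c ≠ d₁ := by
    rcases hcs with ⟨rfl, rfl, rfl, rfl⟩ | ⟨rfl, rfl, rfl, rfl⟩
    · exact L.ne _ (by omega) _ (by omega)
    · exact (L.ne _ (by omega) _ (by omega)).symm
  -- Otherwise `extend_rung` applies to `X j`, `Y j` and makes `s` free. But `s` has four
  -- neighbours: both its neighbours on the old ladder, then `t` and the last vertex `X j`.
  have htS : P.Special t := by
    by_contra htS
    have hsc := P.symm hcs'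
    have h3 : ({c, d₁, t} : Finset α) ⊆ P.N s := by simp [Finset.insert_subset_iff, hsc, hd₁s, hst]
    have h3' : ({c, d₁, t} : Finset α).card = 3 :=
      Finset.card_eq_three.2 ⟨c, d₁, t, hcd₁, htc.symm, htd₁.symm, rfl⟩
    have h3'' := Finset.card_le_card h3
    have hsS : ¬ P.Special s := by unfold Special; omega
    obtain ⟨-, hFs, -⟩ := extend_rung hM hT hFX hFY (p₁ := s) (q₁ := t) (p₂ := X (k + 1))
      (q₂ := Y (k + 1)) (by rw [hNX, triple_rotate]; rfl) (by rw [hNY, triple_rotate]; rfl) hst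
      (L.rung _ (by omega)) hsS htS
    have hNs := eq_of_card_three hFs.1.le hsc hd₁s hst hcd₁ htc.symm htd₁.symm
    have := P.symm hsX
    rw [hNs] at this
    simp only [Finset.mem_insert, Finset.mem_singleton] at this
    rcases this with h | h | h
    · rcases hcs with ⟨rfl, rfl, rfl, rfl⟩ | ⟨rfl, rfl, rfl, rfl⟩
      · have := L.injX _ (by omega) _ (by omega) h
        omega
      · exact L.ne _ (by omega) _ (by omega) h
    · rcases hcs with ⟨rfl, rfl, rfl, rfl⟩ | ⟨rfl, rfl, rfl, rfl⟩
      · exact L.ne _ (by omega) _ (by omega) h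
      · have := L.injX _ (by omega) _ (by omega) h
        omega
    · exact hXt h
  have htN : P.N t = {Y (k + 2), s} := eq_of_card_two htS.le (P.symm htY) (P.symm hst) hYs
  have hton : ¬ OnLad (k + 2) X Y t := by
    intro hon
    have := L.swap.end_of_mem htY hY1t.symm hXt.symm hon.swap
    rcases hcs with ⟨rfl, rfl, rfl, rfl⟩ | ⟨rfl, rfl, rfl, rfl⟩
    · exact this.elim (fun h => ne_of_adj hst h.symm) htc
    · exact this.elim htc (fun h => ne_of_adj hst h.symm)
  have hsame : P.Same c t := same_of_mem (P.symm hcs') hst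
  have hcV := mem_side hcs'
  have hTs : ∀ v ∈ insert t (ladClass P (k + 2) X Y c), P.Same c v := by
    intro v hv
    rcases Finset.mem_insert.1 hv with rfl | hv
    · exact hsame
    · exact ((L.mem_ladClass hcV).1 hv).1
  -- Together with `t`, which is off the ladder, the vertices of the ladder coloured like `c` number
  -- `j + 2`, while all their neighbours are among `j + 1` vertices. The weak form of Hall's
  -- condition is used because the set may be a whole class.
  have h1 := hall_weak (P := P) (T := insert t (ladClass P (k + 2) X Y c)) (side_of_same c
    (Finset.mem_insert_of_mem ((L.mem_ladClass hcV).2 ⟨hsame.trans hsame.symm, hcon⟩)) hTs)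
  have hYon : OnLad (k + 2) X Y (Y (k + 2)) := ⟨k + 2, le_rfl, Or.inr rfl⟩
  have h2 := L.card_nb_le hTs (by
    intro v hv w hw
    rcases Finset.mem_insert.1 hv with rfl | hv
    · rw [htN] at hw
      simp only [Finset.mem_insert, Finset.mem_singleton] at hw
      rcases hw with rfl | rfl
      · exact hYon
      · exact hson
    · obtain ⟨hcv, i, hi, hvi⟩ := (L.mem_ladClass hcV).1 hv
      rcases Nat.eq_zero_or_pos i with rfl | h0
      · have hvc : v = c := by
          have hvs : v ≠ s := by rintro rfl; exact hcv.not_adj hcs'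
          rcases hcs with ⟨rfl, rfl, -⟩ | ⟨rfl, rfl, -⟩
          · exact hvi.resolve_right hvs
          · exact hvi.resolve_left hvs
        rw [hvc, hcN] at hw
        simp only [Finset.mem_insert, Finset.mem_singleton] at hw
        rcases hw with rfl | rfl
        · exact hc₁on
        · exact hson
      rcases hi.lt_or_eq with hi | rfl
      · exact L.onLad_of_interior h0 hi hvi hw
      · rcases hvi with rfl | rfl
        · rw [hNX] at hw
          simp only [Finset.mem_insert, Finset.mem_singleton] at hw
          rcases hw with rfl | rfl | rfl
          · exact ⟨k + 1, by omega, Or.inl rfl⟩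
          · exact hYon
          · exact hson
        · exact ((hcv.symm.trans hsame).not_adj htY).elim)
  rw [Finset.card_insert_of_notMem (fun h => hton ((L.mem_ladClass hcV).1 h).2),
    L.card_ladClass] at h1
  omega

/-- On the ladder, `s` could only be an end of the first rung. If that rung has a special vertex,
then this vertex is saturated, so `s` is the other end and `Lad.not_return` applies. Otherwise both
its ends are free and the ladder closes up, straight or twisted, which `Lad.not_closed` forbids. -/
lemma Lad.not_wrap (hM : ∀ x y, P.Thin x y → P.Multi x y) (L : P.Lad j X Y) {s t : α}
    (hT : P.Thin (X j) (Y j)) (hFX : P.Free (X j)) (hFY : P.Free (Y j))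
    (hNX : P.N (X j) = {X (j - 1), Y j, s}) (hNY : P.N (Y j) = {Y (j - 1), X j, t})
    (hst : t ∈ P.N s) : ¬ OnLad j X Y s := by
  intro hon
  have h2j := L.two_le
  obtain ⟨-, hX1s, hYs⟩ := hFX.ne_of_eq hNX
  obtain ⟨-, hY1t, hXt⟩ := hFY.ne_of_eq hNY
  have hsX : s ∈ P.N (X j) := by simp [hNX]
  have htY : t ∈ P.N (Y j) := by simp [hNY]
  have hs := L.end_of_mem hsX hX1s.symm hYs.symm hon
  by_cases hX0 : P.Special (X 0)
  · rcases hs with rfl | rfl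
    · have hN := eq_of_card_two hX0.le (L.stepX 0 (by omega)) (L.rung 0 (by omega))
        (L.ne _ (by omega) _ (by omega))
      have := P.symm hsX
      rw [hN] at this
      simp only [Finset.mem_insert, Finset.mem_singleton] at this
      rcases this with h | h
      · have := L.injX _ (by omega) _ (by omega) h
        omega
      · exact L.ne _ (by omega) _ (by omega) h
    · exact L.not_return hM hT hFX hFY hNX hNY hst hX0 (Or.inl ⟨rfl, rfl, rfl, rfl⟩)
  by_cases hY0 : P.Special (Y 0)
  · rcases hs with rfl | rfl
    · exact L.not_return hM hT hFX hFY hNX hNY hst hY0 (Or.inr ⟨rfl, rfl, rfl, rfl⟩)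
    · have hN := eq_of_card_two hY0.le (L.stepY 0 (by omega)) (P.symm (L.rung 0 (by omega)))
        (L.ne _ (by omega) _ (by omega)).symm
      have := P.symm hsX
      rw [hN] at this
      simp only [Finset.mem_insert, Finset.mem_singleton] at this
      rcases this with h | h
      · exact L.ne _ (by omega) _ (by omega) h
      · have := L.injX _ (by omega) _ (by omega) h
        omega
  -- Read backwards, the ladder can be extended at its first rung; so the ends of that rung are
  -- free, with third neighbours `s'` and `t'`.
  obtain ⟨-, hFX0, hFY0, s', t', hNX0, hNY0, -⟩ := L.reverse.extend_right hM
    (by simpa using hX0) (by simpa using hY0)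
  have e1 : j - (j - 1) = 1 := by omega
  simp only [Nat.sub_self, e1] at hFX0 hFY0 hNX0 hNY0
  have hX0on : OnLad j X Y (X 0) := ⟨0, by omega, Or.inl rfl⟩
  have hY0on : OnLad j X Y (Y 0) := ⟨0, by omega, Or.inr rfl⟩
  have hX1on : OnLad j X Y (X 1) := ⟨1, by omega, Or.inl rfl⟩
  have hY1on : OnLad j X Y (Y 1) := ⟨1, by omega, Or.inr rfl⟩
  have hXjon : OnLad j X Y (X j) := ⟨j, le_rfl, Or.inl rfl⟩
  have hYjon : OnLad j X Y (Y j) := ⟨j, le_rfl, Or.inr rfl⟩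
  have hXj'on : OnLad j X Y (X (j - 1)) := ⟨j - 1, by omega, Or.inl rfl⟩
  have hYj'on : OnLad j X Y (Y (j - 1)) := ⟨j - 1, by omega, Or.inr rfl⟩
  have hXX : X j ≠ X 1 := fun h => by have := L.injX _ (by omega) _ (by omega) h; omega
  have hYY : Y j ≠ Y 1 := fun h => by have := L.injY _ (by omega) _ (by omega) h; omega
  have hXX0 : X j ≠ X 0 := fun h => by have := L.injX _ (by omega) _ (by omega) h; omega
  have hYY0 : Y j ≠ Y 0 := fun h => by have := L.injY _ (by omega) _ (by omega) h; omega
  have hXY : ∀ i k, i ≤ j → k ≤ j → X i ≠ Y k := fun i k hi hk => L.ne i hi k hk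
  -- The edge from `X j` to `s` uses the third place of one end of the first rung. Then `t`,
  -- adjacent to `s`, must be the other end of that rung, whose third place is taken by `Y j`.
  have hs'on : OnLad j X Y s' ∧ OnLad j X Y t' ∧ OnLad j X Y t := by
    have hXs := P.symm hsX
    have hYt := P.symm htY
    rcases hs with rfl | rfl
    · rw [hNX0] at hXs hst
      simp only [Finset.mem_insert, Finset.mem_singleton] at hXs hst
      rcases hXs with h | h | rfl
      · exact (hXX h).elim
      · exact (hXY _ _ le_rfl (by omega) h).elim
      refine ⟨hXjon, ?_⟩
      rcases hst with rfl | rfl | rfl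
      · rw [L.nbrX (m := 0) (by omega)] at hYt
        simp only [Finset.mem_insert, Finset.mem_singleton] at hYt
        rcases hYt with h | h | h
        · exact (hYY h).elim
        · exact (hXY _ _ (by omega) (by omega) h.symm).elim
        · exact (hXY _ _ (by omega) (by omega) h.symm).elim
      · rw [hNY0] at hYt
        simp only [Finset.mem_insert, Finset.mem_singleton] at hYt
        rcases hYt with h | h | rfl
        · exact (hYY h).elim
        · exact (hXY _ _ (by omega) (by omega) h.symm).elim
        · exact ⟨hYjon, hY0on⟩
      · exact (hXt rfl).elim
    · rw [hNY0] at hXs hst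
      simp only [Finset.mem_insert, Finset.mem_singleton] at hXs hst
      rcases hXs with h | h | rfl
      · exact (hXY _ _ le_rfl (by omega) h).elim
      · exact (hXX0 h).elim
      rcases hst with rfl | rfl | rfl
      · rw [L.nbrY (m := 0) (by omega)] at hYt
        simp only [Finset.mem_insert, Finset.mem_singleton] at hYt
        rcases hYt with h | h | h
        · exact (hXY _ _ (by omega) (by omega) h.symm).elim
        · have := L.injY _ (by omega) _ (by omega) h
          obtain rfl : j = 2 := by omega
          exact (hY1t rfl).elim
        · exact (hYY0 h).elim
      · rw [hNX0] at hYt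
        simp only [Finset.mem_insert, Finset.mem_singleton] at hYt
        rcases hYt with h | h | rfl
        · exact (hXY _ _ (by omega) (by omega) h.symm).elim
        · exact (hYY0 h).elim
        · exact ⟨hYjon, hXjon, hX0on⟩
      · exact (hXt rfl).elim
  refine L.not_closed hFX0 hFY0 hFX hFY fun v hv w hw => ?_
  simp only [Finset.mem_insert, Finset.mem_singleton] at hv
  rcases hv with rfl | rfl | rfl | rfl
  · rw [hNX0] at hw
    simp only [Finset.mem_insert, Finset.mem_singleton] at hw
    rcases hw with rfl | rfl | rfl
    exacts [hX1on, hY0on, hs'on.1]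
  · rw [hNY0] at hw
    simp only [Finset.mem_insert, Finset.mem_singleton] at hw
    rcases hw with rfl | rfl | rfl
    exacts [hY1on, hX0on, hs'on.2.1]
  · rw [hNX] at hw
    simp only [Finset.mem_insert, Finset.mem_singleton] at hw
    rcases hw with rfl | rfl | rfl
    exacts [hXj'on, hYjon, hon]
  · rw [hNY] at hw
    simp only [Finset.mem_insert, Finset.mem_singleton] at hw
    rcases hw with rfl | rfl | rfl
    exacts [hYj'on, hXjon, hs'on.2.2]

/-- A ladder whose last rung has no special vertex can be prolonged. -/
lemma Lad.prolong (hM : ∀ x y, P.Thin x y → P.Multi x y) (L : P.Lad j X Y)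
    (hX : ¬ P.Special (X j)) (hY : ¬ P.Special (Y j)) :
    ∃ X' Y', P.Lad (j + 1) X' Y' ∧ (∀ i ≤ j, X' i = X i) ∧ (∀ i ≤ j, Y' i = Y i) := by
  obtain ⟨hT, hFX, hFY, s, t, hNX, hNY, hst⟩ := L.extend_right hM hX hY
  have hs := L.not_wrap hM hT hFX hFY hNX hNY hst
  have ht := L.swap.not_wrap hM hT.symm hFY hFX hNY hNX (P.symm hst)
  exact L.snoc (by simp [hNX]) (by simp [hNY]) hst hFX hFY hT
    (fun i hi h => hs ⟨i, hi, Or.inl h⟩) (fun i hi h => hs ⟨i, hi, Or.inr h⟩)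
    (fun i hi h => ht ⟨i, hi, Or.inr h⟩) (fun i hi h => ht ⟨i, hi, Or.inl h⟩)

/-- If both external rungs contain special vertices, there are such vertices of different colour. -/
lemma Lad.exists_special (L : P.Lad j X Y) (hX0 : P.Special (X 0))
    (h : P.Special (X j) ∨ P.Special (Y j)) :
    ∃ a u b w, s(a, u) = s(X 0, Y 0) ∧ s(b, w) = s(X j, Y j) ∧ P.Special a ∧ P.Special b ∧
      ¬ P.Same a b := by
  have h2j := L.two_le
  by_contra! hcon
  obtain ⟨b, w, b₁, hb, hbw, hbN, hb₁⟩ : ∃ b w b₁, P.Special b ∧ s(b, w) = s(X j, Y j) ∧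
      P.N b = {b₁, w} ∧ (b₁ = X (j - 1) ∨ b₁ = Y (j - 1)) := by
    have hstep : X (j - 1) ∈ P.N (X j) ∧ Y (j - 1) ∈ P.N (Y j) := by
      have h1 := P.symm (L.stepX (j - 1) (by omega))
      have h2 := P.symm (L.stepY (j - 1) (by omega))
      rw [Nat.sub_add_cancel (by omega)] at h1 h2
      exact ⟨h1, h2⟩
    rcases h with h | h
    · exact ⟨X j, Y j, X (j - 1), h, rfl, eq_of_card_two h.le hstep.1 (L.rung _ le_rfl)
        (L.ne _ (by omega) _ (by omega)), Or.inl rfl⟩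
    · exact ⟨Y j, X j, Y (j - 1), h, Sym2.eq_swap, eq_of_card_two h.le hstep.2
        (P.symm (L.rung _ le_rfl)) (L.ne _ (by omega) _ (by omega)).symm, Or.inr rfl⟩
  have hs := hcon (X 0) (Y 0) b w rfl hbw hX0 hb
  have hwb : w ∈ P.N b := by simp [hbN]
  have hbw' : (b = X j ∧ w = Y j) ∨ (b = Y j ∧ w = X j) := by simpa using hbw
  have hY0X0 : Y 0 ∈ P.N (X 0) := L.rung 0 (by omega)
  have hY0 : ¬ P.Special (Y 0) := by
    intro hY0
    have := hcon (Y 0) (X 0) b w Sym2.eq_swap hbw hY0 hb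
    exact (hs.trans this.symm).not_adj hY0X0
  have hc := mem_side hY0X0
  have hN0 := eq_of_card_two hX0.le (L.stepX 0 (by omega)) hY0X0 (L.ne _ (by omega) _ (by omega))
  set T := ladClass P j X Y (X 0) with hTdef
  have hT : ∀ v ∈ T, P.Same (X 0) v := fun v hv => ((L.mem_ladClass hc).1 hv).1
  have hxT : X 0 ∈ T := (L.mem_ladClass hc).2 ⟨hs.trans hs.symm, 0, by omega, Or.inl rfl⟩
  have hcases : ∀ v ∈ T, v = X 0 ∨ v = b ∨ ∃ i, 0 < i ∧ i < j ∧ (v = X i ∨ v = Y i) := by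
    intro v hv
    obtain ⟨hsv, i, hi, hvi⟩ := (L.mem_ladClass hc).1 hv
    rcases Nat.eq_zero_or_pos i with rfl | h0
    · refine Or.inl (hvi.resolve_right ?_)
      rintro rfl
      exact hsv.not_adj hY0X0
    rcases hi.lt_or_eq with hi | rfl
    · exact Or.inr (Or.inr ⟨i, h0, hi, hvi⟩)
    · refine Or.inr (Or.inl ?_)
      have hvw : v ≠ w := by
        rintro rfl
        exact (hs.symm.trans hsv).not_adj hwb
      rcases hbw' with ⟨rfl, rfl⟩ | ⟨rfl, rfl⟩
      · exact hvi.resolve_right hvw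
      · exact hvi.resolve_left hvw
  have hle := L.card_nb_le hT (by
    intro v hv z hz
    rcases hcases v hv with rfl | rfl | ⟨i, h0, hi, hvi⟩
    · rw [hN0] at hz
      simp only [Finset.mem_insert, Finset.mem_singleton] at hz
      rcases hz with rfl | rfl
      · exact ⟨1, by omega, Or.inl rfl⟩
      · exact ⟨0, by omega, Or.inr rfl⟩
    · rw [hbN] at hz
      simp only [Finset.mem_insert, Finset.mem_singleton] at hz
      rcases hz with rfl | rfl
      · exact ⟨j - 1, by omega, hb₁⟩
      · exact ⟨j, le_rfl, by rcases hbw' with h | h <;> simp [h.2]⟩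
    · exact L.onLad_of_interior h0 hi hvi hz)
  have hcard : T.card = j + 1 := L.card_ladClass _
  have hside : P.Side T := side_of_same _ hxT hT
  -- There are `j + 1` vertices in `T` and at most `j + 1` neighbours; only a whole class may lack a
  -- surplus.
  have hAB : T = P.A ∨ T = P.B := by
    by_contra! hne
    have h1 := hall' hside ⟨_, hxT⟩ hne.1 hne.2
    have h2 := one_le_req (P := P) T
    omega
  -- All neighbours of `Y 0` now lie in `T`, where the known neighbourhoods leave only `X 0` and `Y
  -- 1`. So `Y 0` is special, and its colour differs from that of `b`.
  have hsub : P.N (Y 0) ⊆ {X 0, Y 1} := by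
    intro v hv
    have hsv : P.Same (X 0) v := same_of_mem (P.symm hY0X0) hv
    have hvT : v ∈ T := by
      rcases hAB with h | h <;> rcases hsv with h' | h'
      · rw [h]; exact h'.2
      · exact (not_mem_A_B (h ▸ hxT) h'.1).elim
      · exact (not_mem_A_B h'.1 (h ▸ hxT)).elim
      · rw [h]; exact h'.2
    have hv' := P.symm hv
    rcases hcases v hvT with rfl | rfl | ⟨i, h0, hi, hvi⟩
    · simp
    · exfalso
      rw [hbN] at hv'
      simp only [Finset.mem_insert, Finset.mem_singleton] at hv'
      rcases hv' with h | h
      · rcases hb₁ with rfl | rfl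
        · exact L.ne _ (by omega) _ (by omega) h.symm
        · have := L.injY _ (by omega) _ (by omega) h
          omega
      · rcases hbw' with h' | h' <;> rw [h'.2] at h
        · have := L.injY _ (by omega) _ (by omega) h
          omega
        · exact L.ne _ (by omega) _ (by omega) h.symm
    · obtain ⟨m, rfl⟩ : ∃ m, i = m + 1 := ⟨i - 1, by omega⟩
      rcases hvi with rfl | rfl
      · exfalso
        rw [L.nbrX hi] at hv'
        simp only [Finset.mem_insert, Finset.mem_singleton] at hv'
        rcases hv' with h | h | h
        · have := L.injY _ (by omega) _ (by omega) h
          omega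
        · exact L.ne _ (by omega) _ (by omega) h.symm
        · exact L.ne _ (by omega) _ (by omega) h.symm
      · rw [L.nbrY hi] at hv'
        simp only [Finset.mem_insert, Finset.mem_singleton] at hv'
        rcases hv' with h | h | h
        · exact (L.ne _ (by omega) _ (by omega) h.symm).elim
        · have := L.injY _ (by omega) _ (by omega) h
          omega
        · have := L.injY _ (by omega) _ (by omega) h
          subst this
          simp
  have h1 := (Finset.card_le_card hsub).trans Finset.card_le_two
  have h2 := two_le_card (mem_side (P.symm hY0X0))
  exact hY0 (le_antisymm h1 h2)

lemma Lad.length_le (L : P.Lad j X Y) : j ≤ (P.A ∪ P.B).card := by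
  have h1 := L.card_ladClass (X 0)
  have hc := mem_side (L.rung 0 (by omega))
  have h2 : ladClass P j X Y (X 0) ⊆ P.A ∪ P.B := by
    intro v hv
    rcases ((L.mem_ladClass hc).1 hv).1 with h | h
    · exact Finset.mem_union_left _ h.2
    · exact Finset.mem_union_right _ h.2
  have := Finset.card_le_card h2
  omega

/-- Each thin edge with cubic ends outside `R` lies in a ladder whose external rungs contain special
vertices of different colours. -/
theorem exists_ladder (hM : ∀ x y, P.Thin x y → P.Multi x y) {p q : α} (h : P.Thin p q)
    (hp : P.Free p) (hq : P.Free q) :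
    ∃ j X Y, P.Lad j X Y ∧ LadAdj j X Y p q ∧ ∃ a u b w, s(a, u) = s(X 0, Y 0) ∧
      s(b, w) = s(X j, Y j) ∧ P.Special a ∧ P.Special b ∧ ¬ P.Same a b := by
  by_contra! hcon
  -- By assumption at most one external rung contains special vertices; at the other one, after a
  -- reversal if necessary, the ladder grows. Since ladders have bounded length, this cannot go on.
  have step : ∀ j X Y, P.Lad j X Y → LadAdj j X Y p q →
      ∃ X' Y', P.Lad (j + 1) X' Y' ∧ LadAdj (j + 1) X' Y' p q := by
    intro j X Y L hadj
    have fin : ∀ X Y, P.Lad j X Y → LadAdj j X Y p q → ¬ P.Special (X j) → ¬ P.Special (Y j) →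
        ∃ X' Y', P.Lad (j + 1) X' Y' ∧ LadAdj (j + 1) X' Y' p q := by
      intro X Y L hadj hX hY
      obtain ⟨X', Y', L', h1, h2⟩ := L.prolong hM hX hY
      exact ⟨X', Y', L', hadj.mono (by omega) h1 h2⟩
    by_cases hr : P.Special (X j) ∨ P.Special (Y j)
    · by_cases hX0 : P.Special (X 0)
      · obtain ⟨a, u, b, w, h1, h2, h3, h4, h5⟩ := L.exists_special hX0 hr
        exact (h5 (hcon j X Y L hadj a u b w h1 h2 h3 h4)).elim
      by_cases hY0 : P.Special (Y 0)
      · obtain ⟨a, u, b, w, h1, h2, h3, h4, h5⟩ := L.swap.exists_special hY0 hr.symm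
        exact (h5 (hcon j Y X L.swap hadj.swap a u b w h1 h2 h3 h4)).elim
      · exact fin _ _ L.reverse hadj.reverse (by simpa using hX0) (by simpa using hY0)
    · push Not at hr
      exact fin X Y L hadj hr.1 hr.2
  obtain ⟨j₀, X₀, Y₀, L₀, hadj₀⟩ := initial_ladder hM h hp hq
  have all : ∀ n, ∃ X Y, P.Lad (j₀ + n) X Y ∧ LadAdj (j₀ + n) X Y p q := by
    intro n
    induction n with
    | zero => exact ⟨X₀, Y₀, L₀, hadj₀⟩
    | succ n ih =>
      obtain ⟨X, Y, L, hadj⟩ := ih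
      exact step _ X Y L hadj
  obtain ⟨X, Y, L, -⟩ := all ((P.A ∪ P.B).card + 1)
  have := L.length_le
  omega

end HallGraph
end RBrick

namespace RBrick

/-! ### Connectedness and perfect matchings of multigraphs -/

section Basic

variable {γ β : Type*} {F : Graph γ β}

lemma isConnected_of_forall (hne : V(F).Nonempty)
    (h : ∀ X ⊆ V(F), X.Nonempty → (∀ u v, F.Adj u v → u ∈ X → v ∈ X) → V(F) ⊆ X) :
    IsConnected F := by
  obtain ⟨x₀, hx₀⟩ := hne
  have key : ∀ v : V(F), F.toSimpleGraph.Reachable ⟨x₀, hx₀⟩ v := by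
    intro v
    have := h {w | ∃ hw : w ∈ V(F), F.toSimpleGraph.Reachable ⟨x₀, hx₀⟩ ⟨w, hw⟩}
      (fun w hw => hw.1) ⟨x₀, hx₀, SimpleGraph.Reachable.refl _⟩ (by
        rintro u w huw ⟨hu, hr⟩
        refine ⟨huw.right_mem, ?_⟩
        by_cases he : u = w
        · subst he; exact hr
        · exact hr.trans (SimpleGraph.Adj.reachable ⟨fun h => he (congrArg Subtype.val h), huw⟩))
    exact (this v.2).2
  have : Nonempty V(F) := ⟨⟨x₀, hx₀⟩⟩
  exact SimpleGraph.Connected.mk fun u v => (key u).symm.trans (key v)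

lemma IsConnected.subset_of_closed (h : IsConnected F) {X : Set γ} {x : γ} (hxV : x ∈ V(F))
    (hx : x ∈ X) (hX : ∀ u v, F.Adj u v → u ∈ X → v ∈ X) : V(F) ⊆ X := by
  intro v hv
  obtain ⟨p⟩ := h.preconnected ⟨x, hxV⟩ ⟨v, hv⟩
  have : ∀ {a b : V(F)}, F.toSimpleGraph.Walk a b → (a : γ) ∈ X → (b : γ) ∈ X := by
    intro a b p
    induction p with
    | nil => exact id
    | cons hadj _ ih => exact fun ha => ih (hX _ _ hadj.2 ha)
  exact this p hx

/-- `M` is a perfect matching of the graph obtained from `F` by deleting the vertices in `D`. -/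
structure PMOff (F : Graph γ β) (D : Set γ) (M : Set β) : Prop where
  subset : M ⊆ E(F)
  off : ∀ e ∈ M, ∀ v, F.Inc e v → v ∉ D
  cover : ∀ v ∈ V(F), v ∉ D → ∃! e, e ∈ M ∧ F.Inc e v

lemma pmOff_iff {D : Set γ} {M : Set β} :
    IsPerfectMatching (F.deleteVerts D) M ↔ PMOff F D M := by
  have hinc : ∀ {e v}, (F.deleteVerts D).Inc e v → F.Inc e v := by
    rintro e v ⟨w, hw⟩
    rw [Graph.deleteVerts_isLink] at hw
    exact ⟨w, hw.1⟩
  constructor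
  · rintro ⟨hM, hc⟩
    have hoff : ∀ e ∈ M, ∀ v, F.Inc e v → v ∉ D ∧ (F.deleteVerts D).Inc e v := by
      rintro e he v ⟨w, hw⟩
      obtain ⟨x, y, hxy⟩ := Graph.exists_isLink_of_mem_edgeSet (hM he)
      have hxy' := hxy
      rw [Graph.deleteVerts_isLink] at hxy'
      rcases hw.left_eq_or_eq hxy'.1 with rfl | rfl
      · exact ⟨hxy'.2.1, hxy.inc_left⟩
      · exact ⟨hxy'.2.2, hxy.inc_right⟩
    refine ⟨fun e he => ?_, fun e he v hv => (hoff e he v hv).1, fun v hv hvD => ?_⟩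
    · obtain ⟨x, y, hxy⟩ := Graph.exists_isLink_of_mem_edgeSet (hM he)
      exact (hinc hxy.inc_left).edge_mem
    · obtain ⟨e, ⟨heM, he⟩, hu⟩ := hc v (by simpa using ⟨hv, hvD⟩)
      exact ⟨e, ⟨heM, hinc he⟩, fun e' he' => hu e' ⟨he'.1, (hoff e' he'.1 v he'.2).2⟩⟩
  · rintro ⟨hM, hoff, hc⟩
    have hinc' : ∀ {e v}, e ∈ M → F.Inc e v → (F.deleteVerts D).Inc e v := by
      rintro e v he ⟨w, hw⟩
      exact ⟨w, (Graph.deleteVerts_isLink ..).2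
        ⟨hw, hoff e he v hw.inc_left, hoff e he w hw.inc_right⟩⟩
    refine ⟨fun e he => ?_, fun v hv => ?_⟩
    · obtain ⟨x, y, hxy⟩ := Graph.exists_isLink_of_mem_edgeSet (hM he)
      exact (hinc' he hxy.inc_left).edge_mem
    · have hv' : v ∈ V(F) ∧ v ∉ D := by simpa using hv
      obtain ⟨e, ⟨heM, he⟩, hu⟩ := hc v hv'.1 hv'.2
      exact ⟨e, ⟨heM, hinc' heM he⟩, fun e' he' => hu e' ⟨he'.1, hinc he'.2⟩⟩

lemma pmOff_empty_iff {M : Set β} : PMOff F ∅ M ↔ IsPerfectMatching F M := by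
  rw [← pmOff_iff, Graph.deleteVerts_empty]

lemma PMOff.eq {D : Set γ} {M : Set β} (h : PMOff F D M) {e e' : β} {v : γ} (he : e ∈ M)
    (he' : e' ∈ M) (hv : F.Inc e v) (hv' : F.Inc e' v) : e = e' :=
  (h.cover v hv.vertex_mem (h.off e he v hv)).unique ⟨he, hv⟩ ⟨he', hv'⟩

/-- Distinct vertices have distinct mates. The counts below that compare two sets by means of a
matching are instances of this. -/
lemma PMOff.ncard_le {D : Set γ} {M : Set β} (h : PMOff F D M) {T K : Set γ} (hK : K.Finite)
    (hT : ∀ v ∈ T, v ∈ V(F) ∧ v ∉ D) (hTK : ∀ e ∈ M, ∀ v ∈ T, ∀ w, F.IsLink e v w → w ∈ K) :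
    T.ncard ≤ K.ncard := by
  classical
  have : ∀ v, ∃ w, v ∈ T → ∃ e ∈ M, F.IsLink e v w := by
    intro v
    by_cases hv : v ∈ T
    · obtain ⟨e, ⟨he, w, hw⟩, -⟩ := h.cover v (hT v hv).1 (hT v hv).2
      exact ⟨w, fun _ => ⟨e, he, hw⟩⟩
    · exact ⟨v, fun h => (hv h).elim⟩
  choose f hf using this
  refine Set.ncard_le_ncard_of_injOn f (fun v hv => ?_) (fun v hv v' hv' heq => ?_) hK
  · obtain ⟨e, he, hl⟩ := hf v hv
    exact hTK e he v hv _ hl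
  · obtain ⟨e, he, hl⟩ := hf v hv
    obtain ⟨e', he', hl'⟩ := hf v' hv'
    rw [← heq] at hl'
    obtain rfl := h.eq he he' hl.inc_right hl'.inc_right
    exact hl.left_unique hl'

lemma PMOff.insert {u v : γ} {M : Set β} (h : PMOff F {u, v} M) {e : β} (he : F.IsLink e u v) :
    IsPerfectMatching F (insert e M) := by
  refine ⟨Set.insert_subset he.edge_mem h.subset, fun w hw => ?_⟩
  by_cases hwD : w ∈ ({u, v} : Set γ)
  · refine ⟨e, ⟨Set.mem_insert _ _, ?_⟩, ?_⟩
    · rcases hwD with rfl | rfl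
      · exact he.inc_left
      · exact he.inc_right
    · rintro e' ⟨rfl | he', hi⟩
      · rfl
      · exact (h.off e' he' w hi hwD).elim
  · obtain ⟨e', ⟨he', hi⟩, hu⟩ := h.cover w hw hwD
    refine ⟨e', ⟨Set.mem_insert_of_mem _ he', hi⟩, ?_⟩
    rintro e'' ⟨rfl | he'', hi'⟩
    · refine (hwD ?_).elim
      rcases hi'.eq_or_eq_of_isLink he with rfl | rfl <;> simp
    · exact hu e'' ⟨he'', hi'⟩

end Basic

/-! ### Graphs which are bipartite up to a pair of edges -/

/-- `F` is a finite loopless graph which becomes bipartite with classes `A` and `B` when the edges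
`r` (inside `A`) and `s` (inside `B`) are deleted. -/
structure Frame {γ β : Type*} (F : Graph γ β) (A B : Set γ) (r s : β) : Prop where
  finite : V(F).Finite
  loopless : F.Loopless
  disj : Disjoint A B
  union : A ∪ B = V(F)
  left : ∃ a a', F.IsLink r a a' ∧ a ∈ A ∧ a' ∈ A
  right : ∃ b b', F.IsLink s b b' ∧ b ∈ B ∧ b' ∈ B
  link : ∀ e u v, F.IsLink e u v → e ≠ r → e ≠ s → (u ∈ A ∧ v ∈ B) ∨ (u ∈ B ∧ v ∈ A)

/-- Deleting a pair of vertices (not in `Ex`) leaves a graph with a perfect matching of the expected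
form. -/
structure Matchable {γ β : Type*} (F : Graph γ β) (A B : Set γ) (r s : β) (Ex : Set (Sym2 γ)) :
    Prop where
  cross : ∀ a ∈ A, ∀ b ∈ B, ∃ M, PMOff F {a, b} M ∧ r ∉ M ∧ s ∉ M
  left : ∀ u ∈ A, ∀ v ∈ A, u ≠ v → s(u, v) ∉ Ex → ∃ M, PMOff F {u, v} M ∧ r ∉ M
  right : ∀ u ∈ B, ∀ v ∈ B, u ≠ v → s(u, v) ∉ Ex → ∃ M, PMOff F {u, v} M ∧ s ∉ M

namespace Frame

variable {γ β : Type*} {F : Graph γ β} {A B : Set γ} {r s : β}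

lemma swap (h : Frame F A B r s) : Frame F B A s r :=
  ⟨h.finite, h.loopless, h.disj.symm, by rw [Set.union_comm, h.union], h.right, h.left,
    fun e u v he hs hr => (h.link e u v he hr hs).symm⟩

lemma _root_.RBrick.Matchable.swap {Ex : Set (Sym2 γ)} (h : Matchable F A B r s Ex) :
    Matchable F B A s r Ex :=
  ⟨fun b hb a ha => by
    obtain ⟨M, h1, h2, h3⟩ := h.cross a ha b hb
    exact ⟨M, by rwa [Set.pair_comm], h3, h2⟩, h.right, h.left⟩

lemma memV_left (h : Frame F A B r s) {v : γ} (hv : v ∈ A) : v ∈ V(F) := by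
  rw [← h.union]; exact Or.inl hv

lemma memV_right (h : Frame F A B r s) {v : γ} (hv : v ∈ B) : v ∈ V(F) := by
  rw [← h.union]; exact Or.inr hv

lemma not_mem (h : Frame F A B r s) {v : γ} (hv : v ∈ A) : v ∉ B :=
  Set.disjoint_left.1 h.disj hv

lemma finite_left (h : Frame F A B r s) : A.Finite :=
  h.finite.subset fun _ => h.memV_left

lemma finite_right (h : Frame F A B r s) : B.Finite := h.swap.finite_left

/-- An edge incident with a vertex of `A` either is `r` or leads to `B`. -/
lemma right_mem_of_left (h : Frame F A B r s) {e : β} {u v : γ} (he : F.IsLink e u v) (hu : u ∈ A)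
    (hr : e ≠ r) : v ∈ B := by
  by_cases hs : e = s
  · obtain ⟨b, b', hl, hb, hb'⟩ := h.right
    rw [← hs] at hl
    rcases he.left_eq_or_eq hl with rfl | rfl
    · exact (h.not_mem hu hb).elim
    · exact (h.not_mem hu hb').elim
  · rcases h.link e u v he hr hs with h' | h'
    · exact h'.2
    · exact (h.not_mem hu h'.1).elim

lemma left_mem_of_right (h : Frame F A B r s) {e : β} {u v : γ} (he : F.IsLink e u v) (hu : u ∈ B)
    (hs : e ≠ s) : v ∈ A := h.swap.right_mem_of_left he hu hs

lemma r_inc (h : Frame F A B r s) {v : γ} (hv : F.Inc r v) : v ∈ A := by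
  obtain ⟨a, a', hl, ha, ha'⟩ := h.left
  rcases hv.eq_or_eq_of_isLink hl with rfl | rfl <;> assumption

lemma s_inc (h : Frame F A B r s) {v : γ} (hv : F.Inc s v) : v ∈ B := h.swap.r_inc hv

lemma ne (h : Frame F A B r s) : r ≠ s := by
  rintro rfl
  obtain ⟨a, a', hl, ha, ha'⟩ := h.left
  exact h.not_mem ha (h.s_inc hl.inc_left)

/-- A matching missing `u`, `v` and avoiding `r` stays inside `X` and pairs `X ∩ A` with `X ∩ B`,
since `s` has no end in `X`; so these have equal size. A matching missing `u` and some `b ∈ X ∩ B`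
instead sends `X ∩ A` into the smaller set `(X ∩ B) \ {b}`, because `v` lies in `A` and cannot serve
as a mate. -/
lemma not_separated_left {Ex : Set (Sym2 γ)} (h : Frame F A B r s) (hm : Matchable F A B r s Ex)
    {u v : γ} (hu : u ∈ A) (hv : v ∈ A) (huv : u ≠ v) (hE : s(u, v) ∉ Ex) {X : Set γ}
    (hXV : X ⊆ V(F)) (huX : u ∉ X) (hvX : v ∉ X)
    (hX : ∀ e x y, F.IsLink e x y → x ∈ X → y ∈ X ∨ y = u ∨ y = v)
    (hs : ∀ x, F.Inc s x → x ∉ X) : X = ∅ := by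
  by_contra hne
  have hfA : (X ∩ A).Finite := h.finite_left.subset Set.inter_subset_right
  have hfB : (X ∩ B).Finite := h.finite_right.subset Set.inter_subset_right
  obtain ⟨M, hM, hr⟩ := hm.left u hu v hv huv hE
  have hD : ∀ x ∈ X, x ∈ V(F) ∧ x ∉ ({u, v} : Set γ) := by
    intro x hx
    refine ⟨hXV hx, ?_⟩
    rintro (rfl | rfl)
    · exact huX hx
    · exact hvX hx
  have hstay : ∀ e ∈ M, ∀ x ∈ X, ∀ y, F.IsLink e x y → y ∈ X := by
    intro e he x hx y hxy
    have := hM.off e he y hxy.inc_right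
    simp only [Set.mem_insert_iff, Set.mem_singleton_iff, not_or] at this
    have := hX e x y hxy hx
    tauto
  have h1 : (X ∩ A).ncard ≤ (X ∩ B).ncard := hM.ncard_le hfB (fun x hx => hD x hx.1)
    fun e he x hx y hxy => ⟨hstay e he x hx.1 y hxy,
      h.right_mem_of_left hxy hx.2 (fun h => hr (h ▸ he))⟩
  have hB : (X ∩ B).Nonempty := by
    rw [← Set.ncard_pos hfB]
    obtain ⟨x, hx⟩ := Set.nonempty_iff_ne_empty.2 hne
    have hxV := hXV hx
    rw [← h.union] at hxV
    rcases hxV with hxA | hxB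
    · exact lt_of_lt_of_le ((Set.ncard_pos hfA).2 ⟨x, hx, hxA⟩) h1
    · exact (Set.ncard_pos hfB).2 ⟨x, hx, hxB⟩
  obtain ⟨b, hb⟩ := hB
  have h2 : (X ∩ B).ncard ≤ (X ∩ A).ncard := hM.ncard_le hfA (fun x hx => hD x hx.1)
    fun e he x hx y hxy => ⟨hstay e he x hx.1 y hxy,
      h.left_mem_of_right hxy hx.2 (by rintro rfl; exact hs x hxy.inc_left hx.1)⟩
  obtain ⟨M', hM', hr', hs'⟩ := hm.cross u hu b hb.2
  have h3 : (X ∩ A).ncard ≤ ((X ∩ B) \ {b}).ncard := by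
    refine hM'.ncard_le (hfB.subset Set.sdiff_subset) (fun x hx => ⟨hXV hx.1, ?_⟩) ?_
    · rintro (rfl | rfl)
      · exact huX hx.1
      · exact h.not_mem hx.2 hb.2
    · intro e he x hx y hxy
      have hyB := h.right_mem_of_left hxy hx.2 (fun h => hr' (h ▸ he))
      have hoff := hM'.off e he y hxy.inc_right
      simp only [Set.mem_insert_iff, Set.mem_singleton_iff, not_or] at hoff
      refine ⟨⟨?_, hyB⟩, hoff.2⟩
      rcases hX e x y hxy hx.1 with h' | rfl | rfl
      · exact h'
      · exact (hoff.1 rfl).elim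
      · exact (h.not_mem hv hyB).elim
  have h4 := Set.ncard_sdiff_singleton_add_one hb hfB
  omega

/-- Again `X ∩ A` and `X ∩ B` have equal size. Now a matching missing `u` and some `a ∈ X ∩ A` sends
`X ∩ B` into `(X ∩ A) \ {a}`, a contradiction. -/
lemma not_separated_cross {Ex : Set (Sym2 γ)} (h : Frame F A B r s) (hm : Matchable F A B r s Ex)
    (hEx : ∀ z ∈ Ex, False)
    {u v : γ} (hu : u ∈ A) (hv : v ∈ B) {X : Set γ}
    (hXV : X ⊆ V(F)) (huX : u ∉ X) (hvX : v ∉ X)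
    (hX : ∀ e x y, F.IsLink e x y → x ∈ X → y ∈ X ∨ y = u ∨ y = v)
    (hs : ∀ x, F.Inc s x → x ∉ X) : X = ∅ := by
  by_contra hne
  have hfA : (X ∩ A).Finite := h.finite_left.subset Set.inter_subset_right
  have hfB : (X ∩ B).Finite := h.finite_right.subset Set.inter_subset_right
  obtain ⟨M, hM, hrM, hsM⟩ := hm.cross u hu v hv
  have hD : ∀ x ∈ X, x ∈ V(F) ∧ x ∉ ({u, v} : Set γ) := by
    intro x hx
    refine ⟨hXV hx, ?_⟩
    rintro (rfl | rfl)
    · exact huX hx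
    · exact hvX hx
  have hstay : ∀ e ∈ M, ∀ x ∈ X, ∀ y, F.IsLink e x y → y ∈ X := by
    intro e he x hx y hxy
    have := hM.off e he y hxy.inc_right
    simp only [Set.mem_insert_iff, Set.mem_singleton_iff, not_or] at this
    have := hX e x y hxy hx
    tauto
  have h1 : (X ∩ A).ncard ≤ (X ∩ B).ncard := hM.ncard_le hfB (fun x hx => hD x hx.1)
    fun e he x hx y hxy => ⟨hstay e he x hx.1 y hxy,
      h.right_mem_of_left hxy hx.2 (fun h => hrM (h ▸ he))⟩
  have h2 : (X ∩ B).ncard ≤ (X ∩ A).ncard := hM.ncard_le hfA (fun x hx => hD x hx.1)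
    fun e he x hx y hxy => ⟨hstay e he x hx.1 y hxy,
      h.left_mem_of_right hxy hx.2 (fun h => hsM (h ▸ he))⟩
  have hA : (X ∩ A).Nonempty := by
    rw [← Set.ncard_pos hfA]
    obtain ⟨x, hx⟩ := Set.nonempty_iff_ne_empty.2 hne
    have hxV := hXV hx
    rw [← h.union] at hxV
    rcases hxV with hxA | hxB
    · exact (Set.ncard_pos hfA).2 ⟨x, hx, hxA⟩
    · exact lt_of_lt_of_le ((Set.ncard_pos hfB).2 ⟨x, hx, hxB⟩) h2
  obtain ⟨a, ha⟩ := hA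
  obtain ⟨M', hM', hr'⟩ := hm.left u hu a ha.2 (by rintro rfl; exact huX ha.1) (fun h => hEx _ h)
  have h3 : (X ∩ B).ncard ≤ ((X ∩ A) \ {a}).ncard := by
    refine hM'.ncard_le (hfA.subset Set.sdiff_subset) (fun x hx => ⟨hXV hx.1, ?_⟩) ?_
    · rintro (rfl | rfl)
      · exact huX hx.1
      · exact h.not_mem ha.2 hx.2
    · intro e he x hx y hxy
      have hyA := h.left_mem_of_right hxy hx.2 (by rintro rfl; exact hs x hxy.inc_left hx.1)
      have hoff := hM'.off e he y hxy.inc_right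
      simp only [Set.mem_insert_iff, Set.mem_singleton_iff, not_or] at hoff
      refine ⟨⟨?_, hyA⟩, hoff.2⟩
      rcases hX e x y hxy hx.1 with h' | rfl | rfl
      · exact h'
      · exact (hoff.1 rfl).elim
      · exact (h.not_mem hyA hv).elim
  have h4 := Set.ncard_sdiff_singleton_add_one ha hfA
  omega

/-- `S` separates the graph into two nonempty parts. -/
def Sep (F : Graph γ β) (S : Set γ) : Prop :=
  ∃ X Y : Set γ, X.Nonempty ∧ Y.Nonempty ∧ Disjoint X Y ∧ X ∪ Y = V(F) \ S ∧
    ∀ e x y, F.IsLink e x y → x ∈ X → y ∉ Y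

/-- Move a vertex from a part with at least two vertices into the separator. Hence only separators
of size two need to be excluded. -/
lemma Sep.exists_insert {S : Set γ} (hF : V(F).Finite) (hS : S ⊆ V(F)) (h : Sep F S)
    (hcard : S.ncard + 3 ≤ V(F).ncard) : ∃ v ∈ V(F), v ∉ S ∧ Sep F (insert v S) := by
  obtain ⟨X, Y, hX, hY, hd, hu, hl⟩ := h
  have hfX : X.Finite := hF.subset fun x hx => (hu.subset (Or.inl hx) : x ∈ V(F) \ S).1
  have hfY : Y.Finite := hF.subset fun x hx => (hu.subset (Or.inr hx) : x ∈ V(F) \ S).1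
  have hc : X.ncard + Y.ncard + S.ncard = V(F).ncard := by
    rw [← Set.ncard_union_eq hd hfX hfY, hu, Set.ncard_sdiff_add_ncard_of_subset hS hF]
  have aux : ∀ X Y : Set γ, Y.Nonempty → Disjoint X Y → X ∪ Y = V(F) \ S →
      (∀ e x y, F.IsLink e x y → x ∈ X → y ∉ Y) → 2 ≤ X.ncard →
      ∃ v ∈ V(F), v ∉ S ∧ Sep F (insert v S) := by
    intro X Y hY hd hu hl h2
    have hfX : X.Finite := hF.subset fun x hx => (hu.subset (Or.inl hx) : x ∈ V(F) \ S).1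
    obtain ⟨v, hv⟩ := (Set.ncard_pos hfX).1 (by omega)
    have hvS : v ∈ V(F) \ S := hu.subset (Or.inl hv)
    refine ⟨v, hvS.1, hvS.2, X \ {v}, Y, ?_, hY, hd.mono_left Set.sdiff_subset, ?_, ?_⟩
    · rw [← Set.ncard_pos (hfX.subset Set.sdiff_subset)]
      have := Set.ncard_sdiff_singleton_add_one hv hfX
      omega
    · ext x
      have h1 := Set.ext_iff.1 hu x
      have h2 : x ∈ X → x ∉ Y := fun h => Set.disjoint_left.1 hd h
      simp only [Set.mem_union, Set.mem_sdiff, Set.mem_singleton_iff, Set.mem_insert_iff] at h1 ⊢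
      by_cases hxv : x = v
      · subst hxv
        simp [h2 hv]
      · tauto
    · exact fun e x y he hx => hl e x y he hx.1
  by_cases h2 : 2 ≤ X.ncard
  · exact aux X Y hY hd hu hl h2
  · exact aux Y X hX hd.symm (by rw [Set.union_comm, hu])
      (fun e x y he hx hy => hl e y x he.symm hy hx) (by omega)

/-- No edge joins the two parts, so one of them contains no end of a given edge of `R`. That part is
empty by the preceding counts, applied with `s` if `u` lies in `A` and with `r` otherwise. -/
lemma not_sep_pair (h : Frame F A B r s) (hm : Matchable F A B r s ∅) {u v : γ} (hu : u ∈ V(F))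
    (hv : v ∈ V(F)) (huv : u ≠ v) : ¬ Sep F {u, v} := by
  rintro ⟨X, Y, hX, hY, hd, hun, hl⟩
  have hXs : ∀ x ∈ X, x ∈ V(F) ∧ x ≠ u ∧ x ≠ v := by
    intro x hx
    have : x ∈ V(F) \ {u, v} := hun.subset (Or.inl hx)
    simpa using this
  have hYs : ∀ x ∈ Y, x ∈ V(F) ∧ x ≠ u ∧ x ≠ v := by
    intro x hx
    have : x ∈ V(F) \ {u, v} := hun.subset (Or.inr hx)
    simpa using this
  have hmem : ∀ x ∈ V(F), x ∈ X ∨ x ∈ Y ∨ x = u ∨ x = v := by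
    intro x hx
    by_cases hxD : x = u ∨ x = v
    · tauto
    · have : x ∈ X ∪ Y := by rw [hun]; simpa using ⟨hx, by tauto⟩
      rcases this with h | h <;> tauto
  have hXl : ∀ e x y, F.IsLink e x y → x ∈ X → y ∈ X ∨ y = u ∨ y = v := by
    intro e x y he hx
    have := hmem y he.right_mem
    have := hl e x y he hx
    tauto
  have hYl : ∀ e x y, F.IsLink e x y → x ∈ Y → y ∈ Y ∨ y = u ∨ y = v := by
    intro e x y he hx
    have := hmem y he.right_mem
    have : y ∉ X := fun hy => hl e y x he.symm hy hx
    tauto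
  have hends : ∀ {f : β}, (∃ a b, F.IsLink f a b) → (∀ x, F.Inc f x → x ∉ X) ∨
      (∀ x, F.Inc f x → x ∉ Y) := by
    rintro f ⟨a, b, hf⟩
    by_contra! hcon
    obtain ⟨⟨x, hx, hxX⟩, y, hy, hyY⟩ := hcon
    have hxy : x ≠ y := by rintro rfl; exact Set.disjoint_left.1 hd hxX hyY
    rcases hx.eq_or_eq_of_isLink hf with rfl | rfl <;> rcases hy.eq_or_eq_of_isLink hf with rfl | rfl
    · exact hxy rfl
    · exact hl f _ _ hf hxX hyY
    · exact hl f _ _ hf.symm hxX hyY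
    · exact hxy rfl
  have hrE : ∃ a b, F.IsLink r a b := by obtain ⟨a, b, h, -⟩ := h.left; exact ⟨a, b, h⟩
  have hsE : ∃ a b, F.IsLink s a b := by obtain ⟨a, b, h, -⟩ := h.right; exact ⟨a, b, h⟩
  have hEx : ∀ z ∈ (∅ : Set (Sym2 γ)), False := fun z hz => hz
  have hXV : X ⊆ V(F) := fun x hx => (hXs x hx).1
  have hYV : Y ⊆ V(F) := fun x hx => (hYs x hx).1
  have huX : u ∉ X := fun h => (hXs u h).2.1 rfl
  have hvX : v ∉ X := fun h => (hXs v h).2.2 rfl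
  have huY : u ∉ Y := fun h => (hYs u h).2.1 rfl
  have hvY : v ∉ Y := fun h => (hYs v h).2.2 rfl
  rw [← h.union] at hu hv
  rcases hu with hu | hu <;> rcases hv with hv | hv
  · rcases hends hsE with hs | hs
    · exact hX.ne_empty (h.not_separated_left hm hu hv huv (hEx _) hXV huX hvX hXl hs)
    · exact hY.ne_empty (h.not_separated_left hm hu hv huv (hEx _) hYV huY hvY hYl hs)
  · rcases hends hsE with hs | hs
    · exact hX.ne_empty (h.not_separated_cross hm hEx hu hv hXV huX hvX hXl hs)
    · exact hY.ne_empty (h.not_separated_cross hm hEx hu hv hYV huY hvY hYl hs)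
  · rcases hends hrE with hs | hs
    · exact hX.ne_empty (h.swap.not_separated_cross hm.swap hEx hu hv hXV huX hvX hXl hs)
    · exact hY.ne_empty (h.swap.not_separated_cross hm.swap hEx hu hv hYV huY hvY hYl hs)
  · rcases hends hrE with hs | hs
    · exact hX.ne_empty (h.swap.not_separated_left hm.swap hu hv huv (hEx _) hXV huX hvX hXl hs)
    · exact hY.ne_empty (h.swap.not_separated_left hm.swap hu hv huv (hEx _) hYV huY hvY hYl hs)

/-- A graph which is bipartite up to two edges is a brick if it has the perfect matchings required
by bicriticality. -/
theorem isBrick (h : Frame F A B r s) (hm : Matchable F A B r s ∅) (h4 : 4 ≤ V(F).ncard) :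
    IsBrick F := by
  refine ⟨h.loopless, h4, fun S hS hS2 => ?_, fun u hu v hv huv => ?_⟩
  · have nosep2 : ∀ S ⊆ V(F), S.ncard = 2 → ¬ Sep F S := by
      intro S hS h2 hsep
      obtain ⟨u, v, huv, rfl⟩ := Set.ncard_eq_two.1 h2
      exact h.not_sep_pair hm (hS (by simp)) (hS (by simp)) huv hsep
    have nosep1 : ∀ S ⊆ V(F), S.ncard = 1 → ¬ Sep F S := by
      intro S hS h1 hsep
      obtain ⟨v, hv, hvS, hsep'⟩ := hsep.exists_insert h.finite hS (by omega)
      exact nosep2 _ (Set.insert_subset hv hS)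
        (by rw [Set.ncard_insert_of_notMem hvS (h.finite.subset hS), h1]) hsep'
    have nosep : ¬ Sep F S := by
      intro hsep
      have : S.ncard = 0 ∨ S.ncard = 1 ∨ S.ncard = 2 := by omega
      rcases this with h0 | h1 | h2
      · obtain ⟨v, hv, hvS, hsep'⟩ := hsep.exists_insert h.finite hS (by omega)
        exact nosep1 _ (Set.insert_subset hv hS)
          (by rw [Set.ncard_insert_of_notMem hvS (h.finite.subset hS), h0]) hsep'
      · exact nosep1 S hS h1 hsep
      · exact nosep2 S hS h2 hsep
    have hne : (V(F) \ S).Nonempty := by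
      rw [← Set.ncard_pos (h.finite.subset Set.sdiff_subset)]
      have := Set.ncard_sdiff_add_ncard_of_subset hS h.finite
      omega
    refine isConnected_of_forall (by simpa using hne) fun X hX hXne hcl => ?_
    rw [Graph.vertexSet_deleteVerts] at hX ⊢
    by_contra hnot
    obtain ⟨y, hy, hyX⟩ := Set.not_subset.1 hnot
    refine nosep ⟨X, (V(F) \ S) \ X, hXne, ⟨y, hy, hyX⟩, Set.disjoint_sdiff_right,
      Set.union_sdiff_cancel hX, ?_⟩
    rintro e x z he hx ⟨hz, hzX⟩
    exact hzX (hcl x z ⟨e, (Graph.deleteVerts_isLink ..).2 ⟨he, (hX hx).2, hz.2⟩⟩ hx)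
  · have hEx : ∀ z, z ∉ (∅ : Set (Sym2 γ)) := fun z hz => hz
    rw [← h.union] at hu hv
    simp only [pmOff_iff]
    rcases hu with hu | hu <;> rcases hv with hv | hv
    · obtain ⟨M, hM, -⟩ := hm.left u hu v hv huv (hEx _)
      exact ⟨M, hM⟩
    · obtain ⟨M, hM, -⟩ := hm.cross u hu v hv
      exact ⟨M, hM⟩
    · obtain ⟨M, hM, -⟩ := hm.cross v hv u hu
      exact ⟨M, by rwa [Set.pair_comm]⟩
    · obtain ⟨M, hM, -⟩ := hm.right u hu v hv huv (hEx _)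
      exact ⟨M, hM⟩

end Frame
end RBrick

/-! ### Connectedness and matching coveredness from prescribed matchings -/

namespace RBrick

section Basic

variable {γ β : Type*} {F : Graph γ β}

lemma PMOff.deleteEdges {D : Set γ} {M C : Set β} (h : PMOff F D M) (hd : ∀ e ∈ M, e ∉ C) :
    PMOff (F.deleteEdges C) D M := by
  refine ⟨fun e he => ⟨h.subset he, hd e he⟩, fun e he v hv => ?_, fun v hv hvD => ?_⟩
  · rw [Graph.deleteEdges_inc] at hv
    exact h.off e he v hv.1
  · obtain ⟨e, ⟨he, hi⟩, hu⟩ := h.cover v hv hvD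
    refine ⟨e, ⟨he, Graph.deleteEdges_inc.2 ⟨hi, hd e he⟩⟩, fun e' he' => hu e' ⟨he'.1, ?_⟩⟩
    exact (Graph.deleteEdges_inc.1 he'.2).1

lemma loopless_deleteEdges (h : F.Loopless) (C : Set β) : (F.deleteEdges C).Loopless :=
  h.anti Graph.deleteEdges_le

end Basic

namespace Frame

variable {γ β : Type*} {F : Graph γ β} {A B : Set γ} {r s : β} {Ex : Set (Sym2 γ)}

lemma two_le_left (h : Frame F A B r s) : 2 ≤ A.ncard := by
  obtain ⟨a, a', hl, ha, ha'⟩ := h.left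
  have := h.loopless
  exact (Set.one_lt_ncard_iff h.finite_left).2 ⟨a, a', ha, ha', hl.ne⟩

lemma two_le_right (h : Frame F A B r s) : 2 ≤ B.ncard := h.swap.two_le_left

/-- For a union `X` of components, a matching missing `a` and `b` gives `X ∩ A` without `a` and `X ∩
B` without `b` the same size. Varying `a` shows that `X` contains all of `A` or nothing of it, and
likewise for `B`; as each class has two vertices, `X` cannot contain just one of the classes. -/
lemma isConnected_deleteEdges (h : Frame F A B r s) (hm : Matchable F A B r s Ex) :
    IsConnected (F.deleteEdges {r, s}) := by
  have hAne : A.Nonempty := by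
    rw [← Set.ncard_pos h.finite_left]; have := h.two_le_left; omega
  have hBne : B.Nonempty := by
    rw [← Set.ncard_pos h.finite_right]; have := h.two_le_right; omega
  refine isConnected_of_forall ?_ fun X hX hXne hcl => ?_
  · obtain ⟨a, ha⟩ := hAne
    exact ⟨a, h.memV_left ha⟩
  replace hX : X ⊆ V(F) := hX
  show V(F) ⊆ X
  have hfA : (X ∩ A).Finite := h.finite_left.subset Set.inter_subset_right
  have hfB : (X ∩ B).Finite := h.finite_right.subset Set.inter_subset_right
  have key : ∀ a ∈ A, ∀ b ∈ B, ((X ∩ A) \ {a}).ncard = ((X ∩ B) \ {b}).ncard := by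
    intro a ha b hb
    obtain ⟨M, hM, hr, hs⟩ := hm.cross a ha b hb
    have hstay : ∀ e ∈ M, ∀ x ∈ X, ∀ y, F.IsLink e x y → y ∈ X := fun e he x hx y hxy =>
      hcl x y ⟨e, by
        rw [Graph.deleteEdges_isLink]
        exact ⟨hxy, by rintro (rfl | rfl) <;> contradiction⟩⟩ hx
    apply le_antisymm
    · refine hM.ncard_le (hfB.subset Set.sdiff_subset) (fun x hx => ⟨hX hx.1.1, ?_⟩) ?_
      · rintro (rfl | rfl)
        · exact hx.2 rfl
        · exact h.not_mem hx.1.2 hb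
      · intro e he x hx y hxy
        have hyB := h.right_mem_of_left hxy hx.1.2 (fun h => hr (h ▸ he))
        have hoff := hM.off e he y hxy.inc_right
        simp only [Set.mem_insert_iff, Set.mem_singleton_iff, not_or] at hoff
        exact ⟨⟨hstay e he x hx.1.1 y hxy, hyB⟩, hoff.2⟩
    · refine hM.ncard_le (hfA.subset Set.sdiff_subset) (fun x hx => ⟨hX hx.1.1, ?_⟩) ?_
      · rintro (rfl | rfl)
        · exact h.not_mem ha hx.1.2
        · exact hx.2 rfl
      · intro e he x hx y hxy
        have hyA := h.left_mem_of_right hxy hx.1.2 (fun h => hs (h ▸ he))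
        have hoff := hM.off e he y hxy.inc_right
        simp only [Set.mem_insert_iff, Set.mem_singleton_iff, not_or] at hoff
        exact ⟨⟨hstay e he x hx.1.1 y hxy, hyA⟩, hoff.1⟩
  have inA : ∀ a ∈ A, a ∈ X → A ⊆ X := by
    intro a ha haX a' ha'
    by_contra ha'X
    obtain ⟨b, hb⟩ := hBne
    have h1 := key a ha b hb
    have h2 := key a' ha' b hb
    have h3 := Set.ncard_sdiff_singleton_add_one (show a ∈ X ∩ A from ⟨haX, ha⟩) hfA
    rw [Set.sdiff_singleton_eq_self (a := a') (fun h' => ha'X h'.1)] at h2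
    omega
  have inB : ∀ b ∈ B, b ∈ X → B ⊆ X := by
    intro b hb hbX b' hb'
    by_contra hb'X
    obtain ⟨a, ha⟩ := hAne
    have h1 := key a ha b hb
    have h2 := key a ha b' hb'
    have h3 := Set.ncard_sdiff_singleton_add_one (show b ∈ X ∩ B from ⟨hbX, hb⟩) hfB
    rw [Set.sdiff_singleton_eq_self (a := b') (fun h' => hb'X h'.1)] at h2
    omega
  obtain ⟨a, ha⟩ := hAne
  obtain ⟨b, hb⟩ := hBne
  have hk := key a ha b hb
  have h2A := h.two_le_left
  have h2B := h.two_le_right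
  by_cases haX : a ∈ X
  · have hAX := inA a ha haX
    rw [Set.inter_eq_self_of_subset_right hAX] at hk hfA
    have h3 := Set.ncard_sdiff_singleton_add_one ha hfA
    have : ((X ∩ B) \ {b}).Nonempty := by
      rw [← Set.ncard_pos (hfB.subset Set.sdiff_subset)]; omega
    obtain ⟨b', hb'⟩ := this
    rw [← h.union]
    exact Set.union_subset hAX (inB b' hb'.1.2 hb'.1.1)
  · by_cases hbX : b ∈ X
    · have hBX := inB b hb hbX
      rw [Set.inter_eq_self_of_subset_right hBX] at hk hfB
      have h3 := Set.ncard_sdiff_singleton_add_one hb hfB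
      have : ((X ∩ A) \ {a}).Nonempty := by
        rw [← Set.ncard_pos (hfA.subset Set.sdiff_subset)]; omega
      obtain ⟨a', ha'⟩ := this
      rw [← h.union]
      exact Set.union_subset (inA a' ha'.1.2 ha'.1.1) hBX
    · obtain ⟨x, hx⟩ := hXne
      have := hX hx
      rw [← h.union] at this
      rcases this with hxA | hxB
      · exact (haX (inA x hxA hx ha)).elim
      · exact (hbX (inB x hxB hx hb)).elim

lemma isConnected (h : Frame F A B r s) (hm : Matchable F A B r s Ex) : IsConnected F := by
  have hc := h.isConnected_deleteEdges hm
  obtain ⟨a, _, hl, -⟩ := h.left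
  refine isConnected_of_forall ⟨a, hl.left_mem⟩ fun X hX hXne hcl => ?_
  obtain ⟨x, hx⟩ := hXne
  exact hc.subset_of_closed (x := x) (hX hx) hx fun u v ⟨e, he⟩ => hcl u v ⟨e, he.1⟩

lemma two_le_ncard (h : Frame F A B r s) : 2 ≤ V(F).ncard := by
  refine h.two_le_left.trans (Set.ncard_le_ncard ?_ h.finite)
  rw [← h.union]; exact Set.subset_union_left

lemma matchingCovered_deleteEdges (h : Frame F A B r s) (hm : Matchable F A B r s Ex) :
    IsMatchingCovered (F.deleteEdges {r, s}) := by
  refine ⟨loopless_deleteEdges h.loopless _, h.two_le_ncard, h.isConnected_deleteEdges hm, ?_⟩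
  rintro e ⟨heF, he⟩
  simp only [Set.mem_insert_iff, Set.mem_singleton_iff, not_or] at he
  obtain ⟨x, y, hxy⟩ := Graph.exists_isLink_of_mem_edgeSet heF
  wlog hx : x ∈ A generalizing x y
  · rcases h.link e x y hxy he.1 he.2 with h' | h'
    · exact this x y hxy h'.1
    · exact this y x hxy.symm h'.2
  have hy := h.right_mem_of_left hxy hx he.1
  obtain ⟨M, hM, hr, hs⟩ := hm.cross x hx y hy
  refine ⟨_, (hM.deleteEdges (C := {r, s}) ?_).insert (e := e) ?_, Set.mem_insert _ _⟩
  · rintro f hf (rfl | rfl) <;> contradiction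
  · rw [Graph.deleteEdges_isLink]
    simpa using ⟨hxy, he⟩

/-- Match everything but the ends of an edge, then add the edge. Only `r` and `s` have both ends in
one class, so only their ends must avoid `Ex`. -/
lemma matchingCovered (h : Frame F A B r s) (hm : Matchable F A B r s Ex)
    (hr : ∀ a a', F.IsLink r a a' → s(a, a') ∉ Ex) (hs : ∀ a a', F.IsLink s a a' → s(a, a') ∉ Ex) :
    IsMatchingCovered F := by
  refine ⟨h.loopless, h.two_le_ncard, h.isConnected hm, fun e heF => ?_⟩
  obtain ⟨x, y, hxy⟩ := Graph.exists_isLink_of_mem_edgeSet heF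
  have hloop := h.loopless
  by_cases her : e = r
  · subst her
    obtain ⟨M, hM, -⟩ := hm.left x (h.r_inc hxy.inc_left) y (h.r_inc hxy.inc_right) hxy.ne (hr x y hxy)
    exact ⟨_, hM.insert hxy, Set.mem_insert _ _⟩
  by_cases hes : e = s
  · subst hes
    obtain ⟨M, hM, -⟩ :=
      hm.right x (h.s_inc hxy.inc_left) y (h.s_inc hxy.inc_right) hxy.ne (hs x y hxy)
    exact ⟨_, hM.insert hxy, Set.mem_insert _ _⟩
  wlog hx : x ∈ A generalizing x y
  · rcases h.link e x y hxy her hes with h' | h'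
    · exact this x y hxy h'.1
    · exact this y x hxy.symm h'.2
  obtain ⟨M, hM, -⟩ := hm.cross x hx y (h.right_mem_of_left hxy hx her)
  exact ⟨_, hM.insert hxy, Set.mem_insert _ _⟩

end Frame

/-! ### Bicontraction of a vertex of degree two -/

/-- The vertex `v` is incident with precisely the edges `g₁` and `g₂`, whose other ends `v₁` and `v₂`
are distinct and nonadjacent; `π` identifies the three vertices `v`, `v₁`, `v₂` and no others. -/
structure Bicontraction {γ δ β : Type*} (F : Graph γ β) (π : γ → δ) (v v₁ v₂ : γ) (g₁ g₂ : β) :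
    Prop where
  link₁ : F.IsLink g₁ v v₁
  link₂ : F.IsLink g₂ v v₂
  inc : ∀ e, F.Inc e v → e = g₁ ∨ e = g₂
  ne : v₁ ≠ v₂
  not_link : ∀ e, ¬ F.IsLink e v₁ v₂
  ker : ∀ x ∈ V(F), ∀ y ∈ V(F),
    π x = π y ↔ x = y ∨ (x = v ∨ x = v₁ ∨ x = v₂) ∧ (y = v ∨ y = v₁ ∨ y = v₂)

namespace Bicontraction

variable {γ δ β : Type*} {F : Graph γ β} {π : γ → δ} {v v₁ v₂ : γ} {g₁ g₂ : β}
  {A B : Set γ} {r s : β} {Ex : Set (Sym2 γ)}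

lemma symm (h : Bicontraction F π v v₁ v₂ g₁ g₂) : Bicontraction F π v v₂ v₁ g₂ g₁ :=
  ⟨h.link₂, h.link₁, fun e he => (h.inc e he).symm, h.ne.symm, fun e he => h.not_link e he.symm,
    fun x hx y hy => by
      rw [h.ker x hx y hy]
      tauto⟩

lemma edge_ne (h : Bicontraction F π v v₁ v₂ g₁ g₂) : g₁ ≠ g₂ := by
  rintro rfl
  exact h.ne (h.link₁.right_unique h.link₂)

lemma map_left (h : Bicontraction F π v v₁ v₂ g₁ g₂) : π v₁ = π v :=
  (h.ker _ h.link₁.right_mem _ h.link₁.left_mem).2 (by simp)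

lemma map_right (h : Bicontraction F π v v₁ v₂ g₁ g₂) : π v₂ = π v := h.symm.map_left

lemma ne_of_inc (h : Bicontraction F π v v₁ v₂ g₁ g₂) {e : β} {x : γ} (he : F.Inc e x)
    (h₁ : e ≠ g₁) (h₂ : e ≠ g₂) : x ≠ v := by
  rintro rfl
  rcases h.inc e he with h | h <;> contradiction

lemma loopless (h : Bicontraction F π v v₁ v₂ g₁ g₂) (hF : F.Loopless) :
    ((F.deleteEdges {g₁, g₂}).map π).Loopless := by
  refine ⟨fun e z => ?_⟩
  rintro ⟨x, y, hxy, hx, hy⟩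
  rw [Graph.deleteEdges_isLink] at hxy
  obtain ⟨hxy, he⟩ := hxy
  simp only [Set.mem_insert_iff, Set.mem_singleton_iff, not_or] at he
  have hne := hxy.ne
  have hx' := h.ne_of_inc hxy.inc_left he.1 he.2
  have hy' := h.ne_of_inc hxy.inc_right he.1 he.2
  rcases (h.ker x hxy.left_mem y hxy.right_mem).1 (hx.trans hy.symm) with h' | ⟨h1, h2⟩
  · exact hne h'
  · rcases h1 with h1 | h1 | h1 <;> rcases h2 with h2 | h2 | h2 <;> subst h1 <;> subst h2 <;>
      first
        | exact hx' rfl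
        | exact hy' rfl
        | exact hne rfl
        | exact h.not_link e hxy
        | exact h.not_link e hxy.symm

/-- The matching covers `v` by exactly one of `g₁`, `g₂`, say `g₁`. Once this edge is contracted,
`v₂` alone stands for the merged vertex: it is either covered by an edge that survives or is one of
the deleted vertices. -/
lemma pmOff (h : Bicontraction F π v v₁ v₂ g₁ g₂) (hF : F.Loopless) {a b : γ} {M : Set β}
    (hM : PMOff F {a, b} M) (haV : a ∈ V(F)) (hbV : b ∈ V(F)) (ha : a ≠ v) (hb : b ≠ v)
    (hab : π a ≠ π b) :
    PMOff ((F.deleteEdges {g₁, g₂}).map π) {π a, π b} (M \ {g₁, g₂}) := by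
  have hv₁ : v ≠ v₁ := h.link₁.ne
  have hv₂ : v ≠ v₂ := h.link₂.ne
  have hvD : v ∉ ({a, b} : Set γ) := by
    rintro (rfl | rfl)
    · exact ha rfl
    · exact hb rfl
  obtain ⟨g, ⟨hgM, hg⟩, -⟩ := hM.cover v h.link₁.left_mem hvD
  -- the vertices of the triple which are covered by the matching
  wlog hg1 : g = g₁ generalizing v₁ v₂ g₁ g₂
  · have := this h.symm hv₂ hv₁ ((h.inc g hg).resolve_left hg1)
    rwa [Set.pair_comm g₂ g₁] at this
  subst hg1
  have hv1D : v₁ ∉ ({a, b} : Set γ) := hM.off g hgM _ h.link₁.inc_right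
  have hg2 : g₂ ∉ M := fun hg2 => h.edge_ne (hM.eq hgM hg2 hg h.link₂.inc_left)
  have haoff : ∀ x ∈ V(F), ∀ c ∈ ({a, b} : Set γ), π x = π c → x ≠ v → x ≠ v₁ → x = c := by
    intro x hx c hc hxc hxv hx1
    have hcV : c ∈ V(F) := by rcases hc with rfl | rfl <;> assumption
    rcases (h.ker x hx c hcV).1 hxc with h' | ⟨h1, h2⟩
    · exact h'
    · rcases h2 with rfl | rfl | rfl
      · exact (hvD hc).elim
      · exact (hv1D hc).elim
      · tauto
  have hnot : ∀ e ∈ M, e ≠ g → ∀ x, F.Inc e x → x ≠ v ∧ x ≠ v₁ := by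
    intro e he heg x hx
    constructor
    · rintro rfl
      exact heg (hM.eq he hgM hx hg)
    · rintro rfl
      exact heg (hM.eq he hgM hx h.link₁.inc_right)
  refine ⟨fun e he => ⟨hM.subset he.1, he.2⟩, ?_, ?_⟩
  · rintro e ⟨he, heg⟩ z hz
    simp only [Set.mem_insert_iff, Set.mem_singleton_iff, not_or] at heg
    rw [Graph.map_inc] at hz
    obtain ⟨x, hx, rfl⟩ := hz
    have hx := (Graph.deleteEdges_inc.1 hx).1
    have h' := hnot e he heg.1 x hx
    rintro (hxa | hxa)
    · have := haoff x hx.vertex_mem a (by simp) hxa h'.1 h'.2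
      exact hM.off e he x hx (by simp [this])
    · have := haoff x hx.vertex_mem b (by simp) hxa h'.1 h'.2
      exact hM.off e he x hx (by simp [this])
  · rintro z ⟨x, hxV, rfl⟩ hzD
    replace hxV : x ∈ V(F) := hxV
    -- `y` is the vertex with the same image that is not matched by `g`
    obtain ⟨y, hyV, hyx, hyv, hy1, huniq⟩ : ∃ y ∈ V(F), π y = π x ∧ y ≠ v ∧ y ≠ v₁ ∧
        ∀ y' ∈ V(F), π y' = π x → y' ≠ v → y' ≠ v₁ → y' = y := by
      by_cases hx3 : x = v ∨ x = v₁ ∨ x = v₂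
      · refine ⟨v₂, h.link₂.right_mem, ?_, hv₂.symm, h.ne.symm, ?_⟩
        · exact (h.ker _ h.link₂.right_mem _ hxV).2 (by tauto)
        · intro y' hy' heq h1 h2
          rcases (h.ker _ hy' _ hxV).1 heq with rfl | ⟨h3, -⟩ <;> tauto
      · refine ⟨x, hxV, rfl, by tauto, by tauto, fun y' hy' heq h1 h2 => ?_⟩
        rcases (h.ker _ hy' _ hxV).1 heq with rfl | ⟨h3, h4⟩ <;> tauto
    have hyD : y ∉ ({a, b} : Set γ) := by
      rintro (rfl | rfl)
      · exact hzD (by simp [← hyx])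
      · exact hzD (by simp [← hyx])
    obtain ⟨e, ⟨heM, he⟩, hu⟩ := hM.cover y hyV hyD
    have heg : e ≠ g := by
      rintro rfl
      rcases he.eq_or_eq_of_isLink h.link₁ with rfl | rfl
      · exact hyv rfl
      · exact hy1 rfl
    have he2 : e ≠ g₂ := by rintro rfl; exact hg2 heM
    have hmem : e ∉ ({g, g₂} : Set β) := by
      rintro (h' | h') <;> contradiction
    refine ⟨e, ⟨⟨heM, hmem⟩, ?_⟩, ?_⟩
    · rw [Graph.map_inc]
      exact ⟨y, Graph.deleteEdges_inc.2 ⟨he, hmem⟩, hyx.symm⟩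
    · rintro e' ⟨⟨he'M, he'⟩, hi⟩
      rw [Graph.map_inc] at hi
      obtain ⟨y', hi', hy'⟩ := hi
      have hi' := (Graph.deleteEdges_inc.1 hi').1
      simp only [Set.mem_insert_iff, Set.mem_singleton_iff, not_or] at he'
      have h' := hnot e' he'M he'.1 y' hi'
      obtain rfl := huniq y' hi'.vertex_mem hy'.symm h'.1 h'.2
      exact hu e' ⟨he'M, hi'⟩

lemma edge_ne_frame (h : Bicontraction F π v v₁ v₂ g₁ g₂) (hf : Frame F A B r s) (hv : v ∈ A)
    (hv₁ : v₁ ∈ B) (hv₂ : v₂ ∈ B) :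
    (r ∉ ({g₁, g₂} : Set β)) ∧ s ∉ ({g₁, g₂} : Set β) := by
  constructor
  · rintro (rfl | rfl)
    · exact hf.not_mem (hf.r_inc h.link₁.inc_right) hv₁
    · exact hf.not_mem (hf.r_inc h.link₂.inc_right) hv₂
  · rintro (rfl | rfl)
    · exact hf.not_mem hv (hf.s_inc h.link₁.inc_left)
    · exact hf.not_mem hv (hf.s_inc h.link₂.inc_left)

/-- The merged vertex counts as a vertex of `B`: it replaces `v₁` and `v₂`, while `A` merely loses
`v`. -/
lemma frame (h : Bicontraction F π v v₁ v₂ g₁ g₂) (hf : Frame F A B r s) (hv : v ∈ A)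
    (hv₁ : v₁ ∈ B) (hv₂ : v₂ ∈ B) :
    Frame ((F.deleteEdges {g₁, g₂}).map π) (π '' (A \ {v})) (π '' B) r s := by
  obtain ⟨hr, hs⟩ := h.edge_ne_frame hf hv hv₁ hv₂
  refine ⟨hf.finite.image π, h.loopless hf.loopless, ?_, ?_, ?_, ?_, ?_⟩
  · rw [Set.disjoint_left]
    rintro _ ⟨x, ⟨hx, hxv⟩, rfl⟩ ⟨y, hy, hyx⟩
    rcases (h.ker y (hf.memV_right hy) x (hf.memV_left hx)).1 hyx with rfl | ⟨-, h1⟩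
    · exact hf.not_mem hx hy
    · rcases h1 with h1 | rfl | rfl
      · exact hxv h1
      · exact hf.not_mem hx hv₁
      · exact hf.not_mem hx hv₂
  · show _ = π '' V(F)
    rw [← hf.union, Set.image_union]
    ext z
    constructor
    · rintro (⟨x, hx, rfl⟩ | hz)
      · exact Or.inl ⟨x, hx.1, rfl⟩
      · exact Or.inr hz
    · rintro (⟨x, hx, rfl⟩ | hz)
      · by_cases hxv : x = v
        · exact Or.inr ⟨v₁, hv₁, by rw [h.map_left, hxv]⟩
        · exact Or.inl ⟨x, ⟨hx, hxv⟩, rfl⟩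
      · exact Or.inr hz
  · obtain ⟨a, a', hl, ha, ha'⟩ := hf.left
    have hr' : r ≠ g₁ ∧ r ≠ g₂ := by simpa using hr
    refine ⟨π a, π a', ⟨a, a', ⟨hl, hr⟩, rfl, rfl⟩, ?_, ?_⟩
    · exact ⟨a, ⟨ha, h.ne_of_inc hl.inc_left hr'.1 hr'.2⟩, rfl⟩
    · exact ⟨a', ⟨ha', h.ne_of_inc hl.inc_right hr'.1 hr'.2⟩, rfl⟩
  · obtain ⟨b, b', hl, hb, hb'⟩ := hf.right
    exact ⟨π b, π b', ⟨b, b', ⟨hl, hs⟩, rfl, rfl⟩,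
      ⟨b, hb, rfl⟩, ⟨b', hb', rfl⟩⟩
  · rintro e _ _ ⟨x, y, hxy, rfl, rfl⟩ her hes
    rw [Graph.deleteEdges_isLink] at hxy
    obtain ⟨hxy, he⟩ := hxy
    simp only [Set.mem_insert_iff, Set.mem_singleton_iff, not_or] at he
    have hxv := h.ne_of_inc hxy.inc_left he.1 he.2
    have hyv := h.ne_of_inc hxy.inc_right he.1 he.2
    rcases hf.link e x y hxy her hes with ⟨hx, hy⟩ | ⟨hx, hy⟩
    · exact Or.inl ⟨⟨x, ⟨hx, hxv⟩, rfl⟩, ⟨y, hy, rfl⟩⟩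
    · exact Or.inr ⟨⟨x, hx, rfl⟩, ⟨y, ⟨hy, hyv⟩, rfl⟩⟩

/-- An exceptional pair survives only if its two vertices are not identified. The pair `v₁`, `v₂`
therefore ceases to be an exception, which is the purpose of bicontracting. -/
lemma matchable (h : Bicontraction F π v v₁ v₂ g₁ g₂) (hf : Frame F A B r s) (hv : v ∈ A)
    (hv₁ : v₁ ∈ B) (hv₂ : v₂ ∈ B) (hm : Matchable F A B r s Ex) {Ex' : Set (Sym2 δ)}
    (hEx : ∀ x y, s(x, y) ∈ Ex → x ≠ v → y ≠ v → π x ≠ π y → s(π x, π y) ∈ Ex') :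
    Matchable ((F.deleteEdges {g₁, g₂}).map π) (π '' (A \ {v})) (π '' B) r s Ex' := by
  have hBv : ∀ b ∈ B, b ≠ v := by
    rintro b hb rfl
    exact hf.not_mem hv hb
  refine ⟨?_, ?_, ?_⟩
  · rintro _ ⟨a, ⟨ha, hav⟩, rfl⟩ _ ⟨b, hb, rfl⟩
    obtain ⟨M, hM, hr, hs⟩ := hm.cross a ha b hb
    refine ⟨_, h.pmOff hf.loopless hM (hf.memV_left ha) (hf.memV_right hb) hav (hBv b hb) ?_,
      fun h => hr h.1, fun h => hs h.1⟩
    intro heq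
    exact (Set.disjoint_left.1 (h.frame hf hv hv₁ hv₂).disj) ⟨a, ⟨ha, hav⟩, rfl⟩ ⟨b, hb, heq.symm⟩
  · rintro _ ⟨a, ⟨ha, hav⟩, rfl⟩ _ ⟨b, ⟨hb, hbv⟩, rfl⟩ hab hnot
    obtain ⟨M, hM, hr⟩ := hm.left a ha b hb (fun h => hab (h ▸ rfl))
      (fun hE => hnot (hEx a b hE hav hbv hab))
    exact ⟨_, h.pmOff hf.loopless hM (hf.memV_left ha) (hf.memV_left hb) hav hbv hab,
      fun h => hr h.1⟩
  · rintro _ ⟨a, ha, rfl⟩ _ ⟨b, hb, rfl⟩ hab hnot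
    obtain ⟨M, hM, hr⟩ := hm.right a ha b hb (fun h => hab (h ▸ rfl))
      (fun hE => hnot (hEx a b hE (hBv a ha) (hBv b hb) hab))
    exact ⟨_, h.pmOff hf.loopless hM (hf.memV_right ha) (hf.memV_right hb) (hBv a ha) (hBv b hb) hab,
      fun h => hr h.1⟩

end Bicontraction

/-! ### Relabelling the vertices -/

section Relabel

variable {γ δ β : Type*} {F : Graph γ β} {τ : γ → δ} {A B : Set γ} {r s : β}

lemma PMOff.map (hτ : Set.InjOn τ V(F)) {D : Set γ} (hD : D ⊆ V(F)) {M : Set β}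
    (h : PMOff F D M) : PMOff (F.map τ) (τ '' D) M := by
  have hinc : ∀ e, ∀ x ∈ V(F), (F.map τ).Inc e (τ x) ↔ F.Inc e x := by
    intro e x hx
    rw [Graph.map_inc]
    constructor
    · rintro ⟨y, hy, hxy⟩
      rwa [hτ hx hy.vertex_mem hxy]
    · exact fun h => ⟨x, h, rfl⟩
  refine ⟨h.subset, ?_, ?_⟩
  · rintro e he z hz ⟨d, hd, rfl⟩
    rw [hinc e d (hD hd)] at hz
    exact h.off e he d hz hd
  · rintro _ ⟨x, hx, rfl⟩ hxD
    simp only [hinc _ x hx]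
    exact h.cover x hx fun h => hxD ⟨x, h, rfl⟩

lemma Frame.map (hτ : Set.InjOn τ V(F)) (h : Frame F A B r s) :
    Frame (F.map τ) (τ '' A) (τ '' B) r s := by
  refine ⟨h.finite.image τ, ⟨?_⟩, ?_, ?_, ?_, ?_, ?_⟩
  · rintro e z ⟨x, y, hxy, hx, hy⟩
    have := h.loopless
    exact hxy.ne (hτ hxy.left_mem hxy.right_mem (hx.trans hy.symm))
  · rw [Set.disjoint_left]
    rintro _ ⟨x, hx, rfl⟩ ⟨y, hy, hyx⟩
    have := hτ (h.memV_right hy) (h.memV_left hx) hyx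
    exact h.not_mem hx (this ▸ hy)
  · rw [← Set.image_union, h.union]; rfl
  · obtain ⟨a, a', hl, ha, ha'⟩ := h.left
    exact ⟨τ a, τ a', hl.map τ, ⟨a, ha, rfl⟩, ⟨a', ha', rfl⟩⟩
  · obtain ⟨a, a', hl, ha, ha'⟩ := h.right
    exact ⟨τ a, τ a', hl.map τ, ⟨a, ha, rfl⟩, ⟨a', ha', rfl⟩⟩
  · rintro e _ _ ⟨x, y, hxy, rfl, rfl⟩ her hes
    rcases h.link e x y hxy her hes with ⟨hx, hy⟩ | ⟨hx, hy⟩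
    · exact Or.inl ⟨⟨x, hx, rfl⟩, ⟨y, hy, rfl⟩⟩
    · exact Or.inr ⟨⟨x, hx, rfl⟩, ⟨y, hy, rfl⟩⟩

lemma Matchable.map (hτ : Set.InjOn τ V(F)) (h : Frame F A B r s) (hm : Matchable F A B r s ∅) :
    Matchable (F.map τ) (τ '' A) (τ '' B) r s ∅ := by
  refine ⟨?_, ?_, ?_⟩
  · rintro _ ⟨a, ha, rfl⟩ _ ⟨b, hb, rfl⟩
    obtain ⟨M, hM, h'⟩ := hm.cross a ha b hb
    have := hM.map hτ (by rintro x (rfl | rfl); exacts [h.memV_left ha, h.memV_right hb])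
    exact ⟨M, by rwa [Set.image_pair] at this, h'⟩
  · rintro _ ⟨a, ha, rfl⟩ _ ⟨b, hb, rfl⟩ hab -
    obtain ⟨M, hM, h'⟩ := hm.left a ha b hb (fun h => hab (h ▸ rfl)) (fun h => h)
    have := hM.map hτ (by rintro x (rfl | rfl); exacts [h.memV_left ha, h.memV_left hb])
    exact ⟨M, by rwa [Set.image_pair] at this, h'⟩
  · rintro _ ⟨a, ha, rfl⟩ _ ⟨b, hb, rfl⟩ hab -
    obtain ⟨M, hM, h'⟩ := hm.right a ha b hb (fun h => hab (h ▸ rfl)) (fun h => h)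
    have := hM.map hτ (by rintro x (rfl | rfl); exacts [h.memV_right ha, h.memV_right hb])
    exact ⟨M, by rwa [Set.image_pair] at this, h'⟩

lemma Frame.isBrick_map (hτ : Set.InjOn τ V(F)) (h : Frame F A B r s)
    (hm : Matchable F A B r s ∅) (h4 : 4 ≤ V(F).ncard) : IsBrick (F.map τ) := by
  refine (h.map hτ).isBrick (hm.map hτ h) ?_
  show 4 ≤ (τ '' V(F)).ncard
  rwa [hτ.ncard_image]

lemma simple_map (hτ : Set.InjOn τ V(F)) (h : F.Simple) : (F.map τ).Simple := by
  refine { not_isLoopAt := ?_, eq_of_isLink := ?_ }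
  · rintro e z ⟨x, y, hxy, hx, hy⟩
    exact hxy.ne (hτ hxy.left_mem hxy.right_mem (hx.trans hy.symm))
  · rintro e f _ _ ⟨x, y, hxy, rfl, rfl⟩ ⟨x', y', hxy', hx, hy⟩
    rw [hτ hxy'.left_mem hxy.left_mem hx, hτ hxy'.right_mem hxy.right_mem hy] at hxy'
    exact hxy.eq hxy'

end Relabel
end RBrick

namespace RBrick

/-! ### Tight cuts around a vertex of degree two -/

section FourVertices

variable {γ β : Type*} {C : Graph γ β}

lemma isPerfectMatching_pair {x x' y y' : γ} {e f : β} (hV : V(C) = {x, x', y, y'})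
    (he : C.IsLink e x x') (hf : C.IsLink f y y') (hxy : x ≠ y) (hxy' : x ≠ y') (hx'y : x' ≠ y)
    (hx'y' : x' ≠ y') : IsPerfectMatching C {e, f} := by
  have key : ∀ {e f : β} {x x' y y' : γ}, C.IsLink e x x' → C.IsLink f y y' → x ≠ y → x ≠ y' →
      ∃! g, g ∈ ({e, f} : Set β) ∧ C.Inc g x := by
    intro e f x x' y y' he hf h1 h2
    refine ⟨e, ⟨by simp, he.inc_left⟩, ?_⟩
    rintro g ⟨rfl | rfl, hg⟩
    · rfl
    · rcases hg.eq_or_eq_of_isLink hf with h | h <;> contradiction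
  refine ⟨?_, fun v hv => ?_⟩
  · rintro g (rfl | rfl)
    exacts [he.edge_mem, hf.edge_mem]
  · rw [hV] at hv
    rcases hv with rfl | rfl | rfl | rfl
    · exact key he hf hxy hxy'
    · exact key he.symm hf hx'y hx'y'
    · rw [Set.pair_comm]; exact key hf he hxy.symm hx'y.symm
    · rw [Set.pair_comm]; exact key hf.symm he hxy'.symm hx'y'.symm

/-- A bipartite graph on four vertices containing a cycle of length four is a brace. -/
lemma hasBrickCount_zero_of_four {a b c d : γ} (hab : a ≠ b) (hac : a ≠ c) (had : a ≠ d)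
    (hbc : b ≠ c) (hbd : b ≠ d) (hcd : c ≠ d) (hV : V(C) = {a, b, c, d})
    (hl : ∀ e p q, C.IsLink e p q →
      ((p = a ∨ p = b) ∧ (q = c ∨ q = d)) ∨ ((p = c ∨ p = d) ∧ (q = a ∨ q = b)))
    (h₁ : C.Adj a c) (h₂ : C.Adj a d) (h₃ : C.Adj b c) (h₄ : C.Adj b d) : HasBrickCount C 0 := by
  obtain ⟨e₁, h₁⟩ := h₁
  obtain ⟨e₂, h₂⟩ := h₂
  obtain ⟨e₃, h₃⟩ := h₃
  obtain ⟨e₄, h₄⟩ := h₄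
  have hV1 : V(C) = {a, c, b, d} := by rw [hV]; ext x; simp; tauto
  have hV2 : V(C) = {a, d, b, c} := by rw [hV]; ext x; simp; tauto
  have hV3 : V(C) = {b, d, a, c} := by rw [hV]; ext x; simp; tauto
  have p1 : ∀ {e f}, C.IsLink e a c → C.IsLink f b d → IsPerfectMatching C {e, f} :=
    fun he hf => isPerfectMatching_pair hV1 he hf hab had hbc.symm hcd
  have p2 : ∀ {e f}, C.IsLink e a d → C.IsLink f b c → IsPerfectMatching C {e, f} :=
    fun he hf => isPerfectMatching_pair hV2 he hf hab hac hbd.symm hcd.symm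
  have hfin : V(C).Finite := by rw [hV]; simp
  refine .brace C ⟨⟨?_⟩, ?_, ?_, ?_⟩ ?_ ?_
  · intro e x hx
    have hx' : (x = a ∨ x = b) ∧ (x = c ∨ x = d) := (hl e x x hx).elim id And.symm
    obtain ⟨rfl | rfl, h' | h'⟩ := hx' <;> contradiction
  · exact (Set.one_lt_ncard_iff hfin).2 ⟨a, b, by simp [hV], by simp [hV], hab⟩
  · refine isConnected_of_forall ⟨a, by simp [hV]⟩ fun X hX hXne hcl => ?_
    obtain ⟨x, hx⟩ := hXne
    have hxV := hX hx
    rw [hV] at hxV ⊢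
    have l1 := hcl a c ⟨e₁, h₁⟩
    have l2 := hcl a d ⟨e₂, h₂⟩
    have l3 := hcl b c ⟨e₃, h₃⟩
    have l4 := hcl b d ⟨e₄, h₄⟩
    have l1' := hcl c a ⟨e₁, h₁.symm⟩
    have l2' := hcl d a ⟨e₂, h₂.symm⟩
    have l3' := hcl c b ⟨e₃, h₃.symm⟩
    have l4' := hcl d b ⟨e₄, h₄.symm⟩
    have : a ∈ X ∧ b ∈ X ∧ c ∈ X ∧ d ∈ X := by
      rcases hxV with rfl | rfl | rfl | rfl
      · exact ⟨hx, l3' (l1 hx), l1 hx, l2 hx⟩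
      · exact ⟨l1' (l3 hx), hx, l3 hx, l4 hx⟩
      · exact ⟨l1' hx, l3' hx, hx, l2 (l1' hx)⟩
      · exact ⟨l2' hx, l4' hx, l1 (l2' hx), hx⟩
    rintro y (rfl | rfl | rfl | rfl)
    exacts [this.1, this.2.1, this.2.2.1, this.2.2.2]
  · intro e he
    obtain ⟨p, q, hpq⟩ := Graph.exists_isLink_of_mem_edgeSet he
    have aux : ∀ {p q}, C.IsLink e p q → (p = a ∨ p = b) → (q = c ∨ q = d) →
        ∃ M, IsPerfectMatching C M ∧ e ∈ M := by
      rintro p q h (rfl | rfl) (rfl | rfl)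
      · exact ⟨_, p1 h h₄, by simp⟩
      · exact ⟨_, p2 h h₃, by simp⟩
      · exact ⟨_, p2 h₂ h, by simp⟩
      · exact ⟨_, p1 h₁ h, by simp⟩
    rcases hl e p q hpq with h | h
    · exact aux hpq h.1 h.2
    · exact aux hpq.symm h.2 h.1
  · refine ⟨{a, b}, {c, d}, ?_, ?_, ?_⟩
    · rw [Set.disjoint_left]
      rintro x (rfl | rfl) (h | h) <;> contradiction
    · rw [hV]; ext x; simp; tauto
    · intro e u v h
      simpa using hl e u v h
  · intro X hX
    obtain ⟨m, hm⟩ := Set.ncard_eq_one.1 (hX.tight _ (p1 h₁ h₄))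
    have hne : e₁ ≠ e₄ := by
      rintro rfl
      rcases h₁.left_eq_or_eq h₄ with h | h <;> contradiction
    have cross : ∀ {f x y}, C.IsLink f x y → (f ∈ cut C X ↔ ¬ (x ∈ X ↔ y ∈ X)) := by
      intro f x y h
      constructor
      · rintro ⟨u, w, huw, hu, hw⟩
        rcases h.eq_and_eq_or_eq_and_eq huw with ⟨rfl, rfl⟩ | ⟨rfl, rfl⟩ <;> tauto
      · intro hxy
        by_cases hx : x ∈ X
        · exact ⟨x, y, h, hx, by tauto⟩
        · exact ⟨y, x, h.symm, by tauto, hx⟩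
    -- A nontrivial shore has exactly two of the four vertices, so it cannot split one edge of a
    -- perfect matching without splitting the other. The matching thus meets the cut in an even
    -- number of edges.
    have odd : ∀ {x x' y y' : γ}, V(C) = {x, x', y, y'} → ¬ (x ∈ X ↔ x' ∈ X) → (y ∈ X ↔ y' ∈ X) →
        False := by
      intro x x' y y' hV hx hy
      obtain ⟨s, hs, t, ht, hst⟩ := hX.nontrivial
      obtain ⟨s', hs', t', ht', hst'⟩ := hX.nontrivial_compl
      have h1 := hX.subset hs
      have h2 := hX.subset ht
      have h3 := hs'.1
      have h4 := ht'.1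
      have h3' := hs'.2
      have h4' := ht'.2
      rw [hV] at h1 h2 h3 h4
      by_cases hyX : y ∈ X
      · have hyX' := hy.1 hyX
        have : ∀ z ∉ X, z ∈ ({x, x', y, y'} : Set γ) → z = x ∨ z = x' := by
          rintro z hz (rfl | rfl | rfl | rfl)
          exacts [Or.inl rfl, Or.inr rfl, (hz hyX).elim, (hz hyX').elim]
        have k1 := this _ h3' h3
        have k2 := this _ h4' h4
        rcases k1 with rfl | rfl <;> rcases k2 with rfl | rfl <;> tauto
      · have hyX' : y' ∉ X := fun h => hyX (hy.2 h)
        have : ∀ z ∈ X, z ∈ ({x, x', y, y'} : Set γ) → z = x ∨ z = x' := by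
          rintro z hz (rfl | rfl | rfl | rfl)
          exacts [Or.inl rfl, Or.inr rfl, (hyX hz).elim, (hyX' hz).elim]
        have k1 := this _ hs h1
        have k2 := this _ ht h2
        rcases k1 with rfl | rfl <;> rcases k2 with rfl | rfl <;> tauto
    have c1 := cross h₁
    have c4 := cross h₄
    have hmem1 : e₁ ∈ cut C X ↔ e₁ = m := by
      have := Set.ext_iff.1 hm e₁
      simpa using this
    have hmem4 : e₄ ∈ cut C X ↔ e₄ = m := by
      have := Set.ext_iff.1 hm e₄
      simpa using this
    have hm' : m = e₁ ∨ m = e₄ := by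
      have : m ∈ ({e₁, e₄} : Set β) ∩ cut C X := by rw [hm]; rfl
      simpa using this.1
    by_cases h1 : e₁ ∈ cut C X
    · have h4 : e₄ ∉ cut C X := fun h => hne ((hmem1.1 h1).trans (hmem4.1 h).symm)
      exact odd hV1 (c1.1 h1) (not_not.1 fun h => h4 (c4.2 h))
    · have h4 : e₄ ∈ cut C X := by
        rcases hm' with h | h
        · exact (h1 (hmem1.2 h.symm)).elim
        · exact hmem4.2 h.symm
      exact odd hV3 (c4.1 h4) (not_not.1 fun h => h1 (c1.2 h))

end FourVertices

section Split

variable {γ β : Type*} {F : Graph γ β} {v v₁ v₂ : γ} {g₁ g₂ : β}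

/-- Bicontracting a vertex of degree two preserves the number of bricks. -/
lemma HasBrickCount.of_bicontraction {π : γ → γ} (h : Bicontraction F π v v₁ v₂ g₁ g₂)
    (hπ : ∀ x ∈ ({v, v₁, v₂} : Set γ), π x = v) (hπ' : ∀ x ∉ ({v, v₁, v₂} : Set γ), π x = x)
    (hF : F.Loopless) (h₁ : ∃ w, w ∉ ({v, v₁, v₂} : Set γ) ∧ F.Adj v₁ w)
    (h₂ : ∃ w, w ∉ ({v, v₁, v₂} : Set γ) ∧ F.Adj v₂ w)
    (hV : (V(F) \ {v, v₁, v₂}).Nontrivial) {n : ℕ}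
    (hn : HasBrickCount ((F.deleteEdges {g₁, g₂}).map π) n) : HasBrickCount F n := by
  classical
  set X : Set γ := {v, v₁, v₂} with hX
  have hv₁ : v ≠ v₁ := h.link₁.ne
  have hv₂ : v ≠ v₂ := h.link₂.ne
  have hXV : X ⊆ V(F) := by
    rintro x (rfl | rfl | rfl)
    exacts [h.link₁.left_mem, h.link₁.right_mem, h.link₂.right_mem]
  have hinside : ∀ e x y, F.IsLink e x y → x ∈ X → y ∈ X → e = g₁ ∨ e = g₂ := by
    intro e x y hxy hx hy
    have hne := hxy.ne
    rcases hx with rfl | rfl | rfl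
    · exact h.inc e hxy.inc_left
    · rcases hy with rfl | rfl | rfl
      · exact h.inc e hxy.inc_right
      · exact (hne rfl).elim
      · exact (h.not_link e hxy).elim
    · rcases hy with rfl | rfl | rfl
      · exact h.inc e hxy.inc_right
      · exact (h.not_link e hxy.symm).elim
      · exact (hne rfl).elim
  have hind : E(F.induce X) = {g₁, g₂} := by
    ext e
    constructor
    · intro he
      obtain ⟨x, y, hxy, hx, hy⟩ := Graph.exists_isLink_of_mem_edgeSet he
      exact hinside e x y hxy hx hy
    · rintro (rfl | rfl)
      · exact Graph.IsLink.edge_mem (x := v) (y := v₁) ⟨h.link₁, by simp [hX], by simp [hX]⟩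
      · exact Graph.IsLink.edge_mem (x := v) (y := v₂) ⟨h.link₂, by simp [hX], by simp [hX]⟩
  obtain ⟨y, hy⟩ := hV.nonempty
  -- The vertex `v` is matched inside `X` with one of `v₁`, `v₂`; only the matching edge at the
  -- other one leaves `X`.
  have htight : ∀ M, IsPerfectMatching F M → (M ∩ cut F X).ncard = 1 := by
    intro M hM
    obtain ⟨g, ⟨hgM, hg⟩, -⟩ := hM.2 v h.link₁.left_mem
    have aux : ∀ {v₁ v₂ : γ} {g₁ g₂ : β}, F.IsLink g₁ v v₁ → F.IsLink g₂ v v₂ →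
        (∀ e, F.Inc e v → e = g₁ ∨ e = g₂) → v₁ ≠ v₂ → (∀ e, ¬ F.IsLink e v₁ v₂) →
        X = {v, v₁, v₂} → g₁ ∈ M → (M ∩ cut F X).ncard = 1 := by
      intro v₁ v₂ g₁ g₂ hl₁ hl₂ hinc hne hnl hX hgM
      have hv₂ : v ≠ v₂ := hl₂.ne
      have huniq : ∀ {e e' x}, e ∈ M → e' ∈ M → F.Inc e x → F.Inc e' x → e = e' :=
        fun he he' hi hi' => (hM.2 _ hi.vertex_mem).unique ⟨he, hi⟩ ⟨he', hi'⟩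
      obtain ⟨e, ⟨heM, w, hw⟩, -⟩ := hM.2 v₂ hl₂.right_mem
      have heg : e ≠ g₁ := by
        rintro rfl
        rcases hw.left_eq_or_eq hl₁ with h | h
        · exact hv₂ h.symm
        · exact hne h.symm
      have hwX : w ∉ X := by
        rw [hX]
        rintro (rfl | rfl | rfl)
        · exact heg (huniq heM hgM hw.inc_right hl₁.inc_left)
        · exact hnl e hw.symm
        · exact hw.ne rfl
      rw [Set.ncard_eq_one]
      refine ⟨e, Set.eq_singleton_iff_unique_mem.2 ⟨⟨heM, v₂, w, hw, by simp [hX], hwX⟩, ?_⟩⟩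
      rintro f ⟨hfM, x, z, hxz, hx, hz⟩
      have hfg : f ≠ g₁ := by
        rintro rfl
        rcases hxz.right_eq_or_eq hl₁ with rfl | rfl <;> exact hz (by simp [hX])
      rw [hX] at hx
      rcases hx with rfl | rfl | rfl
      · exact (hfg (huniq hfM hgM hxz.inc_left hl₁.inc_left)).elim
      · exact (hfg (huniq hfM hgM hxz.inc_left hl₁.inc_right)).elim
      · exact huniq hfM heM hxz.inc_left hw.inc_left
    rcases h.inc g hg with rfl | rfl
    · exact aux h.link₁ h.link₂ h.inc h.ne h.not_link rfl hgM
    · refine aux h.link₂ h.link₁ h.symm.inc h.symm.ne h.symm.not_link ?_ hgM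
      rw [hX, Set.pair_comm]
  have hcut : IsNontrivialTightCut F X :=
    ⟨hXV, ⟨v, by simp [hX], v₁, by simp [hX], hv₁⟩, hV, htight⟩
  -- Contracting `X` gives the bicontracted graph. Contracting the other shore gives a cycle of
  -- length four through `v`, `v₁`, `y`, `v₂`, up to parallel edges; it is a brace and contributes
  -- no brick.
  refine HasBrickCount.split F X v y n 0 hcut (by simp [hX]) hy ?_ ?_
  · rw [contractShore, hind, Graph.map_eq_of_eqOn (g := π)]
    · exact hn
    · intro x _
      by_cases hx : x ∈ X
      · simp only [if_pos hx, hπ x hx]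
      · simp only [if_neg hx, hπ' x hx]
  · have hyX : y ∉ X := hy.2
    have hyv : v ≠ y := by rintro rfl; exact hyX (by simp [hX])
    have hyv₁ : v₁ ≠ y := by rintro rfl; exact hyX (by simp [hX])
    have hyv₂ : v₂ ≠ y := by rintro rfl; exact hyX (by simp [hX])
    obtain ⟨ρ, hρ, hin, hout⟩ : ∃ ρ : γ → γ, contractShore F (V(F) \ X) y =
        (F.deleteEdges E(F.induce (V(F) \ X))).map ρ ∧ (∀ x ∈ X, ρ x = x) ∧
        ∀ x ∈ V(F), x ∉ X → ρ x = y :=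
      ⟨fun x => if x ∈ V(F) \ X then y else x, by rw [contractShore]; congr!,
        fun x hx => if_neg fun h => h.2 hx, fun x hx hxX => if_pos ⟨hx, hxX⟩⟩
    rw [hρ]
    have hkeep : ∀ {e x z}, F.IsLink e x z → x ∈ X →
        ((F.deleteEdges E(F.induce (V(F) \ X))).map ρ).IsLink e x (ρ z) := by
      intro e x z hxz hx
      refine ⟨x, z, ⟨hxz, ?_⟩, hin x hx, rfl⟩
      intro he
      obtain ⟨p, q, hpq, hp, hq⟩ := Graph.exists_isLink_of_mem_edgeSet he
      rcases hxz.left_eq_or_eq hpq with rfl | rfl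
      · exact hp.2 hx
      · exact hq.2 hx
    refine hasBrickCount_zero_of_four (a := v) (b := y) (c := v₁) (d := v₂) hyv hv₁ hv₂ hyv₁.symm
      hyv₂.symm h.ne ?_ ?_ ⟨g₁, ?_⟩ ⟨g₂, ?_⟩ ?_ ?_
    · show _ '' V(F) = _
      ext z
      constructor
      · rintro ⟨x, hx, rfl⟩
        by_cases hxX : x ∈ X
        · rw [hin x hxX]
          rcases hxX with rfl | rfl | rfl <;> simp
        · rw [hout x hx hxX]
          simp
      · rintro (rfl | rfl | rfl | rfl)
        · exact ⟨z, hXV (by simp [hX]), hin z (by simp [hX])⟩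
        · exact ⟨z, hy.1, hout z hy.1 hyX⟩
        · exact ⟨z, hXV (by simp [hX]), hin z (by simp [hX])⟩
        · exact ⟨z, hXV (by simp [hX]), hin z (by simp [hX])⟩
    · rintro e _ _ ⟨x, z, ⟨hxz, he⟩, rfl, rfl⟩
      have aux : ∀ {x z}, F.IsLink e x z → x ∈ X →
          ((ρ x = v ∨ ρ x = y) ∧
          (ρ z = v₁ ∨ ρ z = v₂)) ∨
          ((ρ x = v₁ ∨ ρ x = v₂) ∧
          (ρ z = v ∨ ρ z = y)) := by
        intro x z hxz hx
        rw [hin x hx]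
        by_cases hz : z ∈ X
        · rw [hin z hz]
          rcases hinside e x z hxz hx hz with rfl | rfl
          · rcases hxz.eq_and_eq_or_eq_and_eq h.link₁ with ⟨rfl, rfl⟩ | ⟨rfl, rfl⟩ <;> simp
          · rcases hxz.eq_and_eq_or_eq_and_eq h.link₂ with ⟨rfl, rfl⟩ | ⟨rfl, rfl⟩ <;> simp
        · rw [hout z hxz.right_mem hz]
          right
          refine ⟨?_, Or.inr rfl⟩
          rcases hx with rfl | hx
          · refine (hz ?_).elim
            rcases h.inc e hxz.inc_left with rfl | rfl
            · rw [hxz.right_unique h.link₁]; simp [hX]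
            · rw [hxz.right_unique h.link₂]; simp [hX]
          · exact hx
      by_cases hx : x ∈ X
      · exact aux hxz hx
      · by_cases hz : z ∈ X
        · exact (aux hxz.symm hz).symm.imp And.symm And.symm
        · exact (he (Graph.IsLink.edge_mem (x := x) (y := z)
            ⟨hxz, ⟨hxz.left_mem, hx⟩, ⟨hxz.right_mem, hz⟩⟩)).elim
    · have := hkeep h.link₁ (by simp [hX])
      rwa [hin v₁ (by simp [hX])] at this
    · have := hkeep h.link₂ (by simp [hX])
      rwa [hin v₂ (by simp [hX])] at this
    · obtain ⟨w, hw, e, he⟩ := h₁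
      have := hkeep he (by simp [hX])
      rw [hout w he.right_mem hw] at this
      exact ⟨e, this.symm⟩
    · obtain ⟨w, hw, e, he⟩ := h₂
      have := hkeep he (by simp [hX])
      rw [hout w he.right_mem hw] at this
      exact ⟨e, this.symm⟩

end Split
end RBrick

namespace RBrick

/-! ### Surpluses of neighbourhoods -/

section Surplus

variable {α β : Type*} {G : Graph α β}

/-- The ends of the edges that have an end in `T`. -/
def nbrs (G : Graph α β) (T : Set α) : Set α := {w | ∃ v ∈ T, G.Adj v w}

lemma IsPerfectMatching.ncard_le {H : Graph α β} {M : Set β} (hM : IsPerfectMatching H M)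
    {A B : Set α} (hb : IsBipartition H A B) (hB : B.Finite) : A.ncard ≤ B.ncard := by
  refine (pmOff_empty_iff.2 hM).ncard_le hB (fun v hv => ⟨?_, by simp⟩) ?_
  · rw [← hb.union_eq]; exact Or.inl hv
  · intro e _ v hv w hl
    rcases hb.link e v w hl with h | h
    · exact h.2
    · exact (Set.disjoint_left.1 hb.disjoint hv h.1).elim

lemma IsBipartition.symm {H : Graph α β} {A B : Set α} (h : IsBipartition H A B) :
    IsBipartition H B A :=
  ⟨h.disjoint.symm, by rw [Set.union_comm, h.union_eq], fun e u v hl => (h.link e u v hl).symm⟩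

/-- Coveredness speaks only of existing edges; connectedness and the second vertex supply one. -/
lemma IsMatchingCovered.exists_perfectMatching {H : Graph α β} (h : IsMatchingCovered H) :
    ∃ M, IsPerfectMatching H M := by
  by_contra! hcon
  have hE : ∀ e, e ∉ E(H) := fun e he => by
    obtain ⟨M, hM, -⟩ := h.admissible e he
    exact hcon M hM
  have hfin : V(H).Finite := Set.finite_of_ncard_ne_zero (by have := h.two_le; omega)
  obtain ⟨x, y, hx, hy, hxy⟩ := (Set.one_lt_ncard_iff hfin).1 h.two_le
  have := h.connected.subset_of_closed (X := {x}) hx rfl (by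
    rintro u v ⟨e, he⟩ -
    exact (hE e he.edge_mem).elim)
  exact hxy (this hy).symm

/-- In a bipartite matching covered graph every proper nonempty subset of a colour class has more
neighbours than members. -/
lemma IsMatchingCovered.ncard_lt_nbrs {H : Graph α β} (h : IsMatchingCovered H) (hfin : V(H).Finite)
    {A B : Set α} (hb : IsBipartition H A B) {T : Set α} (hT : T ⊆ A) (hne : T.Nonempty)
    (hTA : T ≠ A) : T.ncard < (nbrs H T).ncard := by
  have hAV : A ⊆ V(H) := by rw [← hb.union_eq]; exact Set.subset_union_left
  have hN : (nbrs H T).Finite := hfin.subset fun w ⟨v, _, hw⟩ => hw.right_mem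
  have hNB : nbrs H T ⊆ B := by
    rintro w ⟨v, hv, e, he⟩
    rcases hb.link e v w he with h | h
    · exact h.2
    · exact (Set.disjoint_left.1 hb.disjoint (hT hv) h.1).elim
  -- By connectedness some edge leads from a neighbour `w` of `T` to a vertex outside `T`. A perfect
  -- matching through it sends `T` into the neighbours other than `w`.
  obtain ⟨u, w, e, he, hw, hu⟩ : ∃ u w e, H.IsLink e u w ∧ w ∈ nbrs H T ∧ u ∉ T := by
    by_contra! hcon
    obtain ⟨x, hx⟩ := hne
    have := h.connected.subset_of_closed (X := T ∪ nbrs H T) (hAV (hT hx)) (Or.inl hx) (by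
      rintro u v ⟨e, he⟩ (hu | hu)
      · exact Or.inr ⟨u, hu, e, he⟩
      · exact Or.inl (hcon v u e he.symm hu))
    refine hTA (hT.antisymm fun a ha => ?_)
    rcases this (hAV ha) with h | h
    · exact h
    · exact (Set.disjoint_left.1 hb.disjoint ha (hNB h)).elim
  obtain ⟨M, hM, heM⟩ := h.admissible e he.edge_mem
  have hM' := pmOff_empty_iff.2 hM
  have h1 : T.ncard ≤ (nbrs H T \ {w}).ncard := by
    refine hM'.ncard_le (hN.subset Set.sdiff_subset) (fun v hv => ⟨hAV (hT hv), by simp⟩) ?_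
    rintro f hf v hv z hl
    refine ⟨⟨v, hv, f, hl⟩, ?_⟩
    rintro rfl
    obtain rfl := hM'.eq hf heM hl.inc_right he.inc_right
    exact hu (hl.left_unique he ▸ hv)
  have h2 := Set.ncard_sdiff_singleton_add_one hw hN
  omega

/-- The edges of a removable doubleton lie in different colour classes. -/
lemma IsRemovableDoubleton.exists_frame {R : Set β} (h : IsRemovableDoubleton G R)
    (hfin : V(G).Finite) : ∃ A B r s, R = {r, s} ∧ Frame G A B r s := by
  obtain ⟨A, B, hb⟩ := h.bipartite_delete
  obtain ⟨r, s, hrs, rfl⟩ := Set.ncard_eq_two.1 h.pair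
  have hU : A ∪ B = V(G) := hb.union_eq
  have hAV : A ⊆ V(G) := by rw [← hU]; exact Set.subset_union_left
  have hBV : B ⊆ V(G) := by rw [← hU]; exact Set.subset_union_right
  have hA : A.Finite := hfin.subset hAV
  have hB : B.Finite := hfin.subset hBV
  obtain ⟨M₀, hM₀⟩ := h.matchingCovered_delete.exists_perfectMatching
  have hcard : A.ncard = B.ncard := (hM₀.ncard_le hb hB).antisymm (hM₀.ncard_le hb.symm hA)
  -- If `r` lies inside `A`, a perfect matching containing `r` leaves too few vertices of `A` for
  -- those of `B`, unless `s` lies inside `B`.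
  have key : ∀ {A B : Set α} {r s : β}, IsBipartition (G.deleteEdges {r, s}) A B → A.ncard = B.ncard →
      r ∈ E(G) → s ∈ E(G) → (∃ a a', G.IsLink r a a' ∧ a ∈ A ∧ a' ∈ A) →
      ∃ b b', G.IsLink s b b' ∧ b ∈ B ∧ b' ∈ B := by
    rintro A B r s hb hcard hr hs ⟨a, a', hl, ha, ha'⟩
    have hU : A ∪ B = V(G) := hb.union_eq
    have hAV : A ⊆ V(G) := by rw [← hU]; exact Set.subset_union_left
    have hBV : B ⊆ V(G) := by rw [← hU]; exact Set.subset_union_right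
    have hA : A.Finite := hfin.subset hAV
    by_contra! hcon
    obtain ⟨M, hM, hrM⟩ := h.matchingCovered.admissible r hr
    have hM' := pmOff_empty_iff.2 hM
    have : B.ncard ≤ (A \ {a}).ncard := by
      refine hM'.ncard_le (hA.subset Set.sdiff_subset) (fun v hv => ⟨hBV hv, by simp⟩) ?_
      intro f hf v hv w hvw
      have hfr : f ≠ r := by
        rintro rfl
        rcases hvw.left_eq_or_eq hl with rfl | rfl
        · exact Set.disjoint_left.1 hb.disjoint ha hv
        · exact Set.disjoint_left.1 hb.disjoint ha' hv
      refine ⟨?_, ?_⟩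
      · by_cases hfs : f = s
        · subst hfs
          have := hcon v w hvw hv
          have hw := hvw.right_mem
          rw [← hU] at hw
          exact hw.resolve_right this
        · rcases hb.link f v w ⟨hvw, by rintro (h | h) <;> contradiction⟩ with h | h
          · exact (Set.disjoint_left.1 hb.disjoint h.1 hv).elim
          · exact h.2
      · rintro rfl
        exact hfr (hM'.eq hf hrM hvw.inc_right hl.inc_left)
    have h2 := Set.ncard_sdiff_singleton_add_one ha hA
    omega
  have hrE : r ∈ E(G) := h.subset (by simp)
  have hsE : s ∈ E(G) := h.subset (by simp)
  have hb' : IsBipartition (G.deleteEdges {s, r}) A B := by rwa [Set.pair_comm]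
  have hlink : ∀ e u v, G.IsLink e u v → e ≠ r → e ≠ s → (u ∈ A ∧ v ∈ B) ∨ (u ∈ B ∧ v ∈ A) :=
    fun e u v hl h1 h2 => hb.link e u v ⟨hl, by rintro (h | h) <;> contradiction⟩
  -- the ends of each of the two edges
  have hends : ∀ e ∈ E(G), (∃ a a', G.IsLink e a a' ∧ a ∈ A ∧ a' ∈ A) ∨
      (∃ b b', G.IsLink e b b' ∧ b ∈ B ∧ b' ∈ B) ∨
      ∀ u v, G.IsLink e u v → (u ∈ A ∧ v ∈ B) ∨ (u ∈ B ∧ v ∈ A) := by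
    intro e he
    obtain ⟨x, y, hxy⟩ := Graph.exists_isLink_of_mem_edgeSet he
    have hx := hxy.left_mem
    have hy := hxy.right_mem
    rw [← hU] at hx hy
    rcases hx with hx | hx <;> rcases hy with hy | hy
    · exact Or.inl ⟨x, y, hxy, hx, hy⟩
    · refine Or.inr (Or.inr fun u v huv => ?_)
      rcases huv.eq_and_eq_or_eq_and_eq hxy with ⟨rfl, rfl⟩ | ⟨rfl, rfl⟩ <;> tauto
    · refine Or.inr (Or.inr fun u v huv => ?_)
      rcases huv.eq_and_eq_or_eq_and_eq hxy with ⟨rfl, rfl⟩ | ⟨rfl, rfl⟩ <;> tauto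
    · exact Or.inr (Or.inl ⟨x, y, hxy, hx, hy⟩)
  have conc : ∀ {r s : β}, IsBipartition (G.deleteEdges {r, s}) A B →
      (∃ a a', G.IsLink r a a' ∧ a ∈ A ∧ a' ∈ A) →
      (∃ b b', G.IsLink s b b' ∧ b ∈ B ∧ b' ∈ B) → Frame G A B r s :=
    fun hb hr hs => ⟨hfin, h.matchingCovered.loopless, hb.disjoint, hU, hr, hs,
      fun e u v hl h1 h2 => hb.link e u v ⟨hl, by rintro (h | h) <;> contradiction⟩⟩
  rcases hends r hrE with hr | hr | hr
  · exact ⟨A, B, r, s, rfl, conc hb hr (key hb hcard hrE hsE hr)⟩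
  · exact ⟨A, B, s, r, Set.pair_comm _ _, conc hb' (key hb.symm hcard.symm hrE hsE hr) hr⟩
  · rcases hends s hsE with hs | hs | hs
    · have h2 := key hb' hcard hsE hrE hs
      exact ⟨A, B, s, r, Set.pair_comm _ _, conc hb' hs h2⟩
    · exact ⟨A, B, r, s, rfl, conc hb (key hb'.symm hcard.symm hsE hrE hs) hs⟩
    -- If both edges joined `A` to `B`, the whole graph would be bipartite.
    · refine (h.nonbipartite ⟨A, B, hb.disjoint, hU, fun e u v hl => ?_⟩).elim
      by_cases her : e = r
      · exact hr u v (her ▸ hl)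
      · by_cases hes : e = s
        · exact hs u v (hes ▸ hl)
        · exact hlink e u v hl her hes

lemma Frame.isBipartition {A B : Set α} {r s : β} (h : Frame G A B r s) :
    IsBipartition (G.deleteEdges {r, s}) A B :=
  ⟨h.disj, h.union, fun e u v hl => h.link e u v hl.1 (fun h => hl.2 (by simp [h]))
    (fun h => hl.2 (by simp [h]))⟩


/-- The surpluses of the subsets of a colour class. -/
lemma Frame.hall {A B : Set α} {r s : β} (h : Frame G A B r s) (hG : IsBrick G)
    (hc : IsMatchingCovered (G.deleteEdges {r, s})) {T : Set α} (hT : T ⊆ A) (hne : T.Nonempty)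
    (hTA : T ≠ A) : T.ncard + 1 ≤ (nbrs (G.deleteEdges {r, s}) T).ncard ∧
      ((∀ v ∈ T, ¬ G.Inc r v) → T.ncard + 2 ≤ (nbrs (G.deleteEdges {r, s}) T).ncard) := by
  have h1 := hc.ncard_lt_nbrs h.finite h.isBipartition hT hne hTA
  refine ⟨h1, fun hr => ?_⟩
  set K := nbrs (G.deleteEdges {r, s}) T with hK
  have hKfin : K.Finite := h.finite.subset fun w ⟨v, _, e, hw⟩ => hw.right_mem
  have hTfin : T.Finite := h.finite_left.subset hT
  have h2 : 1 < K.ncard := by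
    have := (Set.ncard_pos hTfin).2 hne
    omega
  have hKB : K ⊆ B := by
    rintro w ⟨v, hv, e, he⟩
    exact h.right_mem_of_left he.1 (hT hv) (fun h => he.2 (by simp [h]))
  -- By bicriticality there is a matching missing two chosen neighbours `x`, `y` of `T`. As `T`
  -- avoids `r`, it sends `T` into the remaining neighbours, so at least two more than `|T|` exist.
  obtain ⟨x, y, hx, hy, hxy⟩ := (Set.one_lt_ncard_iff hKfin).1 h2
  obtain ⟨M, hM⟩ := hG.bicritical x (h.memV_right (hKB hx)) y (h.memV_right (hKB hy)) hxy
  rw [pmOff_iff] at hM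
  have : T.ncard ≤ (K \ {x, y}).ncard := by
    refine hM.ncard_le (hKfin.subset Set.sdiff_subset) (fun v hv => ⟨h.memV_left (hT hv), ?_⟩) ?_
    · rintro (rfl | rfl)
      · exact h.not_mem (hT hv) (hKB hx)
      · exact h.not_mem (hT hv) (hKB hy)
    · intro e he v hv w hw
      refine ⟨⟨v, hv, e, hw, ?_⟩, hM.off e he w hw.inc_right⟩
      rintro (rfl | rfl)
      · exact hr v hv hw.inc_left
      · exact h.not_mem (hT hv) (h.s_inc hw.inc_left)
  have h3 : ({x, y} : Set α).ncard = 2 := Set.ncard_pair hxy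
  have h4 := Set.ncard_sdiff_add_ncard_of_subset (s := {x, y}) (t := K)
    (by rintro z (rfl | rfl) <;> assumption) hKfin
  omega

lemma Frame.ncard_eq {A B : Set α} {r s : β} (h : Frame G A B r s)
    (hc : IsMatchingCovered (G.deleteEdges {r, s})) : A.ncard = B.ncard := by
  obtain ⟨M₀, hM₀⟩ := hc.exists_perfectMatching
  exact (hM₀.ncard_le h.isBipartition h.finite_right).antisymm
    (hM₀.ncard_le h.isBipartition.symm h.finite_left)

end Surplus

/-! ### The Hall graph of an `R`-brick -/

/-- The Hall graph with the colour classes exchanged. -/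
def HallGraph.swap {α : Type*} [DecidableEq α] (P : HallGraph α) : HallGraph α where
  A := P.B
  B := P.A
  R := P.R
  N := P.N
  disj := P.disj.symm
  card_eq := P.card_eq.symm
  card_RA := P.card_RB
  card_RB := P.card_RA
  symm := P.symm
  mem := fun h => (P.mem h).symm
  hall := fun T hT hne h1 h2 => P.hall T hT.symm hne h2 h1

/-- `P` describes the neighbourhoods of `G - {r, s}`, where `G` is a simple brick. -/
structure Model {α β : Type*} [DecidableEq α] (G : Graph α β) (r s : β) (P : HallGraph α) : Prop where
  frame : Frame G P.A P.B r s
  simple : G.Simple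
  brick : IsBrick G
  covered : IsMatchingCovered (G.deleteEdges {r, s})
  mem_R : ∀ v, v ∈ P.R ↔ G.Inc r v ∨ G.Inc s v
  mem_N : ∀ v w, w ∈ P.N v ↔ ∃ e, G.IsLink e v w ∧ e ≠ r ∧ e ≠ s

section Model

variable {α β : Type*} [DecidableEq α] {G : Graph α β} {r s : β} {P : HallGraph α}

lemma Model.swap (h : Model G r s P) : Model G s r P.swap :=
  ⟨h.frame.swap, h.simple, h.brick, by rw [Set.pair_comm]; exact h.covered,
    fun v => (h.mem_R v).trans or_comm, fun v w => (h.mem_N v w).trans (by simp only [and_comm])⟩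

/-- Every simple `R`-brick has a Hall graph. -/
theorem IsRBrick.exists_model {R : Set β} (h : IsRBrick G R) (hs : G.Simple) (hfin : V(G).Finite) :
    ∃ r s, ∃ P : HallGraph α, R = {r, s} ∧ Model G r s P := by
  classical
  obtain ⟨A, B, r, s, rfl, hF⟩ := h.2.exists_frame hfin
  have hc := h.2.matchingCovered_delete
  have hN : ∀ v, {w | ∃ e, G.IsLink e v w ∧ e ≠ r ∧ e ≠ s}.Finite := fun v =>
    hfin.subset fun w ⟨e, he, _⟩ => he.right_mem
  have hR : {v | G.Inc r v ∨ G.Inc s v}.Finite :=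
    hfin.subset fun v hv => hv.elim Graph.Inc.vertex_mem Graph.Inc.vertex_mem
  have hcard2 : ∀ {A B : Set α} {r s : β}, Frame G A B r s →
      ({v | (G.Inc r v ∨ G.Inc s v) ∧ v ∈ A}).ncard = 2 := by
    intro A B r s hF
    obtain ⟨a, a', hl, ha, ha'⟩ := hF.left
    have : {v | (G.Inc r v ∨ G.Inc s v) ∧ v ∈ A} = {a, a'} := by
      ext v
      constructor
      · rintro ⟨hv | hv, hvA⟩
        · exact hv.eq_or_eq_of_isLink hl
        · exact (hF.not_mem hvA (hF.s_inc hv)).elim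
      · rintro (rfl | rfl)
        · exact ⟨Or.inl hl.inc_left, ha⟩
        · exact ⟨Or.inl hl.inc_right, ha'⟩
    rw [this, Set.ncard_pair hl.ne]
  have hnb : ∀ T : Finset α, ((T.biUnion fun v => (hN v).toFinset : Finset α) : Set α) =
      nbrs (G.deleteEdges {r, s}) (T : Set α) := by
    intro T
    ext w
    simp only [Finset.coe_biUnion, Set.mem_iUnion, Set.Finite.coe_toFinset, nbrs, Graph.Adj,
      Graph.deleteEdges_isLink, Set.mem_insert_iff, Set.mem_singleton_iff, not_or, Set.mem_ofPred_eq,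
      Finset.mem_coe, exists_prop]
  refine ⟨r, s, ⟨hF.finite_left.toFinset, hF.finite_right.toFinset, hR.toFinset,
    fun v => (hN v).toFinset, ?_, ?_, ?_, ?_, ?_, ?_, ?_⟩, rfl, ?_⟩
  · rw [Finset.disjoint_left]
    intro v hv hv'
    exact hF.not_mem (hF.finite_left.mem_toFinset.1 hv) (hF.finite_right.mem_toFinset.1 hv')
  · rw [← Set.ncard_eq_toFinset_card A hF.finite_left, ← Set.ncard_eq_toFinset_card B hF.finite_right]
    exact hF.ncard_eq hc
  · rw [← hcard2 hF, ← Set.ncard_coe_finset]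
    congr 1
    ext v
    simp
  · rw [← hcard2 hF.swap, ← Set.ncard_coe_finset]
    congr 1
    ext v
    simp [or_comm]
  · intro v w hw
    rw [Set.Finite.mem_toFinset] at hw ⊢
    obtain ⟨e, he, h'⟩ := hw
    exact ⟨e, he.symm, h'⟩
  · intro v w hw
    rw [Set.Finite.mem_toFinset] at hw
    obtain ⟨e, he, h'⟩ := hw
    simpa using hF.link e v w he h'.1 h'.2
  · intro T hT hne h1 h2
    have h1' : (T : Set α) ≠ A := by
      rintro rfl
      exact h1 (by simp)
    have h2' : (T : Set α) ≠ B := by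
      rintro rfl
      exact h2 (by simp)
    rw [← Set.ncard_coe_finset T, ← Set.ncard_coe_finset (T.biUnion _), hnb]
    have hc' : IsMatchingCovered (G.deleteEdges {s, r}) := by rwa [Set.pair_comm]
    rcases hT with hT | hT
    · have := hF.hall h.1 hc (T := T) (fun v hv => by simpa using hT hv) (by simpa using hne) h1'
      split_ifs with hd
      · refine this.2 fun v hv hr => ?_
        exact (Finset.disjoint_left.1 hd) hv (by simpa using Or.inl hr)
      · exact this.1
    · have := hF.swap.hall h.1 hc' (T := T) (fun v hv => by simpa using hT hv) (by simpa using hne) h2'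
      rw [Set.pair_comm] at this
      split_ifs with hd
      · refine this.2 fun v hv hr => ?_
        exact (Finset.disjoint_left.1 hd) hv (by simpa using Or.inr hr)
      · exact this.1
  · refine ⟨by simpa using hF, hs, h.1, hc, fun v => by simp, fun v w => by simp⟩

namespace Model

lemma mem_V (h : Model G r s P) {v : α} : v ∈ V(G) ↔ v ∈ P.A ∨ v ∈ P.B := by
  rw [← h.frame.union]; simp

lemma mem_N_of_link (h : Model G r s P) {e : β} {v w : α} (he : G.IsLink e v w) (h1 : e ≠ r)
    (h2 : e ≠ s) : w ∈ P.N v := (h.mem_N v w).2 ⟨e, he, h1, h2⟩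

/-- The degree of a vertex in terms of the Hall graph. -/
lemma degree_eq (h : Model G r s P) (v : α) :
    degree G v = (P.N v).card + if v ∈ P.R then 1 else 0 := by
  have := h.simple
  set I : Set β := {e | G.Inc e v ∧ e ≠ r ∧ e ≠ s} with hI
  set J : Set β := {e | G.Inc e v ∧ (e = r ∨ e = s)} with hJ
  have hfinI : I.ncard = (P.N v).card ∧ I.Finite := by
    have : Nonempty β := ⟨r⟩
    choose! g hg using fun w (hw : w ∈ P.N v) => (h.mem_N v w).1 hw
    have hinj : Set.InjOn g (P.N v) := by
      intro w hw w' hw' heq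
      have h1 := (hg w hw).1
      rw [heq] at h1
      exact h1.right_unique (hg w' hw').1
    have himg : g '' (P.N v) = I := by
      ext e
      constructor
      · rintro ⟨w, hw, rfl⟩
        exact ⟨(hg w hw).1.inc_left, (hg w hw).2⟩
      · rintro ⟨⟨w, hw⟩, hne⟩
        have hwN := (h.mem_N v w).2 ⟨e, hw, hne⟩
        exact ⟨w, hwN, (hg w hwN).1.eq hw⟩
    rw [← himg]
    exact ⟨by rw [hinj.ncard_image, Set.ncard_coe_finset], (Finset.finite_toSet _).image g⟩
  have hJcard : J.ncard = if v ∈ P.R then 1 else 0 := by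
    split_ifs with hv
    · rw [h.mem_R] at hv
      rw [Set.ncard_eq_one]
      rcases hv with hv | hv
      · refine ⟨r, Set.eq_singleton_iff_unique_mem.2 ⟨⟨hv, Or.inl rfl⟩, ?_⟩⟩
        rintro e ⟨he, rfl | rfl⟩
        · rfl
        · exact (h.frame.not_mem (h.frame.r_inc hv) (h.frame.s_inc he)).elim
      · refine ⟨s, Set.eq_singleton_iff_unique_mem.2 ⟨⟨hv, Or.inr rfl⟩, ?_⟩⟩
        rintro e ⟨he, rfl | rfl⟩
        · exact (h.frame.not_mem (h.frame.r_inc he) (h.frame.s_inc hv)).elim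
        · rfl
    · rw [h.mem_R] at hv
      have : J = ∅ := by
        rw [Set.eq_empty_iff_forall_notMem]
        rintro e ⟨he, rfl | rfl⟩ <;> exact hv (by tauto)
      simp [this]
  have hJfin : J.Finite := (Set.toFinite {r, s}).subset fun e he => he.2
  have hd : Disjoint I J := by
    rw [Set.disjoint_left]
    rintro e ⟨_, h1, h2⟩ ⟨_, h3⟩
    tauto
  have hU : G.incidenceSet v = I ∪ J := by
    ext e
    simp only [Graph.mem_incidenceSet, hI, hJ, Set.mem_union, Set.mem_ofPred_eq]
    tauto
  rw [degree, hU, Set.ncard_union_eq hd hfinI.2 hJfin, hfinI.1, hJcard]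

lemma isCubic_of_free (h : Model G r s P) {v : α} (hv : P.Free v) : IsCubic G v := by
  rw [IsCubic, h.degree_eq, if_neg hv.2, hv.1]

lemma isCubic_of_special (h : Model G r s P) {v : α} (hv : P.Special v) : IsCubic G v := by
  rw [IsCubic, h.degree_eq, if_pos hv.mem_R, hv]

/-- The vertices of degree two after the deletion of an edge. -/
lemma degree_deleteEdges_eq_two_iff (h : Model G r s P) {f : β} {p q v : α} (hf : G.IsLink f p q)
    (hp : ¬ P.Special p) (hq : ¬ P.Special q) (hv : v ∈ V(G)) :
    degree (G.deleteEdges {f}) v = 2 ↔ (v = p ∨ v = q) ∧ P.Free v := by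
  have hd := h.degree_eq v
  have hv' := h.mem_V.1 hv
  have hset : (G.deleteEdges {f}).incidenceSet v = G.incidenceSet v \ {f} := by
    ext e; simp
  have h2 := HallGraph.two_le_card hv'
  have h3 : v ∉ P.R → 3 ≤ (P.N v).card := HallGraph.three_le_card hv'
  have hpos : (G.incidenceSet v).ncard ≠ 0 := by
    have : degree G v = (G.incidenceSet v).ncard := rfl
    omega
  have hfin := Set.finite_of_ncard_ne_zero hpos
  have hinc : f ∈ G.incidenceSet v ↔ v = p ∨ v = q := by
    constructor
    · exact fun h => Graph.Inc.eq_or_eq_of_isLink h hf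
    · rintro (rfl | rfl)
      exacts [hf.inc_left, hf.inc_right]
  unfold degree at hd ⊢
  rw [hset]
  by_cases hvpq : v = p ∨ v = q
  · have h4 := Set.ncard_sdiff_singleton_add_one (hinc.2 hvpq) hfin
    have h5 : (P.N v).card ≠ 2 := by
      rcases hvpq with rfl | rfl <;> assumption
    unfold HallGraph.Free
    split_ifs at hd with hR
    · simp only [hR, not_true, and_false, iff_false]
      omega
    · simp only [hR, not_false_iff, and_true, hvpq, true_and]
      omega
  · rw [Set.sdiff_singleton_eq_self (fun h => hvpq (hinc.1 h))]
    simp only [hvpq, false_and, iff_false]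
    split_ifs at hd with hR
    · omega
    · have := h3 hR
      omega

end Model
end Model
end RBrick

namespace RBrick

/-! ### Perfect matchings from Hall's theorem -/

section Matchings

variable {α β : Type*} {F : Graph α β} {A B : Set α} {r s : β}

/-- Hall's theorem gives an injection of `A'` into `B'`; equal sizes make it a bijection, that is, a
matching that misses exactly `D` and uses no edge of `R`. -/
lemma Frame.exists_pmOff [DecidableEq α] (h : Frame F A B r s) {A' B' : Finset α} (hA : (A' : Set α) ⊆ A)
    (hB : (B' : Set α) ⊆ B) (hcard : A'.card = B'.card) {N : α → Finset α}
    (hN : ∀ v, ∀ w ∈ N v, ∃ e, F.IsLink e v w ∧ e ≠ r ∧ e ≠ s)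
    (hall : ∀ S ⊆ A', S.card ≤ (S.biUnion N ∩ B').card) {D : Set α}
    (hD : ∀ v ∈ V(F), v ∉ D ↔ v ∈ A' ∨ v ∈ B') : ∃ M, PMOff F D M ∧ r ∉ M ∧ s ∉ M := by
  classical
  obtain ⟨φ, hφ, hφN⟩ := (Finset.all_card_le_biUnion_card_iff_exists_injective
    (fun v : A' => N v ∩ B')).1 (by
      intro S
      have := hall (S.map (Function.Embedding.subtype _)) (by
        intro v hv
        obtain ⟨w, -, rfl⟩ := Finset.mem_map.1 hv
        exact w.2)
      rw [Finset.card_map] at this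
      refine this.trans (Finset.card_le_card fun w hw => ?_)
      simp only [Finset.mem_inter, Finset.mem_biUnion, Finset.mem_map] at hw ⊢
      obtain ⟨⟨v, ⟨v', hv', rfl⟩, hw⟩, hwB⟩ := hw
      exact ⟨v', hv', hw, hwB⟩)
  have hφB : ∀ v, φ v ∈ B' := fun v => (Finset.mem_inter.1 (hφN v)).2
  choose g hg hgr hgs using fun v : A' => hN v (φ v) (Finset.mem_inter.1 (hφN v)).1
  have hsurj : ∀ w ∈ B', ∃ v, φ v = w := by
    intro w hw
    have : Finset.univ.image φ = B' := by
      refine Finset.eq_of_subset_of_card_le (fun x hx => ?_) ?_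
      · obtain ⟨v, -, rfl⟩ := Finset.mem_image.1 hx
        exact hφB v
      · rw [Finset.card_image_of_injective _ hφ, Finset.card_univ, Fintype.card_coe, hcard]
    rw [← this] at hw
    obtain ⟨v, -, rfl⟩ := Finset.mem_image.1 hw
    exact ⟨v, rfl⟩
  have hdis : ∀ (v : A') (w : A'), (v : α) ≠ φ w := fun v w heq =>
    h.not_mem (hA v.2) (heq ▸ hB (hφB w))
  refine ⟨Set.range g, ⟨?_, ?_, ?_⟩, ?_, ?_⟩
  · rintro _ ⟨v, rfl⟩
    exact (hg v).edge_mem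
  · rintro _ ⟨v, rfl⟩ x hx
    rw [hD x hx.vertex_mem]
    rcases hx.eq_or_eq_of_isLink (hg v) with rfl | rfl
    · exact Or.inl v.2
    · exact Or.inr (hφB v)
  · intro x hx hxD
    rcases (hD x hx).1 hxD with hxA | hxB
    · refine ⟨g ⟨x, hxA⟩, ⟨⟨_, rfl⟩, (hg ⟨x, hxA⟩).inc_left⟩, ?_⟩
      rintro _ ⟨⟨y, rfl⟩, hy⟩
      rcases hy.eq_or_eq_of_isLink (hg y) with h' | h'
      · congr 1
        exact Subtype.ext h'.symm
      · exact (hdis ⟨x, hxA⟩ y h').elim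
    · obtain ⟨v, rfl⟩ := hsurj x hxB
      refine ⟨g v, ⟨⟨_, rfl⟩, (hg v).inc_right⟩, ?_⟩
      rintro _ ⟨⟨y, rfl⟩, hy⟩
      rcases hy.eq_or_eq_of_isLink (hg y) with h' | h'
      · exact (hdis y v h'.symm).elim
      · rw [hφ h']
  · rintro ⟨v, hv⟩
    exact hgr v hv
  · rintro ⟨v, hv⟩
    exact hgs v hv

/-- Serves to put an edge of `R` back: Hall's theorem only produces matchings in the bipartite part,
so the ends of that edge are removed beforehand. -/
lemma PMOff.insert_link {D D' : Set α} {M : Set β} (h : PMOff F D' M) {e : β} {x y : α}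
    (he : F.IsLink e x y) (hx : x ∉ D) (hy : y ∉ D)
    (hD : ∀ v ∈ V(F), v ∈ D' ↔ v ∈ D ∨ v = x ∨ v = y) : PMOff F D (Insert.insert e M) := by
  have hxD := (hD x he.left_mem).2 (by tauto)
  have hyD := (hD y he.right_mem).2 (by tauto)
  refine ⟨Set.insert_subset he.edge_mem h.subset, ?_, fun w hw hwD => ?_⟩
  · rintro f (rfl | hf) v hv
    · rcases hv.eq_or_eq_of_isLink he with rfl | rfl <;> assumption
    · intro hvD
      exact h.off f hf v hv ((hD v hv.vertex_mem).2 (Or.inl hvD))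
  · by_cases hwxy : w = x ∨ w = y
    · refine ⟨e, ⟨Set.mem_insert _ _, ?_⟩, ?_⟩
      · rcases hwxy with rfl | rfl
        exacts [he.inc_left, he.inc_right]
      · rintro f ⟨rfl | hf, hi⟩
        · rfl
        · refine (h.off f hf w hi ?_).elim
          rcases hwxy with rfl | rfl <;> assumption
    · obtain ⟨f, ⟨hf, hi⟩, hu⟩ := h.cover w hw (fun h' => by
        rcases (hD w hw).1 h' with h' | h' <;> contradiction)
      refine ⟨f, ⟨Set.mem_insert_of_mem _ hf, hi⟩, ?_⟩
      rintro f' ⟨rfl | hf', hi'⟩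
      · exact (hwxy (hi'.eq_or_eq_of_isLink he)).elim
      · exact hu f' ⟨hf', hi'⟩

lemma Frame.deleteEdges (h : Frame F A B r s) {C : Set β} (hr : r ∉ C) (hs : s ∉ C) :
    Frame (F.deleteEdges C) A B r s := by
  obtain ⟨a, a', hl, ha⟩ := h.left
  obtain ⟨b, b', hl', hb⟩ := h.right
  exact ⟨h.finite, loopless_deleteEdges h.loopless C, h.disj, h.union, ⟨a, a', ⟨hl, hr⟩, ha⟩,
    ⟨b, b', ⟨hl', hs⟩, hb⟩, fun e u v he => h.link e u v he.1⟩

end Matchings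

/-! ### Surpluses and matchings after the deletion of a thin edge -/

namespace HallGraph

variable {α : Type*} [DecidableEq α] {P : HallGraph α} {p q : α}

/-- The neighbourhoods after the deletion of the edge `pq`. -/
def cutN (P : HallGraph α) (p q v : α) : Finset α :=
  if v = p then (P.N p).erase q else if v = q then (P.N q).erase p else P.N v

lemma mem_cutN {v w : α} :
    w ∈ P.cutN p q v ↔ w ∈ P.N v ∧ ¬ (v = p ∧ w = q) ∧ ¬ (v = q ∧ w = p) := by
  unfold cutN
  split_ifs with h1 h2
  · subst h1
    rw [Finset.mem_erase]
    constructor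
    · rintro ⟨h1, h2⟩
      refine ⟨h2, by tauto, ?_⟩
      rintro ⟨rfl, rfl⟩
      exact h1 rfl
    · tauto
  · subst h2
    rw [Finset.mem_erase]
    tauto
  · tauto

lemma cutN_comm (P : HallGraph α) (p q : α) : P.cutN p q = P.cutN q p := by
  ext v w
  rw [mem_cutN, mem_cutN]
  tauto

/-- The pairs of vertices which are the remaining neighbours of a free end of the edge `pq`. -/
def exceptional (P : HallGraph α) (p q : α) : Set (Sym2 α) :=
  {z | (P.Free p ∧ ∀ x, x ∈ z ↔ x ∈ (P.N p).erase q) ∨ (P.Free q ∧ ∀ x, x ∈ z ↔ x ∈ (P.N q).erase p)}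

lemma swap_thin (h : P.Thin p q) : P.swap.Thin p q :=
  ⟨h.adj, h.left_not_special, h.right_not_special,
    fun T hT => h.left T ⟨hT.1.symm, hT.2⟩, fun T hT => h.right T ⟨hT.1.symm, hT.2⟩,
    h.left_tri, h.right_tri⟩

lemma exceptional_comm : P.exceptional q p = P.exceptional p q := by
  ext z
  exact or_comm

/-- Being one-sided, `T` misses an end of the edge, say `q`. Then at most the neighbour `q` is lost,
and only if `p` is the sole neighbour of `q` in `T`. If `T` is not tight, it has one to spare. A
tight `T` equals `{p}`; since `p` is not special, it lies off `R` and is free, and its surplus drops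
from two to one. -/
lemma Thin.surplus (h : P.Thin p q) {T : Finset α} (hT : P.Side T) (hne : T.Nonempty)
    (hA : T ≠ P.A) (hB : T ≠ P.B) : T.card + 1 ≤ (T.biUnion (P.cutN p q)).card ∧
      ((∀ v ∈ T, v ∉ P.R) → ¬ (T = {p} ∧ P.Free p) → ¬ (T = {q} ∧ P.Free q) →
        T.card + 2 ≤ (T.biUnion (P.cutN p q)).card) := by
  wlog hq : q ∉ T generalizing p q
  · have hpT : p ∉ T := fun hp => (hT.same hp (not_not.1 hq)).not_adj h.adj
    have := this h.symm hpT
    rw [cutN_comm] at this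
    exact ⟨this.1, fun h1 h2 h3 => this.2 h1 h3 h2⟩
  have hh : T.card + P.req T ≤ (P.nb T).card := P.hall' hT hne hA hB
  have h1 := P.one_le_req T
  have hav : (∀ v ∈ T, v ∉ P.R) → P.req T = 2 := req_of_avoid
  by_cases hpriv : p ∈ T ∧ P.N q ∩ T = {p}
  · have hsub : (P.nb T).erase q ⊆ T.biUnion (P.cutN p q) := by
      intro w hw
      obtain ⟨hwq, hw⟩ := Finset.mem_erase.1 hw
      obtain ⟨v, hv, hw⟩ := mem_nb.1 hw
      refine Finset.mem_biUnion.2 ⟨v, hv, mem_cutN.2 ⟨hw, by tauto, ?_⟩⟩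
      rintro ⟨rfl, -⟩
      exact hq hv
    have hc := Finset.card_le_card hsub
    have hc' := Finset.pred_card_le_card_erase (s := P.nb T) (a := q)
    by_cases htight : (P.nb T).card = T.card + P.req T
    · have hTp := h.left T ⟨hT, hne, htight⟩ hpriv.1 hpriv.2
      subst hTp
      have hnbp : P.nb {p} = P.N p := by ext w; simp [mem_nb]
      have hpR : p ∉ P.R := by
        intro hpR
        have : P.req {p} = 1 := by
          unfold req
          rw [if_neg]
          simpa using hpR
        refine h.left_not_special ?_
        rw [hnbp, this] at htight
        simpa [Special] using htight
      have hreq := hav (by simpa using hpR)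
      refine ⟨by omega, fun _ hfree _ => (hfree ⟨rfl, ?_, hpR⟩).elim⟩
      rw [hnbp, hreq] at htight
      simpa using htight
    · refine ⟨by omega, fun hR _ _ => ?_⟩
      have := hav hR
      omega
  · have hsub : P.nb T ⊆ T.biUnion (P.cutN p q) := by
      intro w hw
      obtain ⟨v, hv, hw⟩ := mem_nb.1 hw
      by_cases hvw : v = p ∧ w = q
      · obtain ⟨rfl, rfl⟩ := hvw
        have : ¬ P.N w ∩ T ⊆ {v} := fun hs => hpriv ⟨hv, hs.antisymm (by
          simpa using ⟨P.symm hw, hv⟩)⟩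
        obtain ⟨x, hx, hxv⟩ := Finset.not_subset.1 this
        rw [Finset.mem_inter] at hx
        rw [Finset.mem_singleton] at hxv
        refine Finset.mem_biUnion.2 ⟨x, hx.2, mem_cutN.2 ⟨P.symm hx.1, by tauto, ?_⟩⟩
        rintro ⟨rfl, -⟩
        exact hq hx.2
      · refine Finset.mem_biUnion.2 ⟨v, hv, mem_cutN.2 ⟨hw, hvw, ?_⟩⟩
        rintro ⟨rfl, -⟩
        exact hq hv
    have hc := Finset.card_le_card hsub
    refine ⟨by omega, fun hR _ _ => ?_⟩
    have := hav hR
    omega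

end HallGraph

namespace Model

variable {α β : Type*} [DecidableEq α] {G : Graph α β} {r s f : β} {P : HallGraph α} {p q : α}

lemma frame_deleteEdges (h : Model G r s P) (hr : f ≠ r) (hs : f ≠ s) :
    Frame (G.deleteEdges {f}) P.A P.B r s :=
  h.frame.deleteEdges (fun h => hr h.symm) (fun h => hs h.symm)

lemma link_of_mem_cutN (h : Model G r s P) (hf : G.IsLink f p q) {v w : α}
    (hw : w ∈ P.cutN p q v) : ∃ e, (G.deleteEdges {f}).IsLink e v w ∧ e ≠ r ∧ e ≠ s := by
  rw [HallGraph.mem_cutN, h.mem_N] at hw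
  obtain ⟨⟨e, he, hes⟩, h1, h2⟩ := hw
  refine ⟨e, ⟨he, ?_⟩, hes⟩
  rintro rfl
  have := he.eq_and_eq_or_eq_and_eq hf
  tauto

/-- Remove the ends of `r` together with `u` and `v`, match the rest by Hall's theorem, and add `r`.
Subsets of what is left of `A` avoid `R`, so their surplus of two absorbs the loss of `u` and `v`.
The exception is a free end of the deleted edge, which fails only if `u` and `v` are precisely its
two remaining neighbours. -/
lemma matchable_right (h : Model G r s P) (ht : P.Thin p q) (hf : G.IsLink f p q) (hr : f ≠ r)
    (hs : f ≠ s) : ∀ u ∈ P.B, ∀ v ∈ P.B, u ≠ v → s(u, v) ∉ P.exceptional p q →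
      ∃ M, PMOff (G.deleteEdges {f}) {u, v} M ∧ s ∉ M := by
  intro u hu v hv huv hE
  have hF := h.frame_deleteEdges hr hs
  obtain ⟨a, a', hl, ha, ha'⟩ := hF.left
  have hloop := hF.loopless
  have hrA : ∀ x, x ∈ P.A → x ∈ P.R → x = a ∨ x = a' := by
    intro x hx hxR
    rcases (h.mem_R x).1 hxR with hx' | hx'
    · exact hx'.eq_or_eq_of_isLink hl.1
    · exact (h.frame.not_mem hx (h.frame.s_inc hx')).elim
  have haa' : a ≠ a' := hl.ne
  set A' := P.A \ {a, a'}
  set B' := P.B \ {u, v}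
  have hcA : A'.card = P.A.card - 2 := by
    rw [Finset.card_sdiff_of_subset, Finset.card_pair haa']
    simpa [Finset.insert_subset_iff] using ⟨ha, ha'⟩
  have hcB : B'.card = P.B.card - 2 := by
    rw [Finset.card_sdiff_of_subset, Finset.card_pair huv]
    simpa [Finset.insert_subset_iff] using ⟨hu, hv⟩
  have hnotB : ∀ x, x ∈ P.A → x ∉ P.B := fun x hx hx' => HallGraph.not_mem_A_B hx hx'
  have key : ∃ M, PMOff (G.deleteEdges {f}) {u, v, a, a'} M ∧ r ∉ M ∧ s ∉ M := by
    refine hF.exists_pmOff (A' := A') (B' := B') (N := P.cutN p q)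
      (D := {u, v, a, a'}) (by intro x hx; exact (Finset.mem_sdiff.1 hx).1)
      (by intro x hx; exact (Finset.mem_sdiff.1 hx).1) (by rw [hcA, hcB, P.card_eq])
      (fun x w hw => h.link_of_mem_cutN hf hw) ?_ ?_
    · intro S hS
      rcases S.eq_empty_or_nonempty with rfl | hne
      · simp
      have hSA : S ⊆ P.A := fun x hx => (Finset.mem_sdiff.1 (hS hx)).1
      have hav : ∀ x ∈ S, x ∉ P.R := by
        intro x hx hxR
        have h1 := (Finset.mem_sdiff.1 (hS hx)).2
        have := hrA x (hSA hx) hxR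
        simp only [Finset.mem_insert, Finset.mem_singleton] at h1
        exact h1 this
      have hSneA := HallGraph.avoid_ne hav
      have hsurp := (ht.surplus (Or.inl hSA) hne hSneA.1 hSneA.2).2 hav
      have hsubB : S.biUnion (P.cutN p q) ⊆ P.B := by
        intro w hw
        obtain ⟨x, hx, hw⟩ := Finset.mem_biUnion.1 hw
        rcases P.mem (HallGraph.mem_cutN.1 hw).1 with h' | h'
        · exact h'.2
        · exact (hnotB x (hSA hx) h'.1).elim
      have hinter : S.biUnion (P.cutN p q) ∩ B' = S.biUnion (P.cutN p q) \ {u, v} := by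
        ext w
        simp only [Finset.mem_inter, B', Finset.mem_sdiff]
        exact ⟨fun h => ⟨h.1, h.2.2⟩, fun h => ⟨h.1, hsubB h.1, h.2⟩⟩
      rw [hinter]
      have hcard2 : ({u, v} : Finset α).card = 2 := Finset.card_pair huv
      have hle := Finset.le_card_sdiff {u, v} (S.biUnion (P.cutN p q))
      by_cases hexc : (S = {p} ∧ P.Free p) ∨ (S = {q} ∧ P.Free q)
      · have aux : ∀ {p q : α}, q ∈ P.N p → P.Free p → s(u, v) ∉ P.exceptional p q →
            1 ≤ (({p} : Finset α).biUnion (P.cutN p q) \ {u, v}).card := by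
          intro p q hq hfree hE
          rw [Nat.one_le_iff_ne_zero, Finset.card_ne_zero, Finset.sdiff_nonempty]
          intro hsub
          refine hE (Or.inl ⟨hfree, fun x => ?_⟩)
          have hc : ((P.N p).erase q).card = 2 := by
            rw [Finset.card_erase_of_mem hq, hfree.1]
          have heq : ({p} : Finset α).biUnion (P.cutN p q) = (P.N p).erase q := by
            rw [Finset.singleton_biUnion, HallGraph.cutN, if_pos rfl]
          rw [heq] at hsub
          have := Finset.eq_of_subset_of_card_le hsub (by omega)
          rw [this]
          simp
        rcases hexc with ⟨rfl, hfree⟩ | ⟨rfl, hfree⟩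
        · exact aux ht.adj hfree hE
        · have := aux (P.symm ht.adj) hfree (by rwa [HallGraph.exceptional_comm])
          rw [HallGraph.cutN_comm] at this
          simpa using this
      · push Not at hexc
        have := hsurp (fun h => hexc.1 h.1 h.2) (fun h => hexc.2 h.1 h.2)
        omega
    · intro x hx
      have hx' : x ∈ P.A ∨ x ∈ P.B := h.mem_V.1 hx
      have k1 := hnotB x
      have ea : x = a → x ∈ P.A := fun h => h ▸ ha
      have ea' : x = a' → x ∈ P.A := fun h => h ▸ ha'
      have eu : x = u → x ∈ P.B := fun h => h ▸ hu
      have ev : x = v → x ∈ P.B := fun h => h ▸ hv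
      simp only [Set.mem_insert_iff, Set.mem_singleton_iff, A', B', Finset.mem_sdiff,
        Finset.mem_insert, Finset.mem_singleton]
      tauto
  obtain ⟨M, hM, hrM, hsM⟩ := key
  refine ⟨_, hM.insert_link (D := {u, v}) hl ?_ ?_ ?_, ?_⟩
  · rintro (rfl | rfl)
    exacts [hnotB _ ha hu, hnotB _ ha hv]
  · rintro (rfl | rfl)
    exacts [hnotB _ ha' hu, hnotB _ ha' hv]
  · intro x _
    simp only [Set.mem_insert_iff, Set.mem_singleton_iff]
    tauto
  · rintro (rfl | h')
    · exact hF.ne rfl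
    · exact hsM h'

/-- The perfect matchings which remain after the deletion of a thin edge. -/
theorem matchable (h : Model G r s P) (ht : P.Thin p q) (hf : G.IsLink f p q) (hr : f ≠ r)
    (hs : f ≠ s) : Matchable (G.deleteEdges {f}) P.A P.B r s (P.exceptional p q) := by
  have hF := h.frame_deleteEdges hr hs
  refine ⟨?_, h.swap.matchable_right (HallGraph.swap_thin ht) hf hs hr,
    h.matchable_right ht hf hr hs⟩
  intro a ha b hb
  have ha' : a ∈ P.A := ha
  have hb' : b ∈ P.B := hb
  have hnotB : ∀ x, x ∈ P.A → x ∉ P.B := fun x hx hx' => HallGraph.not_mem_A_B hx hx'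
  -- Only `b` is missing among the possible mates, so a surplus of one suffices.
  refine hF.exists_pmOff (A' := P.A.erase a) (B' := P.B.erase b) (N := P.cutN p q)
    (by intro x hx; exact (Finset.mem_erase.1 hx).2) (by intro x hx; exact (Finset.mem_erase.1 hx).2)
    (by rw [Finset.card_erase_of_mem ha', Finset.card_erase_of_mem hb', P.card_eq])
    (fun x w hw => h.link_of_mem_cutN hf hw) ?_ ?_
  · intro S hS
    rcases S.eq_empty_or_nonempty with rfl | hne
    · simp
    have hSA : S ⊆ P.A := fun x hx => (Finset.mem_erase.1 (hS hx)).2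
    have hSneA : S ≠ P.A := by
      rintro rfl
      exact (Finset.mem_erase.1 (hS ha')).1 rfl
    have hSneB : S ≠ P.B := by
      rintro rfl
      exact hnotB b (hSA hb') hb'
    have hsurp := (ht.surplus (Or.inl hSA) hne hSneA hSneB).1
    have hsub : (S.biUnion (P.cutN p q)).erase b ⊆ S.biUnion (P.cutN p q) ∩ P.B.erase b := by
      intro w hw
      obtain ⟨hwb, hw⟩ := Finset.mem_erase.1 hw
      refine Finset.mem_inter.2 ⟨hw, Finset.mem_erase.2 ⟨hwb, ?_⟩⟩
      obtain ⟨x, hx, hw⟩ := Finset.mem_biUnion.1 hw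
      rcases P.mem (HallGraph.mem_cutN.1 hw).1 with h' | h'
      · exact h'.2
      · exact (hnotB x (hSA hx) h'.1).elim
    have h1 := Finset.card_le_card hsub
    have h2 := Finset.pred_card_le_card_erase (s := S.biUnion (P.cutN p q)) (a := b)
    omega
  · intro x hx
    have hx' : x ∈ P.A ∨ x ∈ P.B := h.mem_V.1 hx
    have k1 := hnotB x
    have ea : x = a → x ∈ P.A := fun h => h ▸ ha'
    have eb : x = b → x ∈ P.B := fun h => h ▸ hb'
    simp only [Set.mem_insert_iff, Set.mem_singleton_iff, Finset.mem_erase]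
    tauto

end Model
end RBrick

namespace RBrick

/-! ### The retract after the deletion of a thin edge -/

section Contract

variable {γ β : Type*} {F : Graph γ β}

lemma deleteEdges_map {δ : Type*} (π : γ → δ) (C : Set β) :
    (F.map π).deleteEdges C = (F.deleteEdges C).map π := by
  refine Graph.ext rfl fun e x y => ?_
  constructor
  · rintro ⟨⟨u, v, h, rfl, rfl⟩, he⟩
    exact ⟨u, v, ⟨h, he⟩, rfl, rfl⟩
  · rintro ⟨u, v, ⟨h, he⟩, rfl, rfl⟩
    exact ⟨⟨u, v, h, rfl, rfl⟩, he⟩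

/-- Contracting edges amounts to choosing a representative in each of their components. -/
lemma contractEdges_eq_map {C : Set β} {ψ : γ → γ}
    (hψ : ∀ x ∈ V(F), x = ψ x ∨ ∃ c ∈ C, F.IsLink c x (ψ x))
    (hconst : ∀ c ∈ C, ∀ x y, F.IsLink c x y → ψ x = ψ y)
    (hidem : ∀ x ∈ V(F), ψ (ψ x) = ψ x) :
    ∃ τ : γ → Set γ, Set.InjOn τ V((F.deleteEdges C).map ψ) ∧
      contractEdges F C = ((F.deleteEdges C).map ψ).map τ := by
  set cls : γ → Set γ := fun v =>
    {w | Relation.ReflTransGen (fun p q => ∃ c ∈ C, F.IsLink c p q) v w} with hcls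
  have hsymm : ∀ x y, Relation.ReflTransGen (fun p q => ∃ c ∈ C, F.IsLink c p q) x y →
      Relation.ReflTransGen (fun p q => ∃ c ∈ C, F.IsLink c p q) y x := by
    intro x y h
    induction h with
    | refl => exact .refl
    | tail _ hs ih =>
      obtain ⟨c, hc, hl⟩ := hs
      exact .head ⟨c, hc, hl.symm⟩ ih
  refine ⟨cls, ?_, ?_⟩
  · rintro _ ⟨x, hx, rfl⟩ _ ⟨y, hy, rfl⟩ heq
    have hr : Relation.ReflTransGen (fun p q => ∃ c ∈ C, F.IsLink c p q) (ψ x) (ψ y) := by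
      have : ψ y ∈ cls (ψ y) := Relation.ReflTransGen.refl
      rw [← heq] at this
      exact this
    have : ∀ u v, Relation.ReflTransGen (fun p q => ∃ c ∈ C, F.IsLink c p q) u v → ψ u = ψ v := by
      intro u v h
      induction h with
      | refl => rfl
      | tail _ hs ih =>
        obtain ⟨c, hc, hl⟩ := hs
        exact ih.trans (hconst c hc _ _ hl)
    have := this _ _ hr
    rwa [hidem x hx, hidem y hy] at this
  · rw [Graph.map_map, contractEdges]
    refine Graph.map_eq_of_eqOn fun x hx => ?_
    have hr : Relation.ReflTransGen (fun p q => ∃ c ∈ C, F.IsLink c p q) x (ψ x) := by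
      rcases hψ x hx with h | h
      · rw [← h]
      · exact .single h
    ext w
    exact ⟨fun h => (hsymm _ _ hr).trans h, fun h => hr.trans h⟩

lemma Bicontraction.ncard {δ : Type*} {π : γ → δ} {v v₁ v₂ : γ} {g₁ g₂ : β}
    (h : Bicontraction F π v v₁ v₂ g₁ g₂) (hF : F.Loopless) (hfin : V(F).Finite) :
    V((F.deleteEdges {g₁, g₂}).map π).ncard + 2 = V(F).ncard := by
  have hsub : {v₁, v₂} ⊆ V(F) := by
    rintro x (rfl | rfl)
    exacts [h.link₁.right_mem, h.link₂.right_mem]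
  have hv₁ : v ≠ v₁ := h.link₁.ne
  have hv₂ : v ≠ v₂ := h.link₂.ne
  have hc := Set.ncard_sdiff_add_ncard_of_subset hsub hfin
  rw [Set.ncard_pair h.ne] at hc
  rw [← hc]
  congr 1
  have himg : V((F.deleteEdges {g₁, g₂}).map π) = π '' (V(F) \ {v₁, v₂}) := by
    show π '' V(F) = _
    ext z
    constructor
    · rintro ⟨x, hx, rfl⟩
      by_cases hx' : x ∈ ({v₁, v₂} : Set γ)
      · refine ⟨v, ⟨h.link₁.left_mem, by simp [hv₁, hv₂]⟩, ?_⟩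
        rcases hx' with rfl | rfl
        exacts [h.map_left.symm, h.map_right.symm]
      · exact ⟨x, ⟨hx, hx'⟩, rfl⟩
    · rintro ⟨x, hx, rfl⟩
      exact ⟨x, hx.1, rfl⟩
  rw [himg, Set.InjOn.ncard_image]
  rintro x ⟨hx, hx'⟩ y ⟨hy, hy'⟩ hxy
  simp only [Set.mem_insert_iff, Set.mem_singleton_iff, not_or] at hx' hy'
  rcases (h.ker x hx y hy).1 hxy with h1 | ⟨h1, h2⟩
  · exact h1
  · rw [h1.resolve_right (by tauto), h2.resolve_right (by tauto)]

end Contract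

/-- Identify the vertices in `T` with `v`. -/
def merge {α : Type*} [DecidableEq α] (T : Finset α) (v x : α) : α := if x ∈ T then v else x

section Merge

variable {α : Type*} [DecidableEq α] {T : Finset α} {v x y : α}

lemma merge_of_mem (h : x ∈ T) : merge T v x = v := if_pos h

lemma merge_of_notMem (h : x ∉ T) : merge T v x = x := if_neg h

lemma merge_eq_iff (hv : v ∈ T) : merge T v x = merge T v y ↔ x = y ∨ x ∈ T ∧ y ∈ T := by
  by_cases hx : x ∈ T <;> by_cases hy : y ∈ T
  · simp [merge_of_mem hx, merge_of_mem hy, hx, hy]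
  · rw [merge_of_mem hx, merge_of_notMem hy]
    constructor
    · rintro rfl; contradiction
    · rintro (rfl | h)
      · contradiction
      · exact (hy h.2).elim
  · rw [merge_of_notMem hx, merge_of_mem hy]
    constructor
    · rintro rfl; contradiction
    · rintro (rfl | h)
      · contradiction
      · exact (hx h.1).elim
  · rw [merge_of_notMem hx, merge_of_notMem hy]
    tauto

end Merge

namespace HallGraph

variable {α : Type*} [DecidableEq α] {P : HallGraph α} {p q : α}

/-- The end `p` of the edge `pq` together with its other neighbours. -/
def triple (P : HallGraph α) (p q : α) : Finset α := insert p ((P.N p).erase q)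

open Classical in
/-- The identification of vertices in the retract after the deletion of the edge `pq`. -/
noncomputable def collapse (P : HallGraph α) (p q x : α) : α :=
  if P.Free p ∧ x ∈ P.triple p q then p else if P.Free q ∧ x ∈ P.triple q p then q else x

lemma mem_triple {x : α} : x ∈ P.triple p q ↔ x = p ∨ x ∈ P.N p ∧ x ≠ q := by
  rw [triple, Finset.mem_insert, Finset.mem_erase, and_comm]

lemma self_mem_triple : p ∈ P.triple p q := mem_triple.2 (Or.inl rfl)

/-- Apart from `p`, the triple at `p` lies in the class of `q`, and vice versa. The two
bicontractions thus do not interfere. -/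
lemma not_mem_triple (h : q ∈ P.N p) {x : α} (hx : x ∈ P.triple p q) : x ∉ P.triple q p := by
  rw [mem_triple] at hx ⊢
  have hpq := ne_of_adj h
  have h1 := P.mem h
  have hA := @not_mem_A_B _ _ P p
  have hB := @not_mem_A_B _ _ P q
  rintro (h2 | ⟨h2, h3⟩)
  · rcases hx with hx | hx
    · exact hpq (hx.symm.trans h2)
    · exact hx.2 h2
  · rcases hx with hx | hx
    · exact h3 hx
    · have hs : P.Same x q := same_of_mem hx.1 h
      exact hs.symm.not_adj h2

lemma collapse_comm (h : q ∈ P.N p) : P.collapse p q = P.collapse q p := by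
  ext x
  unfold collapse
  by_cases h1 : x ∈ P.triple p q
  · have := not_mem_triple h h1
    simp [this]
  · simp [h1]

lemma collapse_eq_iff (h : q ∈ P.N p) {x y : α} : P.collapse p q x = P.collapse p q y ↔
    x = y ∨ (P.Free p ∧ x ∈ P.triple p q ∧ y ∈ P.triple p q) ∨
      (P.Free q ∧ x ∈ P.triple q p ∧ y ∈ P.triple q p) := by
  have hpq := ne_of_adj h
  have hp := @self_mem_triple _ _ P p q
  have hq := @self_mem_triple _ _ P q p
  have cases : ∀ z, (P.collapse p q z = p ∧ P.Free p ∧ z ∈ P.triple p q) ∨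
      (P.collapse p q z = q ∧ P.Free q ∧ z ∈ P.triple q p) ∨
      (P.collapse p q z = z ∧ ¬ (P.Free p ∧ z ∈ P.triple p q) ∧ ¬ (P.Free q ∧ z ∈ P.triple q p)) := by
    intro z
    unfold collapse
    split_ifs with h1 h2
    · exact Or.inl ⟨rfl, h1⟩
    · exact Or.inr (Or.inl ⟨rfl, h2⟩)
    · exact Or.inr (Or.inr ⟨rfl, h1, h2⟩)
  constructor
  · intro heq
    rcases cases x with ⟨ex, h1, h2⟩ | ⟨ex, h1, h2⟩ | ⟨ex, h1, h2⟩ <;>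
      rcases cases y with ⟨ey, h3, h4⟩ | ⟨ey, h3, h4⟩ | ⟨ey, h3, h4⟩ <;> rw [ex, ey] at heq
    · exact Or.inr (Or.inl ⟨h1, h2, h4⟩)
    · exact absurd heq hpq
    · exact absurd ⟨h1, heq ▸ hp⟩ h3
    · exact absurd heq.symm hpq
    · exact Or.inr (Or.inr ⟨h1, h2, h4⟩)
    · exact absurd ⟨h1, heq ▸ hq⟩ h4
    · exact absurd ⟨h3, heq.symm ▸ hp⟩ h1
    · exact absurd ⟨h3, heq.symm ▸ hq⟩ h2
    · exact Or.inl heq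
  · rintro (rfl | ⟨h1, h2, h3⟩ | ⟨h1, h2, h3⟩)
    · rfl
    · simp [collapse, h1, h2, h3]
    · rw [collapse_comm h]
      simp [collapse, h1, h2, h3]

lemma collapse_idem (h : q ∈ P.N p) (x : α) :
    P.collapse p q (P.collapse p q x) = P.collapse p q x := by
  rw [collapse_eq_iff h]
  have hp := @self_mem_triple _ _ P p q
  have hq := @self_mem_triple _ _ P q p
  unfold collapse
  split_ifs with h1 h2
  · exact Or.inr (Or.inl ⟨h1.1, hp, h1.2⟩)
  · exact Or.inr (Or.inr ⟨h2.1, hq, h2.2⟩)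
  · exact Or.inl rfl

end HallGraph

namespace Model

variable {α β : Type*} [DecidableEq α] {G : Graph α β} {r s f : β} {P : HallGraph α} {p q : α}

/-- The edges at a free end of the deleted edge. -/
lemma inc_deleteEdges_of_free (h : Model G r s P) (hf : G.IsLink f p q) (hp : P.Free p) {e : β}
    {x : α} : (G.deleteEdges {f}).IsLink e p x ↔ G.IsLink e p x ∧ x ∈ (P.N p).erase q := by
  have := h.simple
  constructor
  · rintro ⟨he, hef⟩
    refine ⟨he, Finset.mem_erase.2 ⟨?_, h.mem_N_of_link he ?_ ?_⟩⟩
    · rintro rfl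
      exact hef (he.eq hf)
    · rintro rfl
      exact hp.2 ((h.mem_R p).2 (Or.inl he.inc_left))
    · rintro rfl
      exact hp.2 ((h.mem_R p).2 (Or.inr he.inc_left))
  · rintro ⟨he, hx⟩
    refine ⟨he, ?_⟩
    rintro rfl
    exact (Finset.mem_erase.1 hx).1 (he.right_unique hf)

lemma link_of_mem (h : Model G r s P) {v w : α} (hw : w ∈ P.N v) : ∃ e, G.IsLink e v w := by
  obtain ⟨e, he, -⟩ := (h.mem_N v w).1 hw
  exact ⟨e, he⟩

lemma degreeTwoEdges_eq (h : Model G r s P) (hf : G.IsLink f p q) (hp : ¬ P.Special p)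
    (hq : ¬ P.Special q) : degreeTwoEdges (G.deleteEdges {f}) =
      {e | ∃ v, (G.deleteEdges {f}).Inc e v ∧ (v = p ∨ v = q) ∧ P.Free v} := by
  ext e
  constructor
  · rintro ⟨v, hv, hd⟩
    exact ⟨v, hv, (h.degree_deleteEdges_eq_two_iff hf hp hq hv.vertex_mem).1 hd⟩
  · rintro ⟨v, hv, hd⟩
    exact ⟨v, hv, (h.degree_deleteEdges_eq_two_iff hf hp hq hv.vertex_mem).2 hd⟩

/-- The retract of `G - f`, up to the names of its vertices. -/
noncomputable def core (G : Graph α β) (P : HallGraph α) (f : β) (p q : α) : Graph α β :=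
  ((G.deleteEdges {f}).deleteEdges (degreeTwoEdges (G.deleteEdges {f}))).map (P.collapse p q)

/-- The vertices of degree two in `G - f` are the free ends of `f`, so the contracted edges form a
star on each triple and `collapse` picks its centre. The map `τ` only renames vertices as the sets
used in the definition of the retract. -/
lemma retract_eq (h : Model G r s P) (hf : G.IsLink f p q) (hadj : q ∈ P.N p)
    (hp : ¬ P.Special p) (hq : ¬ P.Special q) :
    ∃ τ : α → Set α, Set.InjOn τ V(core G P f p q) ∧
      retract (G.deleteEdges {f}) = (core G P f p q).map τ := by
  refine contractEdges_eq_map ?_ ?_ fun x _ => HallGraph.collapse_idem hadj x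
  · intro x _
    have aux : ∀ {p q}, G.IsLink f p q → P.Free p → x ∈ P.triple p q →
        x = p ∨ ∃ c, (∃ v, (G.deleteEdges {f}).Inc c v ∧ v = p ∧ P.Free v) ∧
          (G.deleteEdges {f}).IsLink c x p := by
      intro p q hf hp hx
      rcases HallGraph.mem_triple.1 hx with hx | hx
      · exact Or.inl hx
      · obtain ⟨e, he⟩ := h.link_of_mem hx.1
        have hl := (h.inc_deleteEdges_of_free hf hp (x := x)).2
          ⟨he, Finset.mem_erase.2 ⟨hx.2, hx.1⟩⟩
        exact Or.inr ⟨e, ⟨p, hl.inc_left, rfl, hp⟩, hl.symm⟩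
    rw [h.degreeTwoEdges_eq hf hp hq]
    unfold HallGraph.collapse
    split_ifs with h1 h2
    · rcases aux hf h1.1 h1.2 with h' | ⟨c, ⟨v, hv, hvp, hvF⟩, hl⟩
      · exact Or.inl h'
      · exact Or.inr ⟨c, ⟨v, hv, Or.inl hvp, hvF⟩, hl⟩
    · rcases aux hf.symm h2.1 h2.2 with h' | ⟨c, ⟨v, hv, hvp, hvF⟩, hl⟩
      · exact Or.inl h'
      · exact Or.inr ⟨c, ⟨v, hv, Or.inr hvp, hvF⟩, hl⟩
    · exact Or.inl rfl
  · intro c hc x y hxy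
    rw [h.degreeTwoEdges_eq hf hp hq] at hc
    obtain ⟨v, ⟨w, hvw⟩, hv, hvF⟩ := hc
    have hsame : P.collapse p q v = P.collapse p q w := by
      rw [HallGraph.collapse_eq_iff hadj]
      have aux : ∀ {p q}, G.IsLink f p q → v = p → P.Free p ∧ v ∈ P.triple p q ∧ w ∈ P.triple p q := by
        rintro p q hf rfl
        have := ((h.inc_deleteEdges_of_free hf hvF).1 hvw).2
        exact ⟨hvF, HallGraph.self_mem_triple, Finset.mem_insert_of_mem this⟩
      rcases hv with hv | hv
      · exact Or.inr (Or.inl (aux hf hv))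
      · exact Or.inr (Or.inr (aux hf.symm hv))
    rcases hxy.eq_and_eq_or_eq_and_eq hvw with ⟨rfl, rfl⟩ | ⟨rfl, rfl⟩
    · exact hsame
    · exact hsame.symm

end Model
end RBrick

/-! ### Bicontracting the free ends of a thin edge -/

namespace RBrick
namespace Model

variable {α β : Type*} [DecidableEq α] {G : Graph α β} {r s f : β} {P : HallGraph α} {p q : α}

lemma mem_B_of_mem_N {x y : α} (hx : x ∈ P.A) (hy : y ∈ P.N x) : y ∈ P.B := by
  rcases P.mem hy with h | h
  · exact h.2
  · exact (HallGraph.not_mem_A_B hx h.1).elim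

lemma mem_A_of_mem_N {x y : α} (hx : x ∈ P.B) (hy : y ∈ P.N x) : y ∈ P.A :=
  mem_B_of_mem_N (P := P.swap) hx hy

lemma ncard_V (h : Model G r s P) : V(G).ncard = 2 * P.A.card := by
  rw [← h.frame.union, ← Finset.coe_union, Set.ncard_coe_finset,
    Finset.card_union_of_disjoint P.disj, ← P.card_eq]
  omega

/-- A free end of a thin edge can be bicontracted. -/
lemma exists_bicontraction (h : Model G r s P) (ht : P.Thin p q) (hf : G.IsLink f p q)
    (hp : P.Free p) : ∃ p₁ p₂ g₁ g₂, (P.N p).erase q = {p₁, p₂} ∧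
      Bicontraction (G.deleteEdges {f}) (merge (P.triple p q) p) p p₁ p₂ g₁ g₂ ∧
      (G.deleteEdges {f}).incidenceSet p = {g₁, g₂} := by
  have hs := h.simple
  have hc : ((P.N p).erase q).card = 2 := by
    rw [Finset.card_erase_of_mem ht.adj, hp.1]
  obtain ⟨p₁, p₂, hne, heq⟩ := Finset.card_eq_two.1 hc
  have hm : ∀ x, x ∈ (P.N p).erase q ↔ x = p₁ ∨ x = p₂ := by rw [heq]; simp
  obtain ⟨h1q, h1⟩ := Finset.mem_erase.1 ((hm p₁).2 (Or.inl rfl))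
  obtain ⟨h2q, h2⟩ := Finset.mem_erase.1 ((hm p₂).2 (Or.inr rfl))
  obtain ⟨g₁, hg₁⟩ := h.link_of_mem h1
  obtain ⟨g₂, hg₂⟩ := h.link_of_mem h2
  have l1 := (h.inc_deleteEdges_of_free hf hp).2 ⟨hg₁, (hm _).2 (Or.inl rfl)⟩
  have l2 := (h.inc_deleteEdges_of_free hf hp).2 ⟨hg₂, (hm _).2 (Or.inr rfl)⟩
  have hinc : ∀ e, (G.deleteEdges {f}).Inc e p → e = g₁ ∨ e = g₂ := by
    rintro e ⟨x, hx⟩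
    obtain ⟨he, hxm⟩ := (h.inc_deleteEdges_of_free hf hp).1 hx
    rcases (hm x).1 hxm with rfl | rfl
    · exact Or.inl (he.eq hg₁)
    · exact Or.inr (he.eq hg₂)
  refine ⟨p₁, p₂, g₁, g₂, heq, ⟨l1, l2, hinc, hne, ?_, ?_⟩, ?_⟩
  -- An edge between `p₁` and `p₂`, which have the same colour, would belong to `R`; `left_tri`
  -- excludes this.
  · rintro e ⟨he, -⟩
    have hsame : P.Same p₁ p₂ := HallGraph.same_of_mem h1 h2
    by_cases hers : e = r ∨ e = s
    · refine ht.left_tri hp fun x hx => ?_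
      rw [h.mem_R]
      rcases (hm x).1 hx with rfl | rfl <;> rcases hers with rfl | rfl
      exacts [Or.inl he.inc_left, Or.inr he.inc_left, Or.inl he.inc_right, Or.inr he.inc_right]
    · push Not at hers
      exact hsame.not_adj (h.mem_N_of_link he hers.1 hers.2)
  · intro x _ y _
    rw [merge_eq_iff HallGraph.self_mem_triple]
    simp only [HallGraph.triple, Finset.mem_insert, hm]
  · ext e
    constructor
    · exact fun he => hinc e he
    · rintro (rfl | rfl)
      exacts [l1.inc_left, l2.inc_left]

lemma triple_eq {p₁ p₂ : α} (h : (P.N p).erase q = {p₁, p₂}) :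
    ∀ x, x ∈ ({p, p₁, p₂} : Set α) ↔ x ∈ P.triple p q := by
  intro x
  rw [HallGraph.triple, h]
  simp

lemma exists_nbr_ne (x : α) {y : α} (hy : y ∈ P.A ∨ y ∈ P.B) : ∃ z ∈ P.N y, z ≠ x := by
  by_contra! hcon
  have h2 := HallGraph.two_le_card hy
  have : P.N y ⊆ {x} := fun z hz => by simpa using hcon z hz
  have := Finset.card_le_card this
  simp at this
  omega

/-- The graph obtained from `G - f` by bicontracting a free end of `f`. -/
lemma bicontract_left (h : Model G r s P) (ht : P.Thin p q) (hf : G.IsLink f p q) (hr : f ≠ r)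
    (hs : f ≠ s) (hpA : p ∈ P.A) (hp : P.Free p) {J : Graph α β}
    (hJ : J = ((G.deleteEdges {f}).deleteEdges ((G.deleteEdges {f}).incidenceSet p)).map
      (merge (P.triple p q) p)) :
    Frame J (merge (P.triple p q) p '' (P.A \ {p})) (merge (P.triple p q) p '' P.B) r s ∧
    Matchable J (merge (P.triple p q) p '' (P.A \ {p})) (merge (P.triple p q) p '' P.B) r s
      {z | P.Free q ∧ ∀ x, x ∈ z ↔ x ∈ (P.N q).erase p} ∧
    V(J).ncard + 2 = V(G).ncard ∧ (∀ n, HasBrickCount J n → HasBrickCount (G.deleteEdges {f}) n) := by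
  obtain ⟨p₁, p₂, g₁, g₂, hN, hb, hinc⟩ := h.exists_bicontraction ht hf hp
  have hF := h.frame_deleteEdges hr hs
  have hm := h.matchable ht hf hr hs
  have hm1 : p₁ ∈ (P.N p).erase q := by rw [hN]; simp
  have hm2 : p₂ ∈ (P.N p).erase q := by rw [hN]; simp
  have hp1 : p₁ ∈ P.N p := Finset.mem_of_mem_erase hm1
  have hp2 : p₂ ∈ P.N p := Finset.mem_of_mem_erase hm2
  have hp1B := mem_B_of_mem_N hpA hp1
  have hp2B := mem_B_of_mem_N hpA hp2
  rw [hinc] at hJ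
  subst hJ
  refine ⟨hb.frame hF hpA hp1B hp2B, hb.matchable hF hpA hp1B hp2B hm ?_,
    hb.ncard hF.loopless hF.finite, ?_⟩
  -- The exceptional pair at `p` is merged into one vertex, while the pair at `q` is left untouched.
  · intro x y hxy hxp hyp hne
    rcases hxy with ⟨-, hxy⟩ | ⟨hq, hxy⟩
    · have hx : x ∈ P.triple p q := Finset.mem_insert_of_mem ((hxy x).1 (by simp))
      have hy : y ∈ P.triple p q := Finset.mem_insert_of_mem ((hxy y).1 (by simp))
      exact (hne (by rw [merge_of_mem hx, merge_of_mem hy])).elim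
    · have hfix : ∀ z, z ∈ s(x, y) → merge (P.triple p q) p z = z := by
        intro z hz
        apply merge_of_notMem
        exact HallGraph.not_mem_triple (P.symm ht.adj)
          (Finset.mem_insert_of_mem ((hxy z).1 hz))
      rw [hfix x (by simp), hfix y (by simp)]
      exact ⟨hq, hxy⟩
  · intro n hn
    -- A neighbour of `p` has an edge leaving the triple; these edges complete the four-cycle of the
    -- brace that is split off.
    have hnbr : ∀ y ∈ (P.N p).erase q, ∃ w ∈ P.A, w ∉ ({p, p₁, p₂} : Set α) ∧
        (G.deleteEdges {f}).Adj y w := by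
      intro y hy
      obtain ⟨hyq, hy⟩ := Finset.mem_erase.1 hy
      have hyB := mem_B_of_mem_N hpA hy
      obtain ⟨z, hz, hzp⟩ := exists_nbr_ne p (Or.inr hyB)
      have hzA := mem_A_of_mem_N hyB hz
      refine ⟨z, hzA, ?_, ?_⟩
      · rintro (rfl | rfl | rfl)
        · exact hzp rfl
        · exact HallGraph.not_mem_A_B hzA hp1B
        · exact HallGraph.not_mem_A_B hzA hp2B
      · obtain ⟨e, he⟩ := h.link_of_mem hz
        refine ⟨e, he, ?_⟩
        rintro rfl
        rcases he.left_eq_or_eq hf with rfl | rfl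
        · exact HallGraph.not_mem_A_B hpA hyB
        · exact hyq rfl
    refine HasBrickCount.of_bicontraction hb (fun x hx => merge_of_mem ((triple_eq hN x).1 hx))
      (fun x hx => merge_of_notMem fun h' => hx ((triple_eq hN x).2 h')) hF.loopless
      ?_ ?_ ?_ hn
    · obtain ⟨w, -, hw⟩ := hnbr p₁ hm1
      exact ⟨w, hw⟩
    · obtain ⟨w, -, hw⟩ := hnbr p₂ hm2
      exact ⟨w, hw⟩
    obtain ⟨w, hwA, hw, hadj⟩ := hnbr p₁ hm1
    have hqB := mem_B_of_mem_N hpA ht.adj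
    refine ⟨w, ⟨hadj.right_mem, hw⟩, q, ⟨hF.memV_right hqB, ?_⟩, ?_⟩
    · rintro (rfl | rfl | rfl)
      · exact HallGraph.not_mem_A_B hpA hqB
      · exact (Finset.mem_erase.1 hm1).1 rfl
      · exact (Finset.mem_erase.1 hm2).1 rfl
    · rintro rfl
      exact HallGraph.not_mem_A_B hwA hqB

/-- The graph obtained from `G - f` by bicontracting both ends of `f`. -/
lemma bicontract_both (h : Model G r s P) (ht : P.Thin p q) (hf : G.IsLink f p q) (hr : f ≠ r)
    (hs : f ≠ s) (hpA : p ∈ P.A) (hp : P.Free p) (hq : P.Free q) {J K : Graph α β}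
    (hJ : J = ((G.deleteEdges {f}).deleteEdges ((G.deleteEdges {f}).incidenceSet p)).map
      (merge (P.triple p q) p))
    (hK : K = (J.deleteEdges ((G.deleteEdges {f}).incidenceSet q)).map (merge (P.triple q p) q)) :
    (∃ A' B', Frame K A' B' r s ∧ Matchable K A' B' r s ∅) ∧
    V(K).ncard + 4 = V(G).ncard ∧ 8 ≤ V(G).ncard ∧ (∀ n, HasBrickCount K n → HasBrickCount J n) := by
  obtain ⟨hJF, hJm, hJV, -⟩ := h.bicontract_left ht hf hr hs hpA hp hJ
  obtain ⟨q₁, q₂, h₁, h₂, hN, hb, hinc⟩ := h.exists_bicontraction ht.symm hf.symm hq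
  have hqB := mem_B_of_mem_N hpA ht.adj
  have hTq : ∀ x ∈ P.triple q p, merge (P.triple p q) p x = x := fun x hx =>
    merge_of_notMem (HallGraph.not_mem_triple (P.symm ht.adj) hx)
  have hq0 : q ∈ P.triple q p := HallGraph.self_mem_triple
  have hm1 : q₁ ∈ (P.N q).erase p := by rw [hN]; simp
  have hm2 : q₂ ∈ (P.N q).erase p := by rw [hN]; simp
  have hq1 : q₁ ∈ P.triple q p := Finset.mem_insert_of_mem hm1
  have hq2 : q₂ ∈ P.triple q p := Finset.mem_insert_of_mem hm2
  have hq1A := mem_A_of_mem_N hqB (Finset.mem_of_mem_erase hm1)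
  have hq2A := mem_A_of_mem_N hqB (Finset.mem_of_mem_erase hm2)
  have hinv : ∀ {x y}, y ∈ P.triple q p → merge (P.triple p q) p x = y → x = y := by
    intro x y hy hxy
    by_cases hx : x ∈ P.triple p q
    · rw [merge_of_mem hx] at hxy
      exact (HallGraph.not_mem_triple ht.adj HallGraph.self_mem_triple (hxy ▸ hy)).elim
    · rwa [merge_of_notMem hx] at hxy
  have hJlink : ∀ {e x y}, x ∈ P.triple q p → y ∈ P.triple q p →
      (J.IsLink e x y ↔ (G.deleteEdges {f}).IsLink e x y) := by
    intro e x y hx hy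
    rw [hJ]
    constructor
    · rintro ⟨u, v, ⟨huv, -⟩, hu, hv⟩
      rwa [hinv hx hu, hinv hy hv] at huv
    · intro hl
      refine ⟨x, y, ⟨hl, ?_⟩, hTq x hx, hTq y hy⟩
      intro hep
      have hpT := HallGraph.not_mem_triple ht.adj (HallGraph.self_mem_triple (P := P) (q := q))
      rcases Graph.Inc.eq_or_eq_of_isLink hep hl with h' | h'
      · exact hpT (h' ▸ hx)
      · exact hpT (h' ▸ hy)
  have hb' : Bicontraction J (merge (P.triple q p) q) q q₁ q₂ h₁ h₂ := by
    refine ⟨(hJlink hq0 hq1).2 hb.link₁, (hJlink hq0 hq2).2 hb.link₂, ?_, hb.ne,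
      fun e he => hb.not_link e ((hJlink hq1 hq2).1 he), ?_⟩
    · intro e he
      rw [hJ, Graph.map_inc] at he
      obtain ⟨x, hx, hxq⟩ := he
      rw [hinv hq0 hxq.symm] at hx
      exact hb.inc e (Graph.deleteEdges_inc.1 hx).1
    · intro x _ y _
      rw [merge_eq_iff hq0]
      simp only [← triple_eq hN, Set.mem_insert_iff, Set.mem_singleton_iff]
  have hqJ : q ∈ merge (P.triple p q) p '' (P.B : Set α) := ⟨q, hqB, hTq q hq0⟩
  have hpq := HallGraph.ne_of_adj ht.adj
  have hA' : ∀ x ∈ P.triple q p, x ∈ P.A → x ∈ merge (P.triple p q) p '' ((P.A : Set α) \ {p}) := by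
    intro x hx hxA
    refine ⟨x, ⟨hxA, ?_⟩, hTq x hx⟩
    rintro rfl
    exact HallGraph.not_mem_triple ht.adj HallGraph.self_mem_triple hx
  have hKe : K = (J.deleteEdges {h₁, h₂}).map (merge (P.triple q p) q) := by rw [hK, hinc]
  have hVJ : V(J).ncard + 2 = V(G).ncard := hJV
  -- Besides `p`, the class `A` contains the two ends of `r` and, by `right_tri`, a further
  -- neighbour of `q` that is not one of them. So `G` has at least eight vertices, and four remain
  -- after two bicontractions.
  have h4A : 4 ≤ P.A.card := by
    have hss : P.R ∩ P.A ⊂ (P.N q).erase p ∪ (P.R ∩ P.A) := by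
      refine ⟨Finset.subset_union_right, fun hsub => ht.right_tri hq fun x hx => ?_⟩
      exact (Finset.mem_inter.1 (hsub (Finset.mem_union_left _ hx))).1
    have h1 := Finset.card_lt_card hss
    rw [P.card_RA] at h1
    have hpn : p ∉ (P.N q).erase p ∪ (P.R ∩ P.A) := by
      rw [Finset.mem_union]
      rintro (hx | hx)
      · exact (Finset.mem_erase.1 hx).1 rfl
      · exact hp.2 (Finset.mem_inter.1 hx).1
    have h2 := Finset.card_le_card (s := insert p ((P.N q).erase p ∪ (P.R ∩ P.A))) (t := P.A) (by
      intro x hx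
      rcases Finset.mem_insert.1 hx with rfl | hx
      · exact hpA
      rcases Finset.mem_union.1 hx with hx | hx
      · exact mem_A_of_mem_N hqB (Finset.mem_of_mem_erase hx)
      · exact (Finset.mem_inter.1 hx).2)
    rw [Finset.card_insert_of_notMem hpn] at h2
    omega
  have hVG := h.ncard_V
  have hncard := hb'.ncard hJF.loopless hJF.finite
  rw [← hKe] at hncard
  have hfr := hb'.frame hJF.swap hqJ (hA' q₁ hq1 hq1A) (hA' q₂ hq2 hq2A)
  have hmt := hb'.matchable (Ex' := ∅) hJF.swap hqJ (hA' q₁ hq1 hq1A) (hA' q₂ hq2 hq2A) hJm.swap (by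
    rintro x y ⟨-, hxy⟩ - - hne
    refine (hne ?_).elim
    have hmem : ∀ z ∈ s(x, y), z ∈ P.triple q p := fun z hz => Finset.mem_insert_of_mem ((hxy z).1 hz)
    rw [merge_of_mem (hmem x (by simp)), merge_of_mem (hmem y (by simp))])
  rw [← hKe] at hfr hmt
  refine ⟨⟨_, _, hfr.swap, hmt.swap⟩, by omega, by omega, ?_⟩
  · intro n hn
    rw [hKe] at hn
    have hnbr : ∀ y ∈ (P.N q).erase p, ∃ w, w ∉ ({q, q₁, q₂} : Set α) ∧ J.Adj y w := by
      intro y hy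
      obtain ⟨hyp, hyN⟩ := Finset.mem_erase.1 hy
      have hyA := mem_A_of_mem_N hqB hyN
      obtain ⟨z, hz, hzq⟩ := exists_nbr_ne q (Or.inl hyA)
      have hzB := mem_B_of_mem_N hyA hz
      obtain ⟨e, he⟩ := h.link_of_mem hz
      have hyT : y ∈ P.triple q p := Finset.mem_insert_of_mem hy
      refine ⟨merge (P.triple p q) p z, ?_, e, ?_⟩
      · rw [triple_eq hN]
        intro hmem
        have hzm := hinv hmem rfl
        rw [← hzm] at hmem
        rcases HallGraph.mem_triple.1 hmem with h' | h'
        · exact hzq h'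
        · exact HallGraph.not_mem_A_B (mem_A_of_mem_N hqB h'.1) hzB
      · rw [hJ]
        refine ⟨y, z, ⟨⟨he, ?_⟩, ?_⟩, hTq y hyT, rfl⟩
        · rintro rfl
          rcases he.left_eq_or_eq hf with rfl | rfl
          · exact hyp rfl
          · exact HallGraph.not_mem_A_B hyA hqB
        · intro hep
          rcases (Graph.deleteEdges_inc.1 hep).1.eq_or_eq_of_isLink he with rfl | rfl
          · exact hyp rfl
          · exact HallGraph.not_mem_A_B hpA hzB
    refine HasBrickCount.of_bicontraction hb' (fun x hx => merge_of_mem ((triple_eq hN x).1 hx))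
      (fun x hx => merge_of_notMem fun h' => hx ((triple_eq hN x).2 h')) hJF.loopless
      (hnbr q₁ hm1) (hnbr q₂ hm2) ?_ hn
    have hc : ({q, q₁, q₂} : Set α).ncard ≤ 3 := by
      refine (Set.ncard_insert_le _ _).trans ?_
      rw [Set.ncard_pair hb.ne]
    have hd := Set.ncard_le_ncard_sdiff_add_ncard V(J) ({q, q₁, q₂} : Set α) (Set.toFinite _)
    exact (Set.one_lt_ncard_iff_nontrivial_and_finite.1 (by omega)).1

/-- Deleting a thin edge leaves one brick. -/
lemma core_matchable (h : Model G r s P) (ht : P.Thin p q) (hf : G.IsLink f p q) (hr : f ≠ r)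
    (hs : f ≠ s) : HasBrickCount (G.deleteEdges {f}) 1 ∧ (∃ A B, Frame (core G P f p q) A B r s ∧
      Matchable (core G P f p q) A B r s ∅) ∧ 4 ≤ V(core G P f p q).ncard := by
  wlog hpA : p ∈ P.A generalizing r s P p q
  · have hqA : q ∈ P.swap.B := (P.mem ht.adj).resolve_left (fun h => hpA h.1) |>.2
    have hpA' : p ∈ P.swap.A := (P.mem ht.adj).resolve_left (fun h => hpA h.1) |>.1
    obtain ⟨h1, ⟨A, B, h2, h3⟩, h4⟩ := this h.swap (HallGraph.swap_thin ht) hf hs hr hpA'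
    exact ⟨h1, ⟨B, A, h2.swap, h3.swap⟩, h4⟩
  have hdeg := h.degreeTwoEdges_eq hf ht.left_not_special ht.right_not_special
  have hF := h.frame_deleteEdges hr hs
  have hone : ∀ {p q : α} {r s : β} {P : HallGraph α}, Model G r s P → P.Thin p q → G.IsLink f p q →
      f ≠ r → f ≠ s → p ∈ P.A → P.Free p → ¬ P.Free q →
      HasBrickCount (G.deleteEdges {f}) 1 ∧ (∃ A B, Frame (core G P f p q) A B r s ∧
      Matchable (core G P f p q) A B r s ∅) ∧ 4 ≤ V(core G P f p q).ncard := by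
    intro p q r s P h ht hf hr hs hpA hp hq
    obtain ⟨h1, h2, h3, h4⟩ := h.bicontract_left ht hf hr hs hpA hp rfl
    have hdeg := h.degreeTwoEdges_eq hf ht.left_not_special ht.right_not_special
    have hcore : core G P f p q = ((G.deleteEdges {f}).deleteEdges
        ((G.deleteEdges {f}).incidenceSet p)).map (merge (P.triple p q) p) := by
      have hc : P.collapse p q = merge (P.triple p q) p := by
        ext x
        simp [HallGraph.collapse, merge, hp, hq]
      have hd : degreeTwoEdges (G.deleteEdges {f}) = (G.deleteEdges {f}).incidenceSet p := by
        rw [hdeg]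
        ext e
        constructor
        · rintro ⟨v, hv, rfl | rfl, hvF⟩
          · exact hv
          · exact (hq hvF).elim
        · exact fun he => ⟨p, he, Or.inl rfl, hp⟩
      rw [core, hc, hd]
    rw [← hcore] at h1 h2 h3 h4
    have hE : {z : Sym2 α | P.Free q ∧ ∀ x, x ∈ z ↔ x ∈ (P.N q).erase p} = ∅ := by
      ext z; simp [hq]
    rw [hE] at h2
    have hVG := h.ncard_V
    -- The three neighbours of `p` give six vertices in all, of which one bicontraction takes two.
    have hNB : (P.N p).card ≤ P.B.card := Finset.card_le_card fun x hx => mem_B_of_mem_N hpA hx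
    rw [hp.1, ← P.card_eq] at hNB
    have h5 : 4 ≤ V(core G P f p q).ncard := by omega
    exact ⟨h4 1 (.brick _ (h1.isBrick h2 h5)), ⟨_, _, h1, h2⟩, h5⟩
  by_cases hp : P.Free p <;> by_cases hq : P.Free q
  · obtain ⟨-, -, -, h4⟩ := h.bicontract_left ht hf hr hs hpA hp rfl
    obtain ⟨⟨A, B, h1, h2⟩, h3, h8, h5⟩ := h.bicontract_both ht hf hr hs hpA hp hq rfl rfl
    have hcore : core G P f p q = ((((G.deleteEdges {f}).deleteEdges
        ((G.deleteEdges {f}).incidenceSet p)).map (merge (P.triple p q) p)).deleteEdges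
        ((G.deleteEdges {f}).incidenceSet q)).map (merge (P.triple q p) q) := by
      have hc : P.collapse p q = merge (P.triple q p) q ∘ merge (P.triple p q) p := by
        ext x
        simp only [HallGraph.collapse, merge, hp, hq, true_and, Function.comp_apply]
        by_cases hx : x ∈ P.triple p q
        · simp [hx, HallGraph.not_mem_triple ht.adj HallGraph.self_mem_triple]
        · simp [hx]
      have hd : degreeTwoEdges (G.deleteEdges {f}) =
          (G.deleteEdges {f}).incidenceSet p ∪ (G.deleteEdges {f}).incidenceSet q := by
        rw [hdeg]
        ext e
        constructor
        · rintro ⟨v, hv, rfl | rfl, hvF⟩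
          · exact Or.inl hv
          · exact Or.inr hv
        · rintro (he | he)
          · exact ⟨p, he, Or.inl rfl, hp⟩
          · exact ⟨q, he, Or.inr rfl, hq⟩
      rw [core, hc, hd, deleteEdges_map, Graph.map_map]
      simp only [Graph.deleteEdges_deleteEdges, Set.union_assoc]
    rw [← hcore] at h1 h2 h3 h5
    have h6 : 4 ≤ V(core G P f p q).ncard := by omega
    exact ⟨h4 1 (h5 1 (.brick _ (h1.isBrick h2 h6))), ⟨_, _, h1, h2⟩, h6⟩
  · exact hone h ht hf hr hs hpA hp hq
  · have hqB := mem_B_of_mem_N hpA ht.adj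
    obtain ⟨h1, ⟨A, B, h2, h3⟩, h4⟩ :=
      hone h.swap (HallGraph.swap_thin ht.symm) hf.symm hs hr hqB hq hp
    have hcore : core G P f p q = core G P.swap f q p := by
      rw [core, core, HallGraph.collapse_comm ht.adj]
      rfl
    rw [hcore]
    exact ⟨h1, ⟨B, A, h2.swap, h3.swap⟩, h4⟩
  · have hcore : core G P f p q = G.deleteEdges {f} := by
      have hd : degreeTwoEdges (G.deleteEdges {f}) = ∅ := by
        rw [hdeg]
        ext e
        simp only [Set.mem_ofPred_eq, Set.mem_empty_iff_false, iff_false]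
        rintro ⟨v, hv, rfl | rfl, hvF⟩ <;> contradiction
      have hc : P.collapse p q = id := by
        ext x
        simp [HallGraph.collapse, hp, hq]
      rw [core, hd, hc, Graph.map_id, Graph.deleteEdges_empty]
    have hm := h.matchable ht hf hr hs
    have hE : P.exceptional p q = ∅ := by
      ext z
      simp [HallGraph.exceptional, hp, hq]
    rw [hE] at hm
    have h4 : 4 ≤ V(G.deleteEdges {f}).ncard := h.brick.four_le
    rw [hcore]
    exact ⟨.brick _ (hF.isBrick hm h4), ⟨_, _, hF, hm⟩, h4⟩

lemma link_cases (h : Model G r s P) {e : β} {x y : α} (hl : G.IsLink e x y) :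
    (e ≠ r ∧ e ≠ s ∧ y ∈ P.N x) ∨ ((e = r ∨ e = s) ∧ P.Same x y) := by
  by_cases hr : e = r
  · subst hr
    exact Or.inr ⟨Or.inl rfl, Or.inl ⟨h.frame.r_inc hl.inc_left, h.frame.r_inc hl.inc_right⟩⟩
  · by_cases hs : e = s
    · subst hs
      exact Or.inr ⟨Or.inr rfl, Or.inr ⟨h.frame.s_inc hl.inc_left, h.frame.s_inc hl.inc_right⟩⟩
    · exact Or.inl ⟨hr, hs, h.mem_N_of_link hl hr hs⟩

/-- If one of the edges at `x` belonged to `R`, then `x` would have the colour of both `y` and `y'`,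
so both edges would belong to `R`; but a vertex meets at most one edge of `R`. -/
lemma mem_N_of_common (h : Model G r s P) {e e' : β} {x y y' : α} (hl : G.IsLink e x y)
    (hl' : G.IsLink e' x y') (hsame : P.Same y y') (hne : y ≠ y') : y ∈ P.N x ∧ y' ∈ P.N x := by
  rcases h.link_cases hl with ⟨-, -, h1⟩ | ⟨h1, h2⟩ <;>
    rcases h.link_cases hl' with ⟨-, -, h3⟩ | ⟨h3, h4⟩
  · exact ⟨h1, h3⟩
  · exact ((h4.trans hsame.symm).not_adj h1).elim
  · exact ((h2.trans hsame).not_adj h3).elim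
  · have hee : e = e' := by
      rcases h1 with rfl | rfl <;> rcases h3 with rfl | rfl
      · rfl
      · exact (h.frame.not_mem (h.frame.r_inc hl.inc_left) (h.frame.s_inc hl'.inc_left)).elim
      · exact (h.frame.not_mem (h.frame.r_inc hl'.inc_left) (h.frame.s_inc hl.inc_left)).elim
      · rfl
    subst hee
    exact (hne (hl.right_unique hl')).elim

/-- The retract is simple unless the deleted edge is part of a special local configuration. -/
lemma core_simple (h : Model G r s P) (ht : P.Thin p q) (hf : G.IsLink f p q) (hr : f ≠ r)
    (hs : f ≠ s) (hM : ¬ P.Multi p q) : (core G P f p q).Simple := by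
  obtain ⟨-, ⟨A, B, hFr, -⟩, -⟩ := h.core_matchable ht hf hr hs
  have hsimple := h.simple
  refine { not_isLoopAt := hFr.loopless.not_isLoopAt, eq_of_isLink := ?_ }
  have hdeg := h.degreeTwoEdges_eq hf ht.left_not_special ht.right_not_special
  -- the ends of the remaining edges are not the free ends of the deleted edge
  have hend : ∀ {e x}, e ∉ degreeTwoEdges (G.deleteEdges {f}) → (G.deleteEdges {f}).Inc e x →
      (x = p ∨ x = q) → ¬ P.Free x := by
    intro e x he hx hxpq hfree
    rw [hdeg] at he
    exact he ⟨x, hx, hxpq, hfree⟩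
  have hker : ∀ {e e' x y}, e ∉ degreeTwoEdges (G.deleteEdges {f}) →
      e' ∉ degreeTwoEdges (G.deleteEdges {f}) → (G.deleteEdges {f}).Inc e x →
      (G.deleteEdges {f}).Inc e' y → P.collapse p q x = P.collapse p q y → x = y ∨
      (P.Free p ∧ x ≠ y ∧ (P.N p).erase q = {x, y}) ∨ (P.Free q ∧ x ≠ y ∧ (P.N q).erase p = {x, y}) := by
    intro e e' x y he he' hx hy heq
    have aux : ∀ {p q : α}, q ∈ P.N p → P.Free p → x ≠ p → y ≠ p → x ∈ P.triple p q →
        y ∈ P.triple p q → x ≠ y → (P.N p).erase q = {x, y} := by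
      intro p q hadj hp hxp hyp hx hy hxy
      have hc : ((P.N p).erase q).card = 2 := by
        rw [Finset.card_erase_of_mem hadj, hp.1]
      refine (Finset.eq_of_subset_of_card_le (fun z hz => ?_) ?_).symm
      · rcases Finset.mem_insert.1 hz with rfl | hz
        · exact Finset.mem_of_mem_insert_of_ne hx hxp
        · rw [Finset.mem_singleton.1 hz]
          exact Finset.mem_of_mem_insert_of_ne hy hyp
      · rw [hc, Finset.card_pair hxy]
    by_cases hxy : x = y
    · exact Or.inl hxy
    rcases (HallGraph.collapse_eq_iff ht.adj).1 heq with h1 | ⟨h1, h2, h3⟩ | ⟨h1, h2, h3⟩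
    · exact Or.inl h1
    · refine Or.inr (Or.inl ⟨h1, hxy, aux ht.adj h1 ?_ ?_ h2 h3 hxy⟩)
      · rintro rfl; exact hend he hx (Or.inl rfl) h1
      · rintro rfl; exact hend he' hy (Or.inl rfl) h1
    · refine Or.inr (Or.inr ⟨h1, hxy, aux (P.symm ht.adj) h1 ?_ ?_ h2 h3 hxy⟩)
      · rintro rfl; exact hend he hx (Or.inr rfl) h1
      · rintro rfl; exact hend he' hy (Or.inr rfl) h1
  -- two edges with one common end
  have hcommon : ∀ {e e' x y y'}, e ∉ degreeTwoEdges (G.deleteEdges {f}) →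
      e' ∉ degreeTwoEdges (G.deleteEdges {f}) → (G.deleteEdges {f}).IsLink e x y →
      (G.deleteEdges {f}).IsLink e' x y' → P.collapse p q y = P.collapse p q y' → e = e' := by
    intro e e' x y y' he he' hl hl' heq
    by_contra hee
    have aux : ∀ {p q : α}, y ≠ y' → (P.N p).erase q = {y, y'} → P.Free p →
        (x = p → ¬ P.Free x) → P.Free p ∧ ∃ w, w ≠ p ∧ (P.N p).erase q ⊆ P.N w := by
      intro p q hyy hN hp hx
      have hy : y ∈ P.N p := Finset.mem_of_mem_erase (a := q) (by rw [hN]; simp)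
      have hy' : y' ∈ P.N p := Finset.mem_of_mem_erase (a := q) (by rw [hN]; simp)
      obtain ⟨h1, h2⟩ := h.mem_N_of_common hl.1 hl'.1 (HallGraph.same_of_mem hy hy') hyy
      refine ⟨hp, x, fun hxp => hx hxp (hxp ▸ hp), ?_⟩
      rw [hN]
      intro z hz
      rcases Finset.mem_insert.1 hz with rfl | hz
      · exact h1
      · rw [Finset.mem_singleton.1 hz]; exact h2
    rcases hker he he' hl.inc_right hl'.inc_right heq with rfl | ⟨h1, h2, h3⟩ | ⟨h1, h2, h3⟩
    · exact hee (hl.1.eq hl'.1)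
    · exact hM (Or.inl (aux h2 h3 h1 fun hxp => hend he hl.inc_left (Or.inl hxp)))
    · exact hM (Or.inr (Or.inl (aux h2 h3 h1 fun hxp => hend he hl.inc_left (Or.inr hxp))))
  rintro e e' _ _ ⟨x, y, ⟨hl, he⟩, rfl, rfl⟩ ⟨x', y', ⟨hl', he'⟩, hx, hy⟩
  by_contra hee
  have hpq : ¬ P.Same p q := fun hsame => hsame.not_adj ht.adj
  have hsameP : ∀ {p q x x' : α}, (P.N p).erase q = {x, x'} → x ∈ P.N p ∧ x' ∈ P.N p := by
    intro p q x x' hN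
    exact ⟨Finset.mem_of_mem_erase (a := q) (by rw [hN]; simp),
      Finset.mem_of_mem_erase (a := q) (by rw [hN]; simp)⟩
  rcases hker he he' hl.inc_left hl'.inc_left hx.symm with rfl | hxx
  · exact hee (hcommon he he' hl hl' hy.symm)
  rcases hker he he' hl.inc_right hl'.inc_right hy.symm with rfl | hyy
  · exact hee (hcommon he he' hl.symm hl'.symm hx.symm)
  -- an edge joining the two remaining neighbours of a free end
  have hinner : ∀ {p q x x' y y' : α} {e : β}, P.Thin p q → P.Free p → (P.N p).erase q = {x, x'} →
      (P.N p).erase q = {y, y'} → G.IsLink e x y → False := by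
    intro p q x x' y y' e ht hp hN hN' hl
    have hne := hl.ne
    have hyx : y = x' := by
      have : y ∈ ({x, x'} : Finset α) := by rw [← hN, hN']; simp
      simpa [hne.symm] using this
    subst hyx
    rcases h.link_cases hl with h' | ⟨hers, -⟩
    · exact (HallGraph.same_of_mem (hsameP hN).1 (hsameP hN).2).not_adj h'.2.2
    · refine ht.left_tri hp ?_
      rw [hN]
      intro z hz
      have hz : z = x ∨ z = y := by simpa using hz
      rw [h.mem_R]
      rcases hz with rfl | rfl <;> rcases hers with rfl | rfl
      exacts [Or.inl hl.inc_left, Or.inr hl.inc_left, Or.inl hl.inc_right, Or.inr hl.inc_right]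
  have hcross : ∀ {x y x' y' : α} {e e' : β}, G.IsLink e x y → G.IsLink e' x' y' → P.Free p →
      P.Free q → x ≠ x' → y ≠ y' → (P.N p).erase q = {x, x'} → (P.N q).erase p = {y, y'} →
      False := by
    intro x y x' y' e e' hl hl' hp hq hxx hyy hN hN'
    have hadj : ∀ {x y e}, G.IsLink e x y → x ∈ P.N p → y ∈ P.N q → y ∈ P.N x := by
      intro x y e hl hx hy
      rcases h.link_cases hl with h' | ⟨-, hsame⟩
      · exact h'.2.2
      · have h1 : P.Same q x := HallGraph.same_of_mem ht.adj hx
        have h2 : P.Same y p := HallGraph.same_of_mem hy (P.symm ht.adj)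
        exact (hpq ((h1.trans hsame).trans h2).symm).elim
    refine hM (Or.inr (Or.inr ⟨hp, hq, x, x', y, y', ?_, ?_, hxx, hyy, ?_, ?_⟩))
    · rw [← hN, Finset.insert_erase ht.adj]
    · rw [← hN', Finset.insert_erase (P.symm ht.adj)]
    · exact hadj hl (hsameP hN).1 (hsameP hN').1
    · exact hadj hl' (hsameP hN).2 (hsameP hN').2
  -- Both ends of the parallel edges are now merged pairs. If it is the same pair at both ends, an
  -- edge joins its two members, which is impossible; if the pairs belong to different ends of `f`,
  -- this is the third form of `Multi`.
  rcases hxx with ⟨h1, h2, h3⟩ | ⟨h1, h2, h3⟩ <;> rcases hyy with ⟨k1, k2, k3⟩ | ⟨k1, k2, k3⟩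
  · exact hinner ht h1 h3 k3 hl.1
  · exact hcross hl.1 hl'.1 h1 k1 h2 k2 h3 k3
  · exact hcross hl.1.symm hl'.1.symm k1 h1 k2 h2 k3 h3
  · exact hinner ht.symm h1 h3 k3 hl.1

/-- A thin edge of the Hall graph is an `R`-thin edge of the brick. -/
theorem isRThin (h : Model G r s P) (ht : P.Thin p q) (hf : G.IsLink f p q) (hr : f ≠ r)
    (hs : f ≠ s) : IsRThin G {r, s} f ∧ (¬ P.Multi p q → IsStrictlyRThin G {r, s} f) := by
  have hF := h.frame_deleteEdges hr hs
  have hm := h.matchable ht hf hr hs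
  obtain ⟨hcount, ⟨A, B, hFr, hMt⟩, h4⟩ := h.core_matchable ht hf hr hs
  obtain ⟨τ, hτ, hret⟩ := h.retract_eq hf ht.adj ht.left_not_special ht.right_not_special
  -- An edge of `R` joining an exceptional pair would violate `left_tri` or `right_tri`; so both
  -- edges of `R` remain admissible in `G - f`.
  have hexc : ∀ g, (g = r ∨ g = s) → ∀ a a', G.IsLink g a a' → s(a, a') ∉ P.exceptional p q := by
    intro g hg a a' hl hE
    have hmem : ∀ z ∈ s(a, a'), z ∈ P.R := by
      intro z hz
      rw [h.mem_R]
      rcases Sym2.mem_iff.1 hz with rfl | rfl <;> rcases hg with rfl | rfl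
      exacts [Or.inl hl.inc_left, Or.inr hl.inc_left, Or.inl hl.inc_right, Or.inr hl.inc_right]
    rcases hE with ⟨hp, hE⟩ | ⟨hq, hE⟩
    · exact ht.left_tri hp fun z hz => hmem z ((hE z).2 hz)
    · exact ht.right_tri hq fun z hz => hmem z ((hE z).2 hz)
  have hmc : IsMatchingCovered (G.deleteEdges {f}) := hF.matchingCovered hm
    (fun a a' hl => hexc r (Or.inl rfl) a a' hl.1) (fun a a' hl => hexc s (Or.inr rfl) a a' hl.1)
  have hmc' : IsMatchingCovered ((G.deleteEdges {r, s}).deleteEdges {f}) := by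
    have := hF.matchingCovered_deleteEdges hm
    rwa [Graph.deleteEdges_deleteEdges, Set.union_comm, ← Graph.deleteEdges_deleteEdges] at this
  have hthin : IsThin G f := by
    refine ⟨⟨⟨hf.edge_mem, hmc⟩, hmc, hcount⟩, ?_⟩
    rw [hret]
    exact hFr.isBrick_map hτ hMt h4
  have hRthin : IsRThin G {r, s} f := by
    refine ⟨hthin, ⟨hf.edge_mem, hmc⟩, ⟨hf.edge_mem, ?_⟩, hmc'⟩
    rintro (rfl | rfl)
    · exact hr rfl
    · exact hs rfl
  refine ⟨hRthin, fun hM => ⟨hRthin, hthin, ?_⟩⟩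
  rw [hret]
  exact simple_map hτ (h.core_simple ht hf hr hs hM)

end Model
end RBrick

namespace RBrick

/-! ### Barriers -/

section Barrier

variable {γ β : Type*} {F : Graph γ β}

lemma even_card_of_involution {δ : Type*} (s : Finset δ) (g : δ → δ) (hg : ∀ x ∈ s, g x ∈ s)
    (hinv : ∀ x ∈ s, g (g x) = x) (hne : ∀ x ∈ s, g x ≠ x) : Even s.card := by
  have : ∑ x ∈ s, (1 : ZMod 2) = 0 :=
    Finset.sum_involution (fun x _ => g x) (fun _ _ => by decide) (fun x hx _ => hne x hx)
      (fun x hx => hg x hx) (fun x hx => hinv x hx)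
  rw [Finset.sum_const, nsmul_eq_mul, mul_one] at this
  exact (ZMod.natCast_eq_zero_iff_even).1 this

/-- A matching that misses only vertices of `S` sends an edge from each odd component to `S`. -/
lemma PMOff.ncard_oddComponents_le (hF : F.Loopless) (hfin : V(F).Finite) {D S : Set γ} {M : Set β}
    (hM : PMOff F D M) (hDS : D ⊆ S) (hS : S ⊆ V(F)) :
    (F.deleteVerts S).toSimpleGraph.oddComponents.ncard ≤ (S \ D).ncard := by
  classical
  have hfinS : V(F.deleteVerts S).Finite := hfin.subset Set.sdiff_subset
  have : Finite V(F.deleteVerts S) := hfinS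
  have hfintype : Fintype V(F.deleteVerts S) := Fintype.ofFinite _
  have hex : ∀ c ∈ (F.deleteVerts S).toSimpleGraph.oddComponents, ∃ y e, ∃ x : V(F.deleteVerts S),
      x ∈ c.supp ∧ e ∈ M ∧ F.IsLink e x y ∧ y ∈ S \ D := by
    intro c hc
    by_contra! hcon
    -- If no matching edge joins the component to `S`, taking mates is an involution without fixed
    -- points on it, and its order is even.
    have hmate : ∀ x : V(F.deleteVerts S), ∃ y : V(F.deleteVerts S), x ∈ c.supp →
        y ∈ c.supp ∧ ∃ e ∈ M, F.IsLink e x y := by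
      intro x
      by_cases hx : x ∈ c.supp
      · have hxV : (x : γ) ∈ V(F) \ S := x.2
        obtain ⟨e, ⟨he, y, hy⟩, -⟩ := hM.cover x hxV.1 fun h => hxV.2 (hDS h)
        have hyS : y ∉ S := fun hyS => hcon y e x hx he hy ⟨hyS, hM.off e he y hy.inc_right⟩
        refine ⟨⟨y, hy.right_mem, hyS⟩, fun _ => ⟨?_, e, he, hy⟩⟩
        rw [SimpleGraph.ConnectedComponent.mem_supp_iff] at hx ⊢
        rw [← hx]
        refine SimpleGraph.ConnectedComponent.sound (SimpleGraph.Adj.reachable ?_)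
        refine ⟨fun h => hy.ne (congrArg Subtype.val h).symm, e, ?_⟩
        rw [Graph.deleteVerts_isLink]
        exact ⟨hy.symm, hyS, hxV.2⟩
      · exact ⟨x, fun h => (hx h).elim⟩
    choose g hg using hmate
    have heven := even_card_of_involution c.supp.toFinset g (fun x hx => by
        rw [Set.mem_toFinset] at hx ⊢
        exact (hg x hx).1) (fun x hx => by
        rw [Set.mem_toFinset] at hx
        obtain ⟨h1, e, he, hl⟩ := hg x hx
        obtain ⟨h2, e', he', hl'⟩ := hg (g x) h1
        obtain rfl := hM.eq he he' hl.inc_right hl'.inc_left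
        exact Subtype.ext (hl.symm.right_unique hl').symm) (fun x hx heq => by
        rw [Set.mem_toFinset] at hx
        obtain ⟨h1, e, he, hl⟩ := hg x hx
        rw [heq] at hl
        exact hl.ne rfl)
    have hodd : Odd c.supp.ncard := hc
    rw [Set.ncard_eq_toFinset_card'] at hodd
    exact (Nat.not_odd_iff_even.2 heven) hodd
  rcases (F.deleteVerts S).toSimpleGraph.oddComponents.eq_empty_or_nonempty with he | ⟨c₀, hc₀⟩
  · simp [he]
  have : Nonempty γ := ⟨(hex c₀ hc₀).choose⟩
  choose! φ hφ using hex
  refine Set.ncard_le_ncard_of_injOn φ (fun c hc => ?_) (fun c hc c' hc' heq => ?_)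
    ((hfin.subset hS).subset Set.sdiff_subset)
  · obtain ⟨e, x, -, -, -, h⟩ := hφ c hc
    exact h
  · obtain ⟨e, x, hx, he, hl, -⟩ := hφ c hc
    obtain ⟨e', x', hx', he', hl', -⟩ := hφ c' hc'
    rw [← heq] at hl'
    obtain rfl := hM.eq he he' hl.inc_right hl'.inc_right
    obtain rfl : x = x' := Subtype.ext (hl.left_unique hl')
    rw [SimpleGraph.ConnectedComponent.mem_supp_iff] at hx hx'
    rw [← hx, ← hx']

/-- Without `u` and `v`, only `|S| - 2` vertices are left to receive an edge from each of the `|S|`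
odd components. -/
lemma IsBarrier.not_pmOff {S : Set γ} (h : IsBarrier F S) (hF : F.Loopless) (hfin : V(F).Finite)
    {u v : γ} (hu : u ∈ S) (hv : v ∈ S) (huv : u ≠ v) {M : Set β} : ¬ PMOff F {u, v} M := by
  intro hM
  have hsub : {u, v} ⊆ S := by rintro x (rfl | rfl) <;> assumption
  have h1 := hM.ncard_oddComponents_le hF hfin hsub h.subset
  have h2 := Set.ncard_sdiff_add_ncard_of_subset hsub (hfin.subset h.subset)
  rw [Set.ncard_pair huv] at h2
  rw [h.odd_eq] at h1
  omega

/-- The two neighbours of a vertex of degree two form a barrier. -/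
lemma isBarrier_pair (hc : IsMatchingCovered F) (hfin : V(F).Finite) (heven : Even V(F).ncard)
    {v x y : γ} (hxy : x ≠ y) (hx : F.Adj v x) (hy : F.Adj v y)
    (hv : ∀ z, F.Adj v z → z = x ∨ z = y) : IsBarrier F {x, y} := by
  have hloop := hc.loopless
  have hsub : {x, y} ⊆ V(F) := by rintro z (rfl | rfl); exacts [hx.right_mem, hy.right_mem]
  have hvS : v ∉ ({x, y} : Set γ) := by
    rintro (rfl | rfl)
    exacts [hx.ne rfl, hy.ne rfl]
  have : Finite V(F.deleteVerts {x, y}) := hfin.subset Set.sdiff_subset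
  have hvV : v ∈ V(F.deleteVerts {x, y}) := ⟨hx.left_mem, hvS⟩
  refine ⟨hsub, ⟨x, by simp⟩, ?_⟩
  obtain ⟨M, hM⟩ := hc.exists_perfectMatching
  have hle := (pmOff_empty_iff.2 hM).ncard_oddComponents_le hloop hfin (Set.empty_subset {x, y}) hsub
  rw [Set.sdiff_empty, Set.ncard_pair hxy] at hle
  have hparity := SimpleGraph.odd_ncard_oddComponents (F.deleteVerts {x, y}).toSimpleGraph
  have hcard : Nat.card V(F.deleteVerts {x, y}) + 2 = V(F).ncard := by
    have := Set.ncard_sdiff_add_ncard_of_subset hsub hfin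
    rw [Set.ncard_pair hxy] at this
    rw [← this]
    rfl
  -- Once its two neighbours are removed, `v` is an isolated vertex and hence an odd component. The
  -- number of odd components is even by parity and at most two by the matching, so it is two.
  have hpos : 0 < (F.deleteVerts {x, y}).toSimpleGraph.oddComponents.ncard := by
    rw [Set.ncard_pos (Set.toFinite _)]
    refine ⟨(F.deleteVerts {x, y}).toSimpleGraph.connectedComponentMk ⟨v, hvV⟩, ?_⟩
    have hsupp : ((F.deleteVerts {x, y}).toSimpleGraph.connectedComponentMk ⟨v, hvV⟩).supp =
        {⟨v, hvV⟩} := by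
      ext w
      rw [SimpleGraph.ConnectedComponent.mem_supp_iff, Set.mem_singleton_iff]
      constructor
      · intro hw
        have hr := SimpleGraph.ConnectedComponent.exact hw
        obtain ⟨p⟩ := hr.symm
        cases p with
        | nil => rfl
        | cons hadj _ =>
          exfalso
          obtain ⟨-, e, he⟩ := hadj
          rw [Graph.deleteVerts_isLink] at he
          exact he.2.2 (hv _ ⟨e, he.1⟩)
      · rintro rfl
        rfl
    show Odd _
    rw [hsupp, Set.ncard_singleton]
    exact odd_one
  have hne : ¬ Odd (F.deleteVerts {x, y}).toSimpleGraph.oddComponents.ncard := by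
    rw [hparity, Nat.not_odd_iff_even]
    rw [← hcard] at heven
    exact (Nat.even_add.1 heven).2 even_two
  rw [Set.ncard_pair hxy]
  rcases Nat.lt_or_ge (F.deleteVerts {x, y}).toSimpleGraph.oddComponents.ncard 2 with h | h
  · have h1 : (F.deleteVerts {x, y}).toSimpleGraph.oddComponents.ncard = 1 := by omega
    exact (hne (by rw [h1]; exact odd_one)).elim
  · omega

end Barrier

namespace Model

variable {α β : Type*} [DecidableEq α] {G : Graph α β} {r s f : β} {P : HallGraph α} {p q : α}

lemma isBarrier_of_free (h : Model G r s P) (hc : IsMatchingCovered (G.deleteEdges {f}))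
    (hf : G.IsLink f p q) (hadj : q ∈ P.N p) (hp : P.Free p) :
    IsBarrier (G.deleteEdges {f}) ((P.N p).erase q) := by
  obtain ⟨x, y, hxy, heq⟩ := Finset.card_eq_two.1
    (show ((P.N p).erase q).card = 2 by rw [Finset.card_erase_of_mem hadj, hp.1])
  have hm : ∀ z, z ∈ (P.N p).erase q → (G.deleteEdges {f}).Adj p z := by
    intro z hz
    obtain ⟨e, he⟩ := h.link_of_mem (Finset.mem_of_mem_erase hz)
    exact ⟨e, (h.inc_deleteEdges_of_free hf hp).2 ⟨he, hz⟩⟩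
  have hb := isBarrier_pair (v := p) hc h.frame.finite (by
      show Even V(G).ncard
      rw [h.ncard_V]; simp) hxy (hm x (by simp [heq])) (hm y (by simp [heq])) (by
      rintro z ⟨e, he⟩
      have := ((h.inc_deleteEdges_of_free hf hp).1 he).2
      simpa [heq] using this)
  rw [heq]
  simpa using hb

/-- The nontrivial barriers after the deletion of a thin edge. -/
lemma barrier_eq (h : Model G r s P) (ht : P.Thin p q) (hf : G.IsLink f p q) (hr : f ≠ r)
    (hs : f ≠ s) {S : Set α} (hS : IsBarrier (G.deleteEdges {f}) S) (hn : S.Nontrivial) :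
    (P.Free p ∧ S = (P.N p).erase q) ∨ (P.Free q ∧ S = (P.N q).erase p) := by
  have hF := h.frame_deleteEdges hr hs
  have hm := h.matchable ht hf hr hs
  -- No perfect matching survives the removal of two vertices of a barrier, so any two of them are
  -- an exceptional pair.
  have hpair : ∀ u ∈ S, ∀ v ∈ S, u ≠ v → s(u, v) ∈ P.exceptional p q := by
    intro u hu v hv huv
    have huV := hS.subset hu
    have hvV := hS.subset hv
    rw [← hF.union] at huV hvV
    by_contra hE
    rcases huV with hu' | hu' <;> rcases hvV with hv' | hv'
    · obtain ⟨M, hM, -⟩ := hm.left u hu' v hv' huv hE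
      exact hS.not_pmOff hF.loopless hF.finite hu hv huv hM
    · obtain ⟨M, hM, -⟩ := hm.cross u hu' v hv'
      exact hS.not_pmOff hF.loopless hF.finite hu hv huv hM
    · obtain ⟨M, hM, -⟩ := hm.cross v hv' u hu'
      exact hS.not_pmOff hF.loopless hF.finite hv hu huv.symm hM
    · obtain ⟨M, hM, -⟩ := hm.right u hu' v hv' huv hE
      exact hS.not_pmOff hF.loopless hF.finite hu hv huv hM
  obtain ⟨u, hu, v, hv, huv⟩ := hn
  have aux : ∀ {p q : α}, P.Thin p q →
      (∀ u ∈ S, ∀ v ∈ S, u ≠ v → s(u, v) ∈ P.exceptional p q) → P.Free p →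
      (∀ x, x ∈ s(u, v) ↔ x ∈ (P.N p).erase q) → S = (P.N p).erase q := by
    intro p q ht hpair hp hE
    have hmem : ∀ x, (x = u ∨ x = v) ↔ x ∈ (P.N p).erase q := fun x => by
      rw [← hE, Sym2.mem_iff]
    have huN := (hmem u).1 (Or.inl rfl)
    ext w
    rw [Finset.mem_coe, ← hmem]
    constructor
    · intro hw
      by_contra! hcon
      rcases hpair u hu w hw hcon.1.symm with ⟨-, hE'⟩ | ⟨-, hE'⟩
      · have := (hmem w).2 ((hE' w).1 (by simp))
        tauto
      · have h1 := (hE' u).1 (by simp)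
        have h2 : P.Same u q := HallGraph.same_of_mem (Finset.mem_of_mem_erase huN) ht.adj
        exact h2.symm.not_adj (Finset.mem_of_mem_erase h1)
    · rintro (rfl | rfl) <;> assumption
  rcases hpair u hu v hv huv with ⟨hp, hE⟩ | ⟨hq, hE⟩
  · exact Or.inl ⟨hp, aux ht hpair hp hE⟩
  · refine Or.inr ⟨hq, aux ht.symm ?_ hq hE⟩
    rwa [HallGraph.exceptional_comm]

/-- The pairs left at `p` and at `q` have different colours. Neither contains the other, and thus
each that occurs is a maximal barrier. -/
lemma setOf_maximal_barrier (h : Model G r s P) (ht : P.Thin p q) (hf : G.IsLink f p q) (hr : f ≠ r)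
    (hs : f ≠ s) : {S : Set α | Maximal (IsBarrier (G.deleteEdges {f})) S ∧ S.Nontrivial} =
      {S : Set α | (P.Free p ∧ S = (((P.N p).erase q : Finset α) : Set α)) ∨
        (P.Free q ∧ S = (((P.N q).erase p : Finset α) : Set α))} := by
  have hc := (h.isRThin ht hf hr hs).1.1.1.2.1
  have hnt : ∀ {p q : α}, q ∈ P.N p → P.Free p → (((P.N p).erase q : Finset α) : Set α).Nontrivial := by
    intro p q hadj hp
    rw [Finset.coe_erase, ← Finset.coe_erase, Finset.nontrivial_coe, ← Finset.one_lt_card_iff_nontrivial,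
      Finset.card_erase_of_mem hadj, hp.1]
    norm_num
  have hmax : ∀ {p q : α}, P.Thin p q → (∀ S, IsBarrier (G.deleteEdges {f}) S → S.Nontrivial →
      (P.Free p ∧ S = (P.N p).erase q) ∨ (P.Free q ∧ S = (P.N q).erase p)) → G.IsLink f p q →
      P.Free p → Maximal (IsBarrier (G.deleteEdges {f})) (((P.N p).erase q : Finset α) : Set α) := by
    intro p q ht hb hf hp
    refine ⟨h.isBarrier_of_free hc hf ht.adj hp, fun S hS hle => ?_⟩
    obtain ⟨u, hu, v, hv, huv⟩ := hnt ht.adj hp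
    rcases hb S hS ⟨u, hle hu, v, hle hv, huv⟩ with ⟨-, rfl⟩ | ⟨-, rfl⟩
    · exact le_rfl
    · have h1 : P.Same u q := HallGraph.same_of_mem (Finset.mem_of_mem_erase hu) ht.adj
      exact (h1.symm.not_adj (Finset.mem_of_mem_erase (hle hu))).elim
  ext S
  constructor
  · rintro ⟨h1, h2⟩
    exact h.barrier_eq ht hf hr hs h1.1 h2
  · rintro (⟨hp, rfl⟩ | ⟨hq, rfl⟩)
    · exact ⟨hmax ht (fun S hS hn => h.barrier_eq ht hf hr hs hS hn) hf hp, hnt ht.adj hp⟩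
    · exact ⟨hmax ht.symm (fun S hS hn => (h.barrier_eq ht hf hr hs hS hn).symm) hf.symm hq,
        hnt ht.symm.adj hq⟩

/-- The index of a thin edge is the number of its free ends. -/
theorem index_eq_two_iff (h : Model G r s P) (ht : P.Thin p q) (hf : G.IsLink f p q) (hr : f ≠ r)
    (hs : f ≠ s) : index G f = 2 ↔ P.Free p ∧ P.Free q := by
  rw [index, h.setOf_maximal_barrier ht hf hr hs]
  by_cases hp : P.Free p <;> by_cases hq : P.Free q
  · simp only [hp, hq, true_and, and_self, iff_true]
    have hset : {S : Set α | S = ((P.N p).erase q : Finset α) ∨ S = ((P.N q).erase p : Finset α)} =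
        {(((P.N p).erase q : Finset α) : Set α), (((P.N q).erase p : Finset α) : Set α)} := rfl
    rw [hset, Set.ncard_pair]
    intro heq
    rw [Finset.coe_inj] at heq
    obtain ⟨u, hu⟩ := Finset.card_pos.1 (show 0 < ((P.N p).erase q).card by
      rw [Finset.card_erase_of_mem ht.adj, hp.1]; norm_num)
    have h1 : P.Same u q := HallGraph.same_of_mem (Finset.mem_of_mem_erase hu) ht.adj
    exact h1.symm.not_adj (Finset.mem_of_mem_erase (heq ▸ hu))
  · simp [hp, hq]
  · simp [hp, hq]
  · simp [hp, hq]

end Model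
end RBrick

namespace RBrick

/-! ### Every `R`-thin edge is thin in the Hall graph -/

namespace Model

variable {α β : Type*} [DecidableEq α] {G : Graph α β} {r s f : β} {P : HallGraph α} {p q : α}

/-- If the retract of `G - f` is a brick, then vertices which have no neighbours outside `K`, other
than those identified with `u` or `v`, inject into `K`. -/
lemma card_le_of_isBrick_retract (h : Model G r s P) (hf : G.IsLink f p q) (hadj : q ∈ P.N p)
    (hp : ¬ P.Special p) (hq : ¬ P.Special q) (hb : IsBrick (retract (G.deleteEdges {f})))
    {T K : Finset α} {u v : α} (hu : u ∈ V(G)) (hv : v ∈ V(G))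
    (huv : P.collapse p q u ≠ P.collapse p q v)
    (hT : ∀ t ∈ T, t ∈ V(G) ∧ t ≠ u ∧ t ≠ v ∧ ∀ x, P.collapse p q x = P.collapse p q t → x = t)
    (hTK : ∀ e t w, t ∈ T → (G.deleteEdges {f}).IsLink e t w →
      P.collapse p q w ≠ P.collapse p q u → P.collapse p q w ≠ P.collapse p q v → w ∈ K) :
    T.card ≤ K.card := by
  classical
  obtain ⟨τ, hτ, hret⟩ := h.retract_eq hf hadj hp hq
  rw [hret] at hb
  set c := P.collapse p q with hc
  have hcV : ∀ {x}, x ∈ V(G) → c x ∈ V(core G P f p q) := fun hx => Set.mem_image_of_mem c hx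
  have hV : ∀ {x}, x ∈ V(G) → τ (c x) ∈ V((core G P f p q).map τ) :=
    fun hx => Set.mem_image_of_mem τ (hcV hx)
  have hinj : ∀ {x y}, x ∈ V(G) → y ∈ V(G) → τ (c x) = τ (c y) → c x = c y :=
    fun hx hy hxy => hτ (hcV hx) (hcV hy) hxy
  obtain ⟨M, hM⟩ := hb.bicritical _ (hV hu) _ (hV hv) fun heq => huv (hinj hu hv heq)
  rw [pmOff_iff] at hM
  have key := hM.ncard_le (T := (fun x => τ (c x)) '' T) (K := (fun x => τ (c x)) '' K)
    (K.finite_toSet.image _) (by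
      rintro _ ⟨t, ht, rfl⟩
      obtain ⟨h1, h2, h3, h4⟩ := hT t ht
      refine ⟨hV h1, ?_⟩
      rintro (heq | heq)
      · exact h2 (h4 u (hinj h1 hu heq).symm).symm
      · exact h3 (h4 v (hinj h1 hv heq).symm).symm) (by
      rintro e he _ ⟨t, ht, rfl⟩ z hz
      have hoff := hM.off e he z hz.inc_right
      obtain ⟨_, _, ⟨x, y, hxy, rfl, rfl⟩, hx, rfl⟩ := hz
      have hxV : x ∈ V(G) := hxy.left_mem
      obtain ⟨h1, -, -, h4⟩ := hT t ht
      obtain rfl := h4 x (hinj hxV h1 (by rw [hx]))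
      refine ⟨y, hTK e x y ht hxy.1 ?_ ?_, rfl⟩
      · intro heq
        exact hoff (Or.inl (congrArg τ heq))
      · intro heq
        exact hoff (Or.inr (congrArg τ heq)))
  rw [Set.InjOn.ncard_image, Set.ncard_coe_finset] at key
  · refine key.trans ((Set.ncard_image_le K.finite_toSet).trans ?_)
    rw [Set.ncard_coe_finset]
  · intro x hx y hy hxy
    exact (hT y hy).2.2.2 x (hinj (hT x hx).1 (hT y hy).1 hxy)

/-- Hall's condition with surplus one after the deletion of a removable edge. -/
lemma card_lt_of_removable (h : Model G r s P)
    (hc : IsMatchingCovered ((G.deleteEdges {r, s}).deleteEdges {f})) {T K : Finset α}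
    (hT : P.Side T) (hne : T.Nonempty) (hTA : T ≠ P.A) (hTB : T ≠ P.B)
    (hK : ∀ e, ∀ t ∈ T, ∀ w ∈ P.N t, G.IsLink e t w → e ≠ f → w ∈ K) : T.card < K.card := by
  have aux : ∀ {A B : Finset α}, IsBipartition (G.deleteEdges {r, s}) (A : Set α) B → T ⊆ A →
      T ≠ A → T.card < K.card := by
    intro A B hb hTA hne'
    have hb' : IsBipartition ((G.deleteEdges {r, s}).deleteEdges {f}) (A : Set α) B :=
      ⟨hb.disjoint, hb.union_eq, fun e u v hl => hb.link e u v hl.1⟩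
    have h1 := hc.ncard_lt_nbrs h.frame.finite hb' (T := (T : Set α)) (Finset.coe_subset.2 hTA) hne
      (fun heq => hne' (Finset.coe_inj.1 heq))
    rw [Set.ncard_coe_finset] at h1
    refine h1.trans_le ?_
    rw [← Set.ncard_coe_finset]
    refine Set.ncard_le_ncard ?_ K.finite_toSet
    rintro w ⟨t, ht, e, he⟩
    have hrs : e ≠ r ∧ e ≠ s := by
      have := he.1.2
      simpa using this
    exact hK e t ht w (h.mem_N_of_link he.1.1 hrs.1 hrs.2) he.1.1 he.2
  rcases hT with hT | hT
  · exact aux h.frame.isBipartition hT hTA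
  · exact aux h.frame.isBipartition.symm hT hTB

/-- After the deletion a special end would have a single neighbour and no surplus. -/
lemma not_special_of_removable (h : Model G r s P)
    (hc : IsMatchingCovered ((G.deleteEdges {r, s}).deleteEdges {f})) (hf : G.IsLink f p q)
    (hadj : q ∈ P.N p) : ¬ P.Special p := by
  intro hp
  have hpV := h.mem_V.1 hf.left_mem
  have hcard : 2 ≤ P.A.card := by
    have := Finset.card_le_card (Finset.inter_subset_right (s₁ := P.R) (s₂ := P.A))
    rw [P.card_RA] at this
    exact this
  have hne : ∀ S : Finset α, 2 ≤ S.card → ({p} : Finset α) ≠ S := by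
    rintro S hS rfl
    simp at hS
  have h1 := h.card_lt_of_removable hc (T := {p}) (K := (P.N p).erase q)
    (hpV.imp Finset.singleton_subset_iff.2 Finset.singleton_subset_iff.2) (by simp)
    (hne _ hcard) (hne _ (P.card_eq ▸ hcard)) (by
      intro e t ht w hw hl hef
      obtain rfl := Finset.mem_singleton.1 ht
      refine Finset.mem_erase.2 ⟨?_, hw⟩
      rintro rfl
      have := h.simple
      exact hef (hl.eq hf))
  rw [Finset.card_erase_of_mem hadj, hp] at h1
  simp at h1

/-- Let `T ≠ {p}` be tight with `p` as the only neighbour of `q` in it. Deleting `f` takes one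
neighbour from `T`. If `T` meets `R`, no surplus is left in `H - f`. If `T` avoids `R`, only one
more neighbour than members is left, and deleting two suitable vertices of the retract leaves
vertices that cannot all be matched. -/
lemma half_of_isBrick_retract (h : Model G r s P)
    (hc : IsMatchingCovered ((G.deleteEdges {r, s}).deleteEdges {f})) (hf : G.IsLink f p q)
    (hadj : q ∈ P.N p) (hp : ¬ P.Special p) (hq : ¬ P.Special q)
    (hb : IsBrick (retract (G.deleteEdges {f}))) : P.Half p q := by
  have := h.simple
  intro T hT hpT hqT
  by_contra hne
  obtain ⟨hside, hnon, hcard⟩ := hT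
  have hqnb : q ∈ P.nb T := HallGraph.mem_nb.2 ⟨p, hpT, hadj⟩
  have hqonly : ∀ t ∈ T, q ∈ P.N t → t = p := by
    intro t ht hqt
    have : t ∈ P.N q ∩ T := Finset.mem_inter.2 ⟨P.symm hqt, ht⟩
    rwa [hqT, Finset.mem_singleton] at this
  have hlink : ∀ e, ∀ t ∈ T, ∀ w ∈ P.N t, G.IsLink e t w → e ≠ f → w ∈ (P.nb T).erase q := by
    intro e t ht w hw hl hef
    refine Finset.mem_erase.2 ⟨?_, HallGraph.mem_nb.2 ⟨t, ht, hw⟩⟩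
    rintro rfl
    obtain rfl := hqonly t ht hw
    exact hef (hl.eq hf)
  have hcardK : ((P.nb T).erase q).card + 1 = T.card + P.req T := by
    rw [← hcard, Finset.card_erase_add_one hqnb]
  by_cases hR : Disjoint T P.R
  · rw [show P.req T = 2 from if_pos hR] at hcardK
    have hT2 : 2 ≤ T.card := by
      by_contra! hlt
      refine hne (Finset.eq_singleton_iff_unique_mem.2 ⟨hpT, fun x hx => ?_⟩)
      exact Finset.card_le_one.1 (by omega) x hx p hpT
    have hTV : ∀ t ∈ T, t ∈ V(G) := by
      intro t ht
      exact h.mem_V.2 (hside.imp (fun h => h ht) fun h => h ht)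
    have hKsame : ∀ w ∈ (P.nb T).erase q, P.Same w q ∧ w ∈ V(G) := by
      intro w hw
      obtain ⟨t, ht, hwt⟩ := HallGraph.mem_nb.1 (Finset.mem_of_mem_erase hw)
      have hpt := hside.same hpT ht
      have h1 := P.mem hwt
      have h2 := P.mem hadj
      have h3 := @HallGraph.not_mem_A_B _ _ P p
      have h4 := @HallGraph.not_mem_A_B _ _ P t
      rw [h.mem_V]
      unfold HallGraph.Same at *
      tauto
    have hTnot : ∀ t ∈ T, t ∉ P.triple q p := by
      intro t ht hmem
      rcases HallGraph.mem_triple.1 hmem with rfl | ⟨h1, h2⟩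
      · exact (hside.same hpT ht).not_adj hadj
      · exact h2 (hqonly t ht (P.symm h1))
    have hTfix : ∀ t ∈ T, (P.Free p → t ≠ p) → ∀ x, P.collapse p q x = P.collapse p q t → x = t := by
      intro t ht htp x hx
      rcases (HallGraph.collapse_eq_iff hadj).1 hx with h1 | ⟨h1, -, h3⟩ | ⟨h1, -, h3⟩
      · exact h1
      · rcases HallGraph.mem_triple.1 h3 with h4 | h4
        · exact (htp h1 h4).elim
        · exact ((hside.same hpT ht).not_adj h4.1).elim
      · exact (hTnot t ht h3).elim
    have hTK : ∀ e t w, t ∈ T → (G.deleteEdges {f}).IsLink e t w → w ∈ (P.nb T).erase q := by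
      intro e t w ht hl
      rcases h.link_cases hl.1 with ⟨-, -, h1⟩ | ⟨h1, -⟩
      · exact hlink e t ht w h1 hl.1 hl.2
      · exfalso
        refine Finset.disjoint_left.1 hR ht ((h.mem_R t).2 ?_)
        rcases h1 with rfl | rfl
        exacts [Or.inl hl.1.inc_left, Or.inr hl.1.inc_left]
    have hKne : ∀ t ∈ T, ∀ w ∈ (P.nb T).erase q, t ≠ w := by
      rintro t ht w hw rfl
      exact ((hside.same hpT ht).trans (hKsame t hw).1).not_adj hadj
    -- If `p` is free, it disappears in the retract and its two remaining neighbours become one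
    -- vertex. Deleting this vertex and another neighbour leaves `|T| - 2` possible mates for `|T| -
    -- 1` vertices. If `p` is not free, deleting any two neighbours leaves `|T| - 1` mates for `|T|`
    -- vertices.
    by_cases hpF : P.Free p
    · obtain ⟨p₁, p₂, hp12, hN⟩ := Finset.card_eq_two.1
        (show ((P.N p).erase q).card = 2 by rw [Finset.card_erase_of_mem hadj, hpF.1])
      have hmem : ∀ x, x = p₁ ∨ x = p₂ → x ∈ P.N p ∧ x ∈ (P.nb T).erase q ∧ x ∈ P.triple p q := by
        intro x hx
        have h1 : x ∈ (P.N p).erase q := by rw [hN]; simpa using hx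
        have h2 := Finset.mem_erase.1 h1
        exact ⟨h2.2, Finset.mem_erase.2 ⟨h2.1, HallGraph.mem_nb.2 ⟨p, hpT, h2.2⟩⟩,
          Finset.mem_insert_of_mem h1⟩
      have h1 := hmem p₁ (Or.inl rfl)
      have h2 := hmem p₂ (Or.inr rfl)
      obtain ⟨v, hv⟩ : ((((P.nb T).erase q).erase p₁).erase p₂).Nonempty := by
        rw [← Finset.card_pos, Finset.card_erase_of_mem (Finset.mem_erase.2 ⟨hp12.symm, h2.2.1⟩),
          Finset.card_erase_of_mem h1.2.1]
        omega
      have hv' := hv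
      simp only [Finset.mem_erase] at hv'
      have hvK : v ∈ (P.nb T).erase q := Finset.mem_erase.2 hv'.2.2
      have hc12 : P.collapse p q p₂ = P.collapse p q p₁ :=
        (HallGraph.collapse_eq_iff hadj).2 (Or.inr (Or.inl ⟨hpF, h2.2.2, h1.2.2⟩))
      have key := h.card_le_of_isBrick_retract hf hadj hp hq hb (T := T.erase p)
        (K := ((((P.nb T).erase q).erase p₁).erase p₂).erase v) (u := p₁) (v := v)
        (hKsame _ h1.2.1).2 (hKsame _ hvK).2 (by
          intro heq
          rcases (HallGraph.collapse_eq_iff hadj).1 heq with h3 | ⟨-, -, h3⟩ | ⟨-, h3, -⟩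
          · exact hv'.2.1 h3.symm
          · rcases HallGraph.mem_triple.1 h3 with rfl | h4
            · exact hKne v hpT v hvK rfl
            · have : v ∈ (P.N p).erase q := Finset.mem_erase.2 h4.symm
              rw [hN] at this
              simp [hv'.1, hv'.2.1] at this
          · exact HallGraph.not_mem_triple hadj h1.2.2 h3) (by
          intro t ht
          obtain ⟨h3, h4⟩ := Finset.mem_erase.1 ht
          exact ⟨hTV t h4, hKne t h4 _ h1.2.1, hKne t h4 v hvK, hTfix t h4 fun _ => h3⟩) (by
          intro e t w ht hl hwu hwv
          have := hTK e t w (Finset.mem_of_mem_erase ht) hl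
          refine Finset.mem_erase.2 ⟨?_, Finset.mem_erase.2 ⟨?_, Finset.mem_erase.2 ⟨?_, this⟩⟩⟩
          · rintro rfl; exact hwv rfl
          · rintro rfl; exact hwu hc12
          · rintro rfl; exact hwu rfl)
      rw [Finset.card_erase_of_mem hv,
        Finset.card_erase_of_mem (Finset.mem_erase.2 ⟨hp12.symm, h2.2.1⟩),
        Finset.card_erase_of_mem h1.2.1, Finset.card_erase_of_mem hpT] at key
      omega
    · obtain ⟨u, hu, v, hv, huv⟩ := Finset.one_lt_card.1
        (show 1 < ((P.nb T).erase q).card by omega)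
      have key := h.card_le_of_isBrick_retract hf hadj hp hq hb (T := T)
        (K := (((P.nb T).erase q).erase u).erase v) (u := u) (v := v) (hKsame u hu).2 (hKsame v hv).2
        (by
          intro heq
          rcases (HallGraph.collapse_eq_iff hadj).1 heq with h3 | ⟨h3, -, -⟩ | ⟨-, h3, -⟩
          · exact huv h3
          · exact hpF h3
          · rcases HallGraph.mem_triple.1 h3 with h4 | h4
            · exact (Finset.mem_erase.1 hu).1 h4
            · exact (hKsame u hu).1.symm.not_adj h4.1)
        (fun t ht => ⟨hTV t ht, hKne t ht u hu, hKne t ht v hv, hTfix t ht fun h => (hpF h).elim⟩) (by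
          intro e t w ht hl hwu hwv
          refine Finset.mem_erase.2 ⟨?_, Finset.mem_erase.2 ⟨?_, hTK e t w ht hl⟩⟩
          · rintro rfl; exact hwv rfl
          · rintro rfl; exact hwu rfl)
      rw [Finset.card_erase_of_mem (Finset.mem_erase.2 ⟨huv.symm, hv⟩), Finset.card_erase_of_mem hu]
        at key
      omega
  · have hT' : P.Tight T := ⟨hside, hnon, hcard⟩
    have h1 := h.card_lt_of_removable hc hside hnon hT'.ne.1 hT'.ne.2 hlink
    have h2 : P.req T = 1 := if_neg hR
    omega

/-- Otherwise the two neighbours left at `p` are the ends of one edge of `R`. A perfect matching of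
`G - f` containing that edge leaves no mate for `p`. -/
lemma tri_of_removable (h : Model G r s P) (hc : IsMatchingCovered (G.deleteEdges {f}))
    (hf : G.IsLink f p q) (hr : f ≠ r) (hs : f ≠ s) (hadj : q ∈ P.N p) (hp : P.Free p) :
    ¬ (P.N p).erase q ⊆ P.R := by
  have aux : ∀ {r s : β} {P : HallGraph α}, Model G r s P → f ≠ r → f ≠ s → q ∈ P.N p → P.Free p →
      p ∈ P.A → ¬ (P.N p).erase q ⊆ P.R := by
    intro r s P h hr hs hadj hp hpA hsub
    have hF := h.frame_deleteEdges hr hs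
    obtain ⟨b, b', hl, -⟩ := hF.right
    obtain ⟨M, hM, hsM⟩ := hc.admissible s hl.edge_mem
    obtain ⟨e, ⟨heM, x, hx⟩, -⟩ := hM.2 p hf.left_mem
    have hxN := ((h.inc_deleteEdges_of_free hf hp).1 hx).2
    have hsx : (G.deleteEdges {f}).Inc s x := by
      rcases (h.mem_R x).1 (hsub hxN) with h1 | ⟨y, hy⟩
      · exact (HallGraph.not_mem_A_B (h.frame.r_inc h1)
          (mem_B_of_mem_N hpA (Finset.mem_of_mem_erase hxN))).elim
      · exact ⟨y, hy, fun h => hs h.symm⟩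
    obtain rfl := (pmOff_empty_iff.2 hM).eq heM hsM hx.inc_right hsx
    exact hp.2 ((h.mem_R p).2 (Or.inr hx.1.inc_left))
  rcases h.mem_V.1 hf.left_mem with hpA | hpB
  · exact aux h hr hs hadj hp hpA
  · have := aux (P := P.swap) h.swap hs hr hadj hp hpB
    exact this

/-- The two halves use that the retract is a brick and `H - f` is matching covered; that neither end
is special comes from `H - f`, and the conditions on triples from `G - f`. -/
theorem thin_of_isRThin (h : Model G r s P) (hR : IsRThin G {r, s} f) (hf : G.IsLink f p q) :
    f ≠ r ∧ f ≠ s ∧ P.Thin p q := by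
  have hrs : f ≠ r ∧ f ≠ s := by
    have := hR.2.2.1.2
    simpa using this
  have hadj := h.mem_N_of_link hf hrs.1 hrs.2
  have hc := hR.2.2.2
  have hp := h.not_special_of_removable hc hf hadj
  have hq := h.not_special_of_removable hc hf.symm (P.symm hadj)
  exact ⟨hrs.1, hrs.2, hadj, hp, hq, h.half_of_isBrick_retract hc hf hadj hp hq hR.1.2,
    h.half_of_isBrick_retract hc hf.symm (P.symm hadj) hq hp hR.1.2,
    h.tri_of_removable hR.2.1.2 hf hrs.1 hrs.2 hadj,
    h.tri_of_removable hR.2.1.2 hf.symm hrs.1 hrs.2 (P.symm hadj)⟩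

end Model
end RBrick

namespace RBrick

/-! ### The ladder configuration -/

lemma HallGraph.Lad.mem_of_ladAdj {α : Type*} [DecidableEq α] {P : HallGraph α} {j : ℕ}
    {X Y : ℕ → α} (L : P.Lad j X Y) {u v : α} (hadj : LadAdj j X Y u v) :
    v ∈ P.N u ∧ u ∈ X '' Set.Iic j ∪ Y '' Set.Iic j := by
  have hX : ∀ i ≤ j, X i ∈ X '' Set.Iic j ∪ Y '' Set.Iic j := fun i hi => Or.inl ⟨i, hi, rfl⟩
  have hY : ∀ i ≤ j, Y i ∈ X '' Set.Iic j ∪ Y '' Set.Iic j := fun i hi => Or.inr ⟨i, hi, rfl⟩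
  rcases hadj with ⟨i, hi, heq⟩ | ⟨i, hi, heq | heq⟩ <;>
    rcases Sym2.eq_iff.1 heq with ⟨rfl, rfl⟩ | ⟨rfl, rfl⟩
  · exact ⟨L.rung i hi, hX i hi⟩
  · exact ⟨P.symm (L.rung i hi), hY i hi⟩
  · exact ⟨L.stepX i hi, hX i hi.le⟩
  · exact ⟨P.symm (L.stepX i hi), hX (i + 1) hi⟩
  · exact ⟨L.stepY i hi, hY i hi.le⟩
  · exact ⟨P.symm (L.stepY i hi), hY (i + 1) hi⟩

/-- The subgraph of `G - {r, s}` formed by the vertices and edges of a ladder. -/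
def ladderGraph {α β : Type*} (G : Graph α β) (r s : β) (j : ℕ) (X Y : ℕ → α) : Graph α β :=
  ((G.deleteEdges {r, s}).induce (X '' Set.Iic j ∪ Y '' Set.Iic j)).restrict
    {e | ∃ x y, G.IsLink e x y ∧ HallGraph.LadAdj j X Y x y}

namespace Model

variable {α β : Type*} [DecidableEq α] {G : Graph α β} {r s : β} {P : HallGraph α} {j : ℕ}
  {X Y : ℕ → α}

lemma mem_endsOf (h : Model G r s P) {v : α} (hv : P.Special v) : v ∈ endsOf G {r, s} := by
  rcases (h.mem_R v).1 hv.mem_R with h1 | h1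
  · exact ⟨r, Or.inl rfl, h1⟩
  · exact ⟨s, Or.inr rfl, h1⟩

lemma ladderGraph_isLink_iff (h : Model G r s P) (L : P.Lad j X Y) {e : β} {u v : α} :
    (ladderGraph G r s j X Y).IsLink e u v ↔ G.IsLink e u v ∧ HallGraph.LadAdj j X Y u v := by
  rw [ladderGraph, Graph.restrict_isLink, Graph.induce_isLink]
  constructor
  · rintro ⟨⟨x, y, hxy, hadj⟩, ⟨hl, -⟩, -⟩
    refine ⟨hl, ?_⟩
    rcases hl.eq_and_eq_or_eq_and_eq hxy with ⟨rfl, rfl⟩ | ⟨rfl, rfl⟩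
    exacts [hadj, hadj.symm]
  · rintro ⟨hl, hadj⟩
    refine ⟨⟨u, v, hl, hadj⟩, ⟨hl, ?_⟩, (L.mem_of_ladAdj hadj).2, (L.mem_of_ladAdj hadj.symm).2⟩
    have hN := (L.mem_of_ladAdj hadj).1
    rcases h.link_cases hl with ⟨h1, h2, -⟩ | ⟨-, hs⟩
    · simp [h1, h2]
    · exact (hs.not_adj hN).elim

lemma ladderGraph_le (h : Model G r s P) (L : P.Lad j X Y) :
    ladderGraph G r s j X Y ≤ G.deleteEdges {r, s} := by
  refine Graph.restrict_le.trans (Graph.induce_le ?_)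
  rintro _ (⟨i, hi, rfl⟩ | ⟨i, hi, rfl⟩)
  · obtain ⟨e, he⟩ := h.link_of_mem (L.rung i hi)
    exact he.left_mem
  · obtain ⟨e, he⟩ := h.link_of_mem (L.rung i hi)
    exact he.right_mem

lemma isLadder (h : Model G r s P) (L : P.Lad j X Y) :
    IsLadder (ladderGraph G r s j X Y) j X Y where
  two_le := L.two_le
  injOn_x := fun i hi k hk => L.injX i hi k hk
  injOn_y := fun i hi k hk => L.injY i hi k hk
  ne := L.ne
  vertexSet_eq := rfl
  simple := by
    have := h.simple
    exact
      { not_isLoopAt := fun e x hx => ((h.ladderGraph_isLink_iff L).1 hx).1.ne rfl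
        eq_of_isLink := fun e e' x y hl hl' =>
          ((h.ladderGraph_isLink_iff L).1 hl).1.eq ((h.ladderGraph_isLink_iff L).1 hl').1 }
  adj_iff := fun p q => by
    constructor
    · rintro ⟨e, he⟩
      exact ((h.ladderGraph_isLink_iff L).1 he).2
    · intro hadj
      obtain ⟨e, he⟩ := h.link_of_mem (L.mem_of_ladAdj hadj).1
      exact ⟨e, (h.ladderGraph_isLink_iff L).2 ⟨he, hadj⟩⟩

lemma isRLadderConfiguration (h : Model G r s P) (L : P.Lad j X Y) {a u b w : α}
    (hau : s(a, u) = s(X 0, Y 0)) (hbw : s(b, w) = s(X j, Y j)) (ha : P.Special a)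
    (hb : P.Special b) (hab : ¬ P.Same a b) :
    IsRLadderConfiguration G {r, s} (ladderGraph G r s j X Y) := by
  have hu : u ∈ P.N a := (L.mem_of_ladAdj (Or.inl ⟨0, Nat.zero_le j, hau⟩)).1
  have hw : w ∈ P.N b := (L.mem_of_ladAdj (Or.inl ⟨j, le_rfl, hbw⟩)).1
  have hV : ∀ i ≤ j, ∀ v, v = X i ∨ v = Y i → v ≠ u → v ≠ w → IsCubic G v := by
    intro i hi v hv hvu hvw
    rcases Nat.eq_zero_or_pos i with rfl | h0
    · have : v ∈ s(a, u) := by rw [hau]; exact Sym2.mem_iff.2 hv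
      obtain rfl := (Sym2.mem_iff.1 this).resolve_right hvu
      exact h.isCubic_of_special ha
    · rcases hi.eq_or_lt with rfl | hlt
      · have : v ∈ s(b, w) := by rw [hbw]; exact Sym2.mem_iff.2 hv
        obtain rfl := (Sym2.mem_iff.1 this).resolve_right hvw
        exact h.isCubic_of_special hb
      · refine h.isCubic_of_free ?_
        rcases hv with rfl | rfl
        exacts [L.freeX i h0 hlt, L.freeY i h0 hlt]
  have hcubic : ∀ v ∈ V(ladderGraph G r s j X Y), v ≠ u → v ≠ w → IsCubic G v := by
    rintro _ (⟨i, hi, rfl⟩ | ⟨i, hi, rfl⟩)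
    exacts [hV i hi _ (Or.inl rfl), hV i hi _ (Or.inr rfl)]
  have hrung : ∀ i f, 0 < i → i < j → (ladderGraph G r s j X Y).IsLink f (X i) (Y i) →
      IsRThin G {r, s} f ∧ index G f = 2 := by
    intro i f h0 hj hf
    have hl := ((h.ladderGraph_isLink_iff L).1 hf).1
    have ht := L.thin i h0 hj
    rcases h.link_cases hl with ⟨hr, hs, -⟩ | ⟨-, hsame⟩
    · exact ⟨(h.isRThin ht hl hr hs).1,
        (h.index_eq_two_iff ht hl hr hs).2 ⟨L.freeX i h0 hj, L.freeY i h0 hj⟩⟩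
    · exact (hsame.not_adj ht.adj).elim
  have hbip := h.frame.isBipartition
  have hends := And.intro (h.mem_endsOf ha) (h.mem_endsOf hb)
  refine ⟨h.ladderGraph_le L, j, X, Y, ?_⟩
  unfold HallGraph.Same at hab
  -- The class containing `a` plays the role of the first one; the different colours of `a` and `b`
  -- leave only these two assignments.
  rcases P.mem hu with ⟨haA, huB⟩ | ⟨haB, huA⟩ <;> rcases P.mem hw with ⟨hbA, hwB⟩ | ⟨hbB, hwA⟩
  · exact (hab (Or.inl ⟨haA, hbA⟩)).elim
  · exact ⟨P.A, P.B, a, u, b, w, h.isLadder L, hbip, hau, hbw, haA, hwA, hbB, huB, hcubic, hends.1,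
      hends.2, hrung⟩
  · exact ⟨P.B, P.A, a, u, b, w, h.isLadder L, hbip.symm, hau, hbw, haB, hwB, hbA, huA, hcubic,
      hends.1, hends.2, hrung⟩
  · exact (hab (Or.inr ⟨haB, hbB⟩)).elim

end Model
end RBrick

/-! ### The ladder theorem -/

theorem theorem3p4 {α β : Type*} (G : Graph α β) (hfin : V(G).Finite) (hsimple : G.Simple)
    (R : Set β) (hG : RBrick.IsRBrick G R)
    (hfree : ∀ f, ¬ RBrick.IsStrictlyRThin G R f)
    (e : β) (he : RBrick.IsRThin G R e) (hindex : RBrick.index G e = 2) :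
    ∃ K : Graph α β, RBrick.IsRLadderConfiguration G R K ∧ e ∈ E(K) := by
  classical
  obtain ⟨r, s, P, rfl, h⟩ := hG.exists_model hsimple hfin
  obtain ⟨p, q, hl⟩ := Graph.exists_isLink_of_mem_edgeSet he.1.1.1.1
  obtain ⟨hr, hs, ht⟩ := h.thin_of_isRThin he hl
  obtain ⟨hp, hq⟩ := (h.index_eq_two_iff ht hl hr hs).1 hindex
  -- A thin pair that is not `Multi` would give a strictly `R`-thin edge.
  have hM : ∀ x y, P.Thin x y → P.Multi x y := by
    intro x y hxy
    by_contra hmulti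
    obtain ⟨f, hf, hfr, hfs⟩ := (h.mem_N x y).1 hxy.adj
    exact hfree f ((h.isRThin hxy hf hfr hfs).2 hmulti)
  obtain ⟨j, X, Y, L, hadj, a, u, b, w, hau, hbw, ha, hb, hab⟩ :=
    RBrick.HallGraph.exists_ladder hM ht hp hq
  exact ⟨RBrick.ladderGraph G r s j X Y, h.isRLadderConfiguration L hau hbw ha hb hab,
    ((h.ladderGraph_isLink_iff L).2 ⟨hl, hadj⟩).edge_mem⟩
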